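/- Let $(\mathcal M,g)$ be a stably causal, time-oriented smooth Lorentzian manifold (Hausdorff, second countable, of dimension at least $2$) that is future null geodesically complete, i.e. every future directed null geodesic extends to affine parameter $+\infty$. Conventions. $I^\pm$ are the chronological future and past, $D$ is the domain of dependence, $\partial$, $\mathrm{cl}$ and $\mathrm{Int}$ are the topological boundary, closure and interior, and $\Delta$ is the symmetric difference. The edge of an achronal set $S$ is the set of $p\in\mathrm{cl}(S)$ such that within every open neighbourhood $O$ of $p$ some timelike curve from a point of $I^-_O(p)$ to a point of $I^+_O(p)$ avoids $S$. A slice is a closed achronal set with empty edge; a hypersurface is a relatively open subset of a slice. A causal worldline $W$ is future-infinite if its (generalized) affine length to the future is infinite; its causal horizon is $\partial I^-(W)$. An exterior of $\partial I^-(W)$ is a hypersurface $a\subseteq \mathrm{cl}(I^-(W))$ with $\mathrm{edge}(a)\subseteq\partial I^-(W)$. Two sets are Cauchy comparable if some open subset of $\mathcal M$ that is globally hyperbolic as a spacetime in its own right contains both. A past directed outward null deformation of a hypersurface $a$ within an open set $O$ is a hypersurface $b$ with $D(a)\subseteq D(b)$, $b\subseteq\mathrm{cl}(I^-(a))$, $a\,\Delta\,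 b\subseteq O$ and $\mathrm{edge}(b)\subseteq\mathrm{edge}(a)\cup[(\partial I^-(a)\setminus a)\cap O]$. Let $S_{\mathrm{gen}}$ be a real-valued functional on subsets of $\mathcal M$ (the generalized entropy). A hypersurface $a$ is entropy normal at $p\in\mathrm{edge}(a)$ if $p$ has an open neighbourhood $O$ such that $S_{\mathrm{gen}}(b)-S_{\mathrm{gen}}(a)\le 0$ for every past directed outward null deformation $b$ of $a$ within $O$. The generalized second law (GSL) on the horizon $\partial I^-(W)$ is the assertion that $S_{\mathrm{gen}}(a)-S_{\mathrm{gen}}(b)\ge 0$ whenever $a,b$ are nonempty Cauchy comparable exteriors of $\partial I^-(W)$ such that $D(a)\subseteq D(b)$ and through every point of $\mathrm{edge}(b)\setminus\mathrm{edge}(a)$ there passes a null geodesic $\gamma\subseteq\partial I^-(W)$ that is future-infinite (defined up to affine parameter $+\infty$). Lemma. Let $W$ be a future-infinite causal worldline, and let $\Sigma$ be a slice with $\Sigma\subseteq\mathrm{Int}(D(\Sigma))$. Put $a=I^-(W)\cap\Sigma$. Then $a$ is an exterior of the horizon $\partial I^-(W)$. Moreover, for every $S_{\mathrm{gen}}$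 that satisfies the GSL on $\partial I^-(W)$, the hypersurface $a$ is entropy normal at every point of $\mathrm{edge}(a)$. -/

import Mathlib

open Set Filter Topology MeasureTheory
open scoped Manifold ContDiff

/-- The model space `ℝ^d` of a `d`-dimensional manifold. -/
abbrev ModelSpace (d : ℕ) : Type := EuclideanSpace ℝ (Fin d)

/-- The tangent space of a `d`-dimensional manifold at a point. -/
abbrev Tgt {d : ℕ} {M : Type*} [TopologicalSpace M] [ChartedSpace (ModelSpace d) M] (x : M) :
    Type :=
  TangentSpace 𝓘(ℝ, ModelSpace d) x

/-- A time-oriented Lorentzian structure on a smooth `d`-manifold: a smooth symmetric 2-tensor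
`metric` of signature `(-,+,…,+)` together with a smooth timelike vector field `timeField`, which
is declared to be future directed. The signature condition is expressed through the time field:
it is timelike and the metric is positive definite on its orthogonal complement. -/
structure LorentzSpacetime (d : ℕ) (M : Type*) [TopologicalSpace M]
    [ChartedSpace (ModelSpace d) M] [IsManifold 𝓘(ℝ, ModelSpace d) ∞ M] where
  metric : ∀ x : M, Tgt (d := d) x →L[ℝ] Tgt (d := d) x →L[ℝ] ℝ
  metric_symm : ∀ (x : M) (v w : Tgt (d := d) x), metric x v w = metric x w v
  metric_smooth : ContMDiff 𝓘(ℝ, ModelSpace d)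
    (𝓘(ℝ, ModelSpace d).prod 𝓘(ℝ, ModelSpace d →L[ℝ] ModelSpace d →L[ℝ] ℝ)) ∞
    (fun x ↦ Bundle.TotalSpace.mk' (ModelSpace d →L[ℝ] ModelSpace d →L[ℝ] ℝ)
      (E := fun y : M ↦ (Tgt (d := d) y →L[ℝ] Tgt (d := d) y →L[ℝ] ℝ)) x (metric x))
  timeField : ∀ x : M, Tgt (d := d) x
  timeField_smooth : ContMDiff 𝓘(ℝ, ModelSpace d) 𝓘(ℝ, ModelSpace d).tangent ∞
    (fun x ↦ (⟨x, timeField x⟩ : TangentBundle 𝓘(ℝ, ModelSpace d) M))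
  timeField_timelike : ∀ x : M, metric x (timeField x) (timeField x) < 0
  pos_of_orthogonal : ∀ (x : M) (w : Tgt (d := d) x),
    metric x (timeField x) w = 0 → w ≠ 0 → 0 < metric x w w

noncomputable section

section Curves

variable {d : ℕ} {M : Type*} [TopologicalSpace M] [ChartedSpace (ModelSpace d) M]

/-- Velocity at parameter `t` of the curve `γ`, differentiated within the parameter set `J`. -/
def velocityWithin (d : ℕ) {M : Type*} [TopologicalSpace M] [ChartedSpace (ModelSpace d) M]
    (γ : ℝ → M) (J : Set ℝ) (t : ℝ) : Tgt (d := d) (γ t) :=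
  mfderivWithin 𝓘(ℝ, ℝ) 𝓘(ℝ, ModelSpace d) γ J t (1 : ℝ)

/-- `γ` is a piecewise `C¹` curve on the nondegenerate interval `J` all of whose velocities (the
one-sided ones at break points) lie in the set of tangent vectors `P`: every compact subinterval
`[a, b]` of `J` has a finite set `F` of break points such that `γ` is `C¹` with velocity in `P`
on each closed subinterval of `[a, b]` without break points in its interior. -/
def IsPiecewiseC1Curve (P : ∀ x : M, Tgt (d := d) x → Prop) (γ : ℝ → M) (J : Set ℝ) : Prop :=
  J.OrdConnected ∧ J.Nontrivial ∧
    ∀ a b : ℝ, a < b → Icc a b ⊆ J → ∃ F : Finset ℝ,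
      ∀ u v : ℝ, a ≤ u → u < v → v ≤ b → Disjoint (F : Set ℝ) (Ioo u v) →
        ContMDiffOn 𝓘(ℝ, ℝ) 𝓘(ℝ, ModelSpace d) 1 γ (Icc u v) ∧
          ∀ t ∈ Icc u v, P (γ t) (velocityWithin d γ (Icc u v) t)

/-- `p` is a future endpoint of the curve `γ` on `J`: the curve finally stays in every
neighbourhood of `p`. -/
def IsFutureEndpoint {M : Type*} [TopologicalSpace M] (γ : ℝ → M) (J : Set ℝ) (p : M) : Prop :=
  ∀ O : Set M, IsOpen O → p ∈ O → ∃ t₀ ∈ J, ∀ t ∈ J, t₀ ≤ t → γ t ∈ O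

/-- `p` is a past endpoint of the curve `γ` on `J`. -/
def IsPastEndpoint {M : Type*} [TopologicalSpace M] (γ : ℝ → M) (J : Set ℝ) (p : M) : Prop :=
  ∀ O : Set M, IsOpen O → p ∈ O → ∃ t₀ ∈ J, ∀ t ∈ J, t ≤ t₀ → γ t ∈ O

/-- Components, in the preferred chart around `p`, of a tangent vector `v` at `x`. -/
def coordVec (p x : M) (v : Tgt (d := d) x) : ModelSpace d :=
  mfderiv 𝓘(ℝ, ModelSpace d) 𝓘(ℝ, ModelSpace d) (extChartAt 𝓘(ℝ, ModelSpace d) p) x v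

end Curves

namespace LorentzSpacetime

variable {d : ℕ} {M : Type*} [TopologicalSpace M] [ChartedSpace (ModelSpace d) M]
  [IsManifold 𝓘(ℝ, ModelSpace d) ∞ M] (g : LorentzSpacetime d M)

/-! ### Causal character of vectors and curves -/

/-- Future directed timelike vectors. -/
def FutureTimelike (x : M) (v : Tgt (d := d) x) : Prop :=
  g.metric x v v < 0 ∧ g.metric x (g.timeField x) v < 0

/-- Future directed causal vectors (timelike or null, and nonzero). -/
def FutureCausal (x : M) (v : Tgt (d := d) x) : Prop :=
  g.metric x v v ≤ 0 ∧ g.metric x (g.timeField x) v < 0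

/-- Future directed null vectors (nonzero). -/
def FutureNull (x : M) (v : Tgt (d := d) x) : Prop :=
  g.metric x v v = 0 ∧ g.metric x (g.timeField x) v < 0

/-- Future directed timelike curves. -/
def IsTimelikeCurve (γ : ℝ → M) (J : Set ℝ) : Prop :=
  IsPiecewiseC1Curve g.FutureTimelike γ J

/-- Future directed causal curves. -/
def IsCausalCurve (γ : ℝ → M) (J : Set ℝ) : Prop :=
  IsPiecewiseC1Curve g.FutureCausal γ J

/-! ### Chronology and causality -/

/-- `I⁺(p)` computed in the open set `U`: endpoints of future directed timelike curves that
start at `p` and stay inside `U`. -/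
def chronFutureIn (U : Set M) (p : M) : Set M :=
  {q | ∃ (γ : ℝ → M) (a b : ℝ), a < b ∧ g.IsTimelikeCurve γ (Icc a b) ∧
    MapsTo γ (Icc a b) U ∧ γ a = p ∧ γ b = q}

/-- `I⁻(p)` computed in the open set `U`. -/
def chronPastIn (U : Set M) (p : M) : Set M :=
  {q | p ∈ g.chronFutureIn U q}

/-- The chronological past `I⁻(A)` of a set in the whole spacetime. -/
def chronPast (A : Set M) : Set M :=
  ⋃ p ∈ A, g.chronPastIn univ p

/-- Achronality with respect to timelike curves inside the open set `U`. -/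
def IsAchronalIn (U S : Set M) : Prop :=
  ∀ p ∈ S, ∀ q ∈ S, q ∉ g.chronFutureIn U p

/-- Stable causality: for some continuous timelike vector field `T`, the Lorentzian metric
`g - T♭ ⊗ T♭`, whose light cones are strictly wider than those of `g`, admits no closed timelike
curve (closed timelike curves may be traversed so that `g(T, γ') < 0`). -/
def StablyCausal : Prop :=
  ∃ T : ∀ x : M, Tgt (d := d) x,
    Continuous (fun x ↦ (⟨x, T x⟩ : TangentBundle 𝓘(ℝ, ModelSpace d) M)) ∧
    (∀ x, g.metric x (T x) (T x) < 0) ∧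
    ¬ ∃ (γ : ℝ → M) (a b : ℝ), a < b ∧
      IsPiecewiseC1Curve (d := d)
        (fun x v ↦ g.metric x v v - (g.metric x (T x) v) ^ 2 < 0 ∧ g.metric x (T x) v < 0)
        γ (Icc a b) ∧ γ a = γ b

/-! ### Domains of dependence and global hyperbolicity -/

/-- `D⁺(S)` computed in the open set `U`: every causal curve in `U` through `p` that is
inextendible to the past in `U` meets `S`. -/
def futureDomainIn (U S : Set M) : Set M :=
  {p | p ∈ U ∧ ∀ (γ : ℝ → M) (J : Set ℝ), g.IsCausalCurve γ J → MapsTo γ J U →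
    (¬ ∃ q ∈ U, IsPastEndpoint γ J q) → p ∈ γ '' J → (γ '' J ∩ S).Nonempty}

/-- `D⁻(S)` computed in the open set `U`. -/
def pastDomainIn (U S : Set M) : Set M :=
  {p | p ∈ U ∧ ∀ (γ : ℝ → M) (J : Set ℝ), g.IsCausalCurve γ J → MapsTo γ J U →
    (¬ ∃ q ∈ U, IsFutureEndpoint γ J q) → p ∈ γ '' J → (γ '' J ∩ S).Nonempty}

/-- The domain of dependence `D(S) = D⁺(S) ∪ D⁻(S)` computed in the open set `U`. -/
def domainIn (U S : Set M) : Set M :=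
  g.futureDomainIn U S ∪ g.pastDomainIn U S

/-- The domain of dependence `D(S)` in the whole spacetime. -/
def domain (S : Set M) : Set M :=
  g.domainIn univ S

/-- The open set `U`, as a spacetime of its own, is globally hyperbolic: it has a Cauchy
surface, i.e. a relatively closed achronal subset whose domain of dependence is all of `U`. -/
def IsGloballyHyperbolicOpen (U : Set M) : Prop :=
  IsOpen U ∧ ∃ C ⊆ U, (∃ K : Set M, IsClosed K ∧ C = K ∩ U) ∧ g.IsAchronalIn U C ∧
    g.domainIn U C = U

/-- Two sets are Cauchy comparable if a common globally hyperbolic sub-spacetime contains them. -/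
def CauchyComparable (A B : Set M) : Prop :=
  ∃ U : Set M, g.IsGloballyHyperbolicOpen U ∧ A ⊆ U ∧ B ⊆ U

/-! ### Edges, slices, hypersurfaces -/

/-- The edge of an achronal set `S`: the points `p` of its closure such that inside every open
neighbourhood `O` of `p` some timelike curve from a point of `I⁻_O(p)` to a point of `I⁺_O(p)`
avoids `S`. -/
def edge (S : Set M) : Set M :=
  {p | p ∈ closure S ∧ ∀ O : Set M, IsOpen O → p ∈ O →
    ∃ (γ : ℝ → M) (a b : ℝ), a < b ∧ g.IsTimelikeCurve γ (Icc a b) ∧ MapsTo γ (Icc a b) O ∧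
      γ a ∈ g.chronPastIn O p ∧ γ b ∈ g.chronFutureIn O p ∧ Disjoint (γ '' Icc a b) S}

/-- A slice is a closed achronal set with empty edge. -/
def IsSlice (S : Set M) : Prop :=
  IsClosed S ∧ g.IsAchronalIn univ S ∧ g.edge S = ∅

/-- A hypersurface is a relatively open subset of a slice. -/
def IsHypersurface (a : Set M) : Prop :=
  ∃ S : Set M, g.IsSlice S ∧ ∃ O : Set M, IsOpen O ∧ a = O ∩ S

/-! ### Levi-Civita parallelism and geodesics, in charts -/

/-- The metric `g_y(v, w)` in the coordinates of the preferred chart around `p`. -/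
def chartMetric (p : M) (y v w : ModelSpace d) : ℝ :=
  g.metric ((extChartAt 𝓘(ℝ, ModelSpace d) p).symm y)
    (mfderiv 𝓘(ℝ, ModelSpace d) 𝓘(ℝ, ModelSpace d) (extChartAt 𝓘(ℝ, ModelSpace d) p).symm y v)
    (mfderiv 𝓘(ℝ, ModelSpace d) 𝓘(ℝ, ModelSpace d) (extChartAt 𝓘(ℝ, ModelSpace d) p).symm y w)

/-- The derivative `∂_u (g(v, w))` at `y`, for constant `u, v, w`, in the chart around `p`. -/
def chartMetricDeriv (p : M) (y u v w : ModelSpace d) : ℝ :=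
  fderiv ℝ (fun y' ↦ g.chartMetric p y' v w) y u

/-- The Christoffel symbols of the first kind,
`g(Γ(u, v), z) = ½ (∂_u g(v, z) + ∂_v g(u, z) - ∂_z g(u, v))`, in the chart around `p`. -/
def christoffel (p : M) (y u v z : ModelSpace d) : ℝ :=
  (g.chartMetricDeriv p y u v z + g.chartMetricDeriv p y v u z - g.chartMetricDeriv p y z u v) / 2

/-- The vector field `V` along `γ` satisfies `∇_{γ'} V = 0` at parameter `t`, where derivatives
are taken within `J`: in the chart around `γ t` one has `V' + Γ(γ', V) = 0` at `t` (tested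
against all vectors `z` by means of the metric). -/
def IsParallelWithinAt (γ : ℝ → M) (V : ∀ t, Tgt (d := d) (γ t)) (J : Set ℝ) (t : ℝ) : Prop :=
  ∃ V' : ModelSpace d,
    HasDerivWithinAt (fun s ↦ coordVec (γ t) (γ s) (V s)) V' J t ∧
    ∀ z : ModelSpace d,
      g.chartMetric (γ t) (extChartAt 𝓘(ℝ, ModelSpace d) (γ t) (γ t)) V' z +
        g.christoffel (γ t) (extChartAt 𝓘(ℝ, ModelSpace d) (γ t) (γ t))
          (coordVec (γ t) (γ t) (velocityWithin d γ J t)) (coordVec (γ t) (γ t) (V t)) z = 0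

/-- Parallel fields along a piecewise `C¹` curve: continuous, with vanishing covariant right
derivative. -/
def IsParallelAlong (γ : ℝ → M) (V : ∀ t, Tgt (d := d) (γ t)) (J : Set ℝ) : Prop :=
  ContinuousOn (fun t ↦ (⟨γ t, V t⟩ : TangentBundle 𝓘(ℝ, ModelSpace d) M)) J ∧
  ∀ t ∈ J, (∃ s ∈ J, t < s) → g.IsParallelWithinAt γ V (J ∩ Ici t) t

/-- Future directed, affinely parametrised null geodesics on the interval `J`. -/
def IsNullGeodesic (γ : ℝ → M) (J : Set ℝ) : Prop :=
  ContMDiffOn 𝓘(ℝ, ℝ) 𝓘(ℝ, ModelSpace d) 1 γ J ∧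
  (∀ t ∈ J, g.IsParallelWithinAt γ (velocityWithin d γ J) J t) ∧
  ∀ t ∈ J, g.FutureNull (γ t) (velocityWithin d γ J t)

/-- Future null geodesic completeness: every future directed null vector is the initial velocity
of a null geodesic that is defined for all affine parameters in `[0, ∞)`. -/
def FutureNullComplete : Prop :=
  ∀ (p : M) (v : Tgt (d := d) p), g.FutureNull p v →
    ∃ γ : ℝ → M, g.IsNullGeodesic γ (Ici 0) ∧
      (⟨γ 0, velocityWithin d γ (Ici 0) 0⟩ : TangentBundle 𝓘(ℝ, ModelSpace d) M) = ⟨p, v⟩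

/-- A future-infinite causal worldline: a future directed causal curve of infinite (generalized)
affine length to the future. The generalized affine length is the integral of the Euclidean norm
of the components of the velocity in a parallel frame along the curve; whether it is finite does
not depend on the frame, and along a geodesic it is a constant multiple of the affine
parameter. -/
def IsFutureInfiniteWorldline (W : ℝ → M) (J : Set ℝ) : Prop :=
  g.IsCausalCurve W J ∧
  ∃ t₀ ∈ J, ∃ e : ∀ t : ℝ, Module.Basis (Fin d) ℝ (Tgt (d := d) (W t)),
    (∀ i, g.IsParallelAlong W (fun t ↦ e t i) (J ∩ Ici t₀)) ∧
    ∫⁻ t in J ∩ Ici t₀, ENNReal.ofReal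
      (Real.sqrt (∑ i, ((e t).repr (velocityWithin d W (J ∩ Ici t) t) i) ^ 2)) = ⊤

/-! ### Horizons, deformations, entropy -/

/-- The causal horizon `∂I⁻(W)` of a worldline. -/
def horizon (W : ℝ → M) (J : Set ℝ) : Set M :=
  frontier (g.chronPast (W '' J))

/-- Exteriors of the horizon `∂I⁻(W)`. -/
def IsExterior (W : ℝ → M) (J : Set ℝ) (a : Set M) : Prop :=
  g.IsHypersurface a ∧ a ⊆ closure (g.chronPast (W '' J)) ∧ g.edge a ⊆ g.horizon W J

/-- `b` is a past directed outward null deformation of `a` within `O`. -/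
def IsPastOutwardNullDeformation (O a b : Set M) : Prop :=
  g.IsHypersurface b ∧ g.domain a ⊆ g.domain b ∧ b ⊆ closure (g.chronPast a) ∧
    symmDiff a b ⊆ O ∧ g.edge b ⊆ g.edge a ∪ ((frontier (g.chronPast a) \ a) ∩ O)

/-- `a` is entropy normal at `p`, with respect to the entropy functional `Sgen`. -/
def EntropyNormalAt (Sgen : Set M → ℝ) (a : Set M) (p : M) : Prop :=
  ∃ O : Set M, IsOpen O ∧ p ∈ O ∧
    ∀ b, g.IsPastOutwardNullDeformation O a b → Sgen b - Sgen a ≤ 0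

/-- The generalized second law for the entropy functional `Sgen` on the horizon `∂I⁻(W)` of the
worldline `W` (the full generalized second law asserts this for every future-infinite causal
worldline): if `a`, `b` are nonempty Cauchy comparable exteriors of the horizon with
`D(a) ⊆ D(b)`, and every point of `edge b \ edge a` lies on a future-infinite null geodesic
contained in the horizon, then `Sgen a ≥ Sgen b`. -/
def GeneralizedSecondLaw (Sgen : Set M → ℝ) (W : ℝ → M) (J : Set ℝ) : Prop :=
  ∀ a b : Set M, a.Nonempty → b.Nonempty → g.IsExterior W J a → g.IsExterior W J b →
    g.CauchyComparable a b → g.domain a ⊆ g.domain b →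
    (∀ p ∈ g.edge b \ g.edge a, ∃ γ : ℝ → M, g.IsNullGeodesic γ (Ici 0) ∧
      MapsTo γ (Ici 0) (g.horizon W J) ∧ p ∈ γ '' Ici 0) →
    0 ≤ Sgen a - Sgen b

end LorentzSpacetime

end

/-! Write V for the past of `W`. The heart of the proof is that every point of the boundary of V
starts a null geodesic that stays in this boundary for all affine parameters; given this, the second
law can be applied to the pair consisting of a and its deformation b.

A causal curve with a future endpoint has finite generalized affine length: in a small chart box
parallel frames are distorted by a bounded factor, and the coordinate length of a causal curve is
bounded by its increase of a time coordinate. Hence `W` has no future endpoint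
(`IsFutureInfiniteWorldline.not_endpoint`). Following timelike curves up to `W` and then `W` itself
shows that limit points of V have further limit points to their future, and a greedy choice of
successors turns this into timelike curves inside V without future endpoint
(`isEndlessPast_chronPast`).

Let q be a boundary point. Endless curves in V starting near q cross a chart box of fixed size.
Parallel transport develops each of them into the tangent space at its initial point. The mean
direction m of the development is causal. If m is timelike with defect μ = -g(m, m), a first
variation towards the straight development makes the curve timelike, with enough room to move its
initial point by a multiple of μ² (`GoodBox.exists_timelike_of_defect`). Moving the initial point to
q would put q into V, so the defects tend to zero along curves starting ever closer to q. A small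
defect forces the development to be nearly straight, so the curve stays close to a geodesic
(`GoodBox.dist_geodesic_le`). The limit is a null geodesic from q in the closure of V, and it avoids
V because q does (`IsEndlessPast.exists_local_generator`).

Null completeness extends this geodesic to all parameters. It cannot leave the boundary at a last
parameter T: attach a boundary generator at T; since the boundary is achronal, the joined curve has
null mean direction, is therefore an unbroken geodesic, and agrees with the original one beyond T
(`IsEndlessPast.exists_continuation`, `IsEndlessPast.exists_complete_generator`).

The remaining points are causal theory. The edge of V ∩ S lies in the boundary of V because V is
open and the slice has no edge. As neighbourhood of an edge point take the interior of D(S), with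
one point of a removed so that b keeps that point and is nonempty. The new edge points of b lie in
D(S) and on the boundary of the past of a, hence on the boundary of V
(`IsEndlessPast.frontier_chronPast_inter`). The interior of D(S) has the Cauchy surface S
(`isGloballyHyperbolicOpen_interior_domain`), so a and b are Cauchy comparable. -/

noncomputable section

namespace LorentzSpacetime

/-! ### Coordinate expressions of the metric, of curves and of light cones. -/

section ChartBasics

variable {d : ℕ} {M : Type*} [TopologicalSpace M] [ChartedSpace (ModelSpace d) M]
  [IsManifold 𝓘(ℝ, ModelSpace d) ∞ M]

instance manifold_one_of_smooth : IsManifold 𝓘(ℝ, ModelSpace d) 1 M :=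
  IsManifold.of_le (n := ∞) (by exact_mod_cast le_top)

/-- The preferred chart around `p`. -/
abbrev chart (d : ℕ) {M : Type*} [TopologicalSpace M] [ChartedSpace (ModelSpace d) M] (p : M) :
    PartialEquiv M (ModelSpace d) :=
  extChartAt 𝓘(ℝ, ModelSpace d) p

omit [IsManifold 𝓘(ℝ, ModelSpace d) ∞ M] in
theorem isOpen_chart_target (p : M) : IsOpen (chart d p).target := isOpen_extChartAt_target p

omit [IsManifold 𝓘(ℝ, ModelSpace d) ∞ M] in
theorem isOpen_chart_source (p : M) : IsOpen (chart d p).source := isOpen_extChartAt_source p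

theorem contMDiffOn_symm_chart (p : M) :
    ContMDiffOn 𝓘(ℝ, ModelSpace d) 𝓘(ℝ, ModelSpace d) ∞ (chart d p).symm (chart d p).target :=
  contMDiffOn_extChartAt_symm p

/-- The derivative of the inverse of the chart at `p`. -/
def coordPush (p : M) (y : ModelSpace d) : ModelSpace d →L[ℝ] ModelSpace d :=
  mfderiv 𝓘(ℝ, ModelSpace d) 𝓘(ℝ, ModelSpace d) (chart d p).symm y

/-- The derivative of the chart at `p`. -/
def coordPull (p x : M) : ModelSpace d →L[ℝ] ModelSpace d :=
  mfderiv 𝓘(ℝ, ModelSpace d) 𝓘(ℝ, ModelSpace d) (chart d p) x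

theorem contMDiffOn_coordPush (p : M) (v : ModelSpace d) :
    ContMDiffOn 𝓘(ℝ, ModelSpace d) 𝓘(ℝ, ModelSpace d).tangent ∞
      (fun y ↦ (⟨(chart d p).symm y, coordPush p y v⟩ : TangentBundle 𝓘(ℝ, ModelSpace d) M))
      (chart d p).target := by
  have h := (contMDiffOn_symm_chart (d := d) p).contMDiffOn_tangentMapWithin (m := ∞)
    (by simp) (isOpen_chart_target p).uniqueMDiffOn
  have h2 : ContMDiffOn 𝓘(ℝ, ModelSpace d) 𝓘(ℝ, ModelSpace d).tangent ∞
      (fun y : ModelSpace d ↦ (⟨y, v⟩ : TangentBundle 𝓘(ℝ, ModelSpace d) (ModelSpace d)))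
      (chart d p).target :=
    (contMDiffOn_vectorSpace_iff_contDiffOn (V := fun _ ↦ v)).mpr contDiffOn_const
  have h3 := h.comp h2 (fun y hy ↦ hy)
  refine h3.congr fun y hy ↦ ?_
  simp only [Function.comp, tangentMapWithin]
  rw [mfderivWithin_of_isOpen (isOpen_chart_target p) hy]
  rfl

end ChartBasics

section Metric
variable {d : ℕ} {M : Type*} [TopologicalSpace M] [ChartedSpace (ModelSpace d) M]
  [IsManifold 𝓘(ℝ, ModelSpace d) ∞ M] (g : LorentzSpacetime d M)

/-- The metric at `x` as a bilinear form on the model space. -/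
def formAt (x : M) : ModelSpace d →L[ℝ] ModelSpace d →L[ℝ] ℝ := g.metric x

/-- The metric in the chart at `p` as a bilinear form. -/
def chartForm (p : M) (y : ModelSpace d) : ModelSpace d →L[ℝ] ModelSpace d →L[ℝ] ℝ :=
  (g.formAt ((chart d p).symm y)).bilinearComp (coordPush p y) (coordPush p y)

theorem contDiffOn_chartMetric (p : M) (v w : ModelSpace d) :
    ContDiffOn ℝ ∞ (fun y ↦ g.chartMetric p y v w) (chart d p).target := by
  have h := (g.metric_smooth.comp_contMDiffOn (contMDiffOn_symm_chart (d := d) p))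
  have := ContMDiffOn.clm_bundle_apply₂ (F₃ := ℝ) (E₃ := fun _ : M ↦ ℝ)
    (b := (chart d p).symm) (ψ := fun y ↦ g.metric ((chart d p).symm y)) h
    (contMDiffOn_coordPush p v) (contMDiffOn_coordPush p w)
  have h4 : ContMDiffOn 𝓘(ℝ, ModelSpace d) 𝓘(ℝ, ℝ) ∞ (fun y ↦ g.chartMetric p y v w) (chart d p).target := by
    intro y hy
    have h5 := this y hy
    rw [Bundle.contMDiffWithinAt_totalSpace] at h5
    exact h5.2
  exact contMDiffOn_iff_contDiffOn.mp h4

/-- In finite dimension, smoothness of a family of bilinear forms can be tested on fixed pairs of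
vectors. -/
theorem contDiffOn_chartForm (p : M) : ContDiffOn ℝ ∞ (g.chartForm p) (chart d p).target := by
  rw [contDiffOn_clm_apply]
  intro v
  rw [contDiffOn_clm_apply]
  intro w
  exact g.contDiffOn_chartMetric p v w

/-- The time field in the chart at `p`. -/
def chartTime (p : M) (y : ModelSpace d) : ModelSpace d :=
  coordVec p ((chart d p).symm y) (g.timeField ((chart d p).symm y))

theorem continuousOn_chartTime (p : M) : ContinuousOn (g.chartTime p) (chart d p).target := by
  have h := (contMDiffOn_extChartAt (I := 𝓘(ℝ, ModelSpace d)) (x := p) (n := ∞)).contMDiffOn_tangentMapWithin (m := ∞)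
    (by simp) (chartAt (ModelSpace d) p).open_source.uniqueMDiffOn
  have h2 := h.comp (g.timeField_smooth.comp_contMDiffOn (contMDiffOn_symm_chart (d := d) p))
    (fun y hy ↦ by simpa using! (chart d p).map_target hy)
  have h3 : ContDiffOn ℝ ∞ (g.chartTime p) (chart d p).target := by
    have h4 := contMDiff_snd_tangentBundle_modelSpace (ModelSpace d) 𝓘(ℝ, ModelSpace d) (n := ∞)
    have := h4.comp_contMDiffOn h2
    rw [contMDiffOn_iff_contDiffOn] at this
    refine this.congr fun y hy ↦ ?_
    have hy' : (chart d p).symm y ∈ (chartAt (ModelSpace d) p).source := by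
      simpa using! (chart d p).map_target hy
    simp only [Function.comp, tangentMapWithin, chartTime, coordVec]
    rw [mfderivWithin_of_isOpen (chartAt (ModelSpace d) p).open_source hy']
  exact h3.continuousOn

end Metric

section Velocity

variable {d : ℕ} {M : Type*} [TopologicalSpace M] [ChartedSpace (ModelSpace d) M]
  [IsManifold 𝓘(ℝ, ModelSpace d) ∞ M]

theorem coordPull_coordPush {p : M} {y : ModelSpace d} (hy : y ∈ (chart d p).target)
    (v : ModelSpace d) : coordPull p ((chart d p).symm y) (coordPush p y v) = v := by
  have h := mfderiv_extChartAt_comp_mfderivWithin_extChartAt_symm (I := 𝓘(ℝ, ModelSpace d)) hy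
  simp only [modelWithCornersSelf_coe, Set.range_id, mfderivWithin_univ] at h
  exact congrArg (fun (L : ModelSpace d →L[ℝ] ModelSpace d) ↦ L v) h

theorem coordPush_coordPull {p x : M} (hx : x ∈ (chart d p).source) (v : ModelSpace d) :
    coordPush p (chart d p x) (coordPull p x v) = v := by
  have h := mfderivWithin_extChartAt_symm_comp_mfderiv_extChartAt' (I := 𝓘(ℝ, ModelSpace d)) hx
  simp only [modelWithCornersSelf_coe, Set.range_id, mfderivWithin_univ] at h
  exact congrArg (fun (L : ModelSpace d →L[ℝ] ModelSpace d) ↦ L v) h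

theorem hasMFDerivAt_chart_symm {p : M} {y : ModelSpace d} (hy : y ∈ (chart d p).target) :
    HasMFDerivAt 𝓘(ℝ, ModelSpace d) 𝓘(ℝ, ModelSpace d) (chart d p).symm y (coordPush p y) := by
  have h := (contMDiffOn_symm_chart (d := d) p).contMDiffAt
    ((isOpen_chart_target p).mem_nhds hy)
  exact (h.mdifferentiableAt (by simp)).hasMFDerivAt

theorem hasMFDerivAt_chart {p x : M} (hx : x ∈ (chart d p).source) :
    HasMFDerivAt 𝓘(ℝ, ModelSpace d) 𝓘(ℝ, ModelSpace d) (chart d p) x (coordPull p x) := by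
  refine (mdifferentiableAt_extChartAt ?_).hasMFDerivAt
  simpa using hx

theorem velocityWithin_chart_symm_comp {p : M} {c : ℝ → ModelSpace d} {J : Set ℝ} {t : ℝ}
    (hy : c t ∈ (chart d p).target) (hJ : UniqueDiffWithinAt ℝ J t) {v : ModelSpace d}
    (hc : HasDerivWithinAt c v J t) :
    velocityWithin d ((chart d p).symm ∘ c) J t = coordPush p (c t) v := by
  have h1 := hasMFDerivWithinAt_iff_hasFDerivWithinAt.mpr hc.hasFDerivWithinAt
  have h2 := (hasMFDerivAt_chart_symm hy).comp_hasMFDerivWithinAt t h1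
  have h3 := h2.mfderivWithin hJ.uniqueMDiffWithinAt
  unfold velocityWithin
  rw [h3]
  show coordPush p (c t) ((1 : ℝ) • v) = _
  rw [one_smul]

theorem hasDerivWithinAt_chart_comp {p : M} {γ : ℝ → M} {J : Set ℝ} {t : ℝ}
    (hx : γ t ∈ (chart d p).source)
    (hγ : MDifferentiableWithinAt 𝓘(ℝ, ℝ) 𝓘(ℝ, ModelSpace d) γ J t) :
    HasDerivWithinAt (chart d p ∘ γ) (coordPull p (γ t) (velocityWithin d γ J t)) J t := by
  have h2 := (hasMFDerivAt_chart hx).comp_hasMFDerivWithinAt t hγ.hasMFDerivWithinAt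
  have h3 := hasMFDerivWithinAt_iff_hasFDerivWithinAt.mp h2
  let A : ℝ →L[ℝ] ModelSpace d := mfderivWithin 𝓘(ℝ, ℝ) 𝓘(ℝ, ModelSpace d) γ J t
  have e : ContinuousLinearMap.toSpanSingleton ℝ (coordPull p (γ t) (A 1)) =
      (coordPull p (γ t)).comp A :=
    ContinuousLinearMap.ext_ring (one_smul ℝ (coordPull p (γ t) (A 1)))
  have h4 : HasFDerivWithinAt (chart d p ∘ γ) (ContinuousLinearMap.toSpanSingleton ℝ
      (coordPull p (γ t) (A 1))) J t := by
    rw [e]; exact h3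
  exact hasDerivWithinAt_iff_hasFDerivWithinAt.mpr h4

/-- Piecewise `C¹` curves on `[a, b]` in a vector space whose velocities satisfy `Q`. -/
def PWC1 {E : Type*} [NormedAddCommGroup E] [NormedSpace ℝ E] (Q : E → E → Prop) (c : ℝ → E)
    (a b : ℝ) : Prop :=
  ∃ F : Finset ℝ, ∀ u v : ℝ, a ≤ u → u < v → v ≤ b → Disjoint (F : Set ℝ) (Ioo u v) →
    ContDiffOn ℝ 1 c (Icc u v) ∧ ∀ t ∈ Icc u v, Q (c t) (derivWithin c (Icc u v) t)

theorem PWC1.lift {P : ∀ x : M, Tgt (d := d) x → Prop} {p : M} {c : ℝ → ModelSpace d} {a b : ℝ}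
    (hab : a < b) (hc : PWC1 (fun y v ↦ P ((chart d p).symm y) (coordPush p y v)) c a b)
    (hm : MapsTo c (Icc a b) (chart d p).target) :
    IsPiecewiseC1Curve P ((chart d p).symm ∘ c) (Icc a b) := by
  refine ⟨ordConnected_Icc, ⟨a, by simp [hab.le], b, by simp [hab.le], hab.ne⟩, ?_⟩
  intro a' b' _ hsub
  obtain ⟨F, hF⟩ := hc
  refine ⟨F, fun u v hu huv hv hd ↦ ?_⟩
  have hsub' : Icc u v ⊆ Icc a b := (Icc_subset_Icc hu hv).trans hsub
  obtain ⟨h1, h2⟩ := hF u v (hsub' ⟨le_rfl, huv.le⟩).1 huv (hsub' ⟨huv.le, le_rfl⟩).2 hd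
  refine ⟨?_, fun t ht ↦ ?_⟩
  · exact ((contMDiffOn_symm_chart (d := d) p).of_le (by exact_mod_cast le_top)).comp
      (contMDiffOn_iff_contDiffOn.mpr h1) (fun t ht ↦ hm (hsub' ht))
  · have h3 := ((h1.differentiableOn one_ne_zero) t ht).hasDerivWithinAt
    rw [velocityWithin_chart_symm_comp (hm (hsub' ht)) (uniqueDiffOn_Icc huv t ht) h3]
    exact h2 t ht

theorem pwc1_chart_comp {P : ∀ x : M, Tgt (d := d) x → Prop} {p : M} {γ : ℝ → M} {a b : ℝ}
    (hab : a < b) (hγ : IsPiecewiseC1Curve P γ (Icc a b))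
    (hm : MapsTo γ (Icc a b) (chart d p).source) :
    PWC1 (fun y v ↦ P ((chart d p).symm y) (coordPush p y v)) (chart d p ∘ γ) a b := by
  obtain ⟨F, hF⟩ := hγ.2.2 a b hab subset_rfl
  refine ⟨F, fun u v hu huv hv hd ↦ ?_⟩
  obtain ⟨h1, h2⟩ := hF u v hu huv hv hd
  have hsub : Icc u v ⊆ Icc a b := Icc_subset_Icc hu hv
  refine ⟨?_, fun t ht ↦ ?_⟩
  · refine contMDiffOn_iff_contDiffOn.mp (ContMDiffOn.comp (t := (chartAt (ModelSpace d) p).source)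
      (contMDiffOn_extChartAt (n := 1)) h1 fun t ht ↦ ?_)
    simpa using! hm (hsub ht)
  · have hx := hm (hsub ht)
    have h3 := hasDerivWithinAt_chart_comp hx (h1.mdifferentiableOn (by simp) t ht)
    rw [h3.derivWithin (uniqueDiffOn_Icc huv t ht)]
    have h4 := h2 t ht
    have e1 : (chart d p).symm (chart d p (γ t)) = γ t := (chart d p).left_inv hx
    -- The tangent space depends on the base point, so base point and vector have to be substituted
    -- together.
    have h5 : ∀ (x : M) (w : ModelSpace d), x = γ t → w = velocityWithin d γ (Icc u v) t →
        P x w := by rintro x w rfl rfl; exact h4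
    exact h5 _ _ e1 (coordPush_coordPull hx _)

end Velocity

section Cones

variable {d : ℕ} {M : Type*} [TopologicalSpace M] [ChartedSpace (ModelSpace d) M]
  [IsManifold 𝓘(ℝ, ModelSpace d) ∞ M] (g : LorentzSpacetime d M)

theorem chartForm_coordPull {p x : M} (hx : x ∈ (chart d p).source) (v w : ModelSpace d) :
    g.chartForm p (chart d p x) (coordPull p x v) (coordPull p x w) = g.formAt x v w := by
  show g.formAt ((chart d p).symm (chart d p x)) (coordPush p (chart d p x) (coordPull p x v))
    (coordPush p (chart d p x) (coordPull p x w)) = _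
  rw [coordPush_coordPull hx, coordPush_coordPull hx, (chart d p).left_inv hx]

theorem chartForm_chartTime {p : M} {y : ModelSpace d} (hy : y ∈ (chart d p).target)
    (v : ModelSpace d) : g.chartForm p y (g.chartTime p y) v =
      g.metric ((chart d p).symm y) (g.timeField ((chart d p).symm y)) (coordPush p y v) := by
  have hx := (chart d p).map_target hy
  have h := coordPush_coordPull hx (g.timeField ((chart d p).symm y))
  rw [(chart d p).right_inv hy] at h
  show g.formAt ((chart d p).symm y) (coordPush p y (coordPull p _ _)) (coordPush p y v) = _
  rw [h]
  rfl

/-- Future directed timelike coordinate vectors. -/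
def ChartTimelike (p : M) (y v : ModelSpace d) : Prop :=
  g.chartForm p y v v < 0 ∧ g.chartForm p y (g.chartTime p y) v < 0

/-- Future directed causal coordinate vectors. -/
def ChartCausal (p : M) (y v : ModelSpace d) : Prop :=
  g.chartForm p y v v ≤ 0 ∧ g.chartForm p y (g.chartTime p y) v < 0

theorem chartTimelike_iff {p : M} {y : ModelSpace d} (hy : y ∈ (chart d p).target)
    (v : ModelSpace d) :
    g.ChartTimelike p y v ↔ g.FutureTimelike ((chart d p).symm y) (coordPush p y v) := by
  rw [ChartTimelike, chartForm_chartTime g hy]; rfl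

theorem chartCausal_iff {p : M} {y : ModelSpace d} (hy : y ∈ (chart d p).target)
    (v : ModelSpace d) :
    g.ChartCausal p y v ↔ g.FutureCausal ((chart d p).symm y) (coordPush p y v) := by
  rw [ChartCausal, chartForm_chartTime g hy]; rfl

theorem PWC1.mono {E : Type*} [NormedAddCommGroup E] [NormedSpace ℝ E] {Q Q' : E → E → Prop}
    {c : ℝ → E} {a b : ℝ} (hc : PWC1 Q c a b)
    (h : ∀ t ∈ Icc a b, ∀ v, Q (c t) v → Q' (c t) v) : PWC1 Q' c a b := by
  obtain ⟨F, hF⟩ := hc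
  refine ⟨F, fun u v hu huv hv hd ↦ ⟨(hF u v hu huv hv hd).1, fun t ht ↦ ?_⟩⟩
  exact h t ⟨hu.trans ht.1, ht.2.trans hv⟩ _ ((hF u v hu huv hv hd).2 t ht)

theorem isTimelikeCurve_of_chart {p : M} {c : ℝ → ModelSpace d} {a b : ℝ} (hab : a < b)
    (hc : PWC1 (g.ChartTimelike p) c a b) (hm : MapsTo c (Icc a b) (chart d p).target) :
    g.IsTimelikeCurve ((chart d p).symm ∘ c) (Icc a b) :=
  PWC1.lift hab (hc.mono fun _ ht v hv ↦ (g.chartTimelike_iff (hm ht) v).mp hv) hm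

theorem IsTimelikeCurve.chart_comp {g : LorentzSpacetime d M} {p : M} {γ : ℝ → M} {a b : ℝ}
    (hγ : g.IsTimelikeCurve γ (Icc a b)) (hab : a < b)
    (hm : MapsTo γ (Icc a b) (chart d p).source) :
    PWC1 (g.ChartTimelike p) (chart d p ∘ γ) a b :=
  (pwc1_chart_comp hab hγ hm).mono fun _ ht v hv ↦
    (g.chartTimelike_iff ((chart d p).map_source (hm ht)) v).mpr hv

theorem IsCausalCurve.chart_comp {g : LorentzSpacetime d M} {p : M} {γ : ℝ → M} {a b : ℝ}
    (hγ : g.IsCausalCurve γ (Icc a b)) (hab : a < b)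
    (hm : MapsTo γ (Icc a b) (chart d p).source) :
    PWC1 (g.ChartCausal p) (chart d p ∘ γ) a b :=
  (pwc1_chart_comp hab hγ hm).mono fun _ ht v hv ↦
    (g.chartCausal_iff ((chart d p).map_source (hm ht)) v).mpr hv

end Cones

end LorentzSpacetime

end

set_option maxSynthPendingDepth 3

noncomputable section

namespace LorentzSpacetime

/-! ### Piecewise C¹ curves in a vector space. -/

section PiecewiseTools

/-- Induction on the number of break points strictly inside the interval: cutting at one of them
lowers this number on both sides. It reduces a claim about piecewise curves to smooth pieces and
concatenation. -/
theorem piecewise_induction (F : Finset ℝ) {a b : ℝ} {P : ℝ → ℝ → Prop}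
    (hbase : ∀ u v, a ≤ u → u < v → v ≤ b → Disjoint (F : Set ℝ) (Ioo u v) → P u v)
    (htrans : ∀ u v w, a ≤ u → u < v → v < w → w ≤ b → P u v → P v w → P u w) :
    ∀ u v, a ≤ u → u < v → v ≤ b → P u v := by
  suffices H : ∀ n : ℕ, ∀ u v, a ≤ u → u < v → v ≤ b →
      (F.filter (fun x ↦ x ∈ Ioo u v)).card ≤ n → P u v from
    fun u v h1 h2 h3 ↦ H _ u v h1 h2 h3 le_rfl
  intro n
  induction n with
  | zero =>
    intro u v h1 h2 h3 h4
    refine hbase u v h1 h2 h3 (Set.disjoint_left.mpr fun x hx hx' ↦ ?_)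
    have : x ∈ F.filter (fun x ↦ x ∈ Ioo u v) := Finset.mem_filter.mpr ⟨hx, hx'⟩
    rw [Finset.card_eq_zero.mp (Nat.le_zero.mp h4)] at this
    simp at this
  | succ n ih =>
    intro u v h1 h2 h3 h4
    by_cases hd : Disjoint (F : Set ℝ) (Ioo u v)
    · exact hbase u v h1 h2 h3 hd
    · obtain ⟨x, hx, hx'⟩ := Set.not_disjoint_iff.mp hd
      have key : ∀ u' v', Ioo u' v' ⊆ Ioo u v → x ∉ Ioo u' v' →
          (F.filter (fun y ↦ y ∈ Ioo u' v')).card ≤ n := by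
        intro u' v' hs hn
        refine Nat.le_of_lt_succ (lt_of_lt_of_le (Finset.card_lt_card ?_) h4)
        refine (Finset.ssubset_iff_of_subset fun y hy ↦ ?_).mpr ⟨x, ?_, ?_⟩
        · rw [Finset.mem_filter] at hy ⊢
          exact ⟨hy.1, hs hy.2⟩
        · exact Finset.mem_filter.mpr ⟨hx, hx'⟩
        · exact fun h ↦ hn (Finset.mem_filter.mp h).2
      exact htrans u x v h1 hx'.1 hx'.2 h3
        (ih u x h1 hx'.1 (hx'.2.le.trans h3)
          (key u x (Ioo_subset_Ioo_right hx'.2.le) (by simp)))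
        (ih x v (h1.trans hx'.1.le) hx'.2 h3
          (key x v (Ioo_subset_Ioo_left hx'.1.le) (by simp)))

variable {E : Type*} [NormedAddCommGroup E] [NormedSpace ℝ E] {Q : E → E → Prop} {c : ℝ → E}
  {a b : ℝ}

theorem PWC1.continuousOn (hab : a < b) (hc : PWC1 Q c a b) : ContinuousOn c (Icc a b) := by
  obtain ⟨F, hF⟩ := hc
  refine piecewise_induction F (P := fun u v ↦ ContinuousOn c (Icc u v)) ?_ ?_ a b le_rfl hab le_rfl
  · exact fun u v hu huv hv hd ↦ (hF u v hu huv hv hd).1.continuousOn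
  · intro u v w _ huv hvw _ h1 h2
    rw [← Icc_union_Icc_eq_Icc huv.le hvw.le]
    exact h1.union_of_isClosed h2 isClosed_Icc isClosed_Icc

/-- A `C¹` map transports piecewise `C¹` curves. -/
theorem PWC1.comp {E' : Type*} [NormedAddCommGroup E'] [NormedSpace ℝ E'] {Q' : E' → E' → Prop}
    (hc : PWC1 Q c a b) {f : E → E'} (f' : E → E →L[ℝ] E') (hf : ContDiff ℝ 1 f)
    (hf' : ∀ x, HasFDerivAt f (f' x) x)
    (h : ∀ t ∈ Icc a b, ∀ v, Q (c t) v → Q' (f (c t)) (f' (c t) v)) :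
    PWC1 Q' (f ∘ c) a b := by
  obtain ⟨F, hF⟩ := hc
  refine ⟨F, fun u v hu huv hv hd ↦ ?_⟩
  obtain ⟨h1, h2⟩ := hF u v hu huv hv hd
  refine ⟨hf.comp_contDiffOn h1, fun t ht ↦ ?_⟩
  have h3 := ((h1.differentiableOn one_ne_zero) t ht).hasDerivWithinAt
  rw [((hf' (c t)).comp_hasDerivWithinAt t h3).derivWithin (uniqueDiffOn_Icc huv t ht)]
  exact h t ⟨hu.trans ht.1, ht.2.trans hv⟩ _ (h2 t ht)

/-- Comparison of increments along a piecewise `C¹` curve. -/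
theorem PWC1.norm_sub_le [CompleteSpace E] (hc : PWC1 Q c a b) (L : E →L[ℝ] ℝ)
    (hQ : ∀ t ∈ Icc a b, ∀ v, Q (c t) v → ‖v‖ ≤ L v) {s t : ℝ} (hs : a ≤ s) (hst : s ≤ t)
    (ht : t ≤ b) : ‖c t - c s‖ ≤ L (c t) - L (c s) := by
  rcases hst.eq_or_lt with rfl | hst
  · simp
  obtain ⟨F, hF⟩ := hc
  refine piecewise_induction F (P := fun u v ↦ ‖c v - c u‖ ≤ L (c v) - L (c u)) ?_ ?_ s t hs hst ht
  · intro u v hu huv hv hd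
    obtain ⟨h1, h2⟩ := hF u v hu huv hv hd
    have hd1 : ∀ x ∈ Ioo u v, HasDerivAt c (derivWithin c (Icc u v) x) x := fun x hx ↦
      ((h1.differentiableOn one_ne_zero) x (Ioo_subset_Icc_self hx)).hasDerivWithinAt.hasDerivAt
        (Icc_mem_nhds hx.1 hx.2)
    have hcont : ContinuousOn (derivWithin c (Icc u v)) (Icc u v) :=
      h1.continuousOn_derivWithin (uniqueDiffOn_Icc huv) le_rfl
    have hint : IntervalIntegrable (derivWithin c (Icc u v)) volume u v :=
      (hcont.mono (by rw [uIcc_of_le huv.le])).intervalIntegrable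
    have e1 := intervalIntegral.integral_eq_sub_of_hasDerivAt_of_le huv.le h1.continuousOn hd1 hint
    rw [← map_sub, ← e1, ← ContinuousLinearMap.intervalIntegral_comp_comm L hint]
    refine intervalIntegral.norm_integral_le_of_norm_le huv.le ?_
      ((L.continuous.comp_continuousOn (hcont.mono (by rw [uIcc_of_le huv.le]))).intervalIntegrable)
    filter_upwards with x hx
    have hx' := Ioc_subset_Icc_self hx
    exact hQ x ⟨hu.trans hx'.1, hx'.2.trans hv⟩ _ (h2 x hx')
  · intro u v w _ _ _ _ h1 h2
    calc ‖c w - c u‖ = ‖(c w - c v) + (c v - c u)‖ := by abel_nf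
      _ ≤ ‖c w - c v‖ + ‖c v - c u‖ := norm_add_le _ _
      _ ≤ _ := by linarith

end PiecewiseTools

/-! ### Chart balls with uniform estimates, and the tilting of causal vectors. -/

section GoodBox

variable {E : Type*} [NormedAddCommGroup E] [NormedSpace ℝ E]

/-- Uniform estimates for a Lorentzian metric `G` with Christoffel symbols `Γ` on the ball of
radius `ρ` around `y₀`, where `e` is a reference time direction. -/
structure GoodBox (G : E → E →L[ℝ] E →L[ℝ] ℝ) (Γ : E → E →L[ℝ] E →L[ℝ] E) (y₀ e : E)
    (ρ K : ℝ) : Prop where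
  one_le : 1 ≤ K
  pos : 0 < ρ
  small : 10 ^ 6 * K ^ 12 * ρ ≤ 1
  e_bound : ‖e‖ ≤ K
  symm : ∀ x ∈ Metric.ball y₀ ρ, ∀ v w, G x v w = G x w v
  bound : ∀ x ∈ Metric.ball y₀ ρ, ‖G x‖ ≤ K
  lip : ∀ x ∈ Metric.ball y₀ ρ, ∀ y ∈ Metric.ball y₀ ρ, ‖G x - G y‖ ≤ K * ‖x - y‖
  diff : ∀ x ∈ Metric.ball y₀ ρ, DifferentiableAt ℝ G x
  deriv_bound : ∀ x ∈ Metric.ball y₀ ρ, ‖fderiv ℝ G x‖ ≤ K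
  deriv_lip : ∀ x ∈ Metric.ball y₀ ρ, ∀ y ∈ Metric.ball y₀ ρ,
    ‖fderiv ℝ G x - fderiv ℝ G y‖ ≤ K * ‖x - y‖
  chr_bound : ∀ x ∈ Metric.ball y₀ ρ, ‖Γ x‖ ≤ K
  chr_lip : ∀ x ∈ Metric.ball y₀ ρ, ∀ y ∈ Metric.ball y₀ ρ, ‖Γ x - Γ y‖ ≤ K * ‖x - y‖
  chr_eq : ∀ x ∈ Metric.ball y₀ ρ, ∀ u v w, 2 * G x (Γ x u v) w =
    fderiv ℝ G x u v w + fderiv ℝ G x v u w - fderiv ℝ G x w u v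
  star : ∀ x ∈ Metric.ball y₀ ρ, ∀ y ∈ Metric.ball y₀ ρ, ∀ v,
    ‖v‖ ^ 2 ≤ K * max (G y v v) 0 + K * (G x e v) ^ 2

/-- Future timelike vectors in a good box. -/
def BoxTimelike (G : E → E →L[ℝ] E →L[ℝ] ℝ) (y₀ e : E) (y v : E) : Prop :=
  G y v v < 0 ∧ G y₀ e v < 0

/-- Future causal vectors in a good box. -/
def BoxCausal (G : E → E →L[ℝ] E →L[ℝ] ℝ) (y₀ e : E) (y v : E) : Prop :=
  G y v v ≤ 0 ∧ G y₀ e v < 0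

theorem bilin_le {K : ℝ} {B : E →L[ℝ] E →L[ℝ] ℝ} (hB : ‖B‖ ≤ K) (v w : E) :
    |B v w| ≤ K * ‖v‖ * ‖w‖ := by
  calc |B v w| ≤ ‖B‖ * ‖v‖ * ‖w‖ := B.le_opNorm₂ v w
    _ ≤ _ := by gcongr

namespace GoodBox

variable {G : E → E →L[ℝ] E →L[ℝ] ℝ} {Γ : E → E →L[ℝ] E →L[ℝ] E} {y₀ e : E} {ρ K : ℝ}
  (h : GoodBox G Γ y₀ e ρ K)
include h

theorem K_pos : 0 < K := lt_of_lt_of_le one_pos h.one_le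

theorem center_mem : y₀ ∈ Metric.ball y₀ ρ := Metric.mem_ball_self h.pos

/-- Since K ≥ 1, the single condition `small` covers all lower powers of K; most smallness
conditions on the box below are instances. -/
theorem pow_mul_le (n : ℕ) (hn : n ≤ 12) : 10 ^ 6 * (K ^ n * ρ) ≤ 1 := by
  have := pow_le_pow_right₀ h.one_le hn
  have h2 := h.pos
  nlinarith [h.small, mul_le_mul_of_nonneg_right this h2.le]

/-- For a vector that is causal at y the positive part in `star` vanishes, so the component along
`e`, measured at any point x of the box, controls the whole vector. This is why the covector of `e`
acts as a time function. -/
theorem norm_le_of_causal {x y v : E} (hx : x ∈ Metric.ball y₀ ρ) (hy : y ∈ Metric.ball y₀ ρ)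
    (hv : G y v v ≤ 0) : ‖v‖ ≤ K * |G x e v| := by
  have h1 := h.star x hx y hy v
  rw [max_eq_right hv] at h1
  have hK := h.one_le
  refine abs_le_of_sq_le_sq' (a := ‖v‖) ?_ (by positivity) |>.2
  rw [mul_pow, sq_abs]
  nlinarith [sq_nonneg (G x e v), mul_nonneg (sq_nonneg (G x e v)) (sub_nonneg.mpr hK), h.K_pos]

/-- Moving the base point of the time covector changes the time component by a relative error of at
most 2K³ρ, so the covector may be frozen at the centre of the box. -/
theorem time_compare {x x' y v : E} (hx : x ∈ Metric.ball y₀ ρ) (hx' : x' ∈ Metric.ball y₀ ρ)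
    (hy : y ∈ Metric.ball y₀ ρ) (hv : G y v v ≤ 0) :
    |G x e v - G x' e v| ≤ |G x e v| / 100 := by
  have h1 := h.norm_le_of_causal hx hy hv
  have h2 := bilin_le (h.lip x hx x' hx') e v
  have h3 : ‖x - x'‖ ≤ 2 * ρ := by
    rw [← dist_eq_norm]
    have := dist_triangle_right x x' y₀
    rw [Metric.mem_ball] at hx hx'
    linarith
  have h4 := h.pow_mul_le 3 (by norm_num)
  have hK := h.K_pos
  have hρ := h.pos
  calc |G x e v - G x' e v| = |(G x - G x') e v| := by simp
    _ ≤ K * ‖x - x'‖ * ‖e‖ * ‖v‖ := h2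
    _ ≤ K * (2 * ρ) * K * (K * |G x e v|) := by
        gcongr
        exact h.e_bound
    _ = 2 * (K ^ 3 * ρ) * |G x e v| := by ring
    _ ≤ _ := by nlinarith [abs_nonneg (G x e v)]

theorem time_lower {x y v : E} (hx : x ∈ Metric.ball y₀ ρ) (hy : y ∈ Metric.ball y₀ ρ)
    (hv : BoxCausal G y₀ e y v) : 99 / 100 * (-G y₀ e v) ≤ -G x e v := by
  have h1 := h.time_compare h.center_mem hx hy hv.1
  rw [abs_of_neg hv.2] at h1
  linarith [(abs_le.mp h1).1]

theorem time_upper {x y v : E} (hx : x ∈ Metric.ball y₀ ρ) (hy : y ∈ Metric.ball y₀ ρ)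
    (hv : BoxCausal G y₀ e y v) : -G x e v ≤ 101 / 100 * (-G y₀ e v) := by
  have h1 := h.time_compare h.center_mem hx hy hv.1
  rw [abs_of_neg hv.2] at h1
  linarith [(abs_le.mp h1).2]

theorem norm_le_time {y v : E} (hy : y ∈ Metric.ball y₀ ρ) (hv : BoxCausal G y₀ e y v) :
    ‖v‖ ≤ K * (-G y₀ e v) := by
  have := h.norm_le_of_causal h.center_mem hy hv.1
  rwa [abs_of_neg hv.2] at this

/-- Tilting a causal vector towards the future makes it timelike, also at nearby points. -/
theorem tilt {κ : ℝ} (hκ : 0 < κ) (hκ' : 100 * K ^ 6 * κ ≤ 1) {x y v : E}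
    (hx : x ∈ Metric.ball y₀ ρ) (hy : y ∈ Metric.ball y₀ ρ) (hxy : ‖y - x‖ ≤ 2 * κ)
    (hv : BoxCausal G y₀ e x v) :
    BoxTimelike G y₀ e y (v + (κ * (10 * K ^ 3) * (-G y₀ e v)) • e) := by
  have hK := h.one_le
  have hKp := h.K_pos
  set r := -G y₀ e v with hr
  have hrp : 0 < r := by have := hv.2; linarith
  set s := κ * (10 * K ^ 3) * r with hs
  have hsp : 0 < s := by positivity
  set V := v + s • e with hV
  have hnv : ‖v‖ ≤ K * r := h.norm_le_time hx hv
  have hpow : K ^ 3 ≤ K ^ 6 := pow_le_pow_right₀ hK (by norm_num)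
  have hs1 : s ≤ r := by
    have : κ * (10 * K ^ 3) ≤ 1 := by nlinarith
    nlinarith
  have hs2 : s * K ^ 3 ≤ r / 10 := by
    have : s * K ^ 3 = (10 * K ^ 6 * κ) * r := by rw [hs]; ring
    rw [this]; nlinarith
  have hnV : ‖V‖ ≤ 2 * K * r := by
    calc ‖V‖ ≤ ‖v‖ + ‖s • e‖ := norm_add_le _ _
      _ = ‖v‖ + s * ‖e‖ := by rw [norm_smul, Real.norm_of_nonneg hsp.le]
      _ ≤ K * r + r * K := by gcongr; exact h.e_bound
      _ = _ := by ring
  have hee : ∀ z ∈ Metric.ball y₀ ρ, |G z e e| ≤ K ^ 3 := fun z hz ↦ by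
    calc |G z e e| ≤ K * ‖e‖ * ‖e‖ := bilin_le (h.bound z hz) e e
      _ ≤ K * K * K := by gcongr <;> exact h.e_bound
      _ = _ := by ring
  have hlow := h.time_lower hx hx hv
  -- The term linear in s gains 1.98 s r. The quadratic term costs at most 0.1 s r, and the change
  -- of base point costs 8K³κr² = 0.8 s r, which is the reason for the factor 10K³ in s.
  have hx1 : G x V V ≤ -(2 * s * (99 / 100 * r)) + s * (r / 10) := by
    have e1 : G x V V = G x v v + 2 * s * G x e v + s ^ 2 * G x e e := by
      simp only [hV, map_add, map_smul, add_apply,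
        smul_apply, smul_eq_mul]
      rw [h.symm x hx v e]; ring
    have e2 : s ^ 2 * G x e e ≤ s * (r / 10) := by
      have := (abs_le.mp (hee x hx)).2
      calc s ^ 2 * G x e e ≤ s ^ 2 * K ^ 3 := by gcongr
        _ = s * (s * K ^ 3) := by ring
        _ ≤ _ := by gcongr
    rw [e1]
    have := hv.1
    nlinarith
  have hdiff : G y V V - G x V V ≤ s * (8 / 10 * r) := by
    have := le_of_abs_le (bilin_le (h.lip y hy x hx) V V)
    simp only [sub_apply] at this
    calc G y V V - G x V V ≤ K * ‖y - x‖ * ‖V‖ * ‖V‖ := this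
      _ ≤ K * (2 * κ) * (2 * K * r) * (2 * K * r) := by gcongr
      _ = s * (8 / 10 * r) := by rw [hs]; ring
  refine ⟨?_, ?_⟩
  · nlinarith [mul_pos hsp hrp]
  · have e1 : G y₀ e V = -r + s * G y₀ e e := by
      simp only [hV, map_add, map_smul, smul_eq_mul]; rw [hr]; ring
    have := (abs_le.mp (hee y₀ h.center_mem)).2
    rw [e1]
    nlinarith [mul_le_mul_of_nonneg_left this hsp.le]

/-- Push-up in a good box: the end point of a causal curve may be moved, at the cost of moving
the initial point, so as to become the end point of a timelike curve. -/
theorem exists_timelike_near [CompleteSpace E] {c : ℝ → E} {a b : ℝ} (hab : a < b)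
    (hc : PWC1 (BoxCausal G y₀ e) c a b) (hm : MapsTo c (Icc a b) (Metric.ball y₀ (ρ / 2)))
    {κ : ℝ} (hκ : 0 < κ) (hκ' : 100 * K ^ 6 * κ ≤ 1) (hκρ : 4 * κ ≤ ρ) {z : E}
    (hz : ‖z - c b‖ ≤ κ) :
    ∃ c' : ℝ → E, PWC1 (BoxTimelike G y₀ e) c' a b ∧ MapsTo c' (Icc a b) (Metric.ball y₀ ρ) ∧
      c' b = z ∧ ‖c' a - c a‖ ≤ 2 * κ := by
  have hK := h.K_pos
  have hρ := h.pos
  have hm' : ∀ t ∈ Icc a b, c t ∈ Metric.ball y₀ ρ := fun t ht ↦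
    Metric.ball_subset_ball (by linarith) (hm ht)
  set M := κ * (10 * K ^ 3) with hM
  -- An affine map that sends c b to z and shears along `e` in proportion to the time difference
  -- from the end point; its linear part is exactly the tilt of `tilt`.
  let A : E → E := fun y ↦ y + (z - c b) + (M * (-G y₀ e (y - c b))) • e
  let A' : E →L[ℝ] E := ContinuousLinearMap.id ℝ E +
    (M • -(G y₀ e)).smulRight e
  have hA : ∀ y, HasFDerivAt A A' y := by
    intro y
    have e1 : A = fun y ↦ A' y + ((z - c b) - (M * (-G y₀ e (c b))) • e) := by
      funext y
      simp only [A, A', add_apply, ContinuousLinearMap.smulRight_apply,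
        ContinuousLinearMap.id_apply, smul_apply,
        neg_apply, map_sub, smul_eq_mul]
      module
    rw [e1]
    exact A'.hasFDerivAt.add_const _
  have hAc : ContDiff ℝ 1 A := by
    refine contDiff_one_iff_hasFDerivAt.mpr ⟨fun _ ↦ A', continuous_const, hA⟩
  have hdist : ∀ t ∈ Icc a b, ‖A (c t) - c t‖ ≤ 2 * κ := by
    intro t ht
    have h1 : ‖c t - c b‖ ≤ ρ := by
      rw [← dist_eq_norm]
      have h2 := hm ht
      have h3 := hm ⟨hab.le, le_rfl⟩
      rw [Metric.mem_ball] at h2 h3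
      linarith [dist_triangle_right (c t) (c b) y₀]
    have h2 : |G y₀ e (c t - c b)| ≤ K * K * ρ := by
      calc _ ≤ K * ‖e‖ * ‖c t - c b‖ := bilin_le (h.bound y₀ h.center_mem) _ _
        _ ≤ _ := by gcongr; exact h.e_bound
    have h4 := h.pow_mul_le 6 (by norm_num)
    calc ‖A (c t) - c t‖ = ‖(z - c b) + (M * (-G y₀ e (c t - c b))) • e‖ := by
          simp only [A]; congr 1; abel
      _ ≤ ‖z - c b‖ + M * |G y₀ e (c t - c b)| * ‖e‖ := by
          refine (norm_add_le _ _).trans ?_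
          rw [norm_smul, norm_mul, Real.norm_eq_abs, Real.norm_eq_abs, abs_neg,
            abs_of_nonneg (show 0 ≤ M by positivity)]
      _ ≤ κ + M * (K * K * ρ) * K := by
          gcongr
          exact h.e_bound
      _ = κ + κ * (10 * (K ^ 6 * ρ)) := by rw [hM]; ring
      _ ≤ _ := by nlinarith
  have hmA : MapsTo (A ∘ c) (Icc a b) (Metric.ball y₀ ρ) := by
    intro t ht
    have h1 := hdist t ht
    have h2 := hm ht
    rw [Metric.mem_ball] at h2 ⊢
    rw [← dist_eq_norm] at h1
    have := dist_triangle (A (c t)) (c t) y₀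
    simp only [Function.comp]
    linarith
  refine ⟨A ∘ c, ?_, hmA, by simp [A], hdist a ⟨le_rfl, hab.le⟩⟩
  refine hc.comp (fun _ ↦ A') hAc hA fun t ht v hv ↦ ?_
  have e1 : A' v = v + (κ * (10 * K ^ 3) * (-G y₀ e v)) • e := by
    simp only [A', add_apply, ContinuousLinearMap.smulRight_apply,
        ContinuousLinearMap.id_apply, smul_apply, neg_apply, smul_eq_mul, hM]
  rw [e1]
  exact h.tilt hκ hκ' (hm' t ht) (hmA ht) (hdist t ht) hv

end GoodBox

end GoodBox

end LorentzSpacetime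

end

set_option maxSynthPendingDepth 3

noncomputable section

namespace LorentzSpacetime

/-! ### Existence of good boxes around every point. -/

section GoodBoxExistence

variable {E : Type*} [NormedAddCommGroup E] [NormedSpace ℝ E] [FiniteDimensional ℝ E]

/-- A Lorentzian form is definite modulo the square of a timelike covector. -/
theorem exists_star_of_lorentz (B : E →L[ℝ] E →L[ℝ] ℝ) (hB : ∀ v w, B v w = B w v) (e : E)
    (he : B e e < 0) (hpos : ∀ w, B e w = 0 → w ≠ 0 → 0 < B w w) :
    ∃ k K : ℝ, 0 < k ∧ 0 < K ∧ ∀ v, ‖v‖ ^ 2 ≤ k * B v v + K * (B e v) ^ 2 := by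
  rcases subsingleton_or_nontrivial E with hE | hE
  · exact ⟨1, 1, one_pos, one_pos, fun v ↦ by rw [Subsingleton.elim v 0]; simp⟩
  -- In the splitting along `e`, the form B carries the squared time component with coefficient
  -- -1/(-B e e). Adding twice this amount makes q positive definite.
  set k := 2 / (-B e e) with hk
  have hkp : 0 < k := by rw [hk]; apply div_pos two_pos; linarith
  let q : E → ℝ := fun v ↦ B v v + k * (B e v) ^ 2
  have hq : ∀ v, v ≠ 0 → 0 < q v := by
    intro v hv
    set α := B e v / B e e with hα
    have h1 : B e (v - α • e) = 0 := by
      simp only [map_sub, map_smul, smul_eq_mul]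
      rw [hα, div_mul_cancel₀ _ he.ne, sub_self]
    have h2 : B (v - α • e) (v - α • e) = B v v + (B e v) ^ 2 / (-B e e) := by
      simp only [map_sub, map_smul, smul_eq_mul, sub_apply, smul_apply]
      rw [hB v e, hα]
      field_simp [he.ne]
      ring
    have h3 : q v = B (v - α • e) (v - α • e) + (B e v) ^ 2 / (-B e e) := by
      rw [h2]; simp only [q, hk]; ring
    rw [h3]
    by_cases h4 : v - α • e = 0
    · have h5 : B e v ≠ 0 := by
        intro h6
        rw [hα, h6] at h4
        simp at h4
        exact hv h4
      have : 0 < (B e v) ^ 2 / (-B e e) := div_pos (by positivity) (by linarith)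
      rw [h4]; simpa using this
    · have := hpos _ h1 h4
      have : 0 ≤ (B e v) ^ 2 / (-B e e) := div_nonneg (by positivity) (by linarith)
      linarith
  have hqc : Continuous q := by fun_prop
  obtain ⟨v₀, hv₀, hmin⟩ := (isCompact_sphere (0 : E) 1).exists_isMinOn
    (NormedSpace.sphere_nonempty.mpr zero_le_one) hqc.continuousOn
  have hm : 0 < q v₀ := hq v₀ (by rintro rfl; simp at hv₀)
  have hall : ∀ v, q v₀ * ‖v‖ ^ 2 ≤ q v := by
    intro v
    by_cases hv : v = 0
    · subst hv; simp [q]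
    have hn : 0 < ‖v‖ := norm_pos_iff.mpr hv
    have h1 : q v₀ ≤ q (‖v‖⁻¹ • v) := hmin (by simp [norm_smul, hn.ne'])
    have h2 : q (‖v‖⁻¹ • v) = ‖v‖⁻¹ ^ 2 * q v := by
      simp only [q, map_smul, smul_apply, smul_eq_mul]; ring
    rw [h2] at h1
    calc q v₀ * ‖v‖ ^ 2 ≤ ‖v‖⁻¹ ^ 2 * q v * ‖v‖ ^ 2 := by gcongr
      _ = q v := by field_simp
  refine ⟨1 / q v₀, k / q v₀, by positivity, by positivity, fun v ↦ ?_⟩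
  have h1 : 1 / q v₀ * B v v + k / q v₀ * (B e v) ^ 2 = q v / q v₀ := by
    simp only [q]; ring
  rw [h1, le_div_iff₀ hm, mul_comm]
  exact hall v

/-- The functional `w ↦ (D(u)(v, w) + D(v)(u, w) - D(w)(u, v)) / 2`, depending linearly on the
trilinear form `D`. -/
def christoffelForm (E : Type*) [NormedAddCommGroup E] [NormedSpace ℝ E] :
    (E →L[ℝ] E →L[ℝ] E →L[ℝ] ℝ) →L[ℝ] (E →L[ℝ] E →L[ℝ] E →L[ℝ] ℝ) :=
  let f : (E →L[ℝ] E →L[ℝ] E →L[ℝ] ℝ) →L[ℝ] (E →L[ℝ] E →L[ℝ] E →L[ℝ] ℝ) :=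
    (ContinuousLinearMap.flipₗᵢ ℝ E E (E →L[ℝ] ℝ)).toContinuousLinearEquiv
  let f' : (E →L[ℝ] E →L[ℝ] ℝ) →L[ℝ] (E →L[ℝ] E →L[ℝ] ℝ) :=
    (ContinuousLinearMap.flipₗᵢ ℝ E E ℝ).toContinuousLinearEquiv
  (2⁻¹ : ℝ) • (ContinuousLinearMap.id ℝ _ + f -
    (ContinuousLinearMap.compL ℝ E (E →L[ℝ] E →L[ℝ] ℝ) (E →L[ℝ] E →L[ℝ] ℝ) f').comp f)

omit [FiniteDimensional ℝ E] in
theorem christoffelForm_apply (D : E →L[ℝ] E →L[ℝ] E →L[ℝ] ℝ) (u v w : E) :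
    christoffelForm E D u v w = (D u v w + D v u w - D w u v) / 2 := by
  simp only [christoffelForm, smul_apply, add_apply, sub_apply, ContinuousLinearMap.comp_apply,
    ContinuousLinearMap.id_apply, ContinuousLinearMap.compL_apply, smul_eq_mul]
  show 2⁻¹ * (D u v w + D v u w - D w u v) = _
  ring

/-- The Christoffel symbols of the second kind of a metric `G`. -/
def christoffelSnd (G : E → E →L[ℝ] E →L[ℝ] ℝ) (x : E) : E →L[ℝ] E →L[ℝ] E :=
  (ContinuousLinearMap.compL ℝ E (E →L[ℝ] ℝ) E (G x).inverse).comp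
    (christoffelForm E (fderiv ℝ G x))

theorem isInvertible_of_injective (A : E →L[ℝ] E →L[ℝ] ℝ) (hA : ∀ v, A v = 0 → v = 0) :
    ∃ A' : E ≃L[ℝ] (E →L[ℝ] ℝ), (A' : E →L[ℝ] E →L[ℝ] ℝ) = A := by
  have hinj : Function.Injective A.toLinearMap := by
    rw [injective_iff_map_eq_zero]; exact hA
  have hfin : Module.finrank ℝ E = Module.finrank ℝ (E →L[ℝ] ℝ) := by
    rw [(LinearMap.toContinuousLinearMap (𝕜 := ℝ) (E := E) (F' := ℝ)).symm.finrank_eq]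
    exact Subspace.dual_finrank_eq.symm
  let L := LinearEquiv.ofInjectiveOfFinrankEq A.toLinearMap hinj hfin
  exact ⟨L.toContinuousLinearEquiv, by ext; rfl⟩

theorem christoffelSnd_spec {G : E → E →L[ℝ] E →L[ℝ] ℝ} {x : E} (hG : ∀ v, G x v = 0 → v = 0)
    (u v w : E) : 2 * G x (christoffelSnd G x u v) w =
      fderiv ℝ G x u v w + fderiv ℝ G x v u w - fderiv ℝ G x w u v := by
  obtain ⟨A, hA⟩ := isInvertible_of_injective (G x) hG
  have h1 : G x (christoffelSnd G x u v) = christoffelForm E (fderiv ℝ G x) u v := by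
    show G x ((G x).inverse (christoffelForm E (fderiv ℝ G x) u v)) = _
    rw [← hA, ContinuousLinearMap.inverse_equiv]
    exact A.apply_symm_apply _
  rw [h1, christoffelForm_apply]
  ring

/-- Inversion is smooth at invertible operators, and class C¹ is all that is needed for the local
Lipschitz bound on the Christoffel symbols. -/
theorem contDiffAt_christoffelSnd {G : E → E →L[ℝ] E →L[ℝ] ℝ} {x : E} (hG : ContDiffAt ℝ ∞ G x)
    (hx : ∀ v, G x v = 0 → v = 0) : ContDiffAt ℝ 1 (christoffelSnd G) x := by
  obtain ⟨A, hA⟩ := isInvertible_of_injective (G x) hx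
  have h1 : ContDiffAt ℝ 1 (fun y ↦ (G y).inverse) x := by
    have h2 : ContDiffAt ℝ 1 ContinuousLinearMap.inverse (G x) := by
      rw [← hA]; exact contDiffAt_map_inverse A
    exact h2.comp x (hG.of_le (by exact_mod_cast le_top))
  have h3 : ContDiffAt ℝ 1 (fderiv ℝ G) x := (contDiffAt_infty.mp hG 2).fderiv_right (by norm_num [one_add_one_eq_two])
  exact ((ContinuousLinearMap.contDiff _).contDiffAt.comp x h1).clm_comp
    ((ContinuousLinearMap.contDiff _).contDiffAt.comp x h3)

omit [FiniteDimensional ℝ E] in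
-- Replacing B₀ by nearby forms costs at most half of ‖v‖², which is absorbed on the left and
-- doubles the constants. The form and the time covector are perturbed independently, because `star`
-- evaluates them at different points.
theorem star_perturb {k K₁ δ : ℝ} (hk : 0 < k) (hK₁ : 0 < K₁) (hδ : 0 < δ) {e : E}
    (hδ' : δ * (k + 2 * K₁ * ‖e‖ ^ 2) ≤ 1 / 2) (hδ1 : δ ≤ 1) {B₀ B B' : E →L[ℝ] E →L[ℝ] ℝ}
    (h₀ : ∀ v, ‖v‖ ^ 2 ≤ k * B₀ v v + K₁ * (B₀ e v) ^ 2) (hB : ‖B - B₀‖ ≤ δ)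
    (hB' : ‖B' - B₀‖ ≤ δ) (v : E) :
    ‖v‖ ^ 2 ≤ (2 * k + 4 * K₁) * max (B v v) 0 + (2 * k + 4 * K₁) * (B' e v) ^ 2 := by
  have h1 := (abs_le.mp (bilin_le hB v v)).1
  have h2 := bilin_le hB' e v
  simp only [sub_apply] at h1 h2
  have h3 : (B₀ e v) ^ 2 ≤ 2 * (B' e v) ^ 2 + 2 * (δ * ‖e‖ * ‖v‖) ^ 2 := by
    have h4 : (B' e v - B₀ e v) ^ 2 ≤ (δ * ‖e‖ * ‖v‖) ^ 2 := by
      rw [← sq_abs (B' e v - B₀ e v)]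
      exact pow_le_pow_left₀ (abs_nonneg _) h2 2
    nlinarith [sq_nonneg (2 * B' e v - B₀ e v)]
  have h5 : δ ^ 2 ≤ δ := by nlinarith
  have h6 : (δ * ‖e‖ * ‖v‖) ^ 2 ≤ δ * ‖e‖ ^ 2 * ‖v‖ ^ 2 := by
    have : (δ * ‖e‖ * ‖v‖) ^ 2 = δ ^ 2 * (‖e‖ ^ 2 * ‖v‖ ^ 2) := by ring
    rw [this, mul_assoc]
    gcongr
  have h7 := h₀ v
  have h8 : k * B₀ v v ≤ k * max (B v v) 0 + k * (δ * ‖v‖ * ‖v‖) := by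
    rw [← mul_add]
    gcongr
    linarith [le_max_left (B v v) 0]
  have h9 : K₁ * (B₀ e v) ^ 2 ≤ 2 * K₁ * (B' e v) ^ 2 + 2 * K₁ * (δ * ‖e‖ ^ 2 * ‖v‖ ^ 2) := by
    nlinarith
  have h10 : δ * (k + 2 * K₁ * ‖e‖ ^ 2) * ‖v‖ ^ 2 ≤ 1 / 2 * ‖v‖ ^ 2 := by gcongr
  have h11 : 0 ≤ K₁ * max (B v v) 0 := mul_nonneg hK₁.le (le_max_right _ _)
  have h12 : 0 ≤ k * (B' e v) ^ 2 := by positivity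
  nlinarith

/-- Each estimate holds near y₀ by continuity or because C¹ maps are locally Lipschitz. One K
dominates all constants and is fixed before ρ, so that `small` becomes a condition on ρ alone. -/
theorem exists_goodBox {G : E → E →L[ℝ] E →L[ℝ] ℝ} {y₀ e : E} (hG : ContDiffAt ℝ ∞ G y₀)
    (hsymm : ∀ᶠ x in 𝓝 y₀, ∀ v w, G x v w = G x w v) (he : G y₀ e e < 0)
    (hpos : ∀ w, G y₀ e w = 0 → w ≠ 0 → 0 < G y₀ w w) :
    ∃ K ρ₀ : ℝ, 0 < ρ₀ ∧ ∀ ρ, 0 < ρ → ρ ≤ ρ₀ → GoodBox G (christoffelSnd G) y₀ e ρ K := by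
  obtain ⟨k, K₁, hk, hK₁, hstar⟩ := exists_star_of_lorentz (G y₀) hsymm.self_of_nhds e he hpos
  obtain ⟨δ, hδ, hδ', hδ1⟩ : ∃ δ : ℝ, 0 < δ ∧ δ * (k + 2 * K₁ * ‖e‖ ^ 2) ≤ 1 / 2 ∧ δ ≤ 1 := by
    refine ⟨1 / (2 * (k + 2 * K₁ * ‖e‖ ^ 2) + 1), by positivity, ?_, ?_⟩
    · rw [div_mul_eq_mul_div, div_le_iff₀ (by positivity)]
      linarith
    · rw [div_le_one (by positivity)]
      have : 0 ≤ 2 * (k + 2 * K₁ * ‖e‖ ^ 2) := by positivity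
      linarith
  have hG1 : ContDiffAt ℝ 1 G y₀ := hG.of_le (by exact_mod_cast le_top)
  have hnear : ∀ᶠ x in 𝓝 y₀, ‖G x - G y₀‖ ≤ δ := by
    have := hG1.continuousAt.eventually (Metric.closedBall_mem_nhds (G y₀) hδ)
    simpa [dist_eq_norm] using this
  have hnd : ∀ v, G y₀ v = 0 → v = 0 := by
    intro v hv
    have h1 := hstar v
    rw [hsymm.self_of_nhds e v, hv] at h1
    simpa using h1
  have hDG : ContDiffAt ℝ 1 (fderiv ℝ G) y₀ := (contDiffAt_infty.mp hG 2).fderiv_right (by norm_num [one_add_one_eq_two])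
  have hΓ : ContDiffAt ℝ 1 (christoffelSnd G) y₀ := contDiffAt_christoffelSnd hG hnd
  obtain ⟨L₁, s₁, hs₁, hL₁⟩ := hG1.exists_lipschitzOnWith
  obtain ⟨L₂, s₂, hs₂, hL₂⟩ := hDG.exists_lipschitzOnWith
  obtain ⟨L₃, s₃, hs₃, hL₃⟩ := hΓ.exists_lipschitzOnWith
  have hb : ∀ {F : Type _} [NormedAddCommGroup F] {f : E → F}, ContinuousAt f y₀ →
      ∀ᶠ x in 𝓝 y₀, ‖f x‖ ≤ ‖f y₀‖ + 1 := by
    intro F _ f hf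
    have := hf.norm.eventually (Iic_mem_nhds (lt_add_one ‖f y₀‖))
    exact this
  have hdiff : ∀ᶠ x in 𝓝 y₀, DifferentiableAt ℝ G x := by
    filter_upwards [hG1.eventually (by simp)] with x hx
    exact hx.differentiableAt one_ne_zero
  have hs₁' : ∀ᶠ x in 𝓝 y₀, x ∈ s₁ := hs₁
  have hs₂' : ∀ᶠ x in 𝓝 y₀, x ∈ s₂ := hs₂
  have hs₃' : ∀ᶠ x in 𝓝 y₀, x ∈ s₃ := hs₃
  have hev := (hsymm.and (hnear.and (hdiff.and ((hb hG1.continuousAt).and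
    ((hb hDG.continuousAt).and ((hb hΓ.continuousAt).and
      (hs₁'.and (hs₂'.and hs₃'))))))))
  obtain ⟨ρ₁, hρ₁, hball⟩ := Metric.eventually_nhds_iff_ball.mp hev
  set K : ℝ := 1 + ‖e‖ + (2 * k + 4 * K₁) + (‖G y₀‖ + 1) + (‖fderiv ℝ G y₀‖ + 1) +
    (‖christoffelSnd G y₀‖ + 1) + L₁ + L₂ + L₃ with hK
  have p1 := norm_nonneg e
  have p2 := norm_nonneg (G y₀)
  have p3 := norm_nonneg (fderiv ℝ G y₀)
  have p4 := norm_nonneg (christoffelSnd G y₀)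
  have p5 := L₁.coe_nonneg
  have p6 := L₂.coe_nonneg
  have p7 := L₃.coe_nonneg
  have hK1 : 1 ≤ K := by rw [hK]; linarith
  have hKp : 0 < K := by linarith
  refine ⟨K, min ρ₁ (1 / (10 ^ 6 * K ^ 12)), lt_min hρ₁ (by positivity), fun ρ hρ hρ' ↦ ?_⟩
  have hsub : ∀ x ∈ Metric.ball y₀ ρ, x ∈ Metric.ball y₀ ρ₁ := fun x hx ↦
    Metric.ball_subset_ball (hρ'.trans (min_le_left _ _)) hx
  have hstar' : ∀ x ∈ Metric.ball y₀ ρ, ∀ y ∈ Metric.ball y₀ ρ, ∀ v,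
      ‖v‖ ^ 2 ≤ K * max (G y v v) 0 + K * (G x e v) ^ 2 := by
    intro x hx y hy v
    have h1 := star_perturb hk hK₁ hδ hδ' hδ1 hstar (hball y (hsub y hy)).2.1
      (hball x (hsub x hx)).2.1 v
    have h2 : 2 * k + 4 * K₁ ≤ K := by rw [hK]; linarith
    have h3 : 0 ≤ max (G y v v) 0 := le_max_right _ _
    exact h1.trans (by gcongr)
  have hlip : ∀ {F : Type _} [NormedAddCommGroup F] {f : E → F} {L : NNReal} {s : Set E},
      LipschitzOnWith L f s → (L : ℝ) ≤ K → ∀ x ∈ s, ∀ y ∈ s, ‖f x - f y‖ ≤ K * ‖x - y‖ := by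
    intro F _ f L s hf hLK x hx y hy
    have := hf.dist_le_mul x hx y hy
    rw [dist_eq_norm, dist_eq_norm] at this
    exact this.trans (by gcongr)
  exact
  { one_le := hK1
    pos := hρ
    small := by
      have := hρ'.trans (min_le_right _ _)
      rwa [le_div_iff₀ (by positivity), mul_comm] at this
    e_bound := by rw [hK]; linarith
    symm := fun x hx ↦ (hball x (hsub x hx)).1
    bound := fun x hx ↦ (hball x (hsub x hx)).2.2.2.1.trans (by rw [hK]; linarith)
    lip := fun x hx y hy ↦ hlip hL₁ (by rw [hK]; linarith) x (hball x (hsub x hx)).2.2.2.2.2.2.1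
      y (hball y (hsub y hy)).2.2.2.2.2.2.1
    diff := fun x hx ↦ (hball x (hsub x hx)).2.2.1
    deriv_bound := fun x hx ↦ (hball x (hsub x hx)).2.2.2.2.1.trans (by rw [hK]; linarith)
    deriv_lip := fun x hx y hy ↦ hlip hL₂ (by rw [hK]; linarith) x
      (hball x (hsub x hx)).2.2.2.2.2.2.2.1 y (hball y (hsub y hy)).2.2.2.2.2.2.2.1
    chr_bound := fun x hx ↦ (hball x (hsub x hx)).2.2.2.2.2.1.trans (by rw [hK]; linarith)
    chr_lip := fun x hx y hy ↦ hlip hL₃ (by rw [hK]; linarith) x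
      (hball x (hsub x hx)).2.2.2.2.2.2.2.2 y (hball y (hsub y hy)).2.2.2.2.2.2.2.2
    chr_eq := fun x hx u v w ↦ by
      refine christoffelSnd_spec (fun v hv ↦ ?_) u v w
      have h1 := hstar' x hx x hx v
      rw [(hball x (hsub x hx)).1 e v, hv] at h1
      simpa using h1
    star := hstar' }

end GoodBoxExistence

section ChartBox

variable {d : ℕ} {M : Type*} [TopologicalSpace M] [ChartedSpace (ModelSpace d) M]
  [IsManifold 𝓘(ℝ, ModelSpace d) ∞ M] (g : LorentzSpacetime d M)

/-- The ball of radius `ρ` around the centre of the chart at `p` is a good box, in which the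
reference direction `e` describes the time orientation. -/
structure IsChartBox (p : M) (e : ModelSpace d) (ρ K : ℝ) : Prop where
  sub : Metric.ball (chart d p p) ρ ⊆ (chart d p).target
  good : GoodBox (g.chartForm p) (christoffelSnd (g.chartForm p)) (chart d p p) e ρ K
  timelike_iff : ∀ y ∈ Metric.ball (chart d p p) ρ, ∀ v,
    g.ChartTimelike p y v ↔ BoxTimelike (g.chartForm p) (chart d p p) e y v
  causal_iff : ∀ y ∈ Metric.ball (chart d p p) ρ, ∀ v,
    g.ChartCausal p y v ↔ BoxCausal (g.chartForm p) (chart d p p) e y v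

theorem chartForm_symm (p : M) (y v w : ModelSpace d) :
    g.chartForm p y v w = g.chartForm p y w v :=
  g.metric_symm ((chart d p).symm y) _ _

theorem coordPush_injective {p : M} {y : ModelSpace d} (hy : y ∈ (chart d p).target)
    {v : ModelSpace d} (hv : coordPush p y v = 0) : v = 0 := by
  rw [← coordPull_coordPush hy v, hv, map_zero]

theorem chartForm_time_neg {p : M} {y : ModelSpace d} (hy : y ∈ (chart d p).target) :
    g.chartForm p y (g.chartTime p y) (g.chartTime p y) < 0 := by
  rw [chartForm_chartTime g hy]
  have hx := (chart d p).map_target hy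
  have h := coordPush_coordPull hx (g.timeField ((chart d p).symm y))
  rw [(chart d p).right_inv hy] at h
  have h2 : coordPush p y (g.chartTime p y) = g.timeField ((chart d p).symm y) := h
  rw [h2]
  exact g.timeField_timelike _

theorem chartForm_pos {p : M} {y : ModelSpace d} (hy : y ∈ (chart d p).target)
    {w : ModelSpace d} (hw : g.chartForm p y (g.chartTime p y) w = 0) (hw0 : w ≠ 0) :
    0 < g.chartForm p y w w := by
  rw [chartForm_chartTime g hy] at hw
  exact g.pos_of_orthogonal _ _ hw fun h ↦ hw0 (coordPush_injective hy h)

/-- The direction `e` is the time field at the centre. Near the centre the true time covector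
differs from the frozen one by at most 1/(2K) in norm, hence on a causal vector by at most half of
the frozen value, so both have the same sign. -/
theorem exists_isChartBox (p : M) : ∃ (e : ModelSpace d) (K ρ₀ : ℝ), 0 < ρ₀ ∧
    ∀ ρ, 0 < ρ → ρ ≤ ρ₀ → g.IsChartBox p e ρ K := by
  set y₀ := chart d p p with hy₀
  have hy : y₀ ∈ (chart d p).target := mem_extChartAt_target p
  have hnhds : (chart d p).target ∈ 𝓝 y₀ := (isOpen_chart_target p).mem_nhds hy
  set e := g.chartTime p y₀ with he
  obtain ⟨K, ρ₁, hρ₁, hbox⟩ := exists_goodBox (e := e)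
    ((g.contDiffOn_chartForm p).contDiffAt hnhds)
    (Eventually.of_forall fun x v w ↦ g.chartForm_symm p x v w)
    (g.chartForm_time_neg hy) (fun w hw hw0 ↦ g.chartForm_pos hy hw hw0)
  have hKp : 0 < K := (hbox ρ₁ hρ₁ le_rfl).K_pos
  have hcov : ContinuousAt (fun y ↦ g.chartForm p y (g.chartTime p y)) y₀ :=
    ((g.contDiffOn_chartForm p).continuousOn.continuousAt hnhds).clm_apply
      ((g.continuousOn_chartTime p).continuousAt hnhds)
  have hev : ∀ᶠ y in 𝓝 y₀, ‖g.chartForm p y (g.chartTime p y) - g.chartForm p y₀ e‖ ≤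
      1 / (2 * K) := by
    have := hcov.eventually (Metric.closedBall_mem_nhds _ (by positivity : 0 < 1 / (2 * K)))
    simpa [dist_eq_norm] using this
  obtain ⟨ρ₂, hρ₂, hball⟩ := Metric.eventually_nhds_iff_ball.mp
    (hev.and (show ∀ᶠ y in 𝓝 y₀, y ∈ (chart d p).target from hnhds))
  refine ⟨e, K, min ρ₁ ρ₂, lt_min hρ₁ hρ₂, fun ρ hρ hρ' ↦ ?_⟩
  have hgood := hbox ρ hρ (hρ'.trans (min_le_left _ _))
  have hsub : ∀ y ∈ Metric.ball y₀ ρ, y ∈ Metric.ball y₀ ρ₂ := fun y hy ↦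
    Metric.ball_subset_ball (hρ'.trans (min_le_right _ _)) hy
  have hsign : ∀ y ∈ Metric.ball y₀ ρ, ∀ v, g.chartForm p y v v ≤ 0 →
      (g.chartForm p y (g.chartTime p y) v < 0 ↔ g.chartForm p y₀ e v < 0) := by
    intro y hy v hv
    have h1 := hgood.norm_le_of_causal hgood.center_mem hy hv
    have h2 : |g.chartForm p y (g.chartTime p y) v - g.chartForm p y₀ e v| ≤
        |g.chartForm p y₀ e v| / 2 := by
      calc _ = ‖(g.chartForm p y (g.chartTime p y) - g.chartForm p y₀ e) v‖ := by
            simp [Real.norm_eq_abs]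
        _ ≤ 1 / (2 * K) * (K * |g.chartForm p y₀ e v|) :=
            ((ContinuousLinearMap.le_opNorm _ _).trans (by
              gcongr; exact (hball y (hsub y hy)).1))
        _ = _ := by field_simp
    have h3 := abs_le.mp h2
    constructor
    · intro h4
      by_contra h5
      rw [abs_of_nonneg (not_lt.mp h5)] at h3
      linarith [h3.1]
    · intro h4
      rw [abs_of_neg h4] at h3
      linarith [h3.2]
  exact
  { sub := fun y hy ↦ (hball y (hsub y hy)).2
    good := hgood
    timelike_iff := fun y hy v ↦ and_congr_right fun h ↦ hsign y hy v h.le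
    causal_iff := fun y hy v ↦ and_congr_right fun h ↦ hsign y hy v h }

end ChartBox

end LorentzSpacetime

end

set_option maxSynthPendingDepth 3

noncomputable section

namespace LorentzSpacetime

/-! ### Restriction, gluing and reparametrisation of piecewise curves. -/

section CurveOperations

variable {d : ℕ} {M : Type*} [TopologicalSpace M] [ChartedSpace (ModelSpace d) M]
  {P P' : ∀ x : M, Tgt (d := d) x → Prop} {γ γ' : ℝ → M} {J J₁ J₂ : Set ℝ}

theorem velocityWithin_congr_pred (h : EqOn γ γ' J) {t : ℝ} (ht : t ∈ J)
    (hP : P (γ t) (velocityWithin d γ J t)) : P (γ' t) (velocityWithin d γ' J t) := by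
  have h1 : (mfderivWithin 𝓘(ℝ, ℝ) 𝓘(ℝ, ModelSpace d) γ' J t : ℝ →L[ℝ] ModelSpace d) =
      (mfderivWithin 𝓘(ℝ, ℝ) 𝓘(ℝ, ModelSpace d) γ J t : ℝ →L[ℝ] ModelSpace d) :=
    mfderivWithin_congr (fun x hx ↦ (h hx).symm) (h ht).symm
  have h2 : (velocityWithin d γ' J t : ModelSpace d) = velocityWithin d γ J t :=
    congrArg (fun L : ℝ →L[ℝ] ModelSpace d ↦ L 1) h1
  have h3 : ∀ (x : M) (w : ModelSpace d), x = γ t → w = velocityWithin d γ J t → P x w := by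
    rintro x w rfl rfl; exact hP
  exact h3 _ _ (h ht).symm h2

theorem _root_.IsPiecewiseC1Curve.congr (hγ : IsPiecewiseC1Curve P γ J) (h : EqOn γ γ' J) :
    IsPiecewiseC1Curve P γ' J := by
  refine ⟨hγ.1, hγ.2.1, fun a b hab hsub ↦ ?_⟩
  obtain ⟨F, hF⟩ := hγ.2.2 a b hab hsub
  refine ⟨F, fun u v hu huv hv hd ↦ ?_⟩
  have hs : Icc u v ⊆ J := (Icc_subset_Icc hu hv).trans hsub
  obtain ⟨h1, h2⟩ := hF u v hu huv hv hd
  exact ⟨h1.congr fun x hx ↦ (h (hs hx)).symm,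
    fun t ht ↦ velocityWithin_congr_pred (h.mono hs) ht (h2 t ht)⟩

theorem _root_.IsPiecewiseC1Curve.mono (hγ : IsPiecewiseC1Curve P γ J)
    (h : ∀ x v, P x v → P' x v) : IsPiecewiseC1Curve P' γ J := by
  refine ⟨hγ.1, hγ.2.1, fun a b hab hsub ↦ ?_⟩
  obtain ⟨F, hF⟩ := hγ.2.2 a b hab hsub
  exact ⟨F, fun u v hu huv hv hd ↦ ⟨(hF u v hu huv hv hd).1,
    fun t ht ↦ h _ _ ((hF u v hu huv hv hd).2 t ht)⟩⟩

theorem _root_.IsPiecewiseC1Curve.subset (hγ : IsPiecewiseC1Curve P γ J) (hJ : J₁ ⊆ J)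
    (h1 : J₁.OrdConnected) (h2 : J₁.Nontrivial) : IsPiecewiseC1Curve P γ J₁ :=
  ⟨h1, h2, fun a b hab hsub ↦ hγ.2.2 a b hab (hsub.trans hJ)⟩

theorem _root_.IsPiecewiseC1Curve.sub_Icc (hγ : IsPiecewiseC1Curve P γ J) {a b : ℝ} (hab : a < b)
    (ha : a ∈ J) (hb : b ∈ J) : IsPiecewiseC1Curve P γ (Icc a b) :=
  hγ.subset (hγ.1.out ha hb) ordConnected_Icc ⟨a, by simp [hab.le], b, by simp [hab.le], hab.ne⟩

theorem _root_.IsPiecewiseC1Curve.continuousOn_Icc {a b : ℝ} (hab : a < b)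
    (hγ : IsPiecewiseC1Curve P γ (Icc a b)) : ContinuousOn γ (Icc a b) := by
  obtain ⟨F, hF⟩ := hγ.2.2 a b hab subset_rfl
  refine piecewise_induction F (P := fun u v ↦ ContinuousOn γ (Icc u v)) ?_ ?_ a b le_rfl hab le_rfl
  · exact fun u v hu huv hv hd ↦ (hF u v hu huv hv hd).1.continuousOn
  · intro u v w _ huv hvw _ h1 h2
    rw [← Icc_union_Icc_eq_Icc huv.le hvw.le]
    exact h1.union_of_isClosed h2 isClosed_Icc isClosed_Icc

/-- The junction is added to the break points, so no smooth piece straddles it and the velocities on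
the two sides need not match. -/
theorem _root_.IsPiecewiseC1Curve.glue {t₁ : ℝ} (h1 : IsPiecewiseC1Curve P γ J₁)
    (h2 : IsPiecewiseC1Curve P γ J₂) (ht₁ : IsGreatest J₁ t₁) (ht₂ : IsLeast J₂ t₁) :
    IsPiecewiseC1Curve P γ (J₁ ∪ J₂) := by
  have hc1 : ∀ x ∈ J₁ ∪ J₂, x ≤ t₁ → x ∈ J₁ := by
    rintro x (hx | hx) hxt
    · exact hx
    · rw [le_antisymm hxt (ht₂.2 hx)]; exact ht₁.1
  have hc2 : ∀ x ∈ J₁ ∪ J₂, t₁ ≤ x → x ∈ J₂ := by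
    rintro x (hx | hx) hxt
    · rw [le_antisymm (ht₁.2 hx) hxt]; exact ht₂.1
    · exact hx
  refine ⟨⟨fun x hx y hy z hz ↦ ?_⟩, h1.2.1.mono subset_union_left, fun a b hab hsub ↦ ?_⟩
  · rcases le_total z t₁ with hz1 | hz1
    · exact Or.inl (h1.1.out (hc1 x hx (hz.1.trans hz1)) ht₁.1 ⟨hz.1, hz1⟩)
    · exact Or.inr (h2.1.out ht₂.1 (hc2 y hy (hz1.trans hz.2)) ⟨hz1, hz.2⟩)
  · rcases le_or_gt b t₁ with hb | hb
    · exact h1.2.2 a b hab fun x hx ↦ hc1 x (hsub hx) (hx.2.trans hb)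
    rcases le_or_gt t₁ a with ha | ha
    · exact h2.2.2 a b hab fun x hx ↦ hc2 x (hsub hx) (ha.trans hx.1)
    obtain ⟨F₁, hF₁⟩ := h1.2.2 a t₁ ha fun x hx ↦ hc1 x (hsub ⟨hx.1, hx.2.trans hb.le⟩) hx.2
    obtain ⟨F₂, hF₂⟩ := h2.2.2 t₁ b hb fun x hx ↦ hc2 x (hsub ⟨ha.le.trans hx.1, hx.2⟩) hx.1
    classical
    refine ⟨insert t₁ (F₁ ∪ F₂), fun u v hu huv hv hd ↦ ?_⟩
    rw [Finset.coe_insert, Finset.coe_union, Set.disjoint_insert_left, Set.disjoint_union_left] at hd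
    have hcase : v ≤ t₁ ∨ t₁ ≤ u := by
      by_contra hcon
      push Not at hcon
      exact hd.1 ⟨hcon.2, hcon.1⟩
    rcases hcase with hc | hc
    · exact hF₁ u v hu huv hc hd.2.1
    · exact hF₂ u v hc huv hv hd.2.2

/-- The curve `γ₁` up to parameter `t₁`, then `γ₂`. -/
def concatAt (t₁ : ℝ) (γ₁ γ₂ : ℝ → M) (t : ℝ) : M := if t ≤ t₁ then γ₁ t else γ₂ t

theorem _root_.IsPiecewiseC1Curve.concat {t₁ : ℝ} (h1 : IsPiecewiseC1Curve P γ J₁)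
    (h2 : IsPiecewiseC1Curve P γ' J₂) (ht₁ : IsGreatest J₁ t₁) (ht₂ : IsLeast J₂ t₁)
    (heq : γ t₁ = γ' t₁) : IsPiecewiseC1Curve P (concatAt t₁ γ γ') (J₁ ∪ J₂) := by
  refine (h1.congr fun t ht ↦ ?_).glue (h2.congr fun t ht ↦ ?_) ht₁ ht₂
  · rw [concatAt, if_pos (ht₁.2 ht)]
  · rcases (ht₂.2 ht).eq_or_lt with h | h
    · rw [concatAt, if_pos h.ge, ← h, heq]
    · rw [concatAt, if_neg (not_le.mpr h)]

theorem velocityWithin_comp_affine {α β : ℝ} {I I' : Set ℝ} {t : ℝ}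
    (hm : MapsTo (fun s ↦ α * s + β) I I') (hI : UniqueDiffWithinAt ℝ I t)
    (hγ : MDifferentiableWithinAt 𝓘(ℝ, ℝ) 𝓘(ℝ, ModelSpace d) γ I' (α * t + β)) :
    (velocityWithin d (γ ∘ fun s ↦ α * s + β) I t : ModelSpace d) =
      α • (velocityWithin d γ I' (α * t + β) : ModelSpace d) := by
  have h1 : HasDerivWithinAt (fun s : ℝ ↦ α * s + β) α I t := by
    simpa using (((hasDerivAt_id t).const_mul α).add_const β).hasDerivWithinAt
  have h2 := hasMFDerivWithinAt_iff_hasFDerivWithinAt.mpr h1.hasFDerivWithinAt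
  have h3 := (hγ.hasMFDerivWithinAt.comp t h2 hm).mfderivWithin hI.uniqueMDiffWithinAt
  let A : ℝ →L[ℝ] ModelSpace d := mfderivWithin 𝓘(ℝ, ℝ) 𝓘(ℝ, ModelSpace d) γ I' (α * t + β)
  have h4 : (velocityWithin d (γ ∘ fun s ↦ α * s + β) I t : ModelSpace d) = A ((1 : ℝ) • α) :=
    congrArg (fun L : ℝ →L[ℝ] ModelSpace d ↦ L 1) h3
  rw [h4, one_smul]
  have h5 : A α = α • A 1 := by rw [← map_smul, smul_eq_mul, mul_one]
  exact h5

/-- Both signs of α are admitted, whence the minima and maxima: positive α rescales, negative α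
serves time reversal, with P' the opposite cone. -/
theorem _root_.IsPiecewiseC1Curve.comp_affine {α β : ℝ} (hα : α ≠ 0)
    (hP : ∀ (x : M) (v : ModelSpace d), P x v → P' x (α • v))
    (hγ : IsPiecewiseC1Curve P γ J) :
    IsPiecewiseC1Curve P' (γ ∘ fun s ↦ α * s + β) ((fun s ↦ α * s + β) ⁻¹' J) := by
  set φ : ℝ → ℝ := fun s ↦ α * s + β with hφ
  set ψ : ℝ → ℝ := fun s ↦ (s - β) / α with hψ
  have hφψ : ∀ s, φ (ψ s) = s := fun s ↦ by simp only [hφ, hψ]; field_simp; ring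
  have hbet : ∀ {s t x : ℝ}, s ≤ x → x ≤ t → φ x ∈ Icc (min (φ s) (φ t)) (max (φ s) (φ t)) := by
    intro s t x h1 h2
    simp only [hφ]
    rcases lt_or_gt_of_ne hα with h | h
    · exact ⟨min_le_of_right_le (by nlinarith), le_max_of_le_left (by nlinarith)⟩
    · exact ⟨min_le_of_left_le (by nlinarith), le_max_of_le_right (by nlinarith)⟩
  have hne : ∀ {s t : ℝ}, s < t → min (φ s) (φ t) < max (φ s) (φ t) := by
    intro s t hst
    refine min_lt_max.mpr fun h ↦ ?_
    simp only [hφ] at h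
    have : α * (s - t) = 0 := by linarith
    rcases mul_eq_zero.mp this with h | h
    · exact hα h
    · linarith
  have hbet' : ∀ {s t x : ℝ}, s < t → x ∈ Ioo (min (φ s) (φ t)) (max (φ s) (φ t)) →
      ψ x ∈ Ioo s t := by
    intro s t x hst hx
    have hx' := hφψ x
    set z := ψ x
    rw [← hx'] at hx
    simp only [hφ] at hx
    rcases lt_or_gt_of_ne hα with h | h
    · rw [min_eq_right (by nlinarith), max_eq_left (by nlinarith)] at hx
      exact ⟨by nlinarith [hx.2], by nlinarith [hx.1]⟩
    · rw [min_eq_left (by nlinarith), max_eq_right (by nlinarith)] at hx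
      exact ⟨by nlinarith [hx.1], by nlinarith [hx.2]⟩
  have hmem : ∀ {s t : ℝ}, φ s ∈ J → φ t ∈ J → Icc (min (φ s) (φ t)) (max (φ s) (φ t)) ⊆ J := by
    intro s t hs ht
    exact hγ.1.uIcc_subset hs ht
  refine ⟨⟨fun x hx y hy z hz ↦ hmem hx hy (hbet hz.1 hz.2)⟩, ?_, fun a b hab hsub ↦ ?_⟩
  · obtain ⟨x, hx, y, hy, hxy⟩ := hγ.2.1
    refine ⟨ψ x, by simpa [hφψ] using hx, ψ y, by simpa [hφψ] using hy, fun h ↦ hxy ?_⟩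
    rw [← hφψ x, h, hφψ]
  · obtain ⟨F, hF⟩ := hγ.2.2 _ _ (hne hab)
      (hmem (hsub ⟨le_rfl, hab.le⟩) (hsub ⟨hab.le, le_rfl⟩))
    classical
    refine ⟨F.image ψ, fun u v hu huv hv hd ↦ ?_⟩
    have hu' := hbet hu (huv.le.trans hv)
    have hv' := hbet (hu.trans huv.le) hv
    obtain ⟨h1, h2⟩ := hF _ _ (le_min hu'.1 hv'.1) (hne huv) (max_le hu'.2 hv'.2) (by
      rw [Set.disjoint_left] at hd ⊢
      intro x hx hx'
      exact hd (by simpa using ⟨x, hx, rfl⟩) (hbet' huv hx'))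
    have hm : MapsTo φ (Icc u v) (Icc (min (φ u) (φ v)) (max (φ u) (φ v))) :=
      fun x hx ↦ hbet hx.1 hx.2
    refine ⟨?_, fun t ht ↦ ?_⟩
    · refine h1.comp (contMDiffOn_iff_contDiffOn.mpr ?_) hm
      exact ContDiff.contDiffOn (by fun_prop)
    · have h3 := velocityWithin_comp_affine (d := d) hm (uniqueDiffOn_Icc huv t ht)
        (h1.mdifferentiableOn (by simp) _ (hm ht))
      have h4 := hP _ _ (h2 _ (hm ht))
      have h5 : ∀ w : ModelSpace d, w = α • (velocityWithin d γ
          (Icc (min (φ u) (φ v)) (max (φ u) (φ v))) (α * t + β) : ModelSpace d) →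
          P' (γ (φ t)) w := by rintro w rfl; exact h4
      exact h5 _ h3

end CurveOperations

end LorentzSpacetime

end

set_option maxSynthPendingDepth 3

noncomputable section

namespace LorentzSpacetime

/-! ### The chronology relation and its openness. -/

section Chronology

variable {d : ℕ} {M : Type*} [TopologicalSpace M] [ChartedSpace (ModelSpace d) M]

theorem _root_.IsPiecewiseC1Curve.translate {P : ∀ x : M, Tgt (d := d) x → Prop} {γ : ℝ → M}
    {J : Set ℝ} (hγ : IsPiecewiseC1Curve P γ J) (β : ℝ) :
    IsPiecewiseC1Curve P (fun s ↦ γ (s + β)) ((fun s ↦ s + β) ⁻¹' J) := by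
  have := hγ.comp_affine (α := 1) (β := β) one_ne_zero (P' := P)
    (fun x v hv ↦ by rwa [one_smul])
  simpa only [one_mul] using! this

variable [IsManifold 𝓘(ℝ, ModelSpace d) ∞ M] (g : LorentzSpacetime d M)

/-- The chronology relation: some timelike curve runs from `p` to `q`. -/
def Chron (p q : M) : Prop :=
  ∃ (γ : ℝ → M) (a b : ℝ), a < b ∧ g.IsTimelikeCurve γ (Icc a b) ∧ γ a = p ∧ γ b = q

variable {g}

theorem mem_chronFutureIn_univ {p q : M} : q ∈ g.chronFutureIn univ p ↔ g.Chron p q := by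
  constructor
  · rintro ⟨γ, a, b, h, h1, -, h2, h3⟩; exact ⟨γ, a, b, h, h1, h2, h3⟩
  · rintro ⟨γ, a, b, h, h1, h2, h3⟩; exact ⟨γ, a, b, h, h1, mapsTo_univ _ _, h2, h3⟩

theorem Chron.of_mem {U : Set M} {p q : M} (h : q ∈ g.chronFutureIn U p) : g.Chron p q := by
  obtain ⟨γ, a, b, h, h1, -, h2, h3⟩ := h; exact ⟨γ, a, b, h, h1, h2, h3⟩

theorem mem_chronPast {A : Set M} {q : M} : q ∈ g.chronPast A ↔ ∃ p ∈ A, g.Chron q p := by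
  simp only [chronPast, chronPastIn, mem_iUnion, mem_ofPred_eq, mem_chronFutureIn_univ, exists_prop]

theorem FutureTimelike.smul {x : M} {v : Tgt (d := d) x} (h : g.FutureTimelike x v) {α : ℝ}
    (hα : 0 < α) : g.FutureTimelike x (α • v) := by
  obtain ⟨h1, h2⟩ := h
  constructor
  · simp only [map_smul, smul_apply, smul_eq_mul]
    exact mul_neg_of_pos_of_neg hα (mul_neg_of_pos_of_neg hα h1)
  · simp only [map_smul, smul_eq_mul]
    exact mul_neg_of_pos_of_neg hα h2

theorem Chron.exists_on {p q : M} (h : g.Chron p q) {u v : ℝ} (huv : u < v) :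
    ∃ γ : ℝ → M, g.IsTimelikeCurve γ (Icc u v) ∧ γ u = p ∧ γ v = q := by
  obtain ⟨γ, a, b, hab, hγ, rfl, rfl⟩ := h
  have h1 : (0 : ℝ) < v - u := sub_pos.mpr huv
  have h2 : (0 : ℝ) < b - a := sub_pos.mpr hab
  set α := (b - a) / (v - u) with hα
  have hα0 : 0 < α := div_pos h2 h1
  have hαm : α * (v - u) = b - a := by rw [hα]; field_simp
  refine ⟨γ ∘ fun s ↦ α * s + (a - α * u), ?_, ?_, ?_⟩
  · have := hγ.comp_affine (α := α) (β := a - α * u) hα0.ne' (P' := g.FutureTimelike)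
      (fun x v hv ↦ FutureTimelike.smul hv hα0)
    convert! this using 1
    ext s
    simp only [mem_Icc, mem_preimage]
    constructor
    · rintro ⟨h3, h4⟩
      constructor <;> nlinarith
    · rintro ⟨h3, h4⟩
      constructor <;> by_contra! h5 <;> nlinarith
  · simp
  · simp only [Function.comp_apply]; congr 1; linarith

theorem Chron.trans {p q r : M} (h1 : g.Chron p q) (h2 : g.Chron q r) : g.Chron p r := by
  obtain ⟨γ₁, hγ₁, ha, hb⟩ := h1.exists_on (u := 0) (v := 1) one_pos
  obtain ⟨γ₂, hγ₂, ha', hb'⟩ := h2.exists_on (u := 1) (v := 2) (by norm_num)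
  refine ⟨concatAt 1 γ₁ γ₂, 0, 2, by norm_num, ?_, ?_, ?_⟩
  · have := hγ₁.concat hγ₂ (isGreatest_Icc zero_le_one) (isLeast_Icc one_le_two) (by rw [hb, ha'])
    rwa [Icc_union_Icc_eq_Icc zero_le_one one_le_two] at this
  · simpa [concatAt] using ha
  · simpa [concatAt] using hb'

theorem IsTimelikeCurve.chron {γ : ℝ → M} {J : Set ℝ} (hγ : g.IsTimelikeCurve γ J) {s t : ℝ}
    (hs : s ∈ J) (ht : t ∈ J) (hst : s < t) : g.Chron (γ s) (γ t) :=
  ⟨γ, s, t, hst, hγ.sub_Icc hst hs ht, rfl, rfl⟩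

theorem IsTimelikeCurve.causal {γ : ℝ → M} {J : Set ℝ} (hγ : g.IsTimelikeCurve γ J) :
    g.IsCausalCurve γ J :=
  IsPiecewiseC1Curve.mono hγ fun _ _ h ↦ ⟨h.1.le, h.2⟩

/-- Concatenation of a sequence of timelike curves. -/
theorem exists_timelike_through {x : ℕ → M} (h : ∀ k, g.Chron (x k) (x (k + 1))) :
    ∃ γ : ℝ → M, g.IsTimelikeCurve γ (Ici 0) ∧ ∀ k : ℕ, γ k = x k := by
  choose γ hγ hγ0 hγ1 using fun k : ℕ ↦ (h k).exists_on (u := k) (v := k + 1) (by linarith)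
  set C : ℝ → M := fun t ↦ γ ⌊t⌋₊ t with hC
  have hCk : ∀ k : ℕ, C k = x k := fun k ↦ by simp [hC, hγ0]
  have hpiece : ∀ k : ℕ, g.IsTimelikeCurve C (Icc (k : ℝ) (k + 1)) := by
    intro k
    refine (hγ k).congr fun t ht ↦ ?_
    rcases ht.2.eq_or_lt with rfl | h2
    · rw [hγ1, ← Nat.cast_succ, hCk]
    · have : ⌊t⌋₊ = k := (Nat.floor_eq_iff ((Nat.cast_nonneg k).trans ht.1)).mpr ⟨ht.1, h2⟩
      simp [hC, this]
  have hfin : ∀ n : ℕ, g.IsTimelikeCurve C (Icc (0 : ℝ) (n + 1)) := by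
    intro n
    induction n with
    | zero => simpa using hpiece 0
    | succ n ih =>
      have := IsPiecewiseC1Curve.glue ih (hpiece (n + 1)) (t₁ := (n : ℝ) + 1)
        (isGreatest_Icc (by positivity)) (by push_cast; exact isLeast_Icc (by linarith))
      push_cast at this ⊢
      rwa [Icc_union_Icc_eq_Icc (by positivity) (by linarith)] at this
  refine ⟨C, ⟨ordConnected_Ici, ⟨0, by simp, 1, by simp, by norm_num⟩, fun a b hab hsub ↦ ?_⟩, hCk⟩
  obtain ⟨n, hn⟩ := exists_nat_ge b
  refine (hfin n).2.2 a b hab fun t ht ↦ ⟨hsub ht, ht.2.trans (by linarith)⟩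

/-! ### Openness -/

theorem eventually_chartTimelike {p : M} {y v : ModelSpace d} (hy : y ∈ (chart d p).target)
    (h : g.ChartTimelike p y v) :
    ∀ᶠ z : ModelSpace d × ModelSpace d in 𝓝 (y, v),
      z.1 ∈ (chart d p).target ∧ g.ChartTimelike p z.1 z.2 := by
  have ht : (chart d p).target ∈ 𝓝 y := (isOpen_chart_target p).mem_nhds hy
  have c1 : ContinuousAt (fun z : ModelSpace d × ModelSpace d ↦ g.chartForm p z.1) (y, v) :=
    ContinuousAt.comp (g := g.chartForm p) (x := (y, v))
      ((g.contDiffOn_chartForm p).continuousOn.continuousAt ht) continuousAt_fst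
  have c2 : ContinuousAt (fun z : ModelSpace d × ModelSpace d ↦ g.chartTime p z.1) (y, v) :=
    ContinuousAt.comp (g := g.chartTime p) (x := (y, v))
      ((g.continuousOn_chartTime p).continuousAt ht) continuousAt_fst
  have c3 : ContinuousAt (fun z : ModelSpace d × ModelSpace d ↦ g.chartForm p z.1 z.2 z.2) (y, v) :=
    (c1.clm_apply continuousAt_snd).clm_apply continuousAt_snd
  have c4 : ContinuousAt
      (fun z : ModelSpace d × ModelSpace d ↦ g.chartForm p z.1 (g.chartTime p z.1) z.2) (y, v) :=
    (c1.clm_apply c2).clm_apply continuousAt_snd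
  filter_upwards [continuousAt_fst.preimage_mem_nhds (x := (y, v)) ht, c3.eventually_lt_const h.1,
    c4.eventually_lt_const h.2] with z h1 h2 h3
  exact ⟨h1, h2, h3⟩

theorem ChartTimelike.smul {p : M} {y v : ModelSpace d} (h : g.ChartTimelike p y v) {α : ℝ}
    (hα : 0 < α) : g.ChartTimelike p y (α • v) := by
  obtain ⟨h1, h2⟩ := h
  constructor
  · simp only [map_smul, smul_apply, smul_eq_mul]
    exact mul_neg_of_pos_of_neg hα (mul_neg_of_pos_of_neg hα h1)
  · simp only [map_smul, smul_eq_mul]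
    exact mul_neg_of_pos_of_neg hα h2

theorem chron_of_segment {p : M} {x y : ModelSpace d}
    (h : ∀ t ∈ Icc (0 : ℝ) 1, x + t • (y - x) ∈ (chart d p).target ∧
      g.ChartTimelike p (x + t • (y - x)) (y - x)) :
    g.Chron ((chart d p).symm x) ((chart d p).symm y) := by
  set c : ℝ → ModelSpace d := fun t ↦ x + t • (y - x) with hc
  have hd : ∀ t, HasDerivAt c (y - x) t := fun t ↦ by
    simpa [hc] using! ((hasDerivAt_id t).smul_const (y - x)).const_add x
  have hcurve : g.IsTimelikeCurve ((chart d p).symm ∘ c) (Icc 0 1) := by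
    refine isTimelikeCurve_of_chart g one_pos ⟨∅, fun u v hu huv hv _ ↦ ⟨?_, fun t ht ↦ ?_⟩⟩
      fun t ht ↦ (h t ht).1
    · exact (contDiff_const.add (contDiff_id.smul contDiff_const)).contDiffOn
    · rw [(hd t).hasDerivWithinAt.derivWithin (uniqueDiffOn_Icc huv t ht)]
      exact (h t ⟨hu.trans ht.1, ht.2.trans hv⟩).2
  exact ⟨_, 0, 1, one_pos, hcurve, by simp [hc], by simp [hc]⟩

/-- The last stretch of a timelike curve is replaced by a straight chart segment from γ s to a point
near γ b. For s close to b its slope is close to the final one-sided velocity, and being timelike is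
an open condition on base point and vector. -/
theorem isOpen_chron_future (p : M) : IsOpen {q | g.Chron p q} := by
  rw [isOpen_iff_mem_nhds]
  rintro q ⟨γ, a, b, hab, hγ, rfl, rfl⟩
  set q := γ b with hq
  have hcont := IsPiecewiseC1Curve.continuousOn_Icc hab hγ
  have hsrc : (chart d q).source ∈ 𝓝 (γ b) :=
    (isOpen_chart_source q).mem_nhds (mem_extChartAt_source q)
  obtain ⟨u₀, hau₀, hu₀b, hu₀⟩ : ∃ u₀, a < u₀ ∧ u₀ < b ∧
      MapsTo γ (Icc u₀ b) (chart d q).source := by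
    have h1 := hcont b ⟨hab.le, le_rfl⟩ hsrc
    rw [mem_map, mem_nhdsWithin_iff_exists_mem_nhds_inter] at h1
    obtain ⟨w, hw, hws⟩ := h1
    obtain ⟨ε, hε, hball⟩ := Metric.mem_nhds_iff.mp hw
    refine ⟨max ((a + b) / 2) (b - ε / 2), ?_, ?_, fun t ht ↦ hws ⟨hball ?_, ?_⟩⟩
    · exact lt_max_of_lt_left (by linarith)
    · exact max_lt (by linarith) (by linarith)
    · rw [Metric.mem_ball, Real.dist_eq, abs_lt]
      have := (le_max_right _ _).trans ht.1
      constructor <;> linarith [ht.2]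
    · have := (le_max_left _ _).trans ht.1
      exact ⟨by linarith, ht.2⟩
  obtain ⟨F, hF⟩ := (IsTimelikeCurve.chart_comp (IsPiecewiseC1Curve.sub_Icc hγ hu₀b
    ⟨hau₀.le, hu₀b.le⟩ ⟨hab.le, le_rfl⟩) hu₀b hu₀)
  set c := chart d q ∘ γ with hc
  obtain ⟨u, hu₀u, hub, hdisj⟩ : ∃ u, u₀ ≤ u ∧ u < b ∧ Disjoint (F : Set ℝ) (Ioo u b) := by
    have h1 : ((F : Set ℝ) \ {b})ᶜ ∈ 𝓝 b :=
      (F.finite_toSet.subset sdiff_subset).isClosed.isOpen_compl.mem_nhds (by simp)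
    obtain ⟨ε, hε, hball⟩ := Metric.mem_nhds_iff.mp h1
    refine ⟨max u₀ (b - ε), le_max_left _ _, max_lt hu₀b (by linarith), ?_⟩
    rw [Set.disjoint_left]
    intro t htF ht
    refine (hball (?_ : t ∈ Metric.ball b ε)) ⟨htF, ht.2.ne⟩
    rw [Metric.mem_ball, Real.dist_eq, abs_lt]
    have := (le_max_right u₀ (b - ε)).trans_lt ht.1
    constructor <;> linarith [ht.2]
  obtain ⟨hC1, hder⟩ := hF u b hu₀u hub le_rfl hdisj
  set v := derivWithin c (Icc u b) b with hv
  have hbmem : b ∈ Icc u b := ⟨hub.le, le_rfl⟩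
  have hder' : HasDerivWithinAt c v (Icc u b) b :=
    ((hC1.differentiableOn (by norm_num)) b hbmem).hasDerivWithinAt
  have hyt : c b ∈ (chart d q).target := (chart d q).map_source (hu₀ ⟨hu₀b.le, le_rfl⟩)
  obtain ⟨ε, hε, hopen⟩ := Metric.eventually_nhds_iff_ball.mp
    (eventually_chartTimelike (g := g) hyt (hder b hbmem))
  have hball : ∀ y w, dist y (c b) < ε → dist w v < ε →
      y ∈ (chart d q).target ∧ g.ChartTimelike q y w := fun y w h1 h2 ↦
    hopen (y, w) (by rw [Metric.mem_ball, Prod.dist_eq]; exact max_lt h1 h2)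
  obtain ⟨s, hus, hsb, hs1, hs2⟩ : ∃ s, u ≤ s ∧ s < b ∧ dist (c s) (c b) < ε ∧
      ‖c b - c s - (b - s) • v‖ ≤ ε / 2 * (b - s) := by
    have e1 : ∀ᶠ s in 𝓝[Icc u b] b, dist (c s) (c b) < ε :=
      Metric.tendsto_nhds.mp hder'.continuousWithinAt ε hε
    have e2 := (hasDerivWithinAt_iff_isLittleO.mp hder').def (half_pos hε)
    have e3 : ∀ᶠ s in 𝓝[Ico u b] b, (dist (c s) (c b) < ε ∧
        ‖c s - c b - (s - b) • v‖ ≤ ε / 2 * ‖s - b‖) ∧ s ∈ Ico u b :=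
      ((e1.and e2).filter_mono (nhdsWithin_mono _ Ico_subset_Icc_self)).and self_mem_nhdsWithin
    have : (𝓝[Ico u b] b).NeBot := by
      rw [nhdsWithin_Ico_eq_nhdsLT hub]; infer_instance
    obtain ⟨s, ⟨h1, h2⟩, h3⟩ := e3.exists
    refine ⟨s, h3.1, h3.2, h1, ?_⟩
    rw [Real.norm_eq_abs, abs_of_neg (by linarith [h3.2])] at h2
    rw [← norm_neg, show -(c b - c s - (b - s) • v) = c s - c b - (s - b) • v by module]
    linarith
  have hbs : 0 < b - s := sub_pos.mpr hsb
  -- After division by b - s, moving the end point changes the slope by less than ε/2; the other ε/2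
  -- is the error of the difference quotient at s.
  have hnb : chart d q ⁻¹' Metric.ball (c b) (min ε (ε / 2 * (b - s))) ∈ 𝓝 q := by
    refine (continuousAt_extChartAt q).preimage_mem_nhds ?_
    have hpos : 0 < min ε (ε / 2 * (b - s)) := lt_min hε (by positivity)
    exact Metric.ball_mem_nhds (c b) hpos
  filter_upwards [hnb, hsrc] with z hz hzs
  have hγs : g.Chron (γ a) (γ s) := IsTimelikeCurve.chron hγ ⟨le_rfl, hab.le⟩
    ⟨by linarith, hsb.le⟩ (by linarith)
  refine hγs.trans ?_
  set y := chart d q z with hy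
  have hz : dist y (c b) < min ε (ε / 2 * (b - s)) := hz
  have hseg := chron_of_segment (g := g) (p := q) (x := c s) (y := y) fun t ht ↦ by
    have h1 : dist (c s + t • (y - c s)) (c b) < ε := by
      have := (convex_ball (c b) ε).add_smul_sub_mem (x := c s) (y := y) hs1
        (hz.trans_le (min_le_left _ _)) ht
      exact this
    have h2 : dist ((b - s)⁻¹ • (y - c s)) v < ε := by
      have h3 : (b - s)⁻¹ • (y - c s) - v =
          (b - s)⁻¹ • ((y - c b) + (c b - c s - (b - s) • v)) := by
        rw [show (y - c b) + (c b - c s - (b - s) • v) = (y - c s) - (b - s) • v by abel,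
          smul_sub _ (y - c s), smul_smul, inv_mul_cancel₀ hbs.ne', one_smul]
      rw [dist_eq_norm, h3, norm_smul, norm_inv, Real.norm_eq_abs, abs_of_pos hbs,
        inv_mul_lt_iff₀ hbs]
      have h4 := hz.trans_le (min_le_right _ _)
      rw [dist_eq_norm] at h4
      calc _ ≤ ‖y - c b‖ + ‖c b - c s - (b - s) • v‖ := norm_add_le _ _
        _ < ε / 2 * (b - s) + ε / 2 * (b - s) := by linarith
        _ = _ := by ring
    obtain ⟨h5, h6⟩ := hball _ _ h1 h2
    refine ⟨h5, ?_⟩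
    have := h6.smul hbs
    rwa [smul_smul, mul_inv_cancel₀ hbs.ne', one_smul] at this
  have e1 : (chart d q).symm (c s) = γ s :=
    (chart d q).left_inv (hu₀ ⟨by linarith, hsb.le⟩)
  have e2 : (chart d q).symm y = z := (chart d q).left_inv hzs
  rwa [e1, e2] at hseg

theorem exists_chron_near (z : M) {O : Set M} (hO : O ∈ 𝓝 z) : ∃ y ∈ O, y ≠ z ∧ g.Chron z y := by
  set y₀ := chart d z z with hy₀
  have hy : y₀ ∈ (chart d z).target := mem_extChartAt_target z
  set e := g.chartTime z y₀ with he
  have hneg := g.chartForm_time_neg hy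
  have he0 : e ≠ 0 := fun h ↦ by
    rw [← he, h] at hneg; simp at hneg
  have hl : Tendsto (fun s : ℝ ↦ y₀ + s • e) (𝓝 0) (𝓝 y₀) := by
    have : Continuous fun s : ℝ ↦ y₀ + s • e := by fun_prop
    simpa using this.tendsto 0
  have hsymm : ContinuousAt (chart d z).symm y₀ := continuousAt_extChartAt_symm z
  have hO' : (chart d z).symm ⁻¹' O ∈ 𝓝 y₀ :=
    hsymm.preimage_mem_nhds (by rwa [hy₀, extChartAt_to_inv])
  obtain ⟨ε, hε, hopen⟩ := Metric.eventually_nhds_iff_ball.mp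
    (eventually_chartTimelike (g := g) hy ⟨hneg, hneg⟩)
  have h1 : ∀ᶠ s : ℝ in 𝓝 0, y₀ + s • e ∈ Metric.ball y₀ ε ∩ (chart d z).symm ⁻¹' O :=
    hl (inter_mem (Metric.ball_mem_nhds _ hε) hO')
  obtain ⟨s, ⟨hs1, hs2⟩, hs0⟩ := ((h1.filter_mono nhdsWithin_le_nhds).and
    (self_mem_nhdsWithin (s := Ioi (0 : ℝ)))).exists
  have hs0 : 0 < s := hs0
  have hball : ∀ x ∈ Metric.ball y₀ ε, x ∈ (chart d z).target ∧ g.ChartTimelike z x e := by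
    intro x hx
    refine hopen (x, e) ?_
    rw [Metric.mem_ball, Prod.dist_eq]
    exact max_lt hx (by rw [dist_self]; exact hε)
  refine ⟨(chart d z).symm (y₀ + s • e), hs2, fun h ↦ ?_, ?_⟩
  · have h2 := congrArg (chart d z) h
    rw [(chart d z).right_inv (hball _ hs1).1] at h2
    have : s • e = 0 := add_eq_left.mp h2
    rcases smul_eq_zero.mp this with h3 | h3
    · exact hs0.ne' h3
    · exact he0 h3
  · have := chron_of_segment (g := g) (p := z) (x := y₀) (y := y₀ + s • e) fun t ht ↦ by
      have h2 := (convex_ball y₀ ε).add_smul_sub_mem (Metric.mem_ball_self hε) hs1 ht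
      refine ⟨(hball _ h2).1, ?_⟩
      have h3 := ((hball _ h2).2).smul hs0
      convert h3 using 1
      module
    rwa [hy₀, extChartAt_to_inv, ← hy₀] at this

end Chronology

end LorentzSpacetime

end

set_option maxSynthPendingDepth 3

noncomputable section

namespace LorentzSpacetime

/-! ### Time reversal. -/

section Reverse

variable {d : ℕ} {M : Type*} [TopologicalSpace M] [ChartedSpace (ModelSpace d) M]
  [IsManifold 𝓘(ℝ, ModelSpace d) ∞ M] (g : LorentzSpacetime d M)

/-- The spacetime with the opposite time orientation. -/
def reverse : LorentzSpacetime d M where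
  metric := g.metric
  metric_symm := g.metric_symm
  metric_smooth := g.metric_smooth
  timeField := fun x ↦ -g.timeField x
  timeField_smooth := g.timeField_smooth.neg_section
  timeField_timelike := fun x ↦ by
    rw [map_neg, map_neg, neg_apply, neg_neg]; exact g.timeField_timelike x
  pos_of_orthogonal := fun x w hw ↦ by
    rw [map_neg, neg_apply, neg_eq_zero] at hw; exact g.pos_of_orthogonal x w hw

theorem reverse_reverse : g.reverse.reverse = g := by
  cases g; simp [reverse]

variable {g}

theorem FutureTimelike.neg {x : M} {v : Tgt (d := d) x} (h : g.FutureTimelike x v) :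
    g.reverse.FutureTimelike x (-v) := by
  constructor
  · show g.metric x (-v) (-v) < 0
    rw [map_neg, map_neg, neg_apply, neg_neg]; exact h.1
  · show g.metric x (-g.timeField x) (-v) < 0
    rw [map_neg, map_neg, neg_apply, neg_neg]; exact h.2

theorem FutureCausal.neg {x : M} {v : Tgt (d := d) x} (h : g.FutureCausal x v) :
    g.reverse.FutureCausal x (-v) := by
  constructor
  · show g.metric x (-v) (-v) ≤ 0
    rw [map_neg, map_neg, neg_apply, neg_neg]; exact h.1
  · show g.metric x (-g.timeField x) (-v) < 0
    rw [map_neg, map_neg, neg_apply, neg_neg]; exact h.2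

theorem IsTimelikeCurve.reverse {γ : ℝ → M} {J : Set ℝ} (hγ : g.IsTimelikeCurve γ J) :
    g.reverse.IsTimelikeCurve (fun t ↦ γ (-t)) (Neg.neg ⁻¹' J) := by
  have := IsPiecewiseC1Curve.comp_affine (α := -1) (β := 0) (by norm_num)
    (P' := g.reverse.FutureTimelike) (fun x v hv ↦ by rw [neg_one_smul]; exact FutureTimelike.neg hv) hγ
  simpa using! this

theorem IsCausalCurve.reverse {γ : ℝ → M} {J : Set ℝ} (hγ : g.IsCausalCurve γ J) :
    g.reverse.IsCausalCurve (fun t ↦ γ (-t)) (Neg.neg ⁻¹' J) := by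
  have := IsPiecewiseC1Curve.comp_affine (α := -1) (β := 0) (by norm_num)
    (P' := g.reverse.FutureCausal) (fun x v hv ↦ by rw [neg_one_smul]; exact FutureCausal.neg hv) hγ
  simpa using! this

theorem Chron.reverse {p q : M} (h : g.Chron p q) : g.reverse.Chron q p := by
  obtain ⟨γ, a, b, hab, hγ, rfl, rfl⟩ := h
  refine ⟨fun t ↦ γ (-t), -b, -a, neg_lt_neg hab, ?_, by simp, by simp⟩
  simpa using hγ.reverse

theorem chron_reverse {p q : M} : g.reverse.Chron p q ↔ g.Chron q p :=
  ⟨fun h ↦ by simpa [reverse_reverse] using h.reverse, Chron.reverse⟩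

theorem isFutureEndpoint_neg {γ : ℝ → M} {J : Set ℝ} {p : M} :
    IsFutureEndpoint (fun t ↦ γ (-t)) (Neg.neg ⁻¹' J) p ↔ IsPastEndpoint γ J p := by
  constructor
  · intro h O hO hp
    obtain ⟨t₀, ht₀, ht⟩ := h O hO hp
    exact ⟨-t₀, ht₀, fun t htJ h ↦ by simpa using ht (-t) (by simpa using htJ) (by linarith)⟩
  · intro h O hO hp
    obtain ⟨t₀, ht₀, ht⟩ := h O hO hp
    exact ⟨-t₀, by simpa using ht₀, fun t htJ h ↦ ht (-t) htJ (by linarith)⟩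

theorem isPastEndpoint_neg {γ : ℝ → M} {J : Set ℝ} {p : M} :
    IsPastEndpoint (fun t ↦ γ (-t)) (Neg.neg ⁻¹' J) p ↔ IsFutureEndpoint γ J p := by
  have := isFutureEndpoint_neg (γ := fun t ↦ γ (-t)) (J := Neg.neg ⁻¹' J) (p := p)
  simp only [neg_neg] at this
  rw [← this]
  have e : Neg.neg ⁻¹' (Neg.neg ⁻¹' J) = J := by ext; simp
  rw [e]

theorem isAchronalIn_reverse {U S : Set M} (h : g.IsAchronalIn U S) :
    g.reverse.IsAchronalIn U S := by
  rintro p hp q hq ⟨γ, a, b, hab, hγ, hm, rfl, rfl⟩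
  refine h _ hq _ hp ⟨fun t ↦ γ (-t), -b, -a, neg_lt_neg hab, ?_, fun t ht ↦ hm ?_, by simp,
    by simp⟩
  · simpa [reverse_reverse] using hγ.reverse
  · simpa [and_comm, neg_le, le_neg] using ht

theorem pastDomainIn_subset_reverse (U S : Set M) :
    g.pastDomainIn U S ⊆ g.reverse.futureDomainIn U S := by
  rintro p ⟨hp, h⟩
  refine ⟨hp, fun γ J hγ hm he hpm ↦ ?_⟩
  have h1 : g.IsCausalCurve (fun t ↦ γ (-t)) (Neg.neg ⁻¹' J) := by
    simpa only [reverse_reverse] using hγ.reverse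
  have e : (fun t ↦ γ (-t)) '' (Neg.neg ⁻¹' J) = γ '' J := by
    ext x
    constructor
    · rintro ⟨t, ht, rfl⟩; exact ⟨-t, ht, rfl⟩
    · rintro ⟨t, ht, rfl⟩; exact ⟨-t, by simpa using ht, by simp⟩
  have := h _ _ h1 (fun t ht ↦ hm ht) (by simpa only [isFutureEndpoint_neg] using he) (e ▸ hpm)
  rwa [e] at this

theorem futureDomainIn_subset_reverse (U S : Set M) :
    g.futureDomainIn U S ⊆ g.reverse.pastDomainIn U S := by
  rintro p ⟨hp, h⟩
  refine ⟨hp, fun γ J hγ hm he hpm ↦ ?_⟩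
  have h1 : g.IsCausalCurve (fun t ↦ γ (-t)) (Neg.neg ⁻¹' J) := by
    simpa only [reverse_reverse] using hγ.reverse
  have e : (fun t ↦ γ (-t)) '' (Neg.neg ⁻¹' J) = γ '' J := by
    ext x
    constructor
    · rintro ⟨t, ht, rfl⟩; exact ⟨-t, ht, rfl⟩
    · rintro ⟨t, ht, rfl⟩; exact ⟨-t, by simpa using ht, by simp⟩
  have := h _ _ h1 (fun t ht ↦ hm ht) (by simpa only [isPastEndpoint_neg] using he) (e ▸ hpm)
  rwa [e] at this

theorem futureDomainIn_reverse (U S : Set M) :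
    g.reverse.futureDomainIn U S = g.pastDomainIn U S := by
  refine subset_antisymm ?_ (pastDomainIn_subset_reverse U S)
  have := futureDomainIn_subset_reverse (g := g.reverse) U S
  rwa [reverse_reverse] at this

theorem pastDomainIn_reverse (U S : Set M) :
    g.reverse.pastDomainIn U S = g.futureDomainIn U S := by
  refine subset_antisymm ?_ (futureDomainIn_subset_reverse U S)
  have := pastDomainIn_subset_reverse (g := g.reverse) U S
  rwa [reverse_reverse] at this

theorem domain_reverse (S : Set M) : g.reverse.domain S = g.domain S := by
  simp only [domain, domainIn, futureDomainIn_reverse, pastDomainIn_reverse, union_comm]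

theorem isOpen_chron_past (q : M) : IsOpen {p | g.Chron p q} := by
  simpa only [chron_reverse] using isOpen_chron_future (g := g.reverse) q

theorem isOpen_chronPast (A : Set M) : IsOpen (g.chronPast A) := by
  have : g.chronPast A = ⋃ q ∈ A, {p | g.Chron p q} := by
    ext x; simp [mem_chronPast]
  rw [this]
  exact isOpen_biUnion fun q _ ↦ isOpen_chron_past q

theorem exists_chron_near_past (z : M) {O : Set M} (hO : O ∈ 𝓝 z) : ∃ y ∈ O, y ≠ z ∧ g.Chron y z := by
  simpa only [chron_reverse] using exists_chron_near (g := g.reverse) z hO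

end Reverse

/-! ### A causal curve preceded or followed by a timelike one. -/

section PushUp

variable {d : ℕ} {M : Type*} [TopologicalSpace M] [ChartedSpace (ModelSpace d) M]
  [IsManifold 𝓘(ℝ, ModelSpace d) ∞ M] {g : LorentzSpacetime d M}

/-- Tilting a short causal arc by `GoodBox.exists_timelike_near` makes it timelike with prescribed
end point, and the open set O absorbs the shift of its initial point. The neighbourhoods O₁ and O₂
do not depend on the arc, so the statement also applies to sequences of arcs with convergent end
points. -/
theorem exists_pushUp_nhds (z : M) : ∃ N ∈ 𝓝 z, ∀ y ∈ N, ∀ z' ∈ N, ∀ O ∈ 𝓝 y,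
    ∃ O₁ ∈ 𝓝 y, ∃ O₂ ∈ 𝓝 z', ∀ (γ : ℝ → M) (a b : ℝ), a < b → g.IsCausalCurve γ (Icc a b) →
      MapsTo γ (Icc a b) N → γ a ∈ O₁ → γ b ∈ O₂ → ∃ o ∈ O, g.Chron o z' := by
  obtain ⟨e, K, ρ, hρ, hbox⟩ := g.exists_isChartBox z
  have hbox := hbox ρ hρ le_rfl
  set y₀ := chart d z z with hy₀
  refine ⟨(chart d z).source ∩ chart d z ⁻¹' Metric.ball y₀ (ρ / 2), inter_mem
    (extChartAt_source_mem_nhds z) ((continuousAt_extChartAt z).preimage_mem_nhds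
      (Metric.ball_mem_nhds _ (half_pos hρ))), ?_⟩
  rintro y ⟨hys, hyb⟩ z' ⟨hzs, hzb⟩ O hO
  have hK := hbox.good.K_pos
  obtain ⟨ε, hε, hεO⟩ : ∃ ε > 0, Metric.ball (chart d z y) ε ⊆ (chart d z).symm ⁻¹' O := by
    refine Metric.mem_nhds_iff.mp ((continuousAt_extChartAt_symm' hys).preimage_mem_nhds ?_)
    rwa [(chart d z).left_inv hys]
  -- The tilt moves the initial point by at most 2κ, and that point is within κ of y; hence 3κ < ε.
  obtain ⟨κ, hκ, hκ1, hκ2, hκ3⟩ : ∃ κ : ℝ, 0 < κ ∧ 100 * K ^ 6 * κ ≤ 1 ∧ 4 * κ ≤ ρ ∧ 3 * κ < ε := by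
    refine ⟨min (1 / (100 * K ^ 6)) (min (ρ / 4) (ε / 4)), by positivity, ?_, ?_, ?_⟩
    · calc _ ≤ 100 * K ^ 6 * (1 / (100 * K ^ 6)) := by gcongr; exact min_le_left _ _
        _ = 1 := by field_simp
    · linarith [(min_le_right (1 / (100 * K ^ 6)) (min (ρ / 4) (ε / 4))).trans (min_le_left _ _)]
    · linarith [(min_le_right (1 / (100 * K ^ 6)) (min (ρ / 4) (ε / 4))).trans (min_le_right _ _)]
  refine ⟨chart d z ⁻¹' Metric.ball (chart d z y) κ,
    (continuousAt_extChartAt' hys).preimage_mem_nhds (Metric.ball_mem_nhds _ hκ),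
    chart d z ⁻¹' Metric.ball (chart d z z') κ,
    (continuousAt_extChartAt' hzs).preimage_mem_nhds (Metric.ball_mem_nhds _ hκ), ?_⟩
  intro γ a b hab hγ hm ha hb
  have hc := (IsCausalCurve.chart_comp hγ hab fun t ht ↦ (hm ht).1)
  have hsub : Metric.ball y₀ (ρ / 2) ⊆ Metric.ball y₀ ρ := Metric.ball_subset_ball (by linarith)
  have hc' : PWC1 (BoxCausal (g.chartForm z) y₀ e) (chart d z ∘ γ) a b :=
    hc.mono fun t ht v hv ↦ (hbox.causal_iff _ (hsub (hm ht).2) v).mp hv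
  have hb' : ‖chart d z z' - (chart d z ∘ γ) b‖ ≤ κ := by
    rw [← dist_eq_norm, dist_comm]; exact (Metric.mem_ball.mp hb).le
  obtain ⟨c', h1, h2, h3, h4⟩ := hbox.good.exists_timelike_near hab hc'
    (fun t ht ↦ (hm ht).2) hκ hκ1 hκ2 hb'
  have h5 := isTimelikeCurve_of_chart g hab (h1.mono fun t ht v hv ↦
    (hbox.timelike_iff _ (h2 ht) v).mpr hv) (fun t ht ↦ hbox.sub (h2 ht))
  refine ⟨(chart d z).symm (c' a), hεO ?_, _, a, b, hab, h5, rfl, ?_⟩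
  · rw [Metric.mem_ball]
    have h6 : dist (chart d z (γ a)) (chart d z y) < κ := ha
    rw [← dist_eq_norm] at h4
    calc _ ≤ dist (c' a) (chart d z (γ a)) + dist (chart d z (γ a)) (chart d z y) :=
          dist_triangle _ _ _
      _ < ε := by linarith [show dist (c' a) (chart d z (γ a)) ≤ 2 * κ from h4]
  · simp only [Function.comp_apply, h3, (chart d z).left_inv hzs]

/-- Compactness cuts the parameter interval into finitely many pieces, each mapped into one of the
neighbourhoods N, and P is carried from piece to piece. -/
theorem curve_induction {γ : ℝ → M} {a b : ℝ} (hab : a ≤ b) (hγ : ContinuousOn γ (Icc a b))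
    {P : ℝ → Prop} (h : ∀ z : M, ∃ N ∈ 𝓝 z, ∀ s t, a ≤ s → s < t → t ≤ b →
      MapsTo γ (Icc s t) N → P s → P t) (ha : P a) : P b := by
  choose N hN hP using h
  obtain ⟨t, ht0, hmono, ⟨m, hm⟩, hsub⟩ := exists_monotone_Icc_subset_open_cover_Icc hab
    (c := fun z : M ↦ {s : Icc a b | γ s ∈ interior (N z)})
    (fun z ↦ (hγ.domRestrict).isOpen_preimage _ isOpen_interior)
    (fun s _ ↦ mem_iUnion.mpr ⟨γ s, mem_interior_iff_mem_nhds.mpr (hN _)⟩)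
  have key : ∀ n, P (t n) := by
    intro n
    induction n with
    | zero => rw [ht0]; exact ha
    | succ n ih =>
      rcases (hmono n.le_succ).eq_or_lt with h | h
      · rw [← Nat.succ_eq_add_one, ← h]; exact ih
      · obtain ⟨z, hz⟩ := hsub n
        refine hP z _ _ (t n).2.1 h (t (n + 1)).2.2 (fun s hs ↦ ?_) ih
        have hs' : (⟨s, (t n).2.1.trans hs.1, hs.2.trans (t (n + 1)).2.2⟩ : Icc a b) ∈
            Icc (t n) (t (n + 1)) := hs
        exact interior_subset (hz hs')
  have := key m
  rwa [hm m le_rfl] at this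

/-- If x precedes γ s, then the open future of x is a neighbourhood of γ s, which is what local
push-up along the next arc requires. -/
theorem Chron.trans_causal {x : M} {γ : ℝ → M} {a b : ℝ} (hab : a ≤ b)
    (hγ : g.IsCausalCurve γ (Icc a b)) (h : g.Chron x (γ a)) : g.Chron x (γ b) := by
  rcases hab.eq_or_lt with rfl | hab
  · exact h
  refine curve_induction (P := fun t ↦ g.Chron x (γ t)) hab.le
    (IsPiecewiseC1Curve.continuousOn_Icc hab hγ) (fun z ↦ ?_) h
  obtain ⟨N, hN, hpush⟩ := exists_pushUp_nhds (g := g) z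
  refine ⟨N, hN, fun s t has hst htb hm hs ↦ ?_⟩
  obtain ⟨O₁, hO₁, O₂, hO₂, H⟩ := hpush (γ s) (hm ⟨le_rfl, hst.le⟩) (γ t) (hm ⟨hst.le, le_rfl⟩) _
    ((isOpen_chron_future x).mem_nhds hs)
  obtain ⟨o, ho, ho'⟩ := H γ s t hst (IsPiecewiseC1Curve.sub_Icc hγ hst ⟨has, hst.le.trans htb⟩
    ⟨has.trans hst.le, htb⟩) hm (mem_of_mem_nhds hO₁) (mem_of_mem_nhds hO₂)
  exact Chron.trans ho ho'

theorem Chron.trans_causal_of_mem {x : M} {γ : ℝ → M} {J : Set ℝ} (hγ : g.IsCausalCurve γ J)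
    {s t : ℝ} (hs : s ∈ J) (ht : t ∈ J) (hst : s ≤ t) (h : g.Chron x (γ s)) : g.Chron x (γ t) := by
  rcases hst.eq_or_lt with rfl | hst
  · exact h
  · exact h.trans_causal hst.le (IsPiecewiseC1Curve.sub_Icc hγ hst hs ht)

/-- The endpoint need not lie on the curve, so push-up is applied to an arc that ends near z. If no
parameter follows t₂, the curve has already arrived at z, by the Hausdorff property. -/
theorem Chron.trans_futureEndpoint [T2Space M] {x z : M} {γ : ℝ → M} {J : Set ℝ}
    (hγ : g.IsCausalCurve γ J) (hz : IsFutureEndpoint γ J z) {t₀ : ℝ} (ht₀ : t₀ ∈ J)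
    (h : g.Chron x (γ t₀)) : g.Chron x z := by
  obtain ⟨N, hN, hpush⟩ := exists_pushUp_nhds (g := g) z
  obtain ⟨t₁, ht₁, hmN⟩ := hz (interior N) isOpen_interior (mem_interior_iff_mem_nhds.mpr hN)
  set t₂ := max t₀ t₁ with ht₂
  have ht₂J : t₂ ∈ J := by rw [ht₂]; rcases max_choice t₀ t₁ with h | h <;> rw [h] <;> assumption
  have h2 : g.Chron x (γ t₂) := h.trans_causal_of_mem hγ ht₀ ht₂J (le_max_left _ _)
  by_cases hex : ∃ s ∈ J, t₂ < s
  · obtain ⟨s, hsJ, hs⟩ := hex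
    obtain ⟨O₁, hO₁, O₂, hO₂, H⟩ := hpush (γ t₂) (interior_subset (hmN _ ht₂J (le_max_right _ _)))
      z (mem_of_mem_nhds hN) _ ((isOpen_chron_future x).mem_nhds h2)
    obtain ⟨t₃, ht₃, hm3⟩ := hz (interior O₂) isOpen_interior (mem_interior_iff_mem_nhds.mpr hO₂)
    have hmJ : max s t₃ ∈ J := by rcases max_choice s t₃ with h | h <;> rw [h] <;> assumption
    have hlt : t₂ < max s t₃ := hs.trans_le (le_max_left _ _)
    obtain ⟨o, ho, ho'⟩ := H γ t₂ (max s t₃) hlt (IsPiecewiseC1Curve.sub_Icc hγ hlt ht₂J hmJ)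
      (fun t ht ↦ interior_subset (hmN _ (hγ.1.out ht₂J hmJ ht) ((le_max_right _ _).trans ht.1)))
      (mem_of_mem_nhds hO₁) (interior_subset (hm3 _ hmJ (le_max_right _ _)))
    exact Chron.trans ho ho'
  · push Not at hex
    have : γ t₂ = z := by
      by_contra hne
      obtain ⟨t₃, ht₃, hm3⟩ := hz {γ t₂}ᶜ isOpen_compl_singleton (by simpa using Ne.symm hne)
      exact hm3 t₂ ht₂J (hex _ ht₃) rfl
    rwa [← this]

theorem Chron.causal_trans_of_mem {x : M} {γ : ℝ → M} {J : Set ℝ} (hγ : g.IsCausalCurve γ J)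
    {s t : ℝ} (hs : s ∈ J) (ht : t ∈ J) (hst : s ≤ t) (h : g.Chron (γ t) x) : g.Chron (γ s) x := by
  have := Chron.trans_causal_of_mem (g := g.reverse) hγ.reverse (s := -t) (t := -s) (x := x)
    (by simpa using ht) (by simpa using hs) (neg_le_neg hst) (by simpa [chron_reverse] using h)
  simpa [chron_reverse] using this

end PushUp

/-! ### Causal curves in a chart box converge or leave it. -/

section Exit

variable {d : ℕ} {M : Type*} [TopologicalSpace M] [ChartedSpace (ModelSpace d) M]
  [IsManifold 𝓘(ℝ, ModelSpace d) ∞ M] {g : LorentzSpacetime d M} {p : M} {e : ModelSpace d}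
  {ρ K : ℝ}

/-- Causal curves are Lipschitz with respect to the time coordinate of a chart box. -/
theorem IsChartBox.norm_sub_le (hbox : g.IsChartBox p e ρ K) {γ : ℝ → M} {J : Set ℝ}
    (hγ : g.IsCausalCurve γ J) {s t : ℝ} (hs : s ∈ J) (ht : t ∈ J) (hst : s ≤ t)
    (hm : MapsTo γ (Icc s t) ((chart d p).source ∩ chart d p ⁻¹' Metric.ball (chart d p p) ρ)) :
    ‖chart d p (γ t) - chart d p (γ s)‖ ≤
      (-K • g.chartForm p (chart d p p) e) (chart d p (γ t)) -
      (-K • g.chartForm p (chart d p p) e) (chart d p (γ s)) := by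
  rcases hst.eq_or_lt with rfl | hlt
  · simp
  have hc := (IsCausalCurve.chart_comp (IsPiecewiseC1Curve.sub_Icc hγ hlt hs ht) hlt
    fun u hu ↦ (hm hu).1)
  refine hc.norm_sub_le (-K • g.chartForm p (chart d p p) e) (fun u hu v hv ↦ ?_) le_rfl hst le_rfl
  have := hbox.good.norm_le_time (hm hu).2 ((hbox.causal_iff _ (hm hu).2 v).mp hv)
  rw [smul_apply, smul_eq_mul]
  linarith

/-- The functional L increases along the curve, is bounded on the compact ball and dominates all
coordinate increments; hence the coordinates form a Cauchy net. -/
theorem IsChartBox.exists_futureEndpoint (hbox : g.IsChartBox p e ρ K) {r : ℝ} (hr : r < ρ)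
    {γ : ℝ → M} {J : Set ℝ} (hγ : g.IsCausalCurve γ J) {t₀ : ℝ} (ht₀ : t₀ ∈ J)
    (hm : ∀ t ∈ J, t₀ ≤ t →
      γ t ∈ (chart d p).source ∩ chart d p ⁻¹' Metric.closedBall (chart d p p) r) :
    ∃ q, IsFutureEndpoint γ J q := by
  set y₀ := chart d p p with hy₀
  set L : ModelSpace d →L[ℝ] ℝ := -K • g.chartForm p y₀ e with hL
  set J' := J ∩ Ici t₀ with hJ'
  set c : J' → ModelSpace d := fun t ↦ chart d p (γ t) with hc
  have : Nonempty J' := ⟨⟨t₀, ht₀, self_mem_Ici⟩⟩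
  have hmem : ∀ t : J', c t ∈ Metric.closedBall y₀ r := fun t ↦ (hm t t.2.1 t.2.2).2
  have hlip : ∀ s t : J', s ≤ t → ‖c t - c s‖ ≤ L (c t) - L (c s) := fun s t hst ↦
    hbox.norm_sub_le hγ s.2.1 t.2.1 hst fun u hu ↦
      let h := hm u (hγ.1.out s.2.1 t.2.1 hu) (s.2.2.trans hu.1)
      ⟨h.1, Metric.closedBall_subset_ball hr h.2⟩
  have hbdd : BddAbove (range fun t ↦ L (c t)) := by
    obtain ⟨B, hB⟩ := ((isCompact_closedBall y₀ r).image L.continuous).bddAbove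
    exact ⟨B, by rintro _ ⟨t, rfl⟩; exact hB ⟨_, hmem t, rfl⟩⟩
  have hcauchy : CauchySeq c := by
    rw [Metric.cauchySeq_iff']
    intro ε hε
    obtain ⟨_, ⟨s, rfl⟩, hs⟩ := exists_lt_of_lt_csSup (range_nonempty fun t ↦ L (c t))
      (sub_lt_self (sSup (range fun t ↦ L (c t))) hε)
    refine ⟨s, fun t ht ↦ ?_⟩
    rw [dist_eq_norm]
    have h1 := hlip s t ht
    have h2 := le_csSup hbdd ⟨t, rfl⟩
    simp only at hs h2
    linarith
  obtain ⟨y, hy⟩ := cauchySeq_tendsto_of_complete hcauchy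
  have hyb : y ∈ Metric.closedBall y₀ r :=
    Metric.isClosed_closedBall.mem_of_tendsto hy (Eventually.of_forall hmem)
  have hyt : y ∈ (chart d p).target := hbox.sub (Metric.closedBall_subset_ball hr hyb)
  refine ⟨(chart d p).symm y, fun O hO hyO ↦ ?_⟩
  have hev := (hy.eventually ((continuousAt_extChartAt_symm'' hyt).preimage_mem_nhds
    (hO.mem_nhds hyO)))
  obtain ⟨s, hs⟩ := eventually_atTop.mp hev
  refine ⟨s, s.2.1, fun t ht hst ↦ ?_⟩
  have ht' : t₀ ≤ t := le_trans s.2.2 hst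
  have : (chart d p).symm (chart d p (γ t)) ∈ O := hs ⟨t, ht, ht'⟩ hst
  have e1 : (chart d p).symm (chart d p (γ t)) = γ t := (chart d p).left_inv (hm t ht ht').1
  rwa [e1] at this

/-- A causal curve without future endpoint that starts in a chart ball reaches its boundary. -/
theorem IsChartBox.exists_exit [T2Space M] (hbox : g.IsChartBox p e ρ K) {r : ℝ} (hr : r < ρ)
    {γ : ℝ → M} {J : Set ℝ} (hγ : g.IsCausalCurve γ J) (hend : ¬ ∃ q, IsFutureEndpoint γ J q)
    {t₀ : ℝ} (ht₀ : t₀ ∈ J) (hs : γ t₀ ∈ (chart d p).source)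
    (hb : chart d p (γ t₀) ∈ Metric.ball (chart d p p) r) :
    ∃ t₁ ∈ J, t₀ < t₁ ∧ MapsTo γ (Icc t₀ t₁)
      ((chart d p).source ∩ chart d p ⁻¹' Metric.closedBall (chart d p p) r) ∧
      chart d p (γ t₁) ∈ Metric.sphere (chart d p p) r := by
  set y₀ := chart d p p with hy₀
  set A := (chart d p).source ∩ chart d p ⁻¹' Metric.ball y₀ r with hA
  set B := (chart d p).source ∩ chart d p ⁻¹' Metric.closedBall y₀ r with hB
  have hAopen : IsOpen A :=
    (continuousOn_extChartAt p).isOpen_inter_preimage (isOpen_chart_source p) Metric.isOpen_ball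
  have hsubt : Metric.closedBall y₀ r ⊆ (chart d p).target :=
    (Metric.closedBall_subset_ball hr).trans hbox.sub
  -- Closedness in M, not only in the chart domain: B is a compact image in a Hausdorff space.
  have hBclosed : IsClosed B := by
    have : B = (chart d p).symm '' Metric.closedBall y₀ r := by
      ext x
      constructor
      · rintro ⟨h1, h2⟩; exact ⟨_, h2, (chart d p).left_inv h1⟩
      · rintro ⟨y, hy, rfl⟩
        refine ⟨(chart d p).map_target (hsubt hy), ?_⟩
        rw [mem_preimage, (chart d p).right_inv (hsubt hy)]; exact hy
    rw [this]
    exact ((isCompact_closedBall y₀ r).image_of_continuousOn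
      ((continuousOn_extChartAt_symm p).mono hsubt)).isClosed
  have hAB : A ⊆ B := fun x hx ↦ ⟨hx.1, Metric.ball_subset_closedBall hx.2⟩
  obtain ⟨t₂, ht₂J, ht₂, hout⟩ : ∃ t₂ ∈ J, t₀ ≤ t₂ ∧ γ t₂ ∉ A := by
    by_contra! hcon
    exact hend (hbox.exists_futureEndpoint hr hγ ht₀ fun t ht h ↦ hAB (hcon t ht h))
  have hlt : t₀ < t₂ := by
    rcases ht₂.eq_or_lt with rfl | h
    · exact absurd ⟨hs, hb⟩ hout
    · exact h
  have hcont := IsPiecewiseC1Curve.continuousOn_Icc hlt (IsPiecewiseC1Curve.sub_Icc hγ hlt ht₀ ht₂J)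
  have hcl : IsClosed (Icc t₀ t₂ ∩ γ ⁻¹' Aᶜ) :=
    hcont.preimage_isClosed_of_isClosed isClosed_Icc hAopen.isClosed_compl
  obtain ⟨t₁, ⟨⟨h1, h2⟩, h3⟩, hleast⟩ :=
    (isCompact_Icc.of_isClosed_subset hcl inter_subset_left).exists_isLeast
      ⟨t₂, ⟨⟨ht₂, le_rfl⟩, hout⟩⟩
  have hlt1 : t₀ < t₁ := by
    rcases h1.eq_or_lt with rfl | h
    · exact absurd ⟨hs, hb⟩ h3
    · exact h
  have hin : ∀ t ∈ Ico t₀ t₁, γ t ∈ A := fun t ht ↦ by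
    by_contra hn
    exact absurd (hleast ⟨⟨ht.1, ht.2.le.trans h2⟩, hn⟩) (not_le.mpr ht.2)
  have h1B : γ t₁ ∈ B := by
    have hcw : ContinuousWithinAt γ (Ico t₀ t₁) t₁ :=
      (hcont t₁ ⟨h1, h2⟩).mono fun t ht ↦ ⟨ht.1, ht.2.le.trans h2⟩
    have := hcw.mem_closure (t := B) (by rw [closure_Ico hlt1.ne]; exact ⟨h1, le_rfl⟩)
      fun t ht ↦ hAB (hin t ht)
    rwa [hBclosed.closure_eq] at this
  refine ⟨t₁, hγ.1.out ht₀ ht₂J ⟨h1, h2⟩, hlt1, fun t ht ↦ ?_, ?_⟩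
  · rcases ht.2.eq_or_lt with rfl | h
    · exact h1B
    · exact hAB (hin t ⟨ht.1, h⟩)
  · refine le_antisymm h1B.2 ?_
    by_contra! hlt2
    exact h3 ⟨h1B.1, hlt2⟩

end Exit

/-! ### Endless timelike curves by greedy prolongation. -/

section Greedy

variable {d : ℕ} {M : Type*} [TopologicalSpace M] [ChartedSpace (ModelSpace d) M]
  [IsManifold 𝓘(ℝ, ModelSpace d) ∞ M] {g : LorentzSpacetime d M}

/-- If every point of `V` starts a causal curve in the closure of `V` without future endpoint, then
every point `z` of the closure of `V` has a limit causal successor in the closure of `V`. -/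
theorem exists_weak_successor [T2Space M] {V : Set M}
    (hV : ∀ q ∈ V, ∃ (γ : ℝ → M) (J : Set ℝ), g.IsCausalCurve γ J ∧ MapsTo γ J (closure V) ∧
      (¬ ∃ p, IsFutureEndpoint γ J p) ∧ q ∈ γ '' J) {z : M} (hz : z ∈ closure V) :
    ∃ y ∈ closure V, y ≠ z ∧ ∀ x, g.Chron x z → g.Chron x y := by
  obtain ⟨e, K, ρ, hρ, hbox⟩ := g.exists_isChartBox z
  have hbox := hbox ρ hρ le_rfl
  set y₀ := chart d z z with hy₀
  have hy₀t : y₀ ∈ (chart d z).target := mem_extChartAt_target z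
  obtain ⟨N, hN, hpush⟩ := exists_pushUp_nhds (g := g) z
  obtain ⟨r, hr, hrρ, hrN⟩ : ∃ r, 0 < r ∧ r < ρ ∧
      Metric.closedBall y₀ r ⊆ (chart d z).symm ⁻¹' N := by
    have h1 : (chart d z).symm ⁻¹' N ∈ 𝓝 y₀ :=
      (continuousAt_extChartAt_symm z).preimage_mem_nhds (by rwa [extChartAt_to_inv])
    obtain ⟨r, hr, h⟩ := Metric.nhds_basis_closedBall.mem_iff.mp h1
    refine ⟨min r (ρ / 2), by positivity, ?_, ?_⟩
    · exact (min_le_right _ _).trans_lt (by linarith)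
    · exact (Metric.closedBall_subset_closedBall (min_le_left _ _)).trans h
  have hsubt : Metric.closedBall y₀ r ⊆ (chart d z).target :=
    (Metric.closedBall_subset_ball hrρ).trans hbox.sub
  -- Arcs that start ever closer to z and run to a fixed sphere around z; a limit of their end
  -- points on the compact sphere is the successor, and it differs from z.
  have key : ∀ n : ℕ, ∃ (γ : ℝ → M) (a b : ℝ), a < b ∧ g.IsCausalCurve γ (Icc a b) ∧
      MapsTo γ (Icc a b) ((chart d z).source ∩ chart d z ⁻¹' Metric.closedBall y₀ r) ∧
      dist (chart d z (γ a)) y₀ < 1 / (n + 1) ∧ chart d z (γ b) ∈ Metric.sphere y₀ r ∧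
      γ b ∈ closure V := by
    intro n
    have hpos : 0 < min r (1 / ((n : ℝ) + 1)) := by positivity
    have hnb : (chart d z).source ∩ chart d z ⁻¹' Metric.ball y₀ (min r (1 / ((n : ℝ) + 1))) ∈ 𝓝 z :=
      inter_mem (extChartAt_source_mem_nhds z) ((continuousAt_extChartAt z).preimage_mem_nhds
        (Metric.ball_mem_nhds _ hpos))
    obtain ⟨q, ⟨hq1, hq2⟩, hqV⟩ := mem_closure_iff_nhds.mp hz _ hnb
    obtain ⟨γ, J, hγ, hm, hend, t₀, ht₀, rfl⟩ := hV q hqV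
    have hq2 : dist (chart d z (γ t₀)) y₀ < min r (1 / ((n : ℝ) + 1)) := hq2
    obtain ⟨t₁, ht₁, hlt, h1, h2⟩ := hbox.exists_exit hrρ hγ hend ht₀ hq1
      (hq2.trans_le (min_le_left _ _))
    exact ⟨γ, t₀, t₁, hlt, IsPiecewiseC1Curve.sub_Icc hγ hlt ht₀ ht₁, h1,
      hq2.trans_le (min_le_right _ _), h2, hm ht₁⟩
  choose γ a b hab hγ hm ha hb hbV using key
  obtain ⟨y, hy, φ, hφ, hlim⟩ := (isCompact_sphere y₀ r).tendsto_subseq hb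
  have hyc : y ∈ Metric.closedBall y₀ r := Metric.sphere_subset_closedBall hy
  have hyt := hsubt hyc
  have hlim' : Tendsto (fun n ↦ γ (φ n) (b (φ n))) atTop (𝓝 ((chart d z).symm y)) := by
    refine ((continuousAt_extChartAt_symm'' hyt).tendsto.comp hlim).congr fun n ↦ ?_
    exact (chart d z).left_inv (hm (φ n) ⟨(hab _).le, le_rfl⟩).1
  have hlima : Tendsto (fun n ↦ γ (φ n) (a (φ n))) atTop (𝓝 z) := by
    have h1 : Tendsto (fun n ↦ chart d z (γ (φ n) (a (φ n)))) atTop (𝓝 y₀) := by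
      have h2 : Tendsto (fun n ↦ chart d z (γ n (a n))) atTop (𝓝 y₀) := by
        rw [tendsto_iff_dist_tendsto_zero]
        exact squeeze_zero (fun _ ↦ dist_nonneg) (fun n ↦ (ha n).le)
          tendsto_one_div_add_atTop_nhds_zero_nat
      exact h2.comp hφ.tendsto_atTop
    have h3 := (continuousAt_extChartAt_symm'' hy₀t).tendsto.comp h1
    rw [hy₀, extChartAt_to_inv] at h3
    refine h3.congr fun n ↦ ?_
    exact (chart d z).left_inv (hm (φ n) ⟨le_rfl, (hab _).le⟩).1
  refine ⟨(chart d z).symm y, isClosed_closure.mem_of_tendsto hlim' (Eventually.of_forall fun n ↦ hbV _),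
    fun h ↦ ?_, fun x hx ↦ ?_⟩
  · have h2 := congrArg (chart d z) h
    rw [(chart d z).right_inv hyt, ← hy₀] at h2
    rw [h2, Metric.mem_sphere, dist_self] at hy
    exact hr.ne hy
  · obtain ⟨O₁, hO₁, O₂, hO₂, H⟩ := hpush z (mem_of_mem_nhds hN) _ (hrN hyc) _
      ((isOpen_chron_future x).mem_nhds hx)
    obtain ⟨n, hn1, hn2⟩ := ((hlima.eventually hO₁).and (hlim'.eventually hO₂)).exists
    obtain ⟨o, ho, ho'⟩ := H _ _ _ (hab (φ n)) (hγ (φ n)) (fun t ht ↦ by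
      have h1 := hm (φ n) ht
      have h2 := hrN h1.2
      rwa [mem_preimage, (chart d z).left_inv h1.1] at h2) hn1 hn2
    exact Chron.trans ho ho'

/-- In a past set each of whose limit points has a limit successor, timelike curves can be
prolonged so as to have no future endpoint. -/
theorem exists_endless_timelike [T2Space M] [SecondCountableTopology M] {V : Set M}
    (hpast : ∀ x y, y ∈ V → g.Chron x y → x ∈ V) (hnext : ∀ x ∈ V, ∃ y ∈ V, g.Chron x y)
    (hfar : ∀ z ∈ closure V, ∃ y ∈ closure V, y ≠ z ∧ ∀ x, g.Chron x z → g.Chron x y)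
    {q : M} (hq : q ∈ V) :
    ∃ γ : ℝ → M, g.IsTimelikeCurve γ (Ici 0) ∧ γ 0 = q ∧ MapsTo γ (Ici 0) V ∧
      ¬ ∃ p, IsFutureEndpoint γ (Ici 0) p := by
  have := ChartedSpace.locallyCompactSpace (ModelSpace d) M
  have := TopologicalSpace.metrizableSpace_of_t3_secondCountable M
  let _ : MetricSpace M := TopologicalSpace.metrizableSpaceMetric M
  -- The greedy choice: in truncated distance, y is at least half as far from x as any other
  -- admissible successor. The truncation keeps the supremum finite.
  have hgreedy : ∀ x : V, ∃ y : V, g.Chron x y ∧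
      ∀ y' ∈ V, g.Chron x y' → min 1 (dist (x : M) y') ≤ 2 * min 1 (dist (x : M) y) := by
    rintro ⟨x, hx⟩
    set A : Set ℝ := (fun y ↦ min 1 (dist x y)) '' {y ∈ V | g.Chron x y} with hA
    have hbdd : BddAbove A := ⟨1, by rintro _ ⟨y, -, rfl⟩; exact min_le_left _ _⟩
    obtain ⟨y₀, hy₀, hxy₀⟩ := hnext x hx
    rcases le_or_gt (sSup A) 0 with h0 | h0
    · refine ⟨⟨y₀, hy₀⟩, hxy₀, fun y' hy' hxy' ↦ ?_⟩
      have h1 := le_csSup hbdd ⟨y', ⟨hy', hxy'⟩, rfl⟩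
      have : 0 ≤ min 1 (dist x y₀) := by positivity
      simp only at h1 ⊢
      linarith
    · obtain ⟨_, ⟨y, ⟨hyV, hxy⟩, rfl⟩, hy⟩ := exists_lt_of_lt_csSup (s := A)
        ⟨_, ⟨y₀, ⟨hy₀, hxy₀⟩, rfl⟩⟩
        (half_lt_self h0)
      refine ⟨⟨y, hyV⟩, hxy, fun y' hy' hxy' ↦ ?_⟩
      have h1 := le_csSup hbdd ⟨y', ⟨hy', hxy'⟩, rfl⟩
      simp only at h1 hy ⊢
      linarith
  choose f hf hfmax using hgreedy
  set x : ℕ → V := fun n ↦ f^[n] ⟨q, hq⟩ with hx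
  have hsucc : ∀ n, x (n + 1) = f (x n) := fun n ↦ Function.iterate_succ_apply' _ _ _
  have hchron : ∀ n, g.Chron (x n) (x (n + 1)) := fun n ↦ by rw [hsucc]; exact hf _
  obtain ⟨γ, hγ, hγx⟩ := exists_timelike_through (x := fun n ↦ (x n : M)) hchron
  refine ⟨γ, hγ, ?_, fun t ht ↦ ?_, ?_⟩
  · simpa [hx] using hγx 0
  · obtain ⟨n, hn⟩ := exists_nat_gt t
    refine hpast _ _ (x n).2 ?_
    rw [← hγx]
    exact hγ.chron ht (mem_Ici.mpr (Nat.cast_nonneg n)) hn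
  · rintro ⟨z, hz⟩
    have hlim : Tendsto (fun n ↦ (x n : M)) atTop (𝓝 z) := by
      rw [tendsto_nhds]
      intro O hO hzO
      obtain ⟨t₀, -, ht⟩ := hz O hO hzO
      obtain ⟨n, hn⟩ := exists_nat_ge t₀
      refine mem_atTop_sets.mpr ⟨n, fun m hm ↦ ?_⟩
      rw [mem_preimage, ← hγx]
      exact ht _ (mem_Ici.mpr (Nat.cast_nonneg m)) (hn.trans (by exact_mod_cast hm))
    have hzV : z ∈ closure V := mem_closure_of_tendsto hlim (Eventually.of_forall fun n ↦ (x n).2)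
    obtain ⟨y, hyV, hyz, hy⟩ := hfar z hzV
    have hxz : ∀ n, g.Chron (x n) z := fun n ↦ by
      refine Chron.trans_futureEndpoint hγ.causal hz (t₀ := ((n + 1 : ℕ) : ℝ))
        (mem_Ici.mpr (Nat.cast_nonneg _)) ?_
      rw [hγx]; exact hchron n
    have hle : ∀ n, min 1 (dist (x n : M) y) ≤ 2 * min 1 (dist (x n : M) (x (n + 1))) := by
      intro n
      -- If the curve converged to z, its steps would shrink to zero. But each x n precedes the
      -- limit successor y of z, so by greediness its step is at least half of the truncated
      -- distance to y, which stays bounded away from zero.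
      have hcl : y ∈ closure {y' ∈ V | g.Chron (x n) y'} := by
        have := (isOpen_chron_future (g := g) (x n : M)).inter_closure
          (⟨hy _ (hxz n), hyV⟩ : y ∈ {w | g.Chron (x n) w} ∩ closure V)
        have hsub : {w | g.Chron (x n) w} ∩ V ⊆ {y' ∈ V | g.Chron (x n) y'} :=
          fun w hw ↦ ⟨hw.2, hw.1⟩
        exact closure_mono hsub this
      refine closure_minimal (s := {y' ∈ V | g.Chron (x n) y'})
        (t := {w | min 1 (dist (x n : M) w) ≤ 2 * min 1 (dist (x n : M) (x (n + 1)))}) ?_ ?_ hcl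
      · rintro w ⟨hw1, hw2⟩
        rw [mem_ofPred_eq, hsucc]
        exact hfmax _ _ hw1 hw2
      · exact isClosed_le (by fun_prop) continuous_const
    have hlim1 : Tendsto (fun n ↦ min 1 (dist (x n : M) y)) atTop (𝓝 (min 1 (dist z y))) :=
      tendsto_const_nhds.min (hlim.dist tendsto_const_nhds)
    have hlim2 : Tendsto (fun n ↦ 2 * min 1 (dist (x n : M) (x (n + 1)))) atTop (𝓝 0) := by
      have h1 := (tendsto_const_nhds (x := (1 : ℝ))).min (hlim.dist
        (hlim.comp (tendsto_add_atTop_nat 1)))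
      have h2 := h1.const_mul 2
      simpa using! h2
    have h3 := le_of_tendsto_of_tendsto' hlim1 hlim2 hle
    have h4 : 0 < min 1 (dist z y) := lt_min one_pos (dist_pos.mpr hyz.symm)
    linarith

end Greedy

end LorentzSpacetime

end

set_option maxSynthPendingDepth 3

noncomputable section

namespace LorentzSpacetime

/-! ### Linear differential equations and the development of causal curves. -/

section LinearODE

open scoped NNReal

variable {F : Type*} [NormedAddCommGroup F] [NormedSpace ℝ F]

theorem hasDerivWithinAt_glue {z₁ z₂ : ℝ → F} {u v w : ℝ} (huv : u < v) (hvw : v < w)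
    (heq : z₁ v = z₂ v) {f : ℝ → F → F}
    (h1 : ∀ t ∈ Icc u v, HasDerivWithinAt z₁ (f t (z₁ t)) (Icc u v) t)
    (h2 : ∀ t ∈ Icc v w, HasDerivWithinAt z₂ (f t (z₂ t)) (Icc v w) t) :
    let z := fun t ↦ if t ≤ v then z₁ t else z₂ t
    ∀ t ∈ Icc u w, HasDerivWithinAt z (f t (z t)) (Icc u w) t := by
  intro z
  have e1 : EqOn z z₁ (Icc u v) := fun t ht ↦ if_pos ht.2
  have e2 : EqOn z z₂ (Icc v w) := fun t ht ↦ by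
    rcases ht.1.eq_or_lt with rfl | h
    · simp [z, heq]
    · exact if_neg (not_le.mpr h)
  have d1 : ∀ t ∈ Icc u v, HasDerivWithinAt z (f t (z t)) (Icc u v) t := fun t ht ↦ by
    rw [e1 ht]; exact (h1 t ht).congr e1 (e1 ht)
  have d2 : ∀ t ∈ Icc v w, HasDerivWithinAt z (f t (z t)) (Icc v w) t := fun t ht ↦ by
    rw [e2 ht]; exact (h2 t ht).congr e2 (e2 ht)
  intro t ht
  rcases lt_trichotomy t v with h | rfl | h
  · refine (d1 t ⟨ht.1, h.le⟩).mono_of_mem_nhdsWithin ?_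
    filter_upwards [self_mem_nhdsWithin, mem_nhdsWithin_of_mem_nhds (Iio_mem_nhds h)] with s hs hs'
    exact ⟨hs.1, (le_of_lt hs')⟩
  · have := (d1 t ⟨ht.1, le_rfl⟩).union (d2 t ⟨le_rfl, ht.2⟩)
    rwa [Icc_union_Icc_eq_Icc ht.1 ht.2] at this
  · refine (d2 t ⟨h.le, ht.2⟩).mono_of_mem_nhdsWithin ?_
    filter_upwards [self_mem_nhdsWithin, mem_nhdsWithin_of_mem_nhds (Ioi_mem_nhds h)] with s hs hs'
    exact ⟨(le_of_lt hs'), hs.2⟩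

/-- Global existence for differential equations with linear growth. -/
theorem exists_solution_Icc [CompleteSpace F] {f : ℝ → F → F} {β : ℝ≥0} {u v : ℝ} (huv : u < v)
    (hL : ∀ t ∈ Icc u v, LipschitzWith β (f t)) (h0 : ∀ t ∈ Icc u v, f t 0 = 0)
    (hc : ∀ x, ContinuousOn (fun t ↦ f t x) (Icc u v)) (z₀ : F) :
    ∃ z : ℝ → F, z u = z₀ ∧ ∀ t ∈ Icc u v, HasDerivWithinAt z (f t (z t)) (Icc u v) t := by
  -- On an interval of this length the Picard–Lindelöf ball of radius ‖z₀‖ + 1 suffices, since h β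
  -- (2‖z₀‖ + 1) ≤ ‖z₀‖ + 1. A grid of mesh h then plays the role of the break points in
  -- `piecewise_induction`.
  set h : ℝ := 1 / (2 * (β + 1)) with hh
  have hpos : 0 < h := by positivity
  obtain ⟨n, hn⟩ := exists_nat_gt ((v - u) / h)
  set G : Finset ℝ := (Finset.range (n + 1)).image fun k : ℕ ↦ u + k * h with hG
  revert z₀
  refine piecewise_induction G (a := u) (b := v) (P := fun u v ↦ ∀ z₀ : F, ∃ z : ℝ → F, z u = z₀ ∧
    ∀ t ∈ Icc u v, HasDerivWithinAt z (f t (z t)) (Icc u v) t) ?_ ?_ u v le_rfl huv le_rfl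
  · intro u' v' hu huv' hv hd z₀
    have hlen : v' - u' ≤ h := by
      by_contra! hlt
      set k := ⌊(u' - u) / h⌋₊ + 1 with hk
      have h1 : (u' - u) / h < k := by rw [hk]; push_cast; exact Nat.lt_floor_add_one _
      have h2 : (k : ℝ) ≤ (u' - u) / h + 1 := by
        rw [hk]; push_cast
        have := Nat.floor_le (div_nonneg (sub_nonneg.mpr hu) hpos.le)
        linarith
      rw [div_lt_iff₀ hpos] at h1
      have h3 : (k : ℝ) * h ≤ (u' - u) + h := by
        calc (k : ℝ) * h ≤ ((u' - u) / h + 1) * h := by gcongr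
          _ = _ := by field_simp
      have hmem : u + (k : ℝ) * h ∈ Ioo u' v' := ⟨by linarith, by linarith⟩
      refine Set.disjoint_left.mp hd ?_ hmem
      rw [hG, Finset.coe_image]
      refine ⟨k, ?_, rfl⟩
      rw [Finset.mem_coe, Finset.mem_range]
      have h4 : (k : ℝ) * h < n * h := by
        rw [div_lt_iff₀ hpos] at hn
        linarith
      have := lt_of_mul_lt_mul_right h4 hpos.le
      have : k < n := by exact_mod_cast this
      omega
    have hsub : Icc u' v' ⊆ Icc u v := Icc_subset_Icc hu hv
    set a : ℝ≥0 := ‖z₀‖₊ + 1 with ha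
    have hPL : IsPicardLindelof f (⟨u', le_rfl, huv'.le⟩ : Icc u' v') z₀ a 0
        (β * (‖z₀‖₊ + a)) β := by
      refine ⟨fun t ht ↦ (hL t (hsub ht)).lipschitzOnWith, fun x _ ↦ (hc x).mono hsub, ?_, ?_⟩
      · intro t ht x hx
        have h1 := (hL t (hsub ht)).dist_le_mul x 0
        rw [h0 t (hsub ht), dist_zero_right, dist_zero_right] at h1
        refine h1.trans ?_
        push_cast
        gcongr
        have : x = z₀ + (x - z₀) := by abel
        rw [Metric.mem_closedBall, dist_eq_norm] at hx
        calc ‖x‖ = ‖z₀ + (x - z₀)‖ := by rw [← this]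
          _ ≤ ‖z₀‖ + ‖x - z₀‖ := norm_add_le _ _
          _ ≤ _ := by gcongr
      · simp only [sub_self, NNReal.coe_zero, sub_zero]
        rw [max_eq_left (by linarith)]
        push_cast
        have h1 : β * (v' - u') ≤ 1 / 2 := by
          calc (β : ℝ) * (v' - u') ≤ (β + 1) * h := by
                have := β.2
                have h5 : (β : ℝ) * (v' - u') ≤ β * h := mul_le_mul_of_nonneg_left hlen this
                nlinarith
            _ = 1 / 2 := by rw [hh]; field_simp
        have h2 : 0 ≤ ‖z₀‖ := norm_nonneg _
        rw [ha]; push_cast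
        nlinarith
    obtain ⟨z, hz, hz'⟩ := hPL.exists_eq_forall_mem_Icc_hasDerivWithinAt₀
    exact ⟨z, hz, hz'⟩
  · intro u' v' w' _ h1 h2 _ H1 H2 z₀
    obtain ⟨z₁, hz₁, hz₁'⟩ := H1 z₀
    obtain ⟨z₂, hz₂, hz₂'⟩ := H2 (z₁ v')
    refine ⟨_, ?_, hasDerivWithinAt_glue h1 h2 hz₂.symm hz₁' hz₂'⟩
    simp [h1.le, hz₁]

end LinearODE

section PWC1

variable {E : Type*} [NormedAddCommGroup E] [NormedSpace ℝ E] {Q : E → E → Prop} {c : ℝ → E}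
  {a b : ℝ}

theorem PWC1.congr {c' : ℝ → E} (hc : PWC1 Q c a b) (h : EqOn c' c (Icc a b)) : PWC1 Q c' a b := by
  obtain ⟨F, hF⟩ := hc
  refine ⟨F, fun u v hu huv hv hd ↦ ?_⟩
  obtain ⟨h1, h2⟩ := hF u v hu huv hv hd
  have h' : EqOn c' c (Icc u v) := h.mono (Icc_subset_Icc hu hv)
  refine ⟨h1.congr h', fun t ht ↦ ?_⟩
  rw [derivWithin_congr h' (h' ht), h' ht]
  exact h2 t ht

theorem PWC1.glue {t₁ : ℝ} (h1 : PWC1 Q c a t₁) (h2 : PWC1 Q c t₁ b) : PWC1 Q c a b := by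
  obtain ⟨F₁, hF₁⟩ := h1
  obtain ⟨F₂, hF₂⟩ := h2
  classical
  refine ⟨insert t₁ (F₁ ∪ F₂), fun u v hu huv hv hd ↦ ?_⟩
  rw [Finset.coe_insert, Finset.coe_union, disjoint_insert_left, disjoint_union_left] at hd
  obtain ⟨h3, h4, h5⟩ := hd
  rcases le_or_gt v t₁ with h | h
  · exact hF₁ u v hu huv h h4
  rcases le_or_gt t₁ u with h' | h'
  · exact hF₂ u v h' huv hv h5
  · exact absurd ⟨h', h⟩ h3

theorem PWC1.concat {c' : ℝ → E} {t₁ : ℝ} (h1 : PWC1 Q c a t₁) (h2 : PWC1 Q c' t₁ b)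
    (heq : c t₁ = c' t₁) : PWC1 Q (fun t ↦ if t ≤ t₁ then c t else c' t) a b := by
  refine (h1.congr fun t ht ↦ if_pos ht.2).glue (h2.congr fun t ht ↦ ?_)
  rcases ht.1.eq_or_lt with rfl | h
  · simp [heq]
  · exact if_neg (not_le.mpr h)

/-- The right derivative of a piecewise `C¹` curve. -/
theorem PWC1.exists_hasDerivWithinAt (hc : PWC1 Q c a b) {t : ℝ} (ht : t ∈ Ico a b) :
    ∃ v, HasDerivWithinAt c v (Ici t) t ∧ Q (c t) v := by
  obtain ⟨F, hF⟩ := hc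
  have h1 : ((F : Set ℝ) \ {t})ᶜ ∈ 𝓝 t :=
    (F.finite_toSet.subset sdiff_subset).isClosed.isOpen_compl.mem_nhds (by simp)
  obtain ⟨ε, hε, hball⟩ := Metric.mem_nhds_iff.mp h1
  have hlt : t < min b (t + ε) := lt_min ht.2 (by linarith)
  obtain ⟨h2, h3⟩ := hF t (min b (t + ε)) ht.1 hlt (min_le_left _ _) (by
    rw [Set.disjoint_left]
    intro s hsF hs
    refine (hball (?_ : s ∈ Metric.ball t ε)) ⟨hsF, hs.1.ne'⟩
    rw [Metric.mem_ball, Real.dist_eq, abs_lt]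
    have := hs.2.trans_le (min_le_right _ _)
    constructor <;> linarith [hs.1])
  refine ⟨_, ?_, h3 t ⟨le_rfl, hlt.le⟩⟩
  have h4 := ((h2.differentiableOn one_ne_zero) t ⟨le_rfl, hlt.le⟩).hasDerivWithinAt
  exact h4.mono_of_mem_nhdsWithin (Icc_mem_nhdsGE hlt)

end PWC1

section Development

variable {E : Type*} [NormedAddCommGroup E] [NormedSpace ℝ E]

/-- Velocities `(c', Φ', Ψ', C')` of a causal curve `c` together with its parallel transport `Φ`,
the inverse `Ψ` of the latter, and the development `C` of the curve into the initial tangent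
space. -/
def Develops (G : E → E →L[ℝ] E →L[ℝ] ℝ) (Γ : E → E →L[ℝ] E →L[ℝ] E) (y₀ e : E)
    (z z' : E × (E →L[ℝ] E) × (E →L[ℝ] E) × E) : Prop :=
  BoxCausal G y₀ e z.1 z'.1 ∧ z'.2.1 = -(Γ z.1 z'.1).comp z.2.1 ∧
    z'.2.2.1 = z.2.2.1.comp (Γ z.1 z'.1) ∧ z'.2.2.2 = z.2.2.1 z'.1

/-- Along a smooth piece the equations for transport, inverse transport and development are linear
with continuous coefficients, so they are solvable on the whole piece. Carrying the inverse
transport as an unknown of its own keeps the system linear. -/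
theorem exists_development [CompleteSpace E] {G : E → E →L[ℝ] E →L[ℝ] ℝ}
    {Γ : E → E →L[ℝ] E →L[ℝ] E} {y₀ e : E} {s : Set E} (hΓ : ContinuousOn Γ s) {c : ℝ → E}
    {a b : ℝ} (hab : a < b) (hc : PWC1 (BoxCausal G y₀ e) c a b) (hm : MapsTo c (Icc a b) s)
    (w₀ : (E →L[ℝ] E) × (E →L[ℝ] E) × E) :
    ∃ w : ℝ → (E →L[ℝ] E) × (E →L[ℝ] E) × E, w a = w₀ ∧
      PWC1 (Develops G Γ y₀ e) (fun t ↦ (c t, w t)) a b := by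
  obtain ⟨F, hF⟩ := hc
  revert w₀
  refine piecewise_induction F (a := a) (b := b) (P := fun a b ↦
    ∀ w₀ : (E →L[ℝ] E) × (E →L[ℝ] E) × E, ∃ w : ℝ → (E →L[ℝ] E) × (E →L[ℝ] E) × E, w a = w₀ ∧
      PWC1 (Develops G Γ y₀ e) (fun t ↦ (c t, w t)) a b) ?_ ?_ a b le_rfl hab le_rfl
  · intro u v hu huv hv hd w₀
    obtain ⟨h1, h2⟩ := hF u v hu huv hv hd
    have hsub : Icc u v ⊆ Icc a b := Icc_subset_Icc hu hv
    have hU : UniqueDiffOn ℝ (Icc u v) := uniqueDiffOn_Icc huv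
    set c' := derivWithin c (Icc u v) with hc'
    have hc'cont : ContinuousOn c' (Icc u v) := h1.continuousOn_derivWithin hU le_rfl
    set B : ℝ → E →L[ℝ] E := fun t ↦ Γ (c t) (c' t) with hB
    have hBcont : ContinuousOn B (Icc u v) :=
      (hΓ.comp h1.continuousOn fun t ht ↦ hm (hsub ht)).clm_apply hc'cont
    obtain ⟨β₁, hβ₁⟩ := isCompact_Icc.exists_bound_of_continuousOn hBcont
    obtain ⟨β₂, hβ₂⟩ := isCompact_Icc.exists_bound_of_continuousOn hc'cont
    set β : NNReal := (max β₁ β₂).toNNReal with hβ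
    have hβ1 : ∀ t ∈ Icc u v, ‖B t‖ ≤ β := fun t ht ↦
      ((hβ₁ t ht).trans (le_max_left _ _)).trans (Real.le_coe_toNNReal _)
    have hβ2 : ∀ t ∈ Icc u v, ‖c' t‖ ≤ β := fun t ht ↦
      ((hβ₂ t ht).trans (le_max_right _ _)).trans (Real.le_coe_toNNReal _)
    set f : ℝ → (E →L[ℝ] E) × (E →L[ℝ] E) × E → (E →L[ℝ] E) × (E →L[ℝ] E) × E := fun t w ↦
      (-(B t).comp w.1, w.2.1.comp (B t), w.2.1 (c' t)) with hf
    have hfL : ∀ t ∈ Icc u v, LipschitzWith β (f t) := by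
      intro t ht
      refine LipschitzWith.of_dist_le_mul fun x y ↦ ?_
      rw [dist_eq_norm, dist_eq_norm]
      have e1 : f t x - f t y = (-(B t).comp (x - y).1, (x - y).2.1.comp (B t),
          (x - y).2.1 (c' t)) := by
        simp only [hf, Prod.fst_sub, Prod.snd_sub, ContinuousLinearMap.comp_sub,
          ContinuousLinearMap.sub_comp, sub_apply, Prod.mk_sub_mk]
        congr 1
        abel
      rw [e1]
      have n1 : ‖(x - y).1‖ ≤ ‖x - y‖ := norm_fst_le _
      have n2 : ‖(x - y).2.1‖ ≤ ‖x - y‖ := (norm_fst_le _).trans (norm_snd_le _)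
      refine max_le ?_ (max_le ?_ ?_)
      · rw [norm_neg]
        exact (ContinuousLinearMap.opNorm_comp_le _ _).trans (by gcongr; exact hβ1 t ht)
      · refine (ContinuousLinearMap.opNorm_comp_le _ _).trans ?_
        rw [mul_comm]; gcongr; exact hβ1 t ht
      · refine (ContinuousLinearMap.le_opNorm _ _).trans ?_
        rw [mul_comm]; gcongr; exact hβ2 t ht
    obtain ⟨w, hw0, hw⟩ := exists_solution_Icc (f := f) huv hfL (fun t _ ↦ by simp [hf])
      (fun x ↦ by
        refine ContinuousOn.prodMk ?_ (ContinuousOn.prodMk ?_ ?_)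
        · exact (hBcont.clm_comp continuousOn_const).neg
        · exact continuousOn_const.clm_comp hBcont
        · exact x.2.1.continuous.comp_continuousOn hc'cont) w₀
    have hwcont : ContinuousOn w (Icc u v) := fun t ht ↦ (hw t ht).continuousWithinAt
    have hfw : ContinuousOn (fun t ↦ f t (w t)) (Icc u v) := by
      have k1 : ContinuousOn (fun t ↦ (w t).2.1) (Icc u v) :=
        (continuous_fst.comp continuous_snd).comp_continuousOn hwcont
      refine ContinuousOn.prodMk ?_ (ContinuousOn.prodMk ?_ ?_)
      · exact (hBcont.clm_comp (continuous_fst.comp_continuousOn hwcont)).neg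
      · exact k1.clm_comp hBcont
      · exact k1.clm_apply hc'cont
    have hz : ∀ t ∈ Icc u v, HasDerivWithinAt (fun t ↦ (c t, w t)) (c' t, f t (w t)) (Icc u v) t :=
      fun t ht ↦ ((h1.differentiableOn one_ne_zero t ht).hasDerivWithinAt).prodMk (hw t ht)
    have hC1 : ContDiffOn ℝ 1 (fun t ↦ (c t, w t)) (Icc u v) := by
      rw [contDiffOn_one_iff_derivWithin hU]
      refine ⟨fun t ht ↦ (hz t ht).differentiableWithinAt,
        (hc'cont.prodMk hfw).congr fun t ht ↦ (hz t ht).derivWithin (hU t ht)⟩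
    refine ⟨w, hw0, ∅, fun u' v' hu' huv' hv' _ ↦ ?_⟩
    have hsub' : Icc u' v' ⊆ Icc u v := Icc_subset_Icc hu' hv'
    refine ⟨hC1.mono hsub', fun t ht ↦ ?_⟩
    rw [((hz t (hsub' ht)).mono hsub').derivWithin (uniqueDiffOn_Icc huv' t ht)]
    exact ⟨h2 t (hsub' ht), rfl, rfl, rfl⟩
  · intro u v w _ huv hvw _ H1 H2 w₀
    obtain ⟨w₁, h1, h1'⟩ := H1 w₀
    obtain ⟨w₂, h2, h2'⟩ := H2 (w₁ v)
    refine ⟨fun t ↦ if t ≤ v then w₁ t else w₂ t, by simp [huv.le, h1], ?_⟩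
    have := h1'.concat h2' (by simp [h2])
    convert this using 2 with t
    split_ifs with hh <;> simp [hh]

end Development

end LorentzSpacetime

end

set_option maxSynthPendingDepth 3

noncomputable section

namespace LorentzSpacetime

/-! ### Comparison by right derivatives and basic estimates for developments. -/

section RightDerivatives

variable {E F : Type*} [NormedAddCommGroup E] [NormedSpace ℝ E] [NormedAddCommGroup F]
  [NormedSpace ℝ F] {Q : E → E → Prop} {c : ℝ → E} {a b : ℝ}

/-- A barrier argument with l as clock, independent of the parametrisation: while the deviation is
at most N/2, the norm of f is at most 3N/2, so the derivative stays strictly below the barrier slope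
2kl'N. Adding ε makes N positive, as strictness requires. -/
theorem norm_sub_le_of_linear_growth {f f' : ℝ → F} {l l' : ℝ → ℝ} {k : ℝ} (hk : 0 < k)
    (hf : ContinuousOn f (Icc a b)) (hf' : ∀ t ∈ Ico a b, HasDerivWithinAt f (f' t) (Ici t) t)
    (hl : ContinuousOn l (Icc a b)) (hl' : ∀ t ∈ Ico a b, HasDerivWithinAt l (l' t) (Ici t) t)
    (hpos : ∀ t ∈ Ico a b, 0 < l' t) (hbd : ∀ t ∈ Ico a b, ‖f' t‖ ≤ k * l' t * ‖f t‖)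
    (hsmall : ∀ t ∈ Icc a b, 4 * k * (l t - l a) ≤ 1) :
    ∀ t ∈ Icc a b, ‖f t - f a‖ ≤ 2 * k * (l t - l a) * ‖f a‖ := by
  have key : ∀ ε > 0, ∀ t ∈ Icc a b, ‖f t - f a‖ ≤ 2 * k * (l t - l a) * (‖f a‖ + ε) := by
    intro ε hε
    set N := ‖f a‖ + ε with hN
    have hN0 : 0 < N := by positivity
    refine image_norm_le_of_norm_deriv_right_lt_deriv_boundary' (f := fun t ↦ f t - f a)
      (f' := f') (B := fun t ↦ 2 * k * (l t - l a) * N) (B' := fun t ↦ 2 * k * l' t * N)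
      (hf.sub continuousOn_const) (fun t ht ↦ (hf' t ht).sub_const _) (by simp)
      ((continuousOn_const.mul (hl.sub continuousOn_const)).mul continuousOn_const)
      (fun t ht ↦ (((hl' t ht).sub_const _).const_mul _).mul_const _) ?_
    intro t ht heq
    have h1 := hsmall t (Ico_subset_Icc_self ht)
    have h2 : ‖f t‖ ≤ ‖f a‖ + ‖f t - f a‖ := by
      simpa using norm_add_le (f a) (f t - f a)
    have h3 : ‖f t - f a‖ ≤ N / 2 := by
      rw [heq]; nlinarith
    have h4 := hpos t ht
    calc ‖f' t‖ ≤ k * l' t * ‖f t‖ := hbd t ht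
      _ ≤ k * l' t * (3 / 2 * N) := by gcongr; linarith
      _ < 2 * k * l' t * N := by nlinarith [mul_pos (mul_pos hk h4) hN0]
  intro t ht
  have hlim : Tendsto (fun ε : ℝ ↦ 2 * k * (l t - l a) * (‖f a‖ + ε)) (𝓝[>] 0)
      (𝓝 (2 * k * (l t - l a) * (‖f a‖ + 0))) := by
    refine Tendsto.mono_left ?_ nhdsWithin_le_nhds
    exact Continuous.tendsto (by fun_prop) 0
  rw [add_zero] at hlim
  exact ge_of_tendsto hlim (by filter_upwards [self_mem_nhdsWithin] with ε hε using key ε hε t ht)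

theorem PWC1.norm_apply_sub_le (hab : a < b) (hc : PWC1 Q c a b) (A : E →L[ℝ] F) (L : E →L[ℝ] ℝ)
    (hQ : ∀ t ∈ Icc a b, ∀ v, Q (c t) v → ‖A v‖ ≤ L v) {s t : ℝ} (hs : a ≤ s) (hst : s ≤ t)
    (ht : t ≤ b) : ‖A (c t) - A (c s)‖ ≤ L (c t) - L (c s) := by
  have hcont := hc.continuousOn hab
  have hsub : Icc s t ⊆ Icc a b := Icc_subset_Icc hs ht
  choose! v hv hv' using fun x (hx : x ∈ Ico a b) ↦ hc.exists_hasDerivWithinAt hx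
  have hsub' : Ico s t ⊆ Ico a b := Ico_subset_Ico hs ht
  exact image_norm_le_of_norm_deriv_right_le_deriv_boundary' (f := fun x ↦ A (c x) - A (c s))
    (f' := fun x ↦ A (v x)) (B := fun x ↦ L (c x) - L (c s)) (B' := fun x ↦ L (v x))
    ((A.continuous.comp_continuousOn (hcont.mono hsub)).sub continuousOn_const)
    (fun x hx ↦ (A.hasFDerivAt.comp_hasDerivWithinAt x (hv x (hsub' hx))).sub_const _) (by simp)
    ((L.continuous.comp_continuousOn (hcont.mono hsub)).sub continuousOn_const)
    (fun x hx ↦ (L.hasFDerivAt.comp_hasDerivWithinAt x (hv x (hsub' hx))).sub_const _)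
    (fun x hx ↦ hQ x (Ico_subset_Icc_self (hsub' hx)) _ (hv' x (hsub' hx))) ⟨hst, le_rfl⟩

theorem PWC1.apply_le_apply (hab : a < b) (hc : PWC1 Q c a b) (L L' : E →L[ℝ] ℝ)
    (hQ : ∀ t ∈ Icc a b, ∀ v, Q (c t) v → L v ≤ L' v) {s t : ℝ} (hs : a ≤ s) (hst : s ≤ t)
    (ht : t ≤ b) : L (c t) - L (c s) ≤ L' (c t) - L' (c s) := by
  have := hc.norm_apply_sub_le hab (0 : E →L[ℝ] ℝ) (L' - L) (fun x hx v hv ↦ by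
    simpa using hQ x hx v hv) hs hst ht
  simp only [zero_apply, sub_self, norm_zero, sub_apply] at this
  linarith

/-- Weak monotonicity comes from the comparison lemma. Equality at the ends would make L constant in
between, against its positive right derivative at s. -/
theorem PWC1.apply_lt_apply (hab : a < b) (hc : PWC1 Q c a b) (L : E →L[ℝ] ℝ)
    (hQ : ∀ t ∈ Icc a b, ∀ v, Q (c t) v → 0 < L v) {s t : ℝ} (hs : a ≤ s) (hst : s < t)
    (ht : t ≤ b) : L (c s) < L (c t) := by
  have hmono : ∀ x y, s ≤ x → x ≤ y → y ≤ t → L (c x) ≤ L (c y) := fun x y hx hxy hy ↦ by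
    have := hc.apply_le_apply hab 0 L (fun x hx v hv ↦ by simpa using (hQ x hx v hv).le)
      (hs.trans hx) hxy (hy.trans ht)
    simpa using this
  refine (hmono s t le_rfl hst.le le_rfl).lt_of_ne fun heq ↦ ?_
  obtain ⟨v, hv, hv'⟩ := hc.exists_hasDerivWithinAt ⟨hs, hst.trans_le ht⟩
  have h1 : HasDerivWithinAt (fun x ↦ L (c x)) (L v) (Icc s t) s :=
    (L.hasFDerivAt.comp_hasDerivWithinAt s hv).mono Icc_subset_Ici_self
  have h2 : HasDerivWithinAt (fun x ↦ L (c x)) 0 (Icc s t) s :=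
    (hasDerivWithinAt_const s (Icc s t) (L (c s))).congr (fun x hx ↦
      le_antisymm ((hmono x t hx.1 hx.2 le_rfl).trans heq.ge) (hmono s x le_rfl hx.1 hx.2)) rfl
  have h3 := (uniqueDiffOn_Icc hst s ⟨le_rfl, hst.le⟩).eq_deriv _ h1 h2
  exact (hQ s ⟨hs, hst.le.trans ht⟩ v hv').ne' h3

end RightDerivatives

variable {E : Type*} [NormedAddCommGroup E] [NormedSpace ℝ E]

/-- A development of a causal curve in the inner half of a good box. -/
structure IsDevelopment (G : E → E →L[ℝ] E →L[ℝ] ℝ) (Γ : E → E →L[ℝ] E →L[ℝ] E) (y₀ e : E)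
    (ρ : ℝ) (z : ℝ → E × (E →L[ℝ] E) × (E →L[ℝ] E) × E) (a b : ℝ) : Prop where
  lt : a < b
  curve : PWC1 (Develops G Γ y₀ e) z a b
  mem : ∀ t ∈ Icc a b, (z t).1 ∈ Metric.ball y₀ (ρ / 2)
  start : (z a).2 = (ContinuousLinearMap.id ℝ E, ContinuousLinearMap.id ℝ E, 0)

namespace GoodBox

variable {G : E → E →L[ℝ] E →L[ℝ] ℝ} {Γ : E → E →L[ℝ] E →L[ℝ] E} {y₀ e : E} {ρ K : ℝ}
  (h : GoodBox G Γ y₀ e ρ K)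
include h

theorem deriv_symm {x : E} (hx : x ∈ Metric.ball y₀ ρ) (u v w : E) :
    fderiv ℝ G x u v w = fderiv ℝ G x u w v := by
  have h1 : HasFDerivAt (fun y ↦ G y v w) (((fderiv ℝ G x).flip v).flip w) x := by
    have := ((h.diff x hx).hasFDerivAt.clm_apply (hasFDerivAt_const v x)).clm_apply
      (hasFDerivAt_const w x)
    convert! this using 1
    ext; simp
  have h2 : HasFDerivAt (fun y ↦ G y v w) (((fderiv ℝ G x).flip w).flip v) x := by
    have := ((h.diff x hx).hasFDerivAt.clm_apply (hasFDerivAt_const w x)).clm_apply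
      (hasFDerivAt_const v x)
    have h3 : HasFDerivAt (fun y ↦ G y w v) (((fderiv ℝ G x).flip w).flip v) x := by
      convert! this using 1
      ext; simp
    refine h3.congr_of_eventuallyEq ?_
    filter_upwards [Metric.isOpen_ball.mem_nhds hx] with y hy using h.symm y hy v w
  exact congrArg (fun L : E →L[ℝ] ℝ ↦ L u) (h1.unique h2)

/-- Metric compatibility of the Christoffel symbols. -/
theorem compat {x : E} (hx : x ∈ Metric.ball y₀ ρ) (u v w : E) :
    fderiv ℝ G x u v w = G x (Γ x u v) w + G x v (Γ x u w) := by
  have h1 := h.chr_eq x hx u v w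
  have h2 := h.chr_eq x hx u w v
  rw [h.symm x hx v]
  rw [h.deriv_symm hx u w v] at h2
  linarith [h.deriv_symm hx v u w, h.deriv_symm hx w u v]

theorem taylor {x y : E} (hx : x ∈ Metric.ball y₀ ρ) (hy : y ∈ Metric.ball y₀ ρ) :
    ‖G y - G x - fderiv ℝ G x (y - x)‖ ≤ K * ‖y - x‖ * ‖y - x‖ := by
  have hsub : segment ℝ x y ⊆ Metric.ball y₀ ρ := (convex_ball y₀ ρ).segment_subset hx hy
  refine (convex_segment x y).norm_image_sub_le_of_norm_hasFDerivWithin_le'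
    (f' := fderiv ℝ G) (fun w hw ↦ (h.diff w (hsub hw)).hasFDerivAt.hasFDerivWithinAt)
    (fun w hw ↦ ?_) (left_mem_segment ℝ x y) (right_mem_segment ℝ x y)
  refine (h.deriv_lip w (hsub hw) x hx).trans ?_
  have hK := h.K_pos
  gcongr
  exact norm_sub_le_of_mem_segment hw

/-- With vanishing time component, `star` bounds f by the positive part of G x f f alone, so a
negative value would force f = 0. -/
theorem spacelike {x f : E} (hx : x ∈ Metric.ball y₀ ρ) (hf : G x e f = 0) :
    0 ≤ G x f f ∧ ‖f‖ ^ 2 ≤ K * G x f f := by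
  have h1 := h.star x hx x hx f
  rw [hf] at h1
  have h2 : 0 ≤ G x f f := by
    by_contra! hneg
    rw [max_eq_right hneg.le] at h1
    have : f = 0 := by
      rw [← norm_eq_zero]
      have : ‖f‖ ^ 2 ≤ 0 := by simpa using h1
      exact pow_eq_zero_iff two_ne_zero |>.mp (le_antisymm this (by positivity))
    rw [this] at hneg
    simp at hneg
  rw [max_eq_left h2] at h1
  exact ⟨h2, by simpa using h1⟩

section Dev

variable {z : ℝ → E × (E →L[ℝ] E) × (E →L[ℝ] E) × E} {a b : ℝ}
  (hz : IsDevelopment G Γ y₀ e ρ z a b)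
include hz

theorem dev_mem {t : ℝ} (ht : t ∈ Icc a b) : (z t).1 ∈ Metric.ball y₀ ρ :=
  Metric.ball_subset_ball (by linarith [h.pos]) (hz.mem t ht)

theorem dev_start_mem : (z a).1 ∈ Metric.ball y₀ ρ := h.dev_mem hz ⟨le_rfl, hz.lt.le⟩

theorem dev_time_le {t : ℝ} (ht : t ∈ Icc a b) :
    -G y₀ e (z t).1 - -G y₀ e (z a).1 ≤ K ^ 2 * ρ := by
  have h1 := hz.mem t ht
  have h2 := hz.mem a ⟨le_rfl, hz.lt.le⟩
  have h3 := (abs_le.mp (bilin_le (h.bound y₀ h.center_mem) e ((z t).1 - (z a).1))).1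
  rw [map_sub] at h3
  have h4 : ‖(z t).1 - (z a).1‖ ≤ ρ := by
    rw [← dist_eq_norm]
    have := dist_triangle_right (z t).1 (z a).1 y₀
    rw [Metric.mem_ball] at h1 h2
    linarith
  have h5 : K * ‖e‖ * ‖(z t).1 - (z a).1‖ ≤ K * K * ρ := by
    have := h.K_pos
    gcongr
    exact h.e_bound
  nlinarith

/-- The clock l dominates the speed and increases by at most K³ρ, so linear growth with rate K keeps
both transports near the identity. The defect A of their product solves A' = -BA + AB with zero
initial value, hence vanishes, and metric compatibility of Γ makes the transport isometric. -/
theorem dev_transport {t : ℝ} (ht : t ∈ Icc a b) :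
    ‖(z t).2.1 - ContinuousLinearMap.id ℝ E‖ ≤ 2 * K ^ 4 * ρ ∧
    ‖(z t).2.2.1 - ContinuousLinearMap.id ℝ E‖ ≤ 2 * K ^ 4 * ρ ∧
    (z t).2.1.comp (z t).2.2.1 = ContinuousLinearMap.id ℝ E ∧
    ∀ u v, G (z t).1 ((z t).2.1 u) ((z t).2.1 v) = G (z a).1 u v := by
  have hK := h.K_pos
  have hcont := hz.curve.continuousOn hz.lt
  choose! v hv hv' using fun x (hx : x ∈ Ico a b) ↦ hz.curve.exists_hasDerivWithinAt hx
  set l : ℝ → ℝ := fun t ↦ K * -G y₀ e (z t).1 with hl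
  set l' : ℝ → ℝ := fun t ↦ K * -G y₀ e (v t).1 with hl'
  have hc1 : ContinuousOn (fun t ↦ (z t).1) (Icc a b) := continuous_fst.comp_continuousOn hcont
  have hc2 : ContinuousOn (fun t ↦ (z t).2.1) (Icc a b) :=
    (continuous_fst.comp continuous_snd).comp_continuousOn hcont
  have hc3 : ContinuousOn (fun t ↦ (z t).2.2.1) (Icc a b) :=
    (continuous_fst.comp (continuous_snd.comp continuous_snd)).comp_continuousOn hcont
  have hd1 : ∀ t ∈ Ico a b, HasDerivWithinAt (fun t ↦ (z t).1) (v t).1 (Ici t) t := fun t ht ↦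
    (hv t ht).fst
  have hd2 : ∀ t ∈ Ico a b, HasDerivWithinAt (fun t ↦ (z t).2.1) (v t).2.1 (Ici t) t :=
    fun t ht ↦ (hv t ht).snd.fst
  have hd3 : ∀ t ∈ Ico a b, HasDerivWithinAt (fun t ↦ (z t).2.2.1) (v t).2.2.1 (Ici t) t :=
    fun t ht ↦ (hv t ht).snd.snd.fst
  have hlc : ContinuousOn l (Icc a b) :=
    continuousOn_const.mul (((G y₀ e).continuous.comp_continuousOn hc1).neg)
  have hld : ∀ t ∈ Ico a b, HasDerivWithinAt l (l' t) (Ici t) t := fun t ht ↦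
    (((G y₀ e).hasFDerivAt.comp_hasDerivWithinAt t (hd1 t ht)).neg).const_mul K
  have hpos : ∀ t ∈ Ico a b, 0 < l' t := fun t ht ↦ mul_pos hK (by linarith [(hv' t ht).1.2])
  have hvl : ∀ t ∈ Ico a b, ‖(v t).1‖ ≤ l' t := fun t ht ↦
    h.norm_le_time (h.dev_mem hz (Ico_subset_Icc_self ht)) (hv' t ht).1
  have hB : ∀ t ∈ Ico a b, ‖Γ (z t).1 (v t).1‖ ≤ K * l' t := fun t ht ↦ by
    refine ((Γ (z t).1).le_opNorm _).trans ?_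
    gcongr
    · exact h.chr_bound _ (h.dev_mem hz (Ico_subset_Icc_self ht))
    · exact hvl t ht
  have hldiff : ∀ t ∈ Icc a b, l t - l a ≤ K ^ 3 * ρ := fun t ht ↦ by
    have := mul_le_mul_of_nonneg_left (h.dev_time_le hz ht) hK.le
    simp only [hl]
    linarith
  have hρ := h.pos
  have hK4 := h.pow_mul_le 4 (by norm_num)
  have hs0 : (z a).2.1 = ContinuousLinearMap.id ℝ E := by rw [hz.start]
  have hs1 : (z a).2.2.1 = ContinuousLinearMap.id ℝ E := by rw [hz.start]
  have hone : ‖ContinuousLinearMap.id ℝ E‖ ≤ 1 := ContinuousLinearMap.norm_id_le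
  have hlnn : ∀ t ∈ Icc a b, 0 ≤ l t - l a := by
    intro t ht
    have := image_norm_le_of_norm_deriv_right_le_deriv_boundary' (f := fun _ : ℝ ↦ (0 : ℝ))
      (f' := fun _ ↦ 0) (a := a) (b := b) (B := fun t ↦ l t - l a) (B' := l')
      continuousOn_const (fun t _ ↦ hasDerivWithinAt_const _ _ _) (by simp)
      (hlc.sub continuousOn_const) (fun t ht ↦ (hld t ht).sub_const _)
      (fun t ht ↦ by simpa using (hpos t ht).le) ht
    simpa using this
  have hsm : ∀ k, 0 < k → k ≤ 2 * K → ∀ t ∈ Icc a b, 4 * k * (l t - l a) ≤ 1 := by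
    intro k hk0 hk t ht
    have h1 := hldiff t ht
    have h2 := hlnn t ht
    calc 4 * k * (l t - l a) ≤ 4 * (2 * K) * (K ^ 3 * ρ) := by gcongr
      _ = 8 * (K ^ 4 * ρ) := by ring
      _ ≤ 1 := by linarith
  have hfin : ∀ x : E →L[ℝ] E, ‖x‖ ≤ 2 * K * (l t - l a) * ‖ContinuousLinearMap.id ℝ E‖ →
      ‖x‖ ≤ 2 * K ^ 4 * ρ := fun x hx ↦ by
    refine hx.trans ?_
    have h1 := hldiff t ht
    have h2 := hlnn t ht
    calc _ ≤ 2 * K * (K ^ 3 * ρ) * 1 := by gcongr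
      _ = _ := by ring
  refine ⟨?_, ?_, ?_, ?_⟩
  · refine hfin _ ?_
    have := norm_sub_le_of_linear_growth (f := fun t ↦ (z t).2.1) (f' := fun t ↦ (v t).2.1) hK
      hc2 hd2 hlc hld hpos (fun t ht ↦ ?_) (hsm K hK (by linarith)) t ht
    · rwa [hs0] at this
    · rw [(hv' t ht).2.1, norm_neg]
      exact (ContinuousLinearMap.opNorm_comp_le _ _).trans (by gcongr; exact hB t ht)
  · refine hfin _ ?_
    have := norm_sub_le_of_linear_growth (f := fun t ↦ (z t).2.2.1) (f' := fun t ↦ (v t).2.2.1) hK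
      hc3 hd3 hlc hld hpos (fun t ht ↦ ?_) (hsm K hK (by linarith)) t ht
    · rwa [hs1] at this
    · rw [(hv' t ht).2.2.1]
      refine (ContinuousLinearMap.opNorm_comp_le _ _).trans ?_
      rw [mul_comm]; gcongr; exact hB t ht
  · have := norm_sub_le_of_linear_growth
      (f := fun t ↦ (z t).2.1.comp (z t).2.2.1 - ContinuousLinearMap.id ℝ E)
      (f' := fun t ↦ (v t).2.1.comp (z t).2.2.1 + (z t).2.1.comp (v t).2.2.1)
      (k := 2 * K) (by positivity) ((hc2.clm_comp hc3).sub continuousOn_const)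
      (fun t ht ↦ ?_) hlc hld hpos (fun t ht ↦ ?_)
      (hsm (2 * K) (by positivity) le_rfl) t ht
    · simpa [hs0, hs1, sub_eq_zero] using this
    · exact ((hd2 t ht).clm_comp (hd3 t ht)).sub_const _
    · rw [(hv' t ht).2.1, (hv' t ht).2.2.1]
      set B := Γ (z t).1 (v t).1 with hBdef
      set A := (z t).2.1.comp (z t).2.2.1 - ContinuousLinearMap.id ℝ E with hA
      have e1 : (-B.comp (z t).2.1).comp (z t).2.2.1 + (z t).2.1.comp ((z t).2.2.1.comp B) =
          -B.comp A + A.comp B := by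
        rw [hA]; ext x; simp; abel
      rw [e1]
      have n1 := ContinuousLinearMap.opNorm_comp_le B A
      have n2 := ContinuousLinearMap.opNorm_comp_le A B
      have n3 := hB t ht
      have n4 : ‖B‖ * ‖A‖ ≤ K * l' t * ‖A‖ := by gcongr
      calc _ ≤ ‖-B.comp A‖ + ‖A.comp B‖ := norm_add_le _ _
        _ ≤ _ := by rw [norm_neg]; linarith
  · intro u w
    have := constant_of_has_deriv_right_zero (f := fun t ↦ G (z t).1 ((z t).2.1 u) ((z t).2.1 w))
      (a := a) (b := b) ?_ ?_ t ht
    · simpa [hs0] using this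
    · have hGc : ContinuousOn (fun t ↦ G (z t).1) (Icc a b) := fun t ht ↦
        ContinuousAt.comp_continuousWithinAt (f := fun t ↦ (z t).1)
          (h.diff _ (h.dev_mem hz ht)).continuousAt (hc1 t ht)
      exact (hGc.clm_apply (hc2.clm_apply continuousOn_const)).clm_apply
        (hc2.clm_apply continuousOn_const)
    · intro t ht
      have hx := h.dev_mem hz (Ico_subset_Icc_self ht)
      have k1 : HasDerivWithinAt (fun t ↦ G (z t).1) (fderiv ℝ G (z t).1 (v t).1) (Ici t) t :=
        (h.diff _ hx).hasFDerivAt.comp_hasDerivWithinAt t (hd1 t ht)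
      have k2 : ∀ u, HasDerivWithinAt (fun t ↦ (z t).2.1 u) ((v t).2.1 u) (Ici t) t := fun u ↦ by
        simpa using (hd2 t ht).clm_apply (hasDerivWithinAt_const t (Ici t) u)
      have k3 := (k1.clm_apply (k2 u)).clm_apply (k2 w)
      convert! k3 using 1
      rw [(hv' t ht).2.1]
      simp only [neg_apply, ContinuousLinearMap.comp_apply, add_apply, map_neg]
      rw [h.compat hx]
      ring

/-- Estimates for the velocity of a development, in terms of the time component `r`. -/
theorem dev_velocity {t : ℝ} (ht : t ∈ Icc a b) {v : E × (E →L[ℝ] E) × (E →L[ℝ] E) × E}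
    (hv : Develops G Γ y₀ e (z t) v) :
    0 < -G (z a).1 e v.2.2.2 ∧ ‖v.1‖ ≤ 2 * K * -G (z a).1 e v.2.2.2 ∧
    ‖v.2.2.2‖ ≤ K * -G (z a).1 e v.2.2.2 ∧ -G (z a).1 e v.2.2.2 ≤ 2 * -G y₀ e v.1 ∧
    -G y₀ e v.1 ≤ 2 * -G (z a).1 e v.2.2.2 ∧
    (z t).2.1 v.2.2.2 = v.1 ∧ G (z a).1 v.2.2.2 v.2.2.2 ≤ 0 := by
  have hK := h.K_pos
  have hx := h.dev_mem hz ht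
  have ha := h.dev_start_mem hz
  obtain ⟨-, h2, h3, h4⟩ := h.dev_transport hz ht
  obtain ⟨hc, -, -, hC⟩ := hv
  set r := -G (z a).1 e v.2.2.2 with hr
  set T := -G y₀ e v.1 with hT
  have hT0 : 0 < T := by have := hc.2; rw [hT]; linarith
  have n1 : ‖v.1‖ ≤ K * T := h.norm_le_time hx hc
  have n2 := h.time_lower ha hx hc
  have n3 := h.time_upper ha hx hc
  -- The velocity of the development is the inverse transport of the velocity of the curve, and that
  -- transport is close to the identity.
  have n4 : |G (z a).1 e (v.2.2.2 - v.1)| ≤ 1 / 100 * T := by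
    have e1 : v.2.2.2 - v.1 = ((z t).2.2.1 - ContinuousLinearMap.id ℝ E) v.1 := by
      rw [hC]; simp
    have e2 : ‖v.2.2.2 - v.1‖ ≤ 2 * K ^ 4 * ρ * (K * T) := by
      rw [e1]
      refine (ContinuousLinearMap.le_opNorm _ _).trans ?_
      have := h.pos
      gcongr
    refine (bilin_le (h.bound _ ha) e (v.2.2.2 - v.1)).trans ?_
    have h7 := h.pow_mul_le 7 (by norm_num)
    calc K * ‖e‖ * ‖v.2.2.2 - v.1‖ ≤ K * K * (2 * K ^ 4 * ρ * (K * T)) := by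
          gcongr; exact h.e_bound
      _ = 2 * (K ^ 7 * ρ) * T := by ring
      _ ≤ 1 / 100 * T := by gcongr; linarith
  have n5 := abs_le.mp n4
  rw [map_sub] at n5
  have r1 : 98 / 100 * T ≤ r := by linarith [n5.2]
  have r2 : r ≤ 102 / 100 * T := by linarith [n5.1]
  have e3 : (z t).2.1 v.2.2.2 = v.1 := by
    rw [hC]; exact congrArg (fun L : E →L[ℝ] E ↦ L v.1) h3
  have g1 : G (z a).1 v.2.2.2 v.2.2.2 ≤ 0 := by
    rw [← h4, e3]; exact hc.1
  have r0 : 0 < r := by linarith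
  refine ⟨r0, ?_, ?_, by linarith, by linarith, e3, g1⟩
  · calc ‖v.1‖ ≤ K * T := n1
      _ ≤ K * (2 * r) := by gcongr; linarith
      _ = _ := by ring
  · have := h.norm_le_of_causal ha ha g1
    rwa [abs_of_neg (by linarith), ← hr] at this

end Dev

end GoodBox

end LorentzSpacetime

end

/-! ### Length parameter and mean direction of a development; the second order variation estimate.
-/

set_option maxSynthPendingDepth 3

noncomputable section

namespace LorentzSpacetime

variable {E : Type*} [NormedAddCommGroup E] [NormedSpace ℝ E]

/-- The projection of the state space of developments to the development itself. -/
def devProj (E : Type*) [NormedAddCommGroup E] [NormedSpace ℝ E] :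
    E × (E →L[ℝ] E) × (E →L[ℝ] E) × E →L[ℝ] E :=
  (ContinuousLinearMap.snd ℝ (E →L[ℝ] E) E).comp
    ((ContinuousLinearMap.snd ℝ (E →L[ℝ] E) ((E →L[ℝ] E) × E)).comp
      (ContinuousLinearMap.snd ℝ E ((E →L[ℝ] E) × (E →L[ℝ] E) × E)))

/-- The projection of the state space of developments to the curve. -/
def devBase (E : Type*) [NormedAddCommGroup E] [NormedSpace ℝ E] :
    E × (E →L[ℝ] E) × (E →L[ℝ] E) × E →L[ℝ] E :=
  ContinuousLinearMap.fst ℝ E ((E →L[ℝ] E) × (E →L[ℝ] E) × E)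

namespace GoodBox

variable {G : E → E →L[ℝ] E →L[ℝ] ℝ} {Γ : E → E →L[ℝ] E →L[ℝ] E} {y₀ e : E} {ρ K : ℝ}
  (h : GoodBox G Γ y₀ e ρ K)
include h

section Dev

variable {z : ℝ → E × (E →L[ℝ] E) × (E →L[ℝ] E) × E} {a b : ℝ}
  (hz : IsDevelopment G Γ y₀ e ρ z a b)
include hz

omit h in
theorem dev_zero : (z a).2.2.2 = 0 := by rw [hz.start]

/-- The time component of the development, taken in the initial tangent space, serves from here on
as an intrinsic length parameter of the curve. -/
theorem dev_len_lt {s t : ℝ} (hs : a ≤ s) (hst : s < t) (ht : t ≤ b) :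
    -G (z a).1 e (z s).2.2.2 < -G (z a).1 e (z t).2.2.2 :=
  hz.curve.apply_lt_apply hz.lt (-(G (z a).1 e).comp (devProj E))
    (fun _ ht _ hv ↦ (h.dev_velocity hz ht hv).1) hs hst ht

theorem dev_len_le {s t : ℝ} (hs : a ≤ s) (hst : s ≤ t) (ht : t ≤ b) :
    -G (z a).1 e (z s).2.2.2 ≤ -G (z a).1 e (z t).2.2.2 := by
  rcases hst.eq_or_lt with rfl | hst
  · rfl
  · exact (h.dev_len_lt hz hs hst ht).le

omit h in
theorem dev_len_start : -G (z a).1 e (z a).2.2.2 = 0 := by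
  rw [dev_zero hz, map_zero, neg_zero]

theorem dev_len_nonneg {t : ℝ} (ht : t ∈ Icc a b) : 0 ≤ -G (z a).1 e (z t).2.2.2 := by
  rw [← dev_len_start hz]; exact h.dev_len_le hz le_rfl ht.1 ht.2

theorem dev_norm_le {t : ℝ} (ht : t ∈ Icc a b) :
    ‖(z t).2.2.2‖ ≤ K * -G (z a).1 e (z t).2.2.2 := by
  have := hz.curve.norm_apply_sub_le hz.lt (devProj E) (K • -(G (z a).1 e).comp (devProj E))
    (fun t ht v hv ↦ (h.dev_velocity hz ht hv).2.2.1) le_rfl ht.1 ht.2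
  have h1 : ‖(z t).2.2.2 - (z a).2.2.2‖ ≤
    K * -G (z a).1 e (z t).2.2.2 - K * -G (z a).1 e (z a).2.2.2 := this
  rwa [dev_zero hz, map_zero, neg_zero, mul_zero, sub_zero, sub_zero] at h1

theorem dev_dist_le {t : ℝ} (ht : t ∈ Icc a b) :
    ‖(z t).1 - (z a).1‖ ≤ 2 * K * -G (z a).1 e (z t).2.2.2 := by
  have := hz.curve.norm_apply_sub_le hz.lt (devBase E)
    ((2 * K) • -(G (z a).1 e).comp (devProj E))
    (fun t ht v hv ↦ (h.dev_velocity hz ht hv).2.1) le_rfl ht.1 ht.2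
  have h1 : ‖(z t).1 - (z a).1‖ ≤
    2 * K * -G (z a).1 e (z t).2.2.2 - 2 * K * -G (z a).1 e (z a).2.2.2 := this
  rwa [dev_zero hz, map_zero, neg_zero, mul_zero, sub_zero] at h1

theorem dev_len_upper {t : ℝ} (ht : t ∈ Icc a b) :
    -G (z a).1 e (z t).2.2.2 ≤ 2 * K ^ 2 * ρ := by
  have := hz.curve.apply_le_apply hz.lt (-(G (z a).1 e).comp (devProj E))
    ((2 : ℝ) • -(G y₀ e).comp (devBase E))
    (fun t ht v hv ↦ (h.dev_velocity hz ht hv).2.2.2.1) le_rfl ht.1 ht.2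
  have h0 := dev_len_start hz
  have h1 := h.dev_time_le hz ht
  have h2 : -G (z a).1 e (z t).2.2.2 - -G (z a).1 e (z a).2.2.2 ≤
    2 * -G y₀ e (z t).1 - 2 * -G y₀ e (z a).1 := this
  linarith

/-- The mean direction of a development over its whole length. -/
theorem dev_mean {L : ℝ} {m : E} (hL : L = -G (z a).1 e (z b).2.2.2)
    (hm : m = L⁻¹ • (z b).2.2.2) :
    0 < L ∧ L • m = (z b).2.2.2 ∧ G (z a).1 e m = -1 ∧ ‖m‖ ≤ K := by
  have hb : b ∈ Icc a b := ⟨hz.lt.le, le_rfl⟩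
  have hL0 : 0 < L := by
    rw [hL, ← dev_len_start hz]; exact h.dev_len_lt hz le_rfl hz.lt le_rfl
  refine ⟨hL0, by rw [hm, smul_smul, mul_inv_cancel₀ hL0.ne', one_smul], ?_, ?_⟩
  · rw [hm, map_smul, smul_eq_mul, show G (z a).1 e (z b).2.2.2 = -L by rw [hL, neg_neg]]
    field_simp
  · have := h.dev_norm_le hz hb
    rw [← hL] at this
    rw [hm, norm_smul, norm_inv, Real.norm_eq_abs, abs_of_pos hL0, inv_mul_le_iff₀ hL0]
    linarith

/-- The deviation `f` of the velocity of a development from a fixed direction `m`. -/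
theorem dev_defect {m : E} (hm : G (z a).1 e m = -1)
    {v : E × (E →L[ℝ] E) × (E →L[ℝ] E) × E} {r : ℝ} {f : E}
    (hr : r = -G (z a).1 e v.2.2.2) (hf : f = r • m - v.2.2.2) :
    0 ≤ G (z a).1 f f ∧ ‖f‖ ^ 2 ≤ K * G (z a).1 f f ∧
    G (z a).1 f f = r ^ 2 * G (z a).1 m m - 2 * r * G (z a).1 m v.2.2.2 +
      G (z a).1 v.2.2.2 v.2.2.2 := by
  have ha := h.dev_start_mem hz
  have h1 : G (z a).1 e f = 0 := by
    rw [hf, map_sub, map_smul, hm, smul_eq_mul, show G (z a).1 e v.2.2.2 = -r by rw [hr, neg_neg]]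
    ring
  refine ⟨(h.spacelike ha h1).1, (h.spacelike ha h1).2, ?_⟩
  rw [hf]
  simp only [map_sub, map_smul, sub_apply, smul_apply, smul_eq_mul]
  rw [h.symm _ ha v.2.2.2 m]
  ring

/-- The deviation r m - v has no time component and is therefore spacelike. Expanding its square and
using g(v, v) ≤ 0 gives 2 g(m, v) ≤ r g(m, m). Since v integrates to L m and r to L, this yields 2L
g(m, m) ≤ L g(m, m). -/
theorem dev_mean_causal {L : ℝ} {m : E} (hL : L = -G (z a).1 e (z b).2.2.2)
    (hm : m = L⁻¹ • (z b).2.2.2) : G (z a).1 m m ≤ 0 := by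
  obtain ⟨hL0, hLm, hme, -⟩ := h.dev_mean hz hL hm
  have := hz.curve.apply_le_apply hz.lt ((2 : ℝ) • (G (z a).1 m).comp (devProj E))
    (G (z a).1 m m • -(G (z a).1 e).comp (devProj E)) (fun t ht v hv ↦ ?_) le_rfl hz.lt.le le_rfl
  · have h0 := dev_zero hz
    have h1 : 2 * G (z a).1 m (z b).2.2.2 - 2 * G (z a).1 m (z a).2.2.2 ≤
      G (z a).1 m m * -G (z a).1 e (z b).2.2.2 - G (z a).1 m m * -G (z a).1 e (z a).2.2.2 := this
    rw [h0, ← hL, ← hLm] at h1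
    simp only [map_smul, smul_eq_mul, map_zero, neg_zero, mul_zero, sub_zero] at h1
    by_contra! hpos
    nlinarith [mul_pos hL0 hpos]
  · obtain ⟨h1, -, h3⟩ := h.dev_defect hz hme (v := v) rfl rfl
    obtain ⟨r0, -, -, -, -, -, h4⟩ := h.dev_velocity hz ht hv
    show 2 * G (z a).1 m v.2.2.2 ≤ G (z a).1 m m * -G (z a).1 e v.2.2.2
    set r := -G (z a).1 e v.2.2.2 with hr
    rw [h3] at h1
    have h5 : r * (2 * G (z a).1 m v.2.2.2) ≤ r * (G (z a).1 m m * r) := by nlinarith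
    exact le_of_mul_le_mul_left h5 r0

end Dev

set_option maxHeartbeats 1000000 in
/-- The second order estimate behind the first variation of the energy. -/
theorem variation_estimate {x hh v X p κ om : E} {ε τ r L μ : ℝ} (hx : x ∈ Metric.ball y₀ ρ)
    (hy : x + hh ∈ Metric.ball y₀ ρ) (hhh : hh = ε • X + om) (hε : 0 ≤ ε) (hτ : 0 ≤ τ) (hr : 0 ≤ r)
    (hL : 0 ≤ L) (hLK : 64 * K ^ 5 * L ≤ 1) (hv : ‖v‖ ≤ 2 * K * r) (hX : ‖X‖ ≤ 4 * K * L)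
    (hp : ‖p‖ ≤ 4 * K * r) (hκ : ‖κ‖ ≤ r * τ) (hom : ‖om‖ ≤ τ * L)
    (hmain : G x v v + 2 * ε * G x v p ≤ -ε * r ^ 2 * μ) :
    ‖hh‖ ≤ 4 * K * L * (ε + τ) ∧ ‖ε • (p - Γ x v X) - κ‖ ≤ 6 * K * r * (ε + τ) ∧
    G (x + hh) (v + (ε • (p - Γ x v X) - κ)) (v + (ε • (p - Γ x v X) - κ)) ≤
      r ^ 2 * (-ε * μ + 5 * K ^ 2 * τ + 38 * K ^ 3 * (ε + τ) ^ 2) := by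
  have hK := h.one_le
  have hK0 := h.K_pos
  set s := ε + τ with hs
  set k := ε • (p - Γ x v X) - κ with hk
  have hs0 : 0 ≤ s := add_nonneg hε hτ
  have hLn : ∀ n ≤ 5, K ^ n * L ≤ 1 / 64 := fun n hn ↦ by
    have := mul_le_mul_of_nonneg_right (pow_le_pow_right₀ hK hn) hL
    linarith
  have bh : ‖hh‖ ≤ 4 * K * L * s := by
    rw [hhh]
    calc ‖ε • X + om‖ ≤ ‖ε • X‖ + ‖om‖ := norm_add_le _ _
      _ ≤ ε * (4 * K * L) + τ * L := by
        rw [norm_smul, Real.norm_eq_abs, abs_of_nonneg hε]; gcongr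
      _ ≤ ε * (4 * K * L) + τ * (4 * K * L) := by
        gcongr
        nlinarith
      _ = _ := by ring
  have bΓ : ‖Γ x v X‖ ≤ r := by
    have h1 : ‖Γ x v X‖ ≤ K * ‖v‖ * ‖X‖ := by
      calc ‖Γ x v X‖ ≤ ‖Γ x‖ * ‖v‖ * ‖X‖ := (Γ x).le_opNorm₂ v X
        _ ≤ _ := by gcongr; exact h.chr_bound x hx
    calc ‖Γ x v X‖ ≤ K * ‖v‖ * ‖X‖ := h1
      _ ≤ K * (2 * K * r) * (4 * K * L) := by gcongr
      _ = 8 * (K ^ 3 * L) * r := by ring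
      _ ≤ 8 * (1 / 64) * r := by gcongr; exact hLn 3 (by norm_num)
      _ ≤ r := by linarith
  have bk : ‖k‖ ≤ 6 * K * r * s := by
    calc ‖k‖ ≤ ‖ε • (p - Γ x v X)‖ + ‖κ‖ := norm_sub_le _ _
      _ ≤ ε * (4 * K * r + r) + r * τ := by
        rw [norm_smul, Real.norm_eq_abs, abs_of_nonneg hε]
        gcongr
        exact (norm_sub_le _ _).trans (by gcongr)
      _ ≤ ε * (6 * K * r) + τ * (6 * K * r) := by
        have : r ≤ K * r := by nlinarith
        nlinarith [mul_nonneg hε hr, mul_nonneg hτ hr, mul_le_mul_of_nonneg_left this hε,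
          mul_le_mul_of_nonneg_left this hτ]
      _ = _ := by ring
  refine ⟨bh, bk, ?_⟩
  have ht := h.taylor hx hy
  rw [add_sub_cancel_left] at ht
  have hl := h.lip (x + hh) hy x hx
  rw [add_sub_cancel_left] at hl
  have e1 := (abs_le.mp (bilin_le ht v v)).2
  have e2 := (abs_le.mp (bilin_le hl v k)).2
  have e3 := (abs_le.mp (bilin_le (h.bound _ hy) k k)).2
  have e4 := (abs_le.mp (bilin_le (h.bound _ hx) v κ)).1
  have e5 : fderiv ℝ G x om v v ≤ K * ‖om‖ * ‖v‖ * ‖v‖ := by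
    have h1 : ‖fderiv ℝ G x om‖ ≤ K * ‖om‖ :=
      (ContinuousLinearMap.le_opNorm _ _).trans (by gcongr; exact h.deriv_bound x hx)
    exact (abs_le.mp (bilin_le h1 v v)).2
  have e6 := h.chr_eq x hx v X v
  have e7 := h.deriv_symm hx v X v
  -- First order expansion in base point and velocity; the last three terms are the remainders
  -- bounded by (ε + τ)².
  have e8 : G (x + hh) (v + k) (v + k) = G x v v + fderiv ℝ G x hh v v + 2 * G x v k +
      (G (x + hh) - G x - fderiv ℝ G x hh) v v + 2 * (G (x + hh) - G x) v k + G (x + hh) k k := by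
    simp only [map_add, add_apply, sub_apply]
    rw [h.symm _ hy k v]
    ring
  have e9 : fderiv ℝ G x hh v v = ε * fderiv ℝ G x X v v + fderiv ℝ G x om v v := by
    rw [hhh]; simp only [map_add, map_smul, add_apply, smul_apply, smul_eq_mul]
  have e10 : G x v k = ε * G x v p - ε * G x v (Γ x v X) - G x v κ := by
    rw [hk]; simp only [map_sub, map_smul, smul_eq_mul]; ring
  have e11 := h.symm x hx v (Γ x v X)
  have b1 : K * ‖hh‖ * ‖hh‖ * ‖v‖ * ‖v‖ ≤ 1 / 64 * (r ^ 2 * (K ^ 3 * s ^ 2)) := by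
    calc _ ≤ K * (4 * K * L * s) * (4 * K * L * s) * (2 * K * r) * (2 * K * r) := by gcongr
      _ = 64 * (K ^ 2 * L) * (K ^ 0 * L) * (r ^ 2 * (K ^ 3 * s ^ 2)) := by ring
      _ ≤ 64 * (1 / 64) * (1 / 64) * (r ^ 2 * (K ^ 3 * s ^ 2)) := by
        gcongr
        · exact hLn 2 (by norm_num)
        · exact hLn 0 (by norm_num)
      _ = _ := by ring
  have b2 : 2 * (K * ‖hh‖ * ‖v‖ * ‖k‖) ≤ 3 / 2 * (r ^ 2 * (K ^ 3 * s ^ 2)) := by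
    calc _ ≤ 2 * (K * (4 * K * L * s) * (2 * K * r) * (6 * K * r * s)) := by gcongr
      _ = 96 * (K ^ 1 * L) * (r ^ 2 * (K ^ 3 * s ^ 2)) := by ring
      _ ≤ 96 * (1 / 64) * (r ^ 2 * (K ^ 3 * s ^ 2)) := by gcongr; exact hLn 1 (by norm_num)
      _ = _ := by ring
  have b3 : K * ‖k‖ * ‖k‖ ≤ 36 * (r ^ 2 * (K ^ 3 * s ^ 2)) := by
    calc _ ≤ K * (6 * K * r * s) * (6 * K * r * s) := by gcongr
      _ = _ := by ring
  have b4 : 2 * (K * ‖v‖ * ‖κ‖) ≤ 4 * (r ^ 2 * (K ^ 2 * τ)) := by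
    calc _ ≤ 2 * (K * (2 * K * r) * (r * τ)) := by gcongr
      _ = _ := by ring
  have b5 : K * ‖om‖ * ‖v‖ * ‖v‖ ≤ r ^ 2 * (K ^ 2 * τ) := by
    calc _ ≤ K * (τ * L) * (2 * K * r) * (2 * K * r) := by gcongr
      _ = 4 * (K ^ 1 * L) * (r ^ 2 * (K ^ 2 * τ)) := by ring
      _ ≤ 4 * (1 / 64) * (r ^ 2 * (K ^ 2 * τ)) := by gcongr; exact hLn 1 (by norm_num)
      _ ≤ _ := by nlinarith [mul_nonneg (sq_nonneg r) (mul_nonneg (sq_nonneg K) hτ)]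
  have b6 : 0 ≤ r ^ 2 * (K ^ 3 * s ^ 2) := by positivity
  -- Metric compatibility: the derivative of the metric along the variation field cancels the
  -- Christoffel term in its velocity, so only 2ε g(v, p) remains at first order.
  have e12 : ε * (2 * G x v (Γ x v X)) = ε * fderiv ℝ G x X v v := by
    rw [e11, e6, e7]; ring
  have e13 : r ^ 2 * (-ε * μ + 5 * K ^ 2 * τ + 38 * K ^ 3 * s ^ 2) =
      -ε * r ^ 2 * μ + 5 * (r ^ 2 * (K ^ 2 * τ)) + 38 * (r ^ 2 * (K ^ 3 * s ^ 2)) := by ring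
  rw [e8, e9, e10, e13]
  linarith

end GoodBox

end LorentzSpacetime

end

/-! ### Deforming a causal curve whose development is not straight. -/

set_option maxSynthPendingDepth 3

noncomputable section

namespace LorentzSpacetime

variable {E : Type*} [NormedAddCommGroup E] [NormedSpace ℝ E]

namespace GoodBox

variable {G : E → E →L[ℝ] E →L[ℝ] ℝ} {Γ : E → E →L[ℝ] E →L[ℝ] E} {y₀ e : E} {ρ K : ℝ}
  (h : GoodBox G Γ y₀ e ρ K)
include h

section Dev

variable {z : ℝ → E × (E →L[ℝ] E) × (E →L[ℝ] E) × E} {a b : ℝ}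
  (hz : IsDevelopment G Γ y₀ e ρ z a b)
include hz

theorem dev_transport_norm {t : ℝ} (ht : t ∈ Icc a b) (u : E) : ‖(z t).2.1 u‖ ≤ 2 * ‖u‖ := by
  obtain ⟨h1, -⟩ := h.dev_transport hz ht
  have h2 := h.pow_mul_le 4 (by norm_num)
  have h3 : (z t).2.1 u = ((z t).2.1 - ContinuousLinearMap.id ℝ E) u + u := by simp
  rw [h3]
  calc _ ≤ ‖((z t).2.1 - ContinuousLinearMap.id ℝ E) u‖ + ‖u‖ := norm_add_le _ _
    _ ≤ 1 * ‖u‖ + ‖u‖ := by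
      gcongr
      exact (ContinuousLinearMap.le_opNorm _ _).trans (by gcongr; linarith)
    _ = _ := by ring

set_option maxHeartbeats 1000000 in
/-- A causal curve whose development is not straight can be deformed to a timelike curve, even
after a small displacement of its initial point. -/
theorem exists_timelike_of_defect {L μ : ℝ} {m w : E} (hL : L = -G (z a).1 e (z b).2.2.2)
    (hm : m = L⁻¹ • (z b).2.2.2) (hμ : μ = -G (z a).1 m m) (hμ0 : 0 < μ)
    (hw : ‖w‖ ≤ L * (μ ^ 2 / (10 ^ 6 * K ^ 12))) :
    ∃ c : ℝ → E, PWC1 (BoxTimelike G y₀ e) c a b ∧ MapsTo c (Icc a b) (Metric.ball y₀ ρ) ∧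
      c a = (z a).1 + w ∧ c b = (z b).1 := by
  have hK := h.one_le
  have hK0 := h.K_pos
  have hρ := h.pos
  have ha := h.dev_start_mem hz
  have hb : b ∈ Icc a b := ⟨hz.lt.le, le_rfl⟩
  obtain ⟨hL0, hLm, hme, hmK⟩ := h.dev_mean hz hL hm
  have hLu : L ≤ 2 * K ^ 2 * ρ := hL ▸ h.dev_len_upper hz hb
  -- The size ε of the variation is such that its gain εμ beats the quadratic cost of order K³(ε +
  -- τ)². The admissible displacement τ satisfies 1000K³τ = με, so its cost 5K²τ is a small part of
  -- the same gain.
  set ε := μ / (1000 * K ^ 9) with hε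
  set τ := μ ^ 2 / (10 ^ 6 * K ^ 12) with hτ
  have hε0 : 0 < ε := by positivity
  have hτ0 : 0 ≤ τ := by positivity
  have hμK : μ ≤ K ^ 3 := by
    have := (abs_le.mp (bilin_le (h.bound _ ha) m m)).1
    calc μ ≤ K * ‖m‖ * ‖m‖ := by rw [hμ]; linarith
      _ ≤ K * K * K := by gcongr
      _ = _ := by ring
  have hεK : ε * (1000 * K ^ 6) ≤ 1 := by
    rw [hε, div_mul_eq_mul_div, div_le_one (by positivity)]
    calc μ * (1000 * K ^ 6) ≤ K ^ 3 * (1000 * K ^ 6) := by gcongr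
      _ = _ := by ring
  have hτε : τ * (1000 * K ^ 3) = μ * ε := by
    rw [hτ, hε]; field_simp; norm_num
  have hτ1 : τ * 1000 ≤ ε := by
    have h1 : τ * (1000 * K ^ 3) ≤ K ^ 3 * ε := by rw [hτε]; gcongr
    have : 0 < K ^ 3 := by positivity
    nlinarith
  set R : E × (E →L[ℝ] E) × (E →L[ℝ] E) × E →L[ℝ] ℝ := -(G (z a).1 e).comp (devProj E) with hR
  set Y : E × (E →L[ℝ] E) × (E →L[ℝ] E) × E →L[ℝ] E := R.smulRight m - devProj E with hY
  set πΦ : E × (E →L[ℝ] E) × (E →L[ℝ] E) × E →L[ℝ] (E →L[ℝ] E) :=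
    (ContinuousLinearMap.fst ℝ (E →L[ℝ] E) ((E →L[ℝ] E) × E)).comp
      (ContinuousLinearMap.snd ℝ E ((E →L[ℝ] E) × (E →L[ℝ] E) × E)) with hπΦ
  -- The variation field is the transport of R m - C, the difference between the straight segment
  -- with the mean direction and the development C; it vanishes at both ends. The last term moves
  -- the initial point by w and fades out linearly in the length.
  set F : E × (E →L[ℝ] E) × (E →L[ℝ] E) × E → E := fun x ↦
    devBase E x + ε • (πΦ x) (Y x) + (1 - L⁻¹ * R x) • w with hF
  set F' : E × (E →L[ℝ] E) × (E →L[ℝ] E) × E → (E × (E →L[ℝ] E) × (E →L[ℝ] E) × E →L[ℝ] E) :=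
    fun x ↦ devBase E + ε • ((πΦ x).comp Y + πΦ.flip (Y x)) + (-(L⁻¹ • R)).smulRight w with hF'
  have hFd : ∀ x, HasFDerivAt F (F' x) x := fun x ↦ by
    refine ((devBase E).hasFDerivAt.add ((πΦ.hasFDerivAt.clm_apply Y.hasFDerivAt).const_smul ε)).add
      ?_
    exact ((R.hasFDerivAt.const_mul L⁻¹).const_sub 1).smul_const w
  have hFC : ContDiff ℝ 1 F :=
    ((devBase E).contDiff.add ((πΦ.contDiff.clm_apply Y.contDiff).const_smul ε)).add
      ((contDiff_const.sub (contDiff_const.mul R.contDiff)).smul contDiff_const)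
  have hRt : ∀ t, R (z t) = -G (z a).1 e (z t).2.2.2 := fun t ↦ rfl
  have hoff : ∀ t ∈ Icc a b, ‖(z t).2.1 (Y (z t))‖ ≤ 4 * K * L ∧
      ‖(1 - L⁻¹ * R (z t)) • w‖ ≤ τ * L ∧
      F (z t) = (z t).1 + (ε • (z t).2.1 (Y (z t)) + (1 - L⁻¹ * R (z t)) • w) ∧
      F (z t) ∈ Metric.ball y₀ ρ := by
    intro t ht
    have h0 := h.dev_len_nonneg hz ht
    have h1 : -G (z a).1 e (z t).2.2.2 ≤ L := hL ▸ h.dev_len_le hz ht.1 ht.2 le_rfl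
    have h2 := h.dev_norm_le hz ht
    rw [← hRt] at h0 h1 h2
    have h3 : ‖Y (z t)‖ ≤ 2 * K * L := by
      show ‖R (z t) • m - (z t).2.2.2‖ ≤ _
      refine (norm_sub_le _ _).trans ?_
      rw [norm_smul, Real.norm_eq_abs, abs_of_nonneg h0]
      calc _ ≤ L * K + K * L := by gcongr; exact h2.trans (by gcongr)
        _ = _ := by ring
    have h4 : ‖(z t).2.1 (Y (z t))‖ ≤ 4 * K * L := by
      have := h.dev_transport_norm hz ht (Y (z t))
      linarith
    have h5 : ‖(1 - L⁻¹ * R (z t)) • w‖ ≤ τ * L := by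
      have h6 : L⁻¹ * R (z t) ≤ 1 := by rw [inv_mul_le_iff₀ hL0]; linarith
      have h7 : 0 ≤ L⁻¹ * R (z t) := by positivity
      rw [norm_smul, Real.norm_eq_abs, abs_of_nonneg (by linarith)]
      calc _ ≤ 1 * ‖w‖ := by gcongr; linarith
        _ ≤ _ := by linarith
    have h6 : F (z t) = (z t).1 + (ε • (z t).2.1 (Y (z t)) + (1 - L⁻¹ * R (z t)) • w) := by
      rw [← add_assoc]; rfl
    refine ⟨h4, h5, h6, ?_⟩
    have h7 : ‖ε • (z t).2.1 (Y (z t)) + (1 - L⁻¹ * R (z t)) • w‖ ≤ ρ / 2 := by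
      refine (norm_add_le _ _).trans ?_
      rw [norm_smul, Real.norm_eq_abs, abs_of_pos hε0]
      have h8 : ε * ‖(z t).2.1 (Y (z t))‖ ≤ ε * (4 * K * (2 * K ^ 2 * ρ)) := by
        gcongr
        exact h4.trans (by gcongr)
      have h9 : ε * (4 * K * (2 * K ^ 2 * ρ)) ≤ ρ / 100 := by
        have : K ^ 3 ≤ K ^ 6 := pow_le_pow_right₀ hK (by norm_num)
        calc ε * (4 * K * (2 * K ^ 2 * ρ)) = 8 * (ε * K ^ 3) * ρ := by ring
          _ ≤ 8 * (ε * K ^ 6) * ρ := by gcongr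
          _ ≤ 8 * (1 / 1000) * ρ := by gcongr; linarith
          _ ≤ _ := by linarith
      have h10 : τ * L ≤ ρ / 100 := by
        have : K ^ 2 ≤ K ^ 6 := pow_le_pow_right₀ hK (by norm_num)
        calc τ * L ≤ ε * (2 * K ^ 2 * ρ) := by gcongr; linarith
          _ = 2 * (ε * K ^ 2) * ρ := by ring
          _ ≤ 2 * (ε * K ^ 6) * ρ := by gcongr
          _ ≤ 2 * (1 / 1000) * ρ := by gcongr; linarith
          _ ≤ _ := by linarith
      linarith
    have h8 := hz.mem t ht
    rw [h6, Metric.mem_ball, dist_eq_norm, add_sub_right_comm]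
    rw [Metric.mem_ball, dist_eq_norm] at h8
    linarith [norm_add_le ((z t).1 - y₀) (ε • (z t).2.1 (Y (z t)) + (1 - L⁻¹ * R (z t)) • w)]
  refine ⟨F ∘ z, hz.curve.comp F' hFC hFd fun t ht v hv ↦ ?_, fun t ht ↦ (hoff t ht).2.2.2, ?_, ?_⟩
  · obtain ⟨b1, b2, b3, b4⟩ := hoff t ht
    have hx := h.dev_mem hz ht
    obtain ⟨r0, v1, v2, v3, v4, v5, v6⟩ := h.dev_velocity hz ht hv
    set r := -G (z a).1 e v.2.2.2 with hr
    set f := r • m - v.2.2.2 with hf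
    obtain ⟨f1, -, f3⟩ := h.dev_defect hz hme (v := v) hr hf
    set X := (z t).2.1 (Y (z t)) with hX
    have hF'v : F' (z t) v = v.1 + (ε • ((z t).2.1 f - Γ (z t).1 v.1 X) - (L⁻¹ * r) • w) := by
      show v.1 + ε • ((z t).2.1 f + v.2.1 (Y (z t))) + (-(L⁻¹ * r)) • w = _
      rw [hv.2.1]
      simp only [neg_apply, ContinuousLinearMap.comp_apply]
      module
    have hfK : ‖(z t).2.1 f‖ ≤ 4 * K * r := by
      have h1 := h.dev_transport_norm hz ht f
      have h2 : ‖f‖ ≤ r * K + K * r := by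
        rw [hf]
        refine (norm_sub_le _ _).trans ?_
        rw [norm_smul, Real.norm_eq_abs, abs_of_pos r0]
        gcongr
      linarith
    have hκ : ‖(L⁻¹ * r) • w‖ ≤ r * τ := by
      rw [norm_smul, Real.norm_eq_abs, abs_of_pos (by positivity)]
      calc L⁻¹ * r * ‖w‖ ≤ L⁻¹ * r * (L * τ) := by gcongr
        _ = _ := by field_simp
    have hLK : 64 * K ^ 5 * L ≤ 1 := by
      have := h.pow_mul_le 7 (by norm_num)
      calc 64 * K ^ 5 * L ≤ 64 * K ^ 5 * (2 * K ^ 2 * ρ) := by gcongr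
        _ = 128 * (K ^ 7 * ρ) := by ring
        _ ≤ 1 := by linarith
    -- Transport is isometric, so this is a computation in the initial tangent space: positivity of
    -- g(f, f) gives the upper bound (1 - ε) g(C', C') - ε r² μ, and C' is causal.
    have hmain : G (z t).1 v.1 v.1 + 2 * ε * G (z t).1 v.1 ((z t).2.1 f) ≤ -ε * r ^ 2 * μ := by
      obtain ⟨-, -, -, hiso⟩ := h.dev_transport hz ht
      rw [← v5, hiso, hiso]
      rw [f3] at f1
      have h1 : G (z a).1 v.2.2.2 f = r * G (z a).1 m v.2.2.2 - G (z a).1 v.2.2.2 v.2.2.2 := by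
        rw [hf, map_sub, map_smul, smul_eq_mul, h.symm _ ha v.2.2.2 m]
      have h2 : G (z a).1 m m = -μ := by rw [hμ, neg_neg]
      rw [h1]
      rw [h2] at f1
      have hε1 : ε ≤ 1 := by
        have : 1 ≤ 1000 * K ^ 6 := by
          have := one_le_pow₀ hK (n := 6)
          linarith
        nlinarith
      nlinarith [mul_nonneg hε0.le f1, mul_nonneg (sub_nonneg.mpr hε1) (neg_nonneg.mpr v6)]
    obtain ⟨-, c2, c3⟩ := h.variation_estimate (hh := ε • X + (1 - L⁻¹ * R (z t)) • w) hx
      (by rw [← b3]; exact b4) rfl hε0.le hτ0 r0.le hL0.le hLK v1 b1 hfK hκ b2 hmain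
    rw [hF'v]
    refine ⟨?_, ?_⟩
    · rw [b3]
      refine c3.trans_lt (mul_neg_of_pos_of_neg (by positivity) ?_)
      have h1 : 5 * K ^ 2 * τ ≤ 5 / 1000 * (μ * ε) := by
        have : K ^ 2 ≤ K ^ 3 := pow_le_pow_right₀ hK (by norm_num)
        calc 5 * K ^ 2 * τ ≤ 5 * K ^ 3 * τ := by gcongr
          _ = 5 / 1000 * (τ * (1000 * K ^ 3)) := by ring
          _ = _ := by rw [hτε]
      have h2 : 38 * K ^ 3 * (ε + τ) ^ 2 ≤ 152 / 1000 * (μ * ε) := by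
        have h3 : (ε + τ) ^ 2 ≤ (2 * ε) ^ 2 := by gcongr; linarith
        have h4 : K ^ 3 * ε ≤ μ / 1000 := by
          rw [hε, mul_div_assoc', div_le_div_iff₀ (by positivity) (by positivity)]
          have : K ^ 3 ≤ K ^ 9 := pow_le_pow_right₀ hK (by norm_num)
          nlinarith
        calc 38 * K ^ 3 * (ε + τ) ^ 2 ≤ 38 * K ^ 3 * (2 * ε) ^ 2 := by gcongr
          _ = 152 * (K ^ 3 * ε) * ε := by ring
          _ ≤ 152 * (μ / 1000) * ε := by gcongr
          _ = _ := by ring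
      have := mul_pos hμ0 hε0
      linarith
    · rw [map_add]
      have h1 := (abs_le.mp (bilin_le (h.bound y₀ h.center_mem) e
        (ε • ((z t).2.1 f - Γ (z t).1 v.1 X) - (L⁻¹ * r) • w))).2
      have h2 : K * ‖e‖ * ‖ε • ((z t).2.1 f - Γ (z t).1 v.1 X) - (L⁻¹ * r) • w‖ ≤ r / 10 := by
        have : K ^ 3 ≤ K ^ 6 := pow_le_pow_right₀ hK (by norm_num)
        calc _ ≤ K * K * (6 * K * r * (2 * ε)) := by
              gcongr
              · exact h.e_bound
              · exact c2.trans (by gcongr; linarith)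
          _ = 12 * (ε * K ^ 3) * r := by ring
          _ ≤ 12 * (ε * K ^ 6) * r := by gcongr
          _ ≤ 12 * (1 / 1000) * r := by gcongr; linarith
          _ ≤ _ := by linarith
      linarith
  · have h1 : Y (z a) = 0 := by
      show R (z a) • m - (z a).2.2.2 = 0
      rw [hRt, dev_len_start hz, dev_zero hz, zero_smul, sub_zero]
    show (z a).1 + ε • (z a).2.1 (Y (z a)) + (1 - L⁻¹ * R (z a)) • w = _
    rw [h1, hRt, dev_len_start hz]
    simp
  · have h1 : Y (z b) = 0 := by
      show R (z b) • m - (z b).2.2.2 = 0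
      rw [hRt, ← hL, hLm, sub_self]
    show (z b).1 + ε • (z b).2.1 (Y (z b)) + (1 - L⁻¹ * R (z b)) • w = _
    rw [h1, hRt, ← hL, inv_mul_cancel₀ hL0.ne']
    simp

end Dev

end GoodBox

end LorentzSpacetime

end

/-! ### Small defect: nearly straight developments and closeness to geodesics. -/

set_option maxSynthPendingDepth 3

noncomputable section

namespace LorentzSpacetime

variable {E : Type*} [NormedAddCommGroup E] [NormedSpace ℝ E]

namespace GoodBox

variable {G : E → E →L[ℝ] E →L[ℝ] ℝ} {Γ : E → E →L[ℝ] E →L[ℝ] E} {y₀ e : E} {ρ K : ℝ}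
  (h : GoodBox G Γ y₀ e ρ K)
include h

section Dev

variable {z : ℝ → E × (E →L[ℝ] E) × (E →L[ℝ] E) × E} {a b : ℝ}
  (hz : IsDevelopment G Γ y₀ e ρ z a b)
include hz

/-- The deviation of the velocity of a development from its mean direction is dominated by a
linear functional whose total increment is controlled by the timelike defect of that direction. -/
theorem exists_defect_control {L θ : ℝ} {m : E} (hL : L = -G (z a).1 e (z b).2.2.2)
    (hm : m = L⁻¹ • (z b).2.2.2) (hθ : 0 < θ) (hμ : K * -G (z a).1 m m ≤ θ ^ 2) :
    ∃ D : E × (E →L[ℝ] E) × (E →L[ℝ] E) × E →L[ℝ] ℝ,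
      (∀ t ∈ Icc a b, ∀ v, Develops G Γ y₀ e (z t) v →
        ‖(-G (z a).1 e v.2.2.2) • m - v.2.2.2‖ ≤ D v) ∧ D (z a) = 0 ∧ D (z b) ≤ θ * L := by
  have hK := h.one_le
  have hK0 := h.K_pos
  obtain ⟨hL0, hLm, hme, hmK⟩ := h.dev_mean hz hL hm
  set μ := -G (z a).1 m m with hμdef
  set R : E × (E →L[ℝ] E) × (E →L[ℝ] E) × E →L[ℝ] ℝ := -(G (z a).1 e).comp (devProj E) with hRdef
  -- The deviation f satisfies ‖f‖² ≤ K r q with q linear in the velocity, so ‖f‖ is at most (θ/2) r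
  -- + (K/2θ) q by the arithmetic-geometric inequality. Over the whole curve r contributes L and q
  -- contributes μL.
  set D : E × (E →L[ℝ] E) × (E →L[ℝ] E) × E →L[ℝ] ℝ :=
    (θ / 2) • R + (K / (2 * θ)) • (-(μ • R) - (2 : ℝ) • (G (z a).1 m).comp (devProj E)) with hD
  have hRz : ∀ t, R (z t) = -G (z a).1 e (z t).2.2.2 := fun t ↦ rfl
  -- the defect is dominated by a linear functional of the velocity
  have hfD : ∀ t ∈ Icc a b, ∀ v, Develops G Γ y₀ e (z t) v →
      ‖R v • m - v.2.2.2‖ ≤ D v := by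
    intro t ht v hv
    obtain ⟨r0, -, -, -, -, -, v6⟩ := h.dev_velocity hz ht hv
    obtain ⟨f1, f2, f3⟩ := h.dev_defect hz hme (v := v) (r := R v) rfl rfl
    have r0 : 0 < R v := r0
    set f := R v • m - v.2.2.2 with hf
    set q := -(μ * R v) - 2 * G (z a).1 m v.2.2.2 with hq
    have hfq : G (z a).1 f f ≤ R v * q := by
      rw [f3, show G (z a).1 m m = -μ by rw [hμdef, neg_neg]]
      nlinarith
    have hq0 : 0 ≤ q := by
      by_contra! hneg
      nlinarith [mul_neg_of_pos_of_neg r0 hneg]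
    have hDv : D v = θ / 2 * R v + K / (2 * θ) * q := rfl
    rw [hDv]
    refine abs_le_of_sq_le_sq' (a := ‖f‖) ?_ (by positivity) |>.2
    calc ‖f‖ ^ 2 ≤ K * (R v * q) := f2.trans (by gcongr)
      _ = 4 * (θ / 2 * R v) * (K / (2 * θ) * q) := by field_simp; ring
      _ ≤ _ := by nlinarith [sq_nonneg (θ / 2 * R v - K / (2 * θ) * q)]
  have hDa : D (z a) = 0 := by
    show θ / 2 * R (z a) + K / (2 * θ) * (-(μ * R (z a)) - 2 * G (z a).1 m (z a).2.2.2) = 0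
    rw [hRz, dev_len_start hz, dev_zero hz]; simp
  have hDb : D (z b) ≤ θ * L := by
    show θ / 2 * R (z b) + K / (2 * θ) * (-(μ * R (z b)) - 2 * G (z a).1 m (z b).2.2.2) ≤ θ * L
    rw [hRz, ← hL, ← hLm, map_smul, smul_eq_mul, show G (z a).1 m m = -μ by rw [hμdef, neg_neg]]
    have h1 : K / (2 * θ) * (-(μ * L) - 2 * (L * -μ)) = (K * μ) / (2 * θ) * L := by ring
    have h2 : (K * μ) / (2 * θ) ≤ θ / 2 := by
      rw [div_le_iff₀ (by positivity)]; nlinarith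
    rw [h1]
    nlinarith [mul_le_mul_of_nonneg_right h2 hL0.le]
  exact ⟨D, hfD, hDa, hDb⟩

/-- A development whose mean direction is null is straight. -/
theorem dev_straight {L : ℝ} {m : E} (hL : L = -G (z a).1 e (z b).2.2.2)
    (hm : m = L⁻¹ • (z b).2.2.2) (hμ : G (z a).1 m m = 0) {t : ℝ} (ht : t ∈ Icc a b) :
    (z t).2.2.2 = (-G (z a).1 e (z t).2.2.2) • m := by
  have hb : b ∈ Icc a b := ⟨hz.lt.le, le_rfl⟩
  obtain ⟨hL0, -⟩ := h.dev_mean hz hL hm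
  set A : E × (E →L[ℝ] E) × (E →L[ℝ] E) × E →L[ℝ] E :=
    (-(G (z a).1 e).comp (devProj E)).smulRight m - devProj E with hA
  have hAz : ∀ v, A v = (-G (z a).1 e v.2.2.2) • m - v.2.2.2 := fun v ↦ rfl
  have key : ∀ θ > 0, ‖A (z t)‖ ≤ θ * L := by
    intro θ hθ
    obtain ⟨D, hD, hDa, hDb⟩ := h.exists_defect_control hz hL hm hθ (by rw [hμ]; simp; positivity)
    have h1 := hz.curve.norm_apply_sub_le hz.lt A D (fun s hs v hv ↦ hD s hs v hv) le_rfl ht.1 ht.2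
    have h2 := hz.curve.norm_apply_sub_le hz.lt A D (fun s hs v hv ↦ hD s hs v hv) ht.1 ht.2 le_rfl
    have h3 : A (z a) = 0 := by rw [hAz, dev_len_start hz, dev_zero hz]; simp
    rw [h3, sub_zero, hDa] at h1
    linarith [norm_nonneg (A (z b) - A (z t))]
  have h0 : A (z t) = 0 := by
    rw [← norm_le_zero_iff]
    refine le_of_forall_pos_le_add fun ε hε ↦ ?_
    have := key (ε / L) (by positivity)
    rwa [div_mul_cancel₀ _ hL0.ne', ← zero_add ε] at this
  rw [hAz, sub_eq_zero] at h0
  exact h0.symm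

set_option maxHeartbeats 1000000 in
/-- A causal curve whose development is nearly straight stays close to a geodesic. -/
theorem dist_geodesic_le {L θ N S : ℝ} {m : E} {σ w : ℝ → E} (hL : L = -G (z a).1 e (z b).2.2.2)
    (hm : m = L⁻¹ • (z b).2.2.2) (hσ : ∀ s ∈ Icc 0 S, HasDerivWithinAt σ (w s) (Icc 0 S) s)
    (hw : ∀ s ∈ Icc 0 S, HasDerivWithinAt w (-Γ (σ s) (w s) (w s)) (Icc 0 S) s)
    (hball : ∀ s ∈ Icc 0 S, σ s ∈ Metric.ball y₀ ρ) (hwK : ∀ s ∈ Icc 0 S, ‖w s‖ ≤ 4 * K)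
    (hθ : 0 < θ) (hμ : K * -G (z a).1 m m ≤ θ ^ 2) (hN : 0 < N) (hN1 : ‖(z a).1 - σ 0‖ ≤ N)
    (hN2 : ‖m - w 0‖ ≤ N) {t₁ : ℝ} (ht₁ : t₁ ∈ Icc a b) (hR : -G (z a).1 e (z t₁).2.2.2 ≤ S) :
    ‖(z t₁).1 - σ (-G (z a).1 e (z t₁).2.2.2)‖ ≤ 2 * (N + 4 * K ^ 2 * θ * L) := by
  have hK := h.one_le
  have hK0 := h.K_pos
  have hρ := h.pos
  have ha := h.dev_start_mem hz
  have hb : b ∈ Icc a b := ⟨hz.lt.le, le_rfl⟩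
  obtain ⟨hL0, hLm, hme, hmK⟩ := h.dev_mean hz hL hm
  have hLu : L ≤ 2 * K ^ 2 * ρ := hL ▸ h.dev_len_upper hz hb
  set R : E × (E →L[ℝ] E) × (E →L[ℝ] E) × E →L[ℝ] ℝ := -(G (z a).1 e).comp (devProj E) with hRdef
  have hRz : ∀ t, R (z t) = -G (z a).1 e (z t).2.2.2 := fun t ↦ rfl
  obtain ⟨D, hfD, hDa, hDb⟩ := h.exists_defect_control hz hL hm hθ hμ
  have hfD : ∀ t ∈ Icc a b, ∀ v, Develops G Γ y₀ e (z t) v → ‖R v • m - v.2.2.2‖ ≤ D v := hfD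
  have hDmono : ∀ s t, a ≤ s → s ≤ t → t ≤ b → D (z s) ≤ D (z t) := fun s t hs hst ht ↦ by
    have := hz.curve.apply_le_apply hz.lt 0 D (fun t ht v hv ↦ by
      rw [zero_apply]; exact (norm_nonneg _).trans (hfD t ht v hv)) hs hst ht
    simpa using this
  have hcont := hz.curve.continuousOn hz.lt
  have hsub : Icc a t₁ ⊆ Icc a b := Icc_subset_Icc le_rfl ht₁.2
  have hmaps : MapsTo (fun t ↦ R (z t)) (Icc a t₁) (Icc 0 S) := fun t ht ↦
    ⟨h.dev_len_nonneg hz (hsub ht), (h.dev_len_le hz ht.1 ht.2 ht₁.2).trans hR⟩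
  have hRcont : ContinuousOn (fun t ↦ R (z t)) (Icc a t₁) :=
    R.continuous.comp_continuousOn (hcont.mono hsub)
  have hRL : ∀ t ∈ Icc a t₁, R (z t) ≤ L := fun t ht ↦
    hL ▸ h.dev_len_le hz ht.1 (hsub ht).2 le_rfl
  choose! v hv hv' using fun x (hx : x ∈ Ico a b) ↦ hz.curve.exists_hasDerivWithinAt hx
  have hsub' : Ico a t₁ ⊆ Ico a b := Ico_subset_Ico le_rfl ht₁.2
  set N' := N + 4 * K ^ 2 * θ * L with hN'
  have hN'0 : 0 < N' := by positivity
  -- The curve and the transported mean direction are compared with the geodesic and its velocity at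
  -- the same length parameter. The transported deviation enters the derivative as a forcing term
  -- controlled by D.
  set U : ℝ → E × E := fun t ↦ ((z t).1 - σ (R (z t)), (z t).2.1 m - w (R (z t))) with hU
  set U' : ℝ → E × E := fun t ↦ ((v t).1 - R (v t) • w (R (z t)),
    (v t).2.1 m - R (v t) • -Γ (σ (R (z t))) (w (R (z t))) (w (R (z t)))) with hU'
  have hL30 : 30 * K ^ 3 * L ≤ 1 := by
    have := h.pow_mul_le 5 (by norm_num)
    calc 30 * K ^ 3 * L ≤ 30 * K ^ 3 * (2 * K ^ 2 * ρ) := by gcongr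
      _ = 60 * (K ^ 5 * ρ) := by ring
      _ ≤ 1 := by linarith
  have hB2 : ∀ t ∈ Icc a t₁, N + 4 * K ^ 2 * D (z t) + 30 * K ^ 3 * N' * R (z t) ≤ 2 * N' := by
    intro t ht
    have h1 : D (z t) ≤ θ * L := (hDmono t b ht.1 (hsub ht).2 le_rfl).trans hDb
    have h2 := hRL t ht
    have h3 : 30 * K ^ 3 * N' * R (z t) ≤ N' := by
      calc _ ≤ 30 * K ^ 3 * N' * L := by gcongr
        _ = (30 * K ^ 3 * L) * N' := by ring
        _ ≤ 1 * N' := by gcongr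
        _ = N' := one_mul _
    have h4 : 4 * K ^ 2 * D (z t) ≤ 4 * K ^ 2 * (θ * L) := by gcongr
    rw [hN'] at h3 ⊢
    linarith
  -- The barrier adds the initial error N, the forcing 4K²D and a growth term in R. It never exceeds
  -- 2N', so the Lipschitz terms contribute at most 20K³N' per unit of R, strictly less than the
  -- slope 30K³N'.
  have key := image_norm_le_of_norm_deriv_right_lt_deriv_boundary' (a := a) (b := t₁) (f := U)
    (f' := U') (B := fun t ↦ N + 4 * K ^ 2 * D (z t) + 30 * K ^ 3 * N' * R (z t))
    (B' := fun t ↦ 4 * K ^ 2 * D (v t) + 30 * K ^ 3 * N' * R (v t)) ?_ ?_ ?_ ?_ ?_ ?_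
    (x := t₁) ⟨ht₁.1, le_rfl⟩
  · exact (norm_fst_le (U t₁)).trans (key.trans (hB2 t₁ ⟨ht₁.1, le_rfl⟩))
  · have c1 : ContinuousOn (fun t ↦ σ (R (z t))) (Icc a t₁) :=
      ContinuousOn.comp (g := σ) (t := Icc 0 S) (fun s hs ↦ (hσ s hs).continuousWithinAt) hRcont hmaps
    have c2 : ContinuousOn (fun t ↦ w (R (z t))) (Icc a t₁) :=
      ContinuousOn.comp (g := w) (t := Icc 0 S) (fun s hs ↦ (hw s hs).continuousWithinAt) hRcont hmaps
    have c3 : ContinuousOn (fun t ↦ (z t).2.1) (Icc a t₁) :=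
      (continuous_fst.comp continuous_snd).comp_continuousOn (hcont.mono hsub)
    exact ((continuous_fst.comp_continuousOn (hcont.mono hsub)).sub c1).prodMk
      ((c3.clm_apply continuousOn_const).sub c2)
  · intro t ht
    have hmem : Icc t t₁ ∈ 𝓝[Ici t] t := Icc_mem_nhdsGE ht.2
    refine HasDerivWithinAt.mono_of_mem_nhdsWithin (t := Icc t t₁) ?_ hmem
    have hvt : HasDerivWithinAt z (v t) (Icc t t₁) t := (hv t (hsub' ht)).mono Icc_subset_Ici_self
    have hm' : MapsTo (fun t ↦ R (z t)) (Icc t t₁) (Icc 0 S) :=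
      hmaps.mono_left (Icc_subset_Icc ht.1 le_rfl)
    have d0 : HasDerivWithinAt (fun t ↦ R (z t)) (R (v t)) (Icc t t₁) t :=
      R.hasFDerivAt.comp_hasDerivWithinAt t hvt
    have ht' : R (z t) ∈ Icc 0 S := hmaps (Ico_subset_Icc_self ht)
    have d1 : HasDerivWithinAt (fun t ↦ σ (R (z t))) (R (v t) • w (R (z t))) (Icc t t₁) t :=
      HasDerivWithinAt.scomp t (hσ _ ht') d0 hm'
    have d2 : HasDerivWithinAt (fun t ↦ w (R (z t)))
        (R (v t) • -Γ (σ (R (z t))) (w (R (z t))) (w (R (z t)))) (Icc t t₁) t :=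
      HasDerivWithinAt.scomp t (hw _ ht') d0 hm'
    have d3 : HasDerivWithinAt (fun t ↦ (z t).2.1 m) ((v t).2.1 m) (Icc t t₁) t :=
      ((ContinuousLinearMap.apply ℝ E m).comp ((ContinuousLinearMap.fst ℝ (E →L[ℝ] E)
        ((E →L[ℝ] E) × E)).comp (ContinuousLinearMap.snd ℝ E _))).hasFDerivAt.comp_hasDerivWithinAt
        t hvt
    have d4 : HasDerivWithinAt (fun t ↦ (z t).1) (v t).1 (Icc t t₁) t :=
      (ContinuousLinearMap.fst ℝ E ((E →L[ℝ] E) × (E →L[ℝ] E) × E)).hasFDerivAt.comp_hasDerivWithinAt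
        t hvt
    exact HasDerivWithinAt.prodMk (d4.sub d1) (d3.sub d2)
  · have h0 : R (z a) = 0 := dev_len_start hz
    simp only [hU, h0, hDa, mul_zero, add_zero]
    have h1 : (z a).2.1 m = m := by rw [hz.start]; rfl
    rw [h1]
    exact max_le hN1 hN2
  · exact (continuousOn_const.add (continuousOn_const.mul
      (D.continuous.comp_continuousOn (hcont.mono hsub)))).add (continuousOn_const.mul hRcont)
  · intro t ht
    have hvt := hv t (hsub' ht)
    exact ((((D.hasFDerivAt.comp_hasDerivWithinAt t hvt).const_mul _).const_add N).add
      ((R.hasFDerivAt.comp_hasDerivWithinAt t hvt).const_mul _))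
  · intro t ht heq
    have htb : t ∈ Icc a b := Ico_subset_Icc_self (hsub' ht)
    have hvt := hv' t (hsub' ht)
    obtain ⟨r0, -, -, -, -, v5, -⟩ := h.dev_velocity hz htb hvt
    have r0 : 0 < R (v t) := r0
    have hf := hfD t htb (v t) hvt
    set f := R (v t) • m - (v t).2.2.2 with hfdef
    have hUn : ‖U t‖ ≤ 2 * N' := heq.le.trans (hB2 t (Ico_subset_Icc_self ht))
    have ht' : R (z t) ∈ Icc 0 S := hmaps (Ico_subset_Icc_self ht)
    set x := (z t).1 with hx
    set y := σ (R (z t)) with hy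
    set ω' := w (R (z t)) with hω'
    set u := (z t).2.1 m with hu
    set p := (z t).2.1 f with hp
    have hxb : x ∈ Metric.ball y₀ ρ := h.dev_mem hz htb
    have hyb : y ∈ Metric.ball y₀ ρ := hball _ ht'
    have n1 : ‖x - y‖ ≤ ‖U t‖ := norm_fst_le (U t)
    have n2 : ‖u - ω'‖ ≤ ‖U t‖ := norm_snd_le (U t)
    have n3 : ‖u‖ ≤ 2 * K := by
      have := h.dev_transport_norm hz htb m
      linarith
    have n4 : ‖p‖ ≤ 2 * D (v t) := by
      have := h.dev_transport_norm hz htb f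
      linarith
    have n5 : ‖ω'‖ ≤ 4 * K := hwK _ ht'
    have hD0 : 0 ≤ D (v t) := (norm_nonneg _).trans hf
    have hv1 : (v t).1 = R (v t) • u - p := by
      rw [← v5, hp, hfdef, map_sub, map_smul]; abel
    have e1 : (U' t).1 = R (v t) • (u - ω') - p := by
      show (v t).1 - R (v t) • ω' = _
      rw [hv1]; module
    have e2 : (U' t).2 = Γ x p u - R (v t) • ((Γ x - Γ y) u u + Γ y (u - ω') u + Γ y ω' (u - ω')) := by
      show (v t).2.1 m - R (v t) • -Γ y ω' ω' = _
      rw [hvt.2.1]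
      show -(Γ x (v t).1 u) - R (v t) • -Γ y ω' ω' = _
      rw [hv1]
      simp only [map_sub, map_smul, sub_apply, smul_apply]
      module
    have hK1 : 1 ≤ K ^ 2 := one_le_pow₀ hK
    have hΓ2 : ∀ (B : E →L[ℝ] E →L[ℝ] E) {k : ℝ}, ‖B‖ ≤ k → ∀ p q : E, ‖B p q‖ ≤ k * ‖p‖ * ‖q‖ :=
      fun B k hB p q ↦ (B.le_opNorm₂ p q).trans (by gcongr)
    have b1 : ‖(U' t).1‖ ≤ R (v t) * ‖U t‖ + 2 * D (v t) := by
      rw [e1]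
      refine (norm_sub_le _ _).trans ?_
      rw [norm_smul, Real.norm_eq_abs, abs_of_pos r0]
      gcongr
    have b2 : ‖(U' t).2‖ ≤ R (v t) * (10 * K ^ 3 * ‖U t‖) + 4 * K ^ 2 * D (v t) := by
      rw [e2]
      refine (norm_sub_le _ _).trans ?_
      rw [norm_smul, Real.norm_eq_abs, abs_of_pos r0, add_comm]
      have k1 : ‖Γ x p u‖ ≤ 4 * K ^ 2 * D (v t) := by
        calc ‖Γ x p u‖ ≤ K * ‖p‖ * ‖u‖ := hΓ2 _ (h.chr_bound _ hxb) _ _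
          _ ≤ K * (2 * D (v t)) * (2 * K) := by gcongr
          _ = _ := by ring
      have k2 : ‖(Γ x - Γ y) u u‖ ≤ 4 * K ^ 3 * ‖U t‖ := by
        calc ‖(Γ x - Γ y) u u‖ ≤ (K * ‖U t‖) * ‖u‖ * ‖u‖ :=
              hΓ2 _ ((h.chr_lip _ hxb _ hyb).trans (by gcongr)) _ _
          _ ≤ (K * ‖U t‖) * (2 * K) * (2 * K) := by gcongr
          _ = _ := by ring
      have k3 : ‖Γ y (u - ω') u‖ ≤ 2 * K ^ 3 * ‖U t‖ := by
        calc ‖Γ y (u - ω') u‖ ≤ K * ‖u - ω'‖ * ‖u‖ := hΓ2 _ (h.chr_bound _ hyb) _ _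
          _ ≤ K * ‖U t‖ * (2 * K) := by gcongr
          _ = 2 * (K ^ 2 * ‖U t‖) := by ring
          _ ≤ 2 * (K ^ 3 * ‖U t‖) := by gcongr; norm_num
          _ = _ := by ring
      have k4 : ‖Γ y ω' (u - ω')‖ ≤ 4 * K ^ 3 * ‖U t‖ := by
        calc ‖Γ y ω' (u - ω')‖ ≤ K * ‖ω'‖ * ‖u - ω'‖ := hΓ2 _ (h.chr_bound _ hyb) _ _
          _ ≤ K * (4 * K) * ‖U t‖ := by gcongr
          _ = 4 * (K ^ 2 * ‖U t‖) := by ring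
          _ ≤ 4 * (K ^ 3 * ‖U t‖) := by gcongr; norm_num
          _ = _ := by ring
      gcongr
      calc _ ≤ ‖(Γ x - Γ y) u u‖ + ‖Γ y (u - ω') u‖ + ‖Γ y ω' (u - ω')‖ := norm_add₃_le
        _ ≤ _ := by linarith
    have b3 : ‖U' t‖ ≤ R (v t) * (10 * K ^ 3 * ‖U t‖) + 4 * K ^ 2 * D (v t) := by
      refine max_le (b1.trans ?_) b2
      have : 1 ≤ K ^ 3 := one_le_pow₀ hK
      have h1 : ‖U t‖ ≤ 10 * K ^ 3 * ‖U t‖ := by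
        have := norm_nonneg (U t)
        nlinarith
      have h2 : 2 * D (v t) ≤ 4 * K ^ 2 * D (v t) := by nlinarith
      have h3 := mul_le_mul_of_nonneg_left h1 r0.le
      linarith
    have hK3 : 0 < K ^ 3 := by positivity
    calc ‖U' t‖ ≤ R (v t) * (10 * K ^ 3 * (2 * N')) + 4 * K ^ 2 * D (v t) := by
          refine b3.trans ?_; gcongr
      _ < _ := by nlinarith [mul_pos (mul_pos r0 hK3) hN'0]

end Dev

end GoodBox

end LorentzSpacetime

end

set_option maxSynthPendingDepth 3

noncomputable section

namespace LorentzSpacetime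

/-! ### Parallel transport in a fixed chart. -/

section Transformation

variable {E : Type*} [NormedAddCommGroup E] [NormedSpace ℝ E]

/-- Derivative of the pullback of a bilinear form. -/
theorem hasFDerivAt_pullback_form {B : E → E →L[ℝ] E →L[ℝ] ℝ} {φ : E → E} {D : E → E →L[ℝ] E}
    {D₂ : E →L[ℝ] E →L[ℝ] E} {y : E} (hφ : HasFDerivAt φ (D y) y) (hD : HasFDerivAt D D₂ y)
    (hB : DifferentiableAt ℝ B (φ y)) (v w u : E) :
    fderiv ℝ (fun y' ↦ B (φ y') (D y' v) (D y' w)) y u =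
      fderiv ℝ B (φ y) (D y u) (D y v) (D y w) + B (φ y) (D₂ u v) (D y w) +
        B (φ y) (D y v) (D₂ u w) := by
  have h1 : HasFDerivAt (fun y' ↦ B (φ y')) ((fderiv ℝ B (φ y)).comp (D y)) y :=
    hB.hasFDerivAt.comp y hφ
  have h2 : ∀ v, HasFDerivAt (fun y' ↦ D y' v) (D₂.flip v) y := fun v ↦ by
    have := hD.clm_apply (hasFDerivAt_const v y)
    convert! this using 1
    ext; simp
  have h3 := (h1.clm_apply (h2 v)).clm_apply (h2 w)
  rw [h3.fderiv]
  simp [add_apply]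
  ring

end Transformation

section Parallel

variable {d : ℕ} {M : Type*} [TopologicalSpace M] [ChartedSpace (ModelSpace d) M]
  [IsManifold 𝓘(ℝ, ModelSpace d) ∞ M] (g : LorentzSpacetime d M)

/-- The change of charts. -/
def coordChange (x p : M) (y : ModelSpace d) : ModelSpace d := chart d p ((chart d x).symm y)

/-- The derivative of the change of charts. -/
def coordChangeDeriv (x p : M) (y : ModelSpace d) : ModelSpace d →L[ℝ] ModelSpace d :=
  (coordPull p ((chart d x).symm y)).comp (coordPush x y)

omit [IsManifold 𝓘(ℝ, ModelSpace d) ∞ M] in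
theorem eventually_mem_source {x p : M} (hx : x ∈ (chart d p).source) :
    ∀ᶠ y in 𝓝 (chart d x x), y ∈ (chart d x).target ∧ (chart d x).symm y ∈ (chart d p).source := by
  have h0 : ∀ᶠ y in 𝓝 (chart d x x), y ∈ (chart d x).target :=
    (isOpen_chart_target x).mem_nhds (mem_extChartAt_target x)
  refine h0.and ?_
  have h1 : ContinuousAt (chart d x).symm (chart d x x) :=
    continuousAt_extChartAt_symm x
  refine h1.preimage_mem_nhds ((isOpen_chart_source p).mem_nhds ?_)
  rwa [extChartAt_to_inv]

theorem hasFDerivAt_coordChange {x p : M} {y : ModelSpace d} (hy : y ∈ (chart d x).target)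
    (hp : (chart d x).symm y ∈ (chart d p).source) :
    HasFDerivAt (coordChange x p) (coordChangeDeriv x p y) y := by
  have h2 := (hasMFDerivAt_chart hp).comp y (hasMFDerivAt_chart_symm hy)
  exact hasMFDerivAt_iff_hasFDerivAt.mp h2

theorem differentiableAt_coordChangeDeriv {x p : M} (hx : x ∈ (chart d p).source) :
    DifferentiableAt ℝ (coordChangeDeriv x p) (chart d x x) := by
  have hev := eventually_mem_source (d := d) hx
  have hmem := hev.self_of_nhds
  have h1 : ContMDiffAt 𝓘(ℝ, ModelSpace d) 𝓘(ℝ, ModelSpace d) ∞ (coordChange x p) (chart d x x) := by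
    have h2 := (contMDiffOn_symm_chart (d := d) x).contMDiffAt
      ((isOpen_chart_target x).mem_nhds hmem.1)
    have h3 : ContMDiffAt 𝓘(ℝ, ModelSpace d) 𝓘(ℝ, ModelSpace d) ∞ (chart d p)
        ((chart d x).symm (chart d x x)) :=
      contMDiffAt_extChartAt' (by simpa using hmem.2)
    exact h3.comp _ h2
  have h2 : ContDiffAt ℝ ∞ (coordChange x p) (chart d x x) := contMDiffAt_iff_contDiffAt.mp h1
  have h3 : DifferentiableAt ℝ (fderiv ℝ (coordChange x p)) (chart d x x) :=
    (h2.fderiv_right (m := 1) (by norm_cast)).differentiableAt one_ne_zero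
  refine h3.congr_of_eventuallyEq ?_
  filter_upwards [hev] with y hy
  exact (hasFDerivAt_coordChange hy.1 hy.2).fderiv.symm

theorem chartForm_coordChange {x p : M} {y : ModelSpace d}
    (hp : (chart d x).symm y ∈ (chart d p).source) (v w : ModelSpace d) :
    g.chartForm p (coordChange x p y) (coordChangeDeriv x p y v) (coordChangeDeriv x p y w) =
      g.chartForm x y v w :=
  g.chartForm_coordPull hp _ _

theorem chartMetricDeriv_coordChange {x p : M} (hx : x ∈ (chart d p).source)
    {D₂ : ModelSpace d →L[ℝ] ModelSpace d →L[ℝ] ModelSpace d}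
    (hD : HasFDerivAt (coordChangeDeriv x p) D₂ (chart d x x)) (u v w : ModelSpace d) :
    g.chartMetricDeriv x (chart d x x) u v w =
      fderiv ℝ (g.chartForm p) (chart d p x) (coordPull p x (coordPush x (chart d x x) u))
        (coordPull p x (coordPush x (chart d x x) v))
        (coordPull p x (coordPush x (chart d x x) w)) +
      g.chartForm p (chart d p x) (D₂ u v) (coordPull p x (coordPush x (chart d x x) w)) +
      g.chartForm p (chart d p x) (coordPull p x (coordPush x (chart d x x) v)) (D₂ u w) := by
  have hev := eventually_mem_source (d := d) hx
  have hmem := hev.self_of_nhds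
  have hinv : (chart d x).symm (chart d x x) = x := extChartAt_to_inv x
  have hφ : coordChange x p (chart d x x) = chart d p x := by rw [coordChange, hinv]
  have hB : DifferentiableAt ℝ (g.chartForm p) (coordChange x p (chart d x x)) := by
    rw [hφ]
    exact ((g.contDiffOn_chartForm p).contDiffAt
      ((isOpen_chart_target p).mem_nhds ((chart d p).map_source hx))).differentiableAt (by simp)
  have h1 := hasFDerivAt_pullback_form (hasFDerivAt_coordChange hmem.1 hmem.2) hD hB v w u
  have h2 : ∀ u, coordChangeDeriv x p (chart d x x) u =
      coordPull p x (coordPush x (chart d x x) u) := fun u ↦ by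
    show coordPull p ((chart d x).symm (chart d x x)) _ = _
    rw [hinv]
    rfl
  simp only [hφ, h2] at h1
  rw [← h1]
  unfold chartMetricDeriv
  congr 1
  refine Filter.EventuallyEq.fderiv_eq ?_
  filter_upwards [hev] with y hy
  exact (g.chartForm_coordChange hy.2 v w).symm

/-- Parallelism is defined in the chart around γ t, which changes with t; differential equations
need one fixed chart. Differentiating the change of charts along the curve adds a second derivative
term, and this is exactly the inhomogeneous term in the transformation law of the Christoffel
symbols. -/
theorem IsParallelWithinAt.hasDerivWithinAt {g : LorentzSpacetime d M} {p : M} {e : ModelSpace d}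
    {ρ K : ℝ} (hbox : g.IsChartBox p e ρ K) {γ : ℝ → M} {V : ∀ t, Tgt (d := d) (γ t)} {J : Set ℝ}
    {t : ℝ} (hV : g.IsParallelWithinAt γ V J t) (htJ : t ∈ J)
    (hγ : MDifferentiableWithinAt 𝓘(ℝ, ℝ) 𝓘(ℝ, ModelSpace d) γ J t)
    (hs : γ t ∈ (chart d p).source) (hb : chart d p (γ t) ∈ Metric.ball (chart d p p) ρ) :
    HasDerivWithinAt (fun s ↦ coordPull p (γ s) (V s))
      (-christoffelSnd (g.chartForm p) (chart d p (γ t))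
        (coordPull p (γ t) (velocityWithin d γ J t)) (coordPull p (γ t) (V t))) J t := by
  obtain ⟨V', hV', hz⟩ := hV
  set x := γ t with hx
  set y := chart d x x with hy
  have hG := hbox.good
  obtain ⟨D₂, hD⟩ : ∃ D₂, HasFDerivAt (coordChangeDeriv x p) D₂ y :=
    ⟨_, (differentiableAt_coordChangeDeriv hs).hasFDerivAt⟩
  have hev := eventually_mem_source (d := d) hs
  have hinv : (chart d x).symm y = x := extChartAt_to_inv x
  have hsx : x ∈ (chart d x).source := mem_extChartAt_source x
  have hsymm : ∀ u v, D₂ u v = D₂ v u := fun u v ↦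
    second_derivative_symmetric_of_eventually
      (hev.mono fun y hy ↦ hasFDerivAt_coordChange hy.1 hy.2) hD u v
  have hc : HasDerivWithinAt (chart d x ∘ γ) (coordPull x x (velocityWithin d γ J t)) J t :=
    hasDerivWithinAt_chart_comp (p := x) hsx hγ
  set c' := coordPull x x (velocityWithin d γ J t) with hc'
  set V₀ := coordPull x x (V t) with hV₀
  set T := coordPull p x ∘L coordPush x y with hT
  have hTpull : ∀ u : ModelSpace d, T (coordPull x x u) = coordPull p x u := fun u ↦
    congrArg (coordPull p x) (coordPush_coordPull hsx u)
  have hTc : T c' = coordPull p x (velocityWithin d γ J t) := hTpull _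
  have hTV : T V₀ = coordPull p x (V t) := hTpull _
  have hDT : coordChangeDeriv x p y = T := by
    show (coordPull p ((chart d x).symm y)).comp _ = _
    rw [hinv]
  have hprod : HasDerivWithinAt (fun s ↦ coordChangeDeriv x p (chart d x (γ s))
      (coordPull x (γ s) (V s))) (D₂ c' V₀ + T V') J t := by
    have h1 : HasDerivWithinAt (fun s ↦ coordChangeDeriv x p (chart d x (γ s))) (D₂ c') J t :=
      HasFDerivAt.comp_hasDerivWithinAt (l := coordChangeDeriv x p) (f := chart d x ∘ γ) t hD hc
    have h2 : HasDerivWithinAt (fun s ↦ coordPull x (γ s) (V s)) V' J t := hV'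
    have h3 := h1.clm_apply h2
    rw [← hx, ← hy, hDT] at h3
    exact h3
  have hcongr : HasDerivWithinAt (fun s ↦ coordPull p (γ s) (V s)) (D₂ c' V₀ + T V') J t := by
    refine hprod.congr_of_eventuallyEq_of_mem ?_ htJ
    have := hγ.continuousWithinAt.preimage_mem_nhdsWithin ((isOpen_chart_source x).mem_nhds hsx)
    filter_upwards [this] with s hs'
    show _ = coordPull p ((chart d x).symm (chart d x (γ s))) (coordPush x (chart d x (γ s))
      (coordPull x (γ s) (V s)))
    rw [(chart d x).left_inv hs']
    exact congrArg (coordPull p (γ s)) (coordPush_coordPull hs' (V s)).symm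
  have hgoal : D₂ c' V₀ + T V' = -christoffelSnd (g.chartForm p) (chart d p x)
        (coordPull p x (velocityWithin d γ J t)) (coordPull p x (V t)) := by
    rw [← hTc, ← hTV, ← sub_eq_zero, sub_neg_eq_add]
    set Ξ := D₂ c' V₀ + T V' + christoffelSnd (g.chartForm p) (chart d p x) (T c') (T V₀) with hΞ
    -- The difference Ξ of the two sides is tested against all vectors, where symmetry of the second
    -- derivative cancels the extra terms; `star` then gives Ξ = 0.
    have hT' : ∀ w, g.chartForm p (chart d p x) Ξ w = 0 := by
      intro w
      set z := coordPull x x (coordPush p (chart d p x) w) with hzdef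
      have hTz : T z = w := by
        rw [hzdef, hTpull]
        have := coordPull_coordPush ((chart d p).map_source hs) w
        rwa [(chart d p).left_inv hs] at this
      have h1 := hz z
      have h2 : g.chartMetric x y V' z = g.chartForm p (chart d p x) (T V') (T z) := by
        have h3 := g.chartForm_coordChange (x := x) (p := p) (y := y) (by rwa [hinv]) V' z
        rw [hDT] at h3
        have h4 : coordChange x p y = chart d p x := by rw [coordChange, hinv]
        rw [h4] at h3
        exact h3.symm
      have h5 := g.chartMetricDeriv_coordChange hs hD
      have h6 := hG.chr_eq _ hb (T c') (T V₀) (T z)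
      have h7 : g.chartMetric x y V' z + g.christoffel x y c' V₀ z = 0 := h1
      unfold christoffel at h7
      rw [h2, h5, h5, h5] at h7
      have s1 : ∀ u, coordPull p x (coordPush x (chart d x x) u) = T u := fun _ ↦ rfl
      simp only [s1] at h7
      rw [hsymm V₀ c', hsymm z c', hsymm z V₀, g.chartForm_symm p _ (T c') (D₂ V₀ z),
        g.chartForm_symm p _ (T V₀) (D₂ c' z)] at h7
      rw [← hTz, hΞ]
      simp only [map_add, add_apply]
      linarith
    have h8 := hG.star _ hb _ hb Ξ
    rw [hT' Ξ, g.chartForm_symm, hT' e] at h8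
    simpa using h8
  rw [← hgoal]
  exact hcongr

end Parallel

end LorentzSpacetime

end

set_option maxSynthPendingDepth 3

noncomputable section

namespace LorentzSpacetime

/-! ### Generalized affine length in a chart box. -/

section FutureInfinite

variable {d : ℕ} {M : Type*} [TopologicalSpace M] [ChartedSpace (ModelSpace d) M]

/-- Just after t there is no break point, and the smooth piece starting at t has the same germ at t
as J ∩ [t, ∞). -/
theorem _root_.IsPiecewiseC1Curve.right_velocity {P : ∀ x : M, Tgt (d := d) x → Prop} {γ : ℝ → M}
    {J : Set ℝ} (hγ : IsPiecewiseC1Curve P γ J) {t s : ℝ} (ht : t ∈ J) (hs : s ∈ J) (hts : t < s) :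
    MDifferentiableWithinAt 𝓘(ℝ, ℝ) 𝓘(ℝ, ModelSpace d) γ (J ∩ Ici t) t ∧
      P (γ t) (velocityWithin d γ (J ∩ Ici t) t) := by
  have hJ : Icc t s ⊆ J := hγ.1.out ht hs
  obtain ⟨F, hF⟩ := hγ.2.2 t s hts hJ
  have h1 : ((F : Set ℝ) \ {t})ᶜ ∈ 𝓝 t :=
    (F.finite_toSet.subset sdiff_subset).isClosed.isOpen_compl.mem_nhds (by simp)
  obtain ⟨ε, hε, hball⟩ := Metric.mem_nhds_iff.mp h1
  set v := min s (t + ε) with hv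
  have hlt : t < v := lt_min hts (by linarith)
  obtain ⟨h2, h3⟩ := hF t v le_rfl hlt (min_le_left _ _) (by
    rw [Set.disjoint_left]
    intro r hrF hr
    refine (hball (?_ : r ∈ Metric.ball t ε)) ⟨hrF, hr.1.ne'⟩
    rw [Metric.mem_ball, Real.dist_eq, abs_lt]
    have := hr.2.trans_le (min_le_right _ _)
    constructor <;> linarith [hr.1])
  have hset : Icc t v =ᶠ[𝓝 t] (J ∩ Ici t : Set ℝ) := by
    filter_upwards [Iio_mem_nhds hlt] with r hr
    exact propext ⟨fun h ↦ ⟨hJ ⟨h.1, h.2.trans (min_le_left _ _)⟩, h.1⟩,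
      fun h ↦ ⟨h.2, le_of_lt hr⟩⟩
  have h4 := h2.mdifferentiableOn (by simp) t ⟨le_rfl, hlt.le⟩
  refine ⟨(mdifferentiableWithinAt_congr_set hset).mp h4, ?_⟩
  have h5 : velocityWithin d γ (J ∩ Ici t) t = velocityWithin d γ (Icc t v) t := by
    unfold velocityWithin
    rw [mfderivWithin_congr_set hset]
  rw [h5]
  exact h3 t ⟨le_rfl, hlt.le⟩

variable [IsManifold 𝓘(ℝ, ModelSpace d) ∞ M] {g : LorentzSpacetime d M}

theorem continuousOn_coordPull {p : M} {γ : ℝ → M} {V : ∀ t, Tgt (d := d) (γ t)} {J : Set ℝ}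
    (hV : ContinuousOn (fun t ↦ (⟨γ t, V t⟩ : TangentBundle 𝓘(ℝ, ModelSpace d) M)) J)
    (hm : MapsTo γ J (chart d p).source) : ContinuousOn (fun t ↦ coordPull p (γ t) (V t)) J := by
  have hm' : MapsTo γ J (chartAt (ModelSpace d) p).source := fun t ht ↦ by simpa using! hm ht
  have h := ((contMDiffOn_extChartAt (I := 𝓘(ℝ, ModelSpace d)) (x := p)
    (n := ∞)).contMDiffOn_tangentMapWithin (m := ∞)
    (by simp) (chartAt (ModelSpace d) p).open_source.uniqueMDiffOn).continuousOn
  have h2 := h.comp hV (fun t ht ↦ hm' ht)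
  have h4 := (contMDiff_snd_tangentBundle_modelSpace (ModelSpace d) 𝓘(ℝ, ModelSpace d)
    (n := ∞)).continuous
  refine (h4.comp_continuousOn h2).congr fun t ht ↦ ?_
  simp only [Function.comp, tangentMapWithin, coordPull]
  rw [mfderivWithin_of_isOpen (chartAt (ModelSpace d) p).open_source (hm' ht)]
  rfl

theorem IsChartBox.boxCausal {p : M} {e : ModelSpace d} {ρ K : ℝ} (hbox : g.IsChartBox p e ρ K)
    {x : M} (hx : x ∈ (chart d p).source) (hb : chart d p x ∈ Metric.ball (chart d p p) ρ)
    {v : Tgt (d := d) x} (hv : g.FutureCausal x v) :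
    BoxCausal (g.chartForm p) (chart d p p) e (chart d p x) (coordPull p x v) := by
  rw [← hbox.causal_iff _ hb, chartCausal_iff _ ((chart d p).map_source hx)]
  have h5 : ∀ (x' : M) (w : ModelSpace d), x' = x → w = v → g.FutureCausal x' w := by
    rintro x' w rfl rfl; exact hv
  exact h5 _ _ ((chart d p).left_inv hx) (coordPush_coordPull hx _)

omit [IsManifold 𝓘(ℝ, ModelSpace d) ∞ M] in
theorem sum_repr_coordPull {p x : M} (B : Module.Basis (Fin d) ℝ (Tgt (d := d) x))
    (v : Tgt (d := d) x) : ∑ i, B.repr v i • coordPull p x (B i) = coordPull p x v := by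
  let L : Tgt (d := d) x →L[ℝ] ModelSpace d := coordPull p x
  have h := congrArg L (B.sum_repr v)
  rw [map_sum] at h
  simp only [map_smul] at h
  exact h

theorem exists_frame_bound {p x : M} (hx : x ∈ (chart d p).source)
    (B : Module.Basis (Fin d) ℝ (Tgt (d := d) x)) :
    ∃ κ : ℝ, 0 < κ ∧ ∀ a : Fin d → ℝ,
      Real.sqrt (∑ i, a i ^ 2) ≤ κ * ‖∑ i, a i • coordPull p x (B i)‖ := by
  let L : Tgt (d := d) x →ₗ[ℝ] ModelSpace d := (coordPull p x).toLinearMap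
  have hL : LinearMap.ker L = ⊥ := by
    rw [LinearMap.ker_eq_bot']
    intro v hv
    have h1 := coordPush_coordPull hx v
    have h2 : coordPull p x v = 0 := hv
    rw [h2, map_zero] at h1
    exact h1.symm
  have hli := B.linearIndependent.map' L hL
  let A : EuclideanSpace ℝ (Fin d) →ₗ[ℝ] ModelSpace d :=
    (Fintype.linearCombination ℝ (L ∘ B)).comp (WithLp.linearEquiv 2 ℝ (Fin d → ℝ)).toLinearMap
  have hA : LinearMap.ker A = ⊥ := by
    rw [LinearMap.ker_eq_bot]
    exact (linearIndependent_iff_injective_fintypeLinearCombination.mp hli).comp (LinearEquiv.injective _)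
  obtain ⟨κ, hκ, hanti⟩ := A.exists_antilipschitzWith hA
  refine ⟨κ, hκ, fun a ↦ ?_⟩
  have h1 := hanti.le_mul_norm_sub (x := WithLp.toLp 2 a) (y := 0)
  rw [map_zero, add_zero, add_zero, norm_neg, norm_neg] at h1
  rw [EuclideanSpace.norm_eq] at h1
  have h2 : A (WithLp.toLp 2 a) = ∑ i, a i • coordPull p x (B i) := rfl
  rw [h2] at h1
  simpa using h1

/-- In a box, parallel transport distorts norms by at most a factor 2, so the frame components of
the velocity are bounded by its coordinate norm, hence by the derivative of the time coordinate,
whose integral is bounded. The constant depends on the frame at s but not on b, which permits b to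
run to the end of the curve. -/
theorem IsChartBox.lintegral_velocity_le {p : M} {e : ModelSpace d} {ρ K : ℝ}
    (hbox : g.IsChartBox p e ρ K) {W : ℝ → M} {J : Set ℝ} (hW : g.IsCausalCurve W J)
    {E : ∀ t : ℝ, Module.Basis (Fin d) ℝ (Tgt (d := d) (W t))}
    (hE : ∀ i, g.IsParallelAlong W (fun t ↦ E t i) J) {s : ℝ} (hs : s ∈ J) :
    ∃ C : ENNReal, C < ⊤ ∧ ∀ b ∈ J, s < b →
      MapsTo W (Icc s b) ((chart d p).source ∩ chart d p ⁻¹' Metric.ball (chart d p p) ρ) →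
      ∫⁻ t in Ico s b, ENNReal.ofReal
        (Real.sqrt (∑ i, ((E t).repr (velocityWithin d W (J ∩ Ici t) t) i) ^ 2)) ≤ C := by
  by_cases hsrc : W s ∈ (chart d p).source
  swap
  · exact ⟨0, by simp, fun b _ hb hm ↦ absurd (hm ⟨le_rfl, hb.le⟩).1 hsrc⟩
  obtain ⟨κ, hκ, hframe⟩ := exists_frame_bound hsrc (E s)
  have hG := hbox.good
  have hK := hG.one_le
  have hK0 := hG.K_pos
  have hρ := hG.pos
  set y₀ := chart d p p with hy₀
  set Γ := christoffelSnd (g.chartForm p) with hΓ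
  set l : ModelSpace d →L[ℝ] ℝ := -(g.chartForm p y₀ e) with hl
  refine ⟨ENNReal.ofReal (2 * κ * K * (K * K * (2 * ρ))), ENNReal.ofReal_lt_top,
    fun b hb hsb hm ↦ ?_⟩
  have hJ : Icc s b ⊆ J := hW.1.out hs hb
  set c' : ℝ → ModelSpace d := fun t ↦ coordPull p (W t) (velocityWithin d W (J ∩ Ici t) t) with hc'
  have hvel : ∀ t ∈ Ico s b, MDifferentiableWithinAt 𝓘(ℝ, ℝ) 𝓘(ℝ, ModelSpace d) W (J ∩ Ici t) t ∧
      g.FutureCausal (W t) (velocityWithin d W (J ∩ Ici t) t) := fun t ht ↦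
    IsPiecewiseC1Curve.right_velocity hW (hJ (Ico_subset_Icc_self ht)) hb ht.2
  have hnhds : ∀ t ∈ Ico s b, J ∩ Ici t ∈ 𝓝[Ici t] t := fun t ht ↦
    Filter.mem_of_superset (Icc_mem_nhdsGE ht.2) fun r hr ↦ ⟨hJ ⟨ht.1.trans hr.1, hr.2⟩, hr.1⟩
  have hder : ∀ t ∈ Ico s b, HasDerivWithinAt (chart d p ∘ W) (c' t) (Ici t) t := fun t ht ↦
    (hasDerivWithinAt_chart_comp (hm (Ico_subset_Icc_self ht)).1 (hvel t ht).1).mono_of_mem_nhdsWithin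
      (hnhds t ht)
  have hlder : ∀ t ∈ Ico s b, HasDerivWithinAt (fun t ↦ l (chart d p (W t))) (l (c' t)) (Ici t) t :=
    fun t ht ↦ l.hasFDerivAt.comp_hasDerivWithinAt t (hder t ht)
  have hcaus : ∀ t ∈ Ico s b, BoxCausal (g.chartForm p) y₀ e (chart d p (W t)) (c' t) := fun t ht ↦
    hbox.boxCausal (hm (Ico_subset_Icc_self ht)).1 (hm (Ico_subset_Icc_self ht)).2 (hvel t ht).2
  have hlpos : ∀ t ∈ Ico s b, 0 < l (c' t) := fun t ht ↦ by
    have := (hcaus t ht).2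
    show 0 < -(g.chartForm p y₀ e (c' t))
    linarith
  have hcl : ∀ t ∈ Ico s b, ‖c' t‖ ≤ K * l (c' t) := fun t ht ↦
    hG.norm_le_time (hm (Ico_subset_Icc_self ht)).2 (hcaus t ht)
  have hWc : ContinuousOn W (Icc s b) := (IsPiecewiseC1Curve.sub_Icc hW hsb hs hb).continuousOn_Icc hsb
  have hcont : ContinuousOn (fun t ↦ l (chart d p (W t))) (Icc s b) :=
    l.continuous.comp_continuousOn ((continuousOn_extChartAt p).comp hWc fun t ht ↦ (hm ht).1)
  have hlbd : ∀ t ∈ Icc s b, l (chart d p (W t)) - l (chart d p (W s)) ≤ K * K * (2 * ρ) := by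
    intro t ht
    have h1 := (hm ht).2
    have h2 := (hm ⟨le_rfl, hsb.le⟩).2
    rw [mem_preimage, Metric.mem_ball] at h1 h2
    have h3 : ‖chart d p (W t) - chart d p (W s)‖ ≤ 2 * ρ := by
      rw [← dist_eq_norm]
      linarith [dist_triangle_right (chart d p (W t)) (chart d p (W s)) y₀]
    rw [← map_sub]
    have h4 := (abs_le.mp (bilin_le (hG.bound y₀ hG.center_mem) e
      (chart d p (W t) - chart d p (W s)))).1
    calc l (chart d p (W t) - chart d p (W s))
        ≤ K * ‖e‖ * ‖chart d p (W t) - chart d p (W s)‖ := by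
          show -(g.chartForm p y₀ e _) ≤ _
          linarith
      _ ≤ K * K * (2 * ρ) := by gcongr; exact hG.e_bound
  have hpt : ∀ t ∈ Ico s b, Real.sqrt (∑ i, ((E t).repr (velocityWithin d W (J ∩ Ici t) t) i) ^ 2) ≤
      2 * κ * K * l (c' t) := by
    intro t ht
    set a := (E t).repr (velocityWithin d W (J ∩ Ici t) t) with ha
    -- The parallel field with the frame components of the velocity at t: it equals the velocity at
    -- t, and at s its norm controls these components.
    set f : ℝ → ModelSpace d := fun r ↦ ∑ i, a i • coordPull p (W r) (E r i) with hf
    have hst : Icc s t ⊆ Icc s b := Icc_subset_Icc le_rfl ht.2.le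
    have hst' : Ico s t ⊆ Ico s b := Ico_subset_Ico le_rfl ht.2.le
    have hft : f t = c' t := sum_repr_coordPull (E t) _
    have hfc : ContinuousOn f (Icc s t) := by
      refine continuousOn_finsetSum _ fun i _ ↦ ?_
      have := continuousOn_coordPull (p := p) ((hE i).1.mono (hst.trans hJ))
        fun r hr ↦ (hm (hst hr)).1
      exact ContinuousOn.fun_smul continuousOn_const this
    have hfd : ∀ r ∈ Ico s t, HasDerivWithinAt f (-Γ (chart d p (W r)) (c' r) (f r)) (Ici r) r := by
      intro r hr
      have hr' := Ico_subset_Icc_self (hst' hr)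
      have h1 : ∀ i, HasDerivWithinAt (fun r ↦ coordPull p (W r) (E r i))
          (-Γ (chart d p (W r)) (c' r) (coordPull p (W r) (E r i))) (Ici r) r := fun i ↦
        (((hE i).2 r (hJ hr') ⟨b, hb, (hst' hr).2⟩).hasDerivWithinAt hbox ⟨hJ hr', self_mem_Ici⟩
          (hvel r (hst' hr)).1 (hm hr').1 (hm hr').2).mono_of_mem_nhdsWithin (hnhds r (hst' hr))
      have h2 := HasDerivWithinAt.fun_sum (u := Finset.univ) fun i _ ↦ (h1 i).const_smul (a i)
      convert! h2 using 1
      simp only [hf, map_sum, map_smul, smul_neg, Finset.sum_neg_distrib]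
    have key := norm_sub_le_of_linear_growth (k := K ^ 2) (by positivity) hfc hfd
      (hcont.mono hst) (fun r hr ↦ hlder r (hst' hr)) (fun r hr ↦ hlpos r (hst' hr))
      (fun r hr ↦ by
        rw [norm_neg]
        calc _ ≤ ‖Γ (chart d p (W r))‖ * ‖c' r‖ * ‖f r‖ := (Γ (chart d p (W r))).le_opNorm₂ _ _
          _ ≤ K * (K * l (c' r)) * ‖f r‖ := by
            gcongr
            · exact hG.chr_bound _ (hm (Ico_subset_Icc_self (hst' hr))).2
            · exact hcl r (hst' hr)
          _ = _ := by ring)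
      (fun r hr ↦ by
        have h1 := hlbd r (hst hr)
        have h2 := hG.pow_mul_le 4 (by norm_num)
        calc _ ≤ 4 * K ^ 2 * (K * K * (2 * ρ)) := by gcongr
          _ = 8 * (K ^ 4 * ρ) := by ring
          _ ≤ 1 := by linarith) t ⟨ht.1, le_rfl⟩
    have h3 : ‖f s‖ ≤ 2 * ‖f t‖ := by
      have h1 := hlbd t (Ico_subset_Icc_self ht)
      have h2 := hG.pow_mul_le 4 (by norm_num)
      have h4 : 2 * K ^ 2 * (l (chart d p (W t)) - l (chart d p (W s))) ≤ 1 / 2 := by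
        calc _ ≤ 2 * K ^ 2 * (K * K * (2 * ρ)) := by gcongr
          _ = 4 * (K ^ 4 * ρ) := by ring
          _ ≤ _ := by linarith
      have h5 : ‖f t - f s‖ ≤ 1 / 2 * ‖f s‖ := key.trans (by gcongr)
      have h6 : ‖f s‖ ≤ ‖f t‖ + ‖f t - f s‖ := by
        exact norm_le_norm_add_norm_sub _ _
      linarith
    calc _ ≤ κ * ‖f s‖ := hframe _
      _ ≤ κ * (2 * (K * l (c' t))) := by
          gcongr
          rw [hft] at h3
          exact h3.trans (by gcongr; exact hcl t ht)
      _ = _ := by ring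
  -- Integrability comes for free from continuity of the time coordinate and nonnegativity of its
  -- right derivative.
  have hint : IntegrableOn (fun t ↦ l (c' t)) (Ioc s b) :=
    intervalIntegral.integrableOn_deriv_right_of_nonneg hcont
      (fun t ht ↦ (hlder t (Ioo_subset_Ico_self ht)).mono Ioi_subset_Ici_self)
      (fun t ht ↦ (hlpos t (Ioo_subset_Ico_self ht)).le)
  have heq := intervalIntegral.integral_eq_sub_of_hasDeriv_right_of_le hsb.le hcont
      (fun t ht ↦ (hlder t (Ioo_subset_Ico_self ht)).mono Ioi_subset_Ici_self)
      ((intervalIntegrable_iff_integrableOn_Ioc_of_le hsb.le).mpr hint)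
  rw [intervalIntegral.integral_of_le hsb.le] at heq
  have hC : 0 ≤ 2 * κ * K := by positivity
  calc _ = ∫⁻ t in Ioo s b, ENNReal.ofReal
        (Real.sqrt (∑ i, ((E t).repr (velocityWithin d W (J ∩ Ici t) t) i) ^ 2)) :=
        setLIntegral_congr Ioo_ae_eq_Ico.symm
    _ ≤ ∫⁻ t in Ioo s b, ENNReal.ofReal (2 * κ * K * l (c' t)) :=
        setLIntegral_mono' measurableSet_Ioo fun t ht ↦
          ENNReal.ofReal_le_ofReal (hpt t (Ioo_subset_Ico_self ht))
    _ = ENNReal.ofReal (∫ t in Ioo s b, 2 * κ * K * l (c' t)) := by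
        refine (ofReal_integral_eq_lintegral_ofReal
          ((hint.mono_set Ioo_subset_Ioc_self).const_mul _) ?_).symm
        filter_upwards [ae_restrict_mem measurableSet_Ioo] with t ht
        exact mul_nonneg hC (hlpos t (Ioo_subset_Ico_self ht)).le
    _ ≤ _ := by
        refine ENNReal.ofReal_le_ofReal ?_
        rw [integral_const_mul, ← integral_Ioc_eq_integral_Ioo, heq]
        gcongr
        exact hlbd b ⟨hsb.le, le_rfl⟩

end FutureInfinite

end LorentzSpacetime

end

set_option maxSynthPendingDepth 3

noncomputable section

namespace LorentzSpacetime

/-! ### Infinite affine length excludes a future endpoint. -/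

section FutureInfiniteEndpoint

variable {d : ℕ} {M : Type*} [TopologicalSpace M] [ChartedSpace (ModelSpace d) M]
  [IsManifold 𝓘(ℝ, ModelSpace d) ∞ M] {g : LorentzSpacetime d M}

omit [IsManifold 𝓘(ℝ, ModelSpace d) ∞ M] in
theorem chart_ball_mem_nhds (p : M) {r : ℝ} (hr : 0 < r) :
    (chart d p).source ∩ chart d p ⁻¹' Metric.ball (chart d p p) r ∈ 𝓝 p :=
  inter_mem (extChartAt_source_mem_nhds p) ((continuousAt_extChartAt p).preimage_mem_nhds
    (Metric.ball_mem_nhds _ hr))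

omit [IsManifold 𝓘(ℝ, ModelSpace d) ∞ M] in
theorem isOpen_chart_ball (p : M) (r : ℝ) :
    IsOpen ((chart d p).source ∩ chart d p ⁻¹' Metric.ball (chart d p p) r) :=
  (continuousOn_extChartAt p).isOpen_inter_preimage (isOpen_chart_source p) Metric.isOpen_ball

/-- The generalized affine length of a causal curve with a future endpoint is finite. -/
theorem lintegral_velocity_lt_top {W : ℝ → M} {J : Set ℝ} (hW : g.IsCausalCurve W J)
    {E : ∀ t : ℝ, Module.Basis (Fin d) ℝ (Tgt (d := d) (W t))}
    (hE : ∀ i, g.IsParallelAlong W (fun t ↦ E t i) J) {t₀ : ℝ} (ht₀ : IsLeast J t₀) {q : M}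
    (hq : IsFutureEndpoint W J q) : ∫⁻ t in J, ENNReal.ofReal
        (Real.sqrt (∑ i, ((E t).repr (velocityWithin d W (J ∩ Ici t) t) i) ^ 2)) < ⊤ := by
  set F : ℝ → ENNReal := fun t ↦ ENNReal.ofReal
        (Real.sqrt (∑ i, ((E t).repr (velocityWithin d W (J ∩ Ici t) t) i) ^ 2)) with hF
  obtain ⟨e, K, ρ, hρ, hbox⟩ := g.exists_isChartBox q
  have hbox := hbox ρ hρ le_rfl
  obtain ⟨t₁, ht₁, hend⟩ := hq _ (isOpen_chart_ball (d := d) q ρ)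
    (mem_of_mem_nhds (chart_ball_mem_nhds q hρ))
  have ht01 := ht₀.2 ht₁
  -- Up to t₁ finitely many boxes suffice; beyond t₁ the curve stays in the one box around its
  -- endpoint.
  have hA : ∫⁻ t in Ico t₀ t₁, F t < ⊤ := by
    rcases ht01.eq_or_lt with rfl | hlt
    · simp
    have hcont := (IsPiecewiseC1Curve.sub_Icc hW hlt ht₀.1 ht₁).continuousOn_Icc hlt
    have hsub := hW.1.out ht₀.1 ht₁
    refine curve_induction ht01 hcont (P := fun t ↦ ∫⁻ r in Ico t₀ t, F r < ⊤) ?_ (by simp)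
    intro z
    obtain ⟨e', K', ρ', hρ', hbox'⟩ := g.exists_isChartBox z
    have hbox' := hbox' ρ' hρ' le_rfl
    refine ⟨_, chart_ball_mem_nhds (d := d) z hρ', fun s t hs hst ht hm hP ↦ ?_⟩
    obtain ⟨C, hC, hle⟩ := hbox'.lintegral_velocity_le hW hE (hsub ⟨hs, hst.le.trans ht⟩)
    rw [← Ico_union_Ico_eq_Ico hs hst.le]
    exact (lintegral_union_le _ _ _).trans_lt (ENNReal.add_lt_top.mpr
      ⟨hP, (hle t (hsub ⟨hs.trans hst.le, ht⟩) hst hm).trans_lt hC⟩)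
  obtain ⟨C, hC, hle⟩ := hbox.lintegral_velocity_le hW hE ht₁
  have hbd : ∀ r ∈ J, ∫⁻ t in Ico t₀ r, F t ≤ (∫⁻ t in Ico t₀ t₁, F t) + C := by
    intro r hr
    rcases le_or_gt r t₁ with h | h
    · exact (lintegral_mono_set (Ico_subset_Ico le_rfl h)).trans le_self_add
    · rw [← Ico_union_Ico_eq_Ico ht01 h.le]
      refine (lintegral_union_le _ _ _).trans ?_
      gcongr
      exact hle r hr h fun t ht ↦ hend t (hW.1.out ht₁ hr ht) ht.1
  -- Rational right ends give a countable directed union that exhausts J up to its possible maximum,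
  -- a null set.
  let ι := {r : ℚ // (r : ℝ) ∈ J}
  have hcover : J ⊆ (⋃ r : ι, Ico t₀ (r.1 : ℝ)) ∪ {t | IsGreatest J t} := by
    intro t ht
    by_cases hmax : ∀ s ∈ J, s ≤ t
    · exact Or.inr ⟨ht, hmax⟩
    · push Not at hmax
      obtain ⟨s, hs, hts⟩ := hmax
      obtain ⟨r, hr1, hr2⟩ := exists_rat_btwn hts
      exact Or.inl (mem_iUnion.mpr ⟨⟨r, hW.1.out ht hs ⟨hr1.le, hr2.le⟩⟩, ht₀.2 ht, hr1⟩)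
  have hzero : ∫⁻ t in {t | IsGreatest J t}, F t = 0 := by
    have hs : {t | IsGreatest J t}.Subsingleton := fun x hx y hy ↦ IsGreatest.unique hx hy
    rw [Measure.restrict_eq_zero.mpr (hs.measure_zero volume), lintegral_zero_measure]
  refine lt_of_le_of_lt ((lintegral_mono_set hcover).trans (lintegral_union_le _ _ _)) ?_
  rw [hzero, add_zero, setLIntegral_iUnion_of_directed]
  · exact (iSup_le fun r ↦ hbd _ r.2).trans_lt (ENNReal.add_lt_top.mpr ⟨hA, hC⟩)
  · intro r s
    rcases le_total r s with h | h
    · exact ⟨s, Ico_subset_Ico le_rfl (by exact_mod_cast h), subset_rfl⟩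
    · exact ⟨r, subset_rfl, Ico_subset_Ico le_rfl (by exact_mod_cast h)⟩

/-- An endpoint would make the affine length from t₀ on finite by `lintegral_velocity_lt_top`. If t₀
is the last parameter, the integral runs over a null set and is finite as well. -/
theorem IsFutureInfiniteWorldline.not_endpoint {W : ℝ → M} {J : Set ℝ}
    (hW : g.IsFutureInfiniteWorldline W J) : ¬ ∃ q, IsFutureEndpoint W J q := by
  rintro ⟨q, hq⟩
  obtain ⟨hWc, t₀, ht₀, E, hE, hint⟩ := hW
  set J₀ := J ∩ Ici t₀ with hJ₀
  have hset : ∀ t ∈ J₀, J ∩ Ici t = J₀ ∩ Ici t := fun t ht ↦ by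
    ext r
    exact ⟨fun h ↦ ⟨⟨h.1, le_trans (mem_Ici.mp ht.2) h.2⟩, h.2⟩, fun h ↦ ⟨h.1.1, h.2⟩⟩
  have hord : J₀.OrdConnected := hWc.1.inter ordConnected_Ici
  have hmeas : MeasurableSet J₀ := hord.measurableSet
  by_cases hnt : J₀.Nontrivial
  · have h1 : g.IsCausalCurve W J₀ := IsPiecewiseC1Curve.subset hWc inter_subset_left hord hnt
    have hleast : IsLeast J₀ t₀ := ⟨⟨ht₀, self_mem_Ici⟩, fun r hr ↦ hr.2⟩
    have h2 : IsFutureEndpoint W J₀ q := by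
      intro O hO hqO
      obtain ⟨t₁, ht₁, h⟩ := hq O hO hqO
      refine ⟨max t₀ t₁, ⟨?_, mem_Ici.mpr (le_max_left _ _)⟩, fun t ht hle ↦
        h t ht.1 ((le_max_right _ _).trans hle)⟩
      rcases le_total t₀ t₁ with h | h
      · rwa [max_eq_right h]
      · rwa [max_eq_left h]
    have h3 := lintegral_velocity_lt_top h1 hE hleast h2
    rw [← hint] at h3
    refine h3.ne (setLIntegral_congr_fun hmeas fun t ht ↦ ?_)
    simp only [hset t ht]
  · rw [not_nontrivial_iff] at hnt
    rw [Measure.restrict_eq_zero.mpr (hnt.measure_zero volume), lintegral_zero_measure] at hint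
    exact ENNReal.zero_ne_top hint

end FutureInfiniteEndpoint

end LorentzSpacetime

end

/-! ### Limits of causal curves with vanishing defect. -/

set_option maxSynthPendingDepth 3

noncomputable section

namespace LorentzSpacetime

variable {E : Type*} [NormedAddCommGroup E] [NormedSpace ℝ E]

theorem tendsto_clm_apply {F : Type*} [NormedAddCommGroup F] [NormedSpace ℝ F] {α : Type*}
    {l : Filter α} {A : α → E →L[ℝ] F} {A₀ : E →L[ℝ] F} {v : α → E} {v₀ : E}
    (hA : Tendsto A l (𝓝 A₀)) (hv : Tendsto v l (𝓝 v₀)) :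
    Tendsto (fun n ↦ A n (v n)) l (𝓝 (A₀ v₀)) :=
  (isBoundedBilinearMap_apply (𝕜 := ℝ) (E := E) (F := F)).continuous.tendsto (A₀, v₀) |>.comp
    (hA.prodMk_nhds hv)

namespace GoodBox

variable {G : E → E →L[ℝ] E →L[ℝ] ℝ} {Γ : E → E →L[ℝ] E →L[ℝ] E} {y₀ e : E} {ρ K : ℝ}
  (h : GoodBox G Γ y₀ e ρ K)
include h

omit h in
/-- The length parameter of a development takes all intermediate values. -/
theorem exists_dev_len_eq {z : ℝ → E × (E →L[ℝ] E) × (E →L[ℝ] E) × E} {a b : ℝ}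
    (hz : IsDevelopment G Γ y₀ e ρ z a b) {s : ℝ} (hs : 0 ≤ s)
    (hsL : s ≤ -G (z a).1 e (z b).2.2.2) :
    ∃ t ∈ Icc a b, -G (z a).1 e (z t).2.2.2 = s := by
  have hc : ContinuousOn (fun t ↦ -G (z a).1 e (z t).2.2.2) (Icc a b) :=
    (-(G (z a).1 e).comp (devProj E)).continuous.comp_continuousOn (hz.curve.continuousOn hz.lt)
  refine intermediate_value_Icc hz.lt.le hc ⟨?_, hsL⟩
  rw [dev_len_start hz]; exact hs

/-- Causal curves whose initial points converge and whose timelike defects tend to zero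
accumulate at a null geodesic. -/
theorem exists_limit_geodesic [FiniteDimensional ℝ E]
    {z : ℕ → ℝ → E × (E →L[ℝ] E) × (E →L[ℝ] E) × E} {a b : ℕ → ℝ}
    (hz : ∀ n, IsDevelopment G Γ y₀ e ρ (z n) (a n) (b n)) {L : ℕ → ℝ} {m : ℕ → E}
    (hL : ∀ n, L n = -G (z n (a n)).1 e (z n (b n)).2.2.2)
    (hm : ∀ n, m n = (L n)⁻¹ • (z n (b n)).2.2.2)
    (hx : Tendsto (fun n ↦ (z n (a n)).1) atTop (𝓝 y₀)) {l : ℝ} (hl : ∀ n, l ≤ L n)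
    (hμ : Tendsto (fun n ↦ G (z n (a n)).1 (m n) (m n)) atTop (𝓝 0)) :
    ∃ m₀ : E, G y₀ m₀ m₀ = 0 ∧ G y₀ e m₀ = -1 ∧ ‖m₀‖ ≤ K ∧
      ∀ (S : ℝ) (σ w : ℝ → E), (∀ s ∈ Icc 0 S, HasDerivWithinAt σ (w s) (Icc 0 S) s) →
        (∀ s ∈ Icc 0 S, HasDerivWithinAt w (-Γ (σ s) (w s) (w s)) (Icc 0 S) s) →
        (∀ s ∈ Icc 0 S, σ s ∈ Metric.ball y₀ ρ) → (∀ s ∈ Icc 0 S, ‖w s‖ ≤ 4 * K) →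
        σ 0 = y₀ → w 0 = m₀ → S ≤ l → ∀ s ∈ Icc 0 S, ∀ ε > 0,
          ∃ n, ∃ t ∈ Icc (a n) (b n), ‖(z n t).1 - σ s‖ < ε := by
  have hK := h.one_le
  have hK0 := h.K_pos
  have hmean := fun n ↦ h.dev_mean (hz n) (hL n) (hm n)
  have : ProperSpace E := FiniteDimensional.proper ℝ E
  obtain ⟨m₀, hm₀, φ, hφ, hlim⟩ := (isCompact_closedBall (0 : E) K).tendsto_subseq
    (x := m) fun n ↦ mem_closedBall_zero_iff.mpr (hmean n).2.2.2
  have hφt := hφ.tendsto_atTop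
  have hx' : Tendsto (fun n ↦ (z (φ n) (a (φ n))).1) atTop (𝓝 y₀) := hx.comp hφt
  have hG : Tendsto (fun n ↦ G (z (φ n) (a (φ n))).1) atTop (𝓝 (G y₀)) :=
    (h.diff y₀ h.center_mem).continuousAt.tendsto.comp hx'
  have hμ' : Tendsto (fun n ↦ G (z (φ n) (a (φ n))).1 (m (φ n)) (m (φ n))) atTop (𝓝 0) :=
    hμ.comp hφt
  have e1 : G y₀ m₀ m₀ = 0 :=
    tendsto_nhds_unique (tendsto_clm_apply (tendsto_clm_apply hG hlim) hlim) hμ'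
  have e2 : G y₀ e m₀ = -1 := by
    refine tendsto_nhds_unique (tendsto_clm_apply (tendsto_clm_apply hG tendsto_const_nhds) hlim) ?_
    exact (tendsto_congr fun n ↦ (hmean (φ n)).2.2.1).mpr tendsto_const_nhds
  refine ⟨m₀, e1, e2, mem_closedBall_zero_iff.mp hm₀, ?_⟩
  intro S σ w hσ hw hball hwK hσ0 hw0 hSl s hs ε hε
  set δ : ℕ → ℝ := fun n ↦ 1 / ((n : ℝ) + 1) with hδ
  have hδ0 : Tendsto δ atTop (𝓝 0) := tendsto_one_div_add_atTop_nhds_zero_nat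
  have hδpos : ∀ n, 0 < δ n := fun n ↦ Nat.one_div_pos_of_nat
  set ν : ℕ → ℝ := fun n ↦ |G (z (φ n) (a (φ n))).1 (m (φ n)) (m (φ n))| with hν
  have hν0 : Tendsto ν atTop (𝓝 0) := by simpa using hμ'.abs
  -- The square of θ n dominates K times the defect, as `dist_geodesic_le` requires; the summand δ n
  -- keeps θ n positive when the defect vanishes. The same summand serves in N n.
  set θ : ℕ → ℝ := fun n ↦ Real.sqrt (K * ν n) + δ n with hθ
  have hθ0 : Tendsto θ atTop (𝓝 0) := by
    have h1 : Tendsto (fun n ↦ Real.sqrt (K * ν n)) atTop (𝓝 (Real.sqrt (K * 0))) :=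
      (Real.continuous_sqrt.tendsto _).comp (hν0.const_mul K)
    simpa using h1.add hδ0
  set N : ℕ → ℝ := fun n ↦ ‖(z (φ n) (a (φ n))).1 - y₀‖ + ‖m (φ n) - m₀‖ + δ n with hN
  have hN0 : Tendsto N atTop (𝓝 0) := by
    have h1 := tendsto_iff_norm_sub_tendsto_zero.mp hx'
    have h2 := tendsto_iff_norm_sub_tendsto_zero.mp hlim
    simpa using (h1.add h2).add hδ0
  have hB : Tendsto (fun n ↦ 2 * (N n + 4 * K ^ 2 * θ n * (2 * K ^ 2 * ρ))) atTop (𝓝 0) := by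
    have := (hN0.add ((hθ0.const_mul (4 * K ^ 2)).mul_const (2 * K ^ 2 * ρ))).const_mul 2
    simpa using this
  obtain ⟨n, hn⟩ := (hB.eventually (Iio_mem_nhds hε)).exists
  have hθp : 0 < θ n := by have := hδpos n; positivity
  have hdev := hz (φ n)
  obtain ⟨t, ht, hts⟩ := exists_dev_len_eq hdev hs.1
    ((hs.2.trans hSl).trans ((hl (φ n)).trans_eq (hL (φ n))))
  refine ⟨φ n, t, ht, ?_⟩
  have key := h.dist_geodesic_le hdev (hL _) (hm _) hσ hw hball hwK hθp (N := N n) ?_ ?_ ?_ ?_ ht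
    (hts.le.trans hs.2)
  · rw [hts] at key
    refine key.trans_lt (lt_of_le_of_lt ?_ (mem_Iio.mp hn))
    have : L (φ n) ≤ 2 * K ^ 2 * ρ := by
      rw [hL]; exact h.dev_len_upper hdev ⟨hdev.lt.le, le_rfl⟩
    gcongr
  · have h1 : 0 ≤ K * ν n := mul_nonneg hK0.le (abs_nonneg _)
    have h2 : K * -G (z (φ n) (a (φ n))).1 (m (φ n)) (m (φ n)) ≤ K * ν n := by
      gcongr; exact neg_le_abs _
    have h3 := Real.sq_sqrt h1
    have h4 := Real.sqrt_nonneg (K * ν n)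
    have h5 := hδpos n
    simp only [hθ]
    nlinarith [mul_nonneg h4 h5.le]
  · have := hδpos n
    positivity
  · rw [hσ0]
    have := hδpos n
    have := norm_nonneg (m (φ n) - m₀)
    simp only [hN]; linarith
  · rw [hw0]
    have := hδpos n
    have := norm_nonneg ((z (φ n) (a (φ n))).1 - y₀)
    simp only [hN]; linarith

end GoodBox

end LorentzSpacetime

end

set_option maxSynthPendingDepth 3

noncomputable section

namespace LorentzSpacetime

/-! ### Null geodesics in a chart box. -/

section NullGeodesics

variable {d : ℕ} {M : Type*} [TopologicalSpace M] [ChartedSpace (ModelSpace d) M]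
  [IsManifold 𝓘(ℝ, ModelSpace d) ∞ M] {g : LorentzSpacetime d M} {p : M} {e : ModelSpace d}
  {ρ K : ℝ} {σ : ℝ → M} {J : Set ℝ}

theorem IsNullGeodesic.causal (hσ : g.IsNullGeodesic σ J) (hJ : J.OrdConnected)
    (hJ' : J.Nontrivial) : g.IsCausalCurve σ J := by
  refine ⟨hJ, hJ', fun a b hab hsub ↦ ⟨∅, fun u v hu huv hv _ ↦ ?_⟩⟩
  have hs : Icc u v ⊆ J := (Icc_subset_Icc hu hv).trans hsub
  refine ⟨hσ.1.mono hs, fun t ht ↦ ?_⟩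
  have h1 : velocityWithin d σ (Icc u v) t = velocityWithin d σ J t := by
    unfold velocityWithin
    rw [mfderivWithin_subset hs (uniqueDiffOn_Icc huv t ht).uniqueMDiffWithinAt
      (hσ.1.mdifferentiableOn (by simp) t (hs ht))]
  rw [h1]
  exact ⟨(hσ.2.2 t (hs ht)).1.le, (hσ.2.2 t (hs ht)).2⟩

/-- The velocity of a curve in the coordinates of the chart at `p`. -/
def coordVelocity (d : ℕ) {M : Type*} [TopologicalSpace M] [ChartedSpace (ModelSpace d) M]
    (p : M) (σ : ℝ → M) (J : Set ℝ) (s : ℝ) : ModelSpace d :=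
  coordPull p (σ s) (velocityWithin d σ J s)

theorem IsNullGeodesic.hasDerivWithinAt_chart (hσ : g.IsNullGeodesic σ J) {s : ℝ} (hs : s ∈ J)
    (hp : σ s ∈ (chart d p).source) :
    HasDerivWithinAt (fun s ↦ chart d p (σ s)) (coordVelocity d p σ J s) J s :=
  hasDerivWithinAt_chart_comp hp (hσ.1.mdifferentiableOn (by simp) s hs)

theorem IsNullGeodesic.hasDerivWithinAt_coordVelocity (hbox : g.IsChartBox p e ρ K)
    (hσ : g.IsNullGeodesic σ J) {s : ℝ} (hs : s ∈ J)
    (hp : σ s ∈ (chart d p).source ∩ chart d p ⁻¹' Metric.ball (chart d p p) ρ) :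
    HasDerivWithinAt (coordVelocity d p σ J)
      (-christoffelSnd (g.chartForm p) (chart d p (σ s)) (coordVelocity d p σ J s)
        (coordVelocity d p σ J s)) J s :=
  (hσ.2.1 s hs).hasDerivWithinAt hbox hs (hσ.1.mdifferentiableOn (by simp) s hs) hp.1 hp.2

theorem IsChartBox.exists_isDevelopment (hbox : g.IsChartBox p e ρ K) {γ : ℝ → M} {a b : ℝ}
    (hab : a < b) (hγ : g.IsCausalCurve γ (Icc a b))
    (hm : MapsTo γ (Icc a b) ((chart d p).source ∩
      chart d p ⁻¹' Metric.ball (chart d p p) (ρ / 2))) :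
    ∃ z, IsDevelopment (g.chartForm p) (christoffelSnd (g.chartForm p)) (chart d p p) e ρ z a b ∧
      ∀ t, (z t).1 = chart d p (γ t) := by
  have hρ := hbox.good.pos
  have hm' : ∀ t ∈ Icc a b, chart d p (γ t) ∈ Metric.ball (chart d p p) ρ := fun t ht ↦
    Metric.ball_subset_ball (by linarith) (hm ht).2
  have hΓ : ContinuousOn (christoffelSnd (g.chartForm p)) (Metric.ball (chart d p p) ρ) := by
    have : LipschitzOnWith K.toNNReal (christoffelSnd (g.chartForm p))
        (Metric.ball (chart d p p) ρ) := by
      refine LipschitzOnWith.of_dist_le_mul fun x hx y hy ↦ ?_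
      rw [dist_eq_norm, dist_eq_norm, Real.coe_toNNReal _ hbox.good.K_pos.le]
      exact hbox.good.chr_lip x hx y hy
    exact this.continuousOn
  have hc : PWC1 (BoxCausal (g.chartForm p) (chart d p p) e) (chart d p ∘ γ) a b :=
    (hγ.chart_comp hab fun t ht ↦ (hm ht).1).mono fun t ht v hv ↦
      (hbox.causal_iff _ (hm' t ht) v).mp hv
  obtain ⟨w, hw, hdev⟩ := exists_development hΓ hab hc hm'
    (ContinuousLinearMap.id ℝ _, ContinuousLinearMap.id ℝ _, 0)
  exact ⟨fun t ↦ (chart d p (γ t), w t), ⟨hab, hdev, fun t ht ↦ (hm ht).2, hw⟩, fun _ ↦ rfl⟩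

theorem IsChartBox.chron_of_boxTimelike (hbox : g.IsChartBox p e ρ K) {c : ℝ → ModelSpace d}
    {a b : ℝ} (hab : a < b) (hc : PWC1 (BoxTimelike (g.chartForm p) (chart d p p) e) c a b)
    (hm : MapsTo c (Icc a b) (Metric.ball (chart d p p) ρ)) :
    g.Chron ((chart d p).symm (c a)) ((chart d p).symm (c b)) :=
  ⟨_, a, b, hab, g.isTimelikeCurve_of_chart hab
    (hc.mono fun _ ht v hv ↦ (hbox.timelike_iff _ (hm ht) v).mpr hv)
    (fun _ ht ↦ hbox.sub (hm ht)), rfl, rfl⟩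

end NullGeodesics

/-! ### Null generators through boundary points of endless past sets. -/

section LocalGenerator

variable {d : ℕ} {M : Type*} [TopologicalSpace M] [ChartedSpace (ModelSpace d) M]
  [IsManifold 𝓘(ℝ, ModelSpace d) ∞ M] {g : LorentzSpacetime d M}

/-- Open past sets in which every point starts an endless timelike curve. -/
structure IsEndlessPast (g : LorentzSpacetime d M) (V : Set M) : Prop where
  isOpen : IsOpen V
  past : ∀ x y, y ∈ V → g.Chron x y → x ∈ V
  endless : ∀ q ∈ V, ∃ γ : ℝ → M, g.IsTimelikeCurve γ (Ici 0) ∧ γ 0 = q ∧ MapsTo γ (Ici 0) V ∧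
    ¬ ∃ p, IsFutureEndpoint γ (Ici 0) p

namespace IsEndlessPast

variable {V : Set M} (hV : g.IsEndlessPast V)
include hV

/-- The open future of x contains y and therefore meets V. In particular the boundary of V is
achronal. -/
theorem mem_of_chron_closure {x y : M} (hy : y ∈ closure V) (hxy : g.Chron x y) : x ∈ V := by
  obtain ⟨w, hw, hwV⟩ := mem_closure_iff.mp hy _ (isOpen_chron_future x) hxy
  exact hV.past _ _ hwV hw

/-- The endless curve from γ t provides a chronologically later point of V, so push-up replaces the
causal relation by a chronological one. -/
theorem mem_of_causal {γ : ℝ → M} {J : Set ℝ} (hγ : g.IsCausalCurve γ J) {s t : ℝ} (hs : s ∈ J)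
    (ht : t ∈ J) (hst : s ≤ t) (hmem : γ t ∈ V) : γ s ∈ V := by
  obtain ⟨c, hc, hc0, hcV, -⟩ := hV.endless _ hmem
  have h1 : g.Chron (c 0) (c 1) := IsTimelikeCurve.chron hc (by simp) (by simp) one_pos
  rw [hc0] at h1
  exact hV.past _ _ (hcV (by simp : (1 : ℝ) ∈ Ici 0)) (Chron.causal_trans_of_mem hγ hs ht hst h1)

/-- An endless curve from a point of V near q must reach the sphere of radius ρ/4. Starting within
ρ/8 of the centre it is displaced by at least ρ/8, and displacement is at most 2K times length. This
uniform lower bound prevents the limit geodesic from shrinking to a point. -/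
theorem exists_development_near {q : M} (hq : q ∈ closure V) {e : ModelSpace d} [T2Space M]
    {ρ K : ℝ} (hbox : g.IsChartBox q e ρ K) {δ : ℝ} (hδ : 0 < δ) :
    ∃ z a b, IsDevelopment (g.chartForm q) (christoffelSnd (g.chartForm q)) (chart d q q) e ρ
        z a b ∧ (∀ t ∈ Icc a b, (chart d q).symm (z t).1 ∈ V) ∧
      ‖(z a).1 - chart d q q‖ < δ ∧ ρ / (16 * K) ≤ -g.chartForm q (z a).1 e (z b).2.2.2 := by
  set y₀ := chart d q q with hy₀
  have hρ := hbox.good.pos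
  have hK := hbox.good.K_pos
  have hpos : 0 < min (ρ / 8) δ := by positivity
  obtain ⟨x, ⟨hx1, hx2⟩, hxV⟩ := mem_closure_iff_nhds.mp hq _ (chart_ball_mem_nhds (d := d) q hpos)
  have hx2 : dist (chart d q x) y₀ < min (ρ / 8) δ := hx2
  obtain ⟨γ, hγ, rfl, hm, hend⟩ := hV.endless x hxV
  have h8 := hx2.trans_le (min_le_left _ _)
  obtain ⟨t₁, ht₁, hlt, h1, h2⟩ := hbox.exists_exit (r := ρ / 4) (by linarith) hγ.causal hend
    self_mem_Ici hx1 (Metric.mem_ball.mpr (h8.trans (by linarith)))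
  have hsub : Icc 0 t₁ ⊆ Ici (0 : ℝ) := Icc_subset_Ici_self
  obtain ⟨z, hz, hzγ⟩ := hbox.exists_isDevelopment hlt
    (IsPiecewiseC1Curve.sub_Icc hγ.causal hlt self_mem_Ici ht₁)
    (h1.mono_right (inter_subset_inter_right _ (preimage_mono
      (Metric.closedBall_subset_ball (by linarith)))))
  refine ⟨z, 0, t₁, hz, fun t ht ↦ ?_, ?_, ?_⟩
  · rw [hzγ, (chart d q).left_inv (h1 ht).1]
    exact hm (hsub ht)
  · rw [hzγ, ← dist_eq_norm]
    exact hx2.trans_le (min_le_right _ _)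
  · have h3 := hbox.good.dev_dist_le hz (t := t₁) ⟨hlt.le, le_rfl⟩
    rw [Metric.mem_sphere] at h2
    have h4 : ρ / 8 ≤ ‖(z t₁).1 - (z 0).1‖ := by
      rw [hzγ, hzγ, ← dist_eq_norm]
      linarith [dist_triangle (chart d q (γ t₁)) (chart d q (γ 0)) y₀]
    rw [div_le_iff₀ (by positivity)]
    linarith

/-- Every boundary point of an endless past set is the initial point of a boundary null geodesic. -/
theorem exists_local_generator [T2Space M] {q : M} (hq : q ∈ frontier V) :
    ∃ v : Tgt (d := d) q, g.FutureNull q v ∧ ∀ σ : ℝ → M, g.IsNullGeodesic σ (Ici 0) →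
      (⟨σ 0, velocityWithin d σ (Ici 0) 0⟩ : TangentBundle 𝓘(ℝ, ModelSpace d) M) = ⟨q, v⟩ →
      ∃ S > 0, ∀ s ∈ Icc 0 S, σ s ∈ frontier V := by
  have hfr : frontier V = closure V \ V := hV.isOpen.frontier_eq
  rw [hfr] at hq
  obtain ⟨e, K, ρ, hρ, hbox⟩ := g.exists_isChartBox q
  have hbox := hbox ρ hρ le_rfl
  have hG := hbox.good
  have hK := hG.K_pos
  set y₀ := chart d q q with hy₀
  have hy₀t : y₀ ∈ (chart d q).target := mem_extChartAt_target q
  have hqs : q ∈ (chart d q).source := mem_extChartAt_source q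
  have hinv : (chart d q).symm y₀ = q := extChartAt_to_inv q
  set δ : ℕ → ℝ := fun n ↦ 1 / ((n : ℝ) + 1) with hδ
  have hδ0 : Tendsto δ atTop (𝓝 0) := tendsto_one_div_add_atTop_nhds_zero_nat
  have hδpos : ∀ n, 0 < δ n := fun n ↦ Nat.one_div_pos_of_nat
  choose z a b hz hzV hza hzl using fun n ↦ hV.exists_development_near hq.1 hbox (hδpos n)
  set L : ℕ → ℝ := fun n ↦ -g.chartForm q (z n (a n)).1 e (z n (b n)).2.2.2 with hL
  set m : ℕ → ModelSpace d := fun n ↦ (L n)⁻¹ • (z n (b n)).2.2.2 with hm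
  set l := ρ / (16 * K) with hl
  have hl0 : 0 < l := by positivity
  have hx : Tendsto (fun n ↦ (z n (a n)).1) atTop (𝓝 y₀) := by
    rw [tendsto_iff_norm_sub_tendsto_zero]
    exact squeeze_zero (fun _ ↦ norm_nonneg _) (fun n ↦ (hza n).le) hδ0
  set C := 10 ^ 6 * K ^ 12 / l with hC
  have hC0 : 0 < C := by positivity
  -- If the defect exceeded √(C δ n), the n-th curve could be deformed into a timelike curve
  -- starting at q itself and ending in V, so q would lie in V. The constant C matches the
  -- admissible displacement with the bound l on the length.
  have hμ : Tendsto (fun n ↦ g.chartForm q (z n (a n)).1 (m n) (m n)) atTop (𝓝 0) := by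
    have hsq : Tendsto (fun n ↦ Real.sqrt (C * δ n)) atTop (𝓝 0) := by
      have h1 : Tendsto (fun n ↦ Real.sqrt (C * δ n)) atTop (𝓝 (Real.sqrt (C * 0))) :=
        (Real.continuous_sqrt.tendsto _).comp (hδ0.const_mul C)
      simpa using h1
    refine squeeze_zero_norm (fun n ↦ ?_) hsq
    have hneg := hG.dev_mean_causal (hz n) (L := L n) (m := m n) rfl rfl
    rw [Real.norm_eq_abs, abs_of_nonpos hneg]
    by_contra! hcon
    set μ := -g.chartForm q (z n (a n)).1 (m n) (m n) with hμ
    have hμ0 : 0 < μ := (Real.sqrt_nonneg _).trans_lt hcon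
    have hμ2 : C * δ n < μ ^ 2 := (Real.sqrt_lt' hμ0).mp hcon
    obtain ⟨c, hc, hcm, hca, hcb⟩ := hG.exists_timelike_of_defect (hz n) (L := L n) (m := m n)
      (μ := μ) (w := y₀ - (z n (a n)).1) rfl rfl rfl hμ0 (by
        rw [norm_sub_rev]
        refine (hza n).le.trans ?_
        have h1 : δ n = l * (C * δ n / (10 ^ 6 * K ^ 12)) := by rw [hC]; field_simp
        rw [h1]
        have h2 : l ≤ L n := hzl n
        have := hδpos n
        have h4 : 0 ≤ L n := hl0.le.trans h2
        gcongr)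
    have h3 := hbox.chron_of_boxTimelike (hz n).lt hc hcm
    rw [hca, hcb, add_sub_cancel, hinv] at h3
    exact hq.2 (hV.past _ _ (hzV n _ ⟨(hz n).lt.le, le_rfl⟩) h3)
  obtain ⟨m₀, hm1, hm2, hm3, hlim⟩ := hG.exists_limit_geodesic hz (fun _ ↦ rfl) (fun _ ↦ rfl) hx
    hzl hμ
  set v : Tgt (d := d) q := coordPush q y₀ m₀ with hv
  have hpull : coordPull q q v = m₀ := by
    have := coordPull_coordPush hy₀t m₀
    rwa [hinv] at this
  refine ⟨v, ?_, fun σ hσ hσ0 ↦ ?_⟩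
  · have h1 : BoxCausal (g.chartForm q) y₀ e y₀ m₀ := ⟨hm1.le, by rw [hm2]; norm_num⟩
    rw [← hbox.causal_iff _ hG.center_mem, chartCausal_iff _ hy₀t] at h1
    have h5 : ∀ (x' : M) (w : ModelSpace d), x' = q → w = v → g.FutureCausal x' w →
        g.FutureCausal q v := by
      rintro x' w rfl rfl h; exact h
    refine ⟨?_, (h5 _ _ hinv rfl h1).2⟩
    have h6 := g.chartForm_coordPull hqs v v
    rw [hpull] at h6
    exact h6.symm.trans hm1
  · have hσq : σ 0 = q := congrArg Bundle.TotalSpace.proj hσ0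
    have hw0 : coordVelocity d q σ (Ici 0) 0 = m₀ := by
      rw [← hpull]
      exact congrArg (fun X : TangentBundle 𝓘(ℝ, ModelSpace d) M ↦ coordPull q X.1 X.2) hσ0
    have hcaus := hσ.causal ordConnected_Ici ⟨0, by simp, 1, by simp, zero_ne_one⟩
    have hσc : ContinuousOn σ (Ici 0) := hσ.1.continuousOn
    have hnear : ∀ᶠ s in 𝓝[≥] (0 : ℝ), σ s ∈ (chart d q).source ∩
        chart d q ⁻¹' Metric.ball y₀ ρ :=
      (hσc 0 self_mem_Ici).preimage_mem_nhdsWithin (by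
        rw [hσq]; exact chart_ball_mem_nhds (d := d) q hρ)
    have hbd : ∀ᶠ s in 𝓝[≥] (0 : ℝ), ‖coordVelocity d q σ (Ici 0) s‖ < 4 * K := by
      have h1 := (hσ.hasDerivWithinAt_coordVelocity hbox self_mem_Ici
        (hnear.self_of_nhdsWithin self_mem_Ici)).continuousWithinAt.norm
      refine h1.eventually_lt continuousWithinAt_const ?_
      simp only [hw0]; linarith
    obtain ⟨S₀, hS₀, hS₀'⟩ := mem_nhdsGE_iff_exists_Icc_subset.mp (hnear.and hbd)
    set S := min S₀ l with hS
    have hS0 : 0 < S := lt_min hS₀ hl0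
    have hSsub : Icc 0 S ⊆ Icc 0 S₀ := Icc_subset_Icc le_rfl (min_le_left _ _)
    have hSI : Icc 0 S ⊆ Ici 0 := Icc_subset_Ici_self
    refine ⟨S, hS0, fun s hs ↦ ?_⟩
    rw [hfr]
    -- The geodesic is a limit of points of V, hence in the closure; it does not enter V, since q
    -- lies in its causal past and outside V.
    refine ⟨?_, fun hsV ↦ hq.2 ?_⟩
    swap
    · rw [← hσq]
      exact hV.mem_of_causal hcaus self_mem_Ici (hSI hs) hs.1 hsV
    have key := hlim S (fun s ↦ chart d q (σ s)) (coordVelocity d q σ (Ici 0))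
      (fun s hs ↦ (hσ.hasDerivWithinAt_chart (hSI hs) (hS₀' (hSsub hs)).1.1).mono hSI)
      (fun s hs ↦ (hσ.hasDerivWithinAt_coordVelocity hbox (hSI hs) (hS₀' (hSsub hs)).1).mono hSI)
      (fun s hs ↦ (hS₀' (hSsub hs)).1.2) (fun s hs ↦ (hS₀' (hSsub hs)).2.le)
      (by rw [hσq]) hw0 (min_le_right _ _) s hs
    have hsm := (hS₀' (hSsub hs)).1
    rw [mem_closure_iff]
    intro O hO hsO
    have hnb : (chart d q).symm ⁻¹' O ∈ 𝓝 (chart d q (σ s)) :=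
      (continuousAt_extChartAt_symm' hsm.1).preimage_mem_nhds (hO.mem_nhds (by
        rwa [(chart d q).left_inv hsm.1]))
    obtain ⟨ε, hε, hball⟩ := Metric.mem_nhds_iff.mp hnb
    obtain ⟨n, t, ht, hnt⟩ := key ε hε
    exact ⟨_, hball (mem_ball_iff_norm.mpr hnt), hzV n t ht⟩

end IsEndlessPast

end LocalGenerator

end LorentzSpacetime

end

/-! ### Completeness of the generators. -/

set_option maxSynthPendingDepth 3

noncomputable section

namespace LorentzSpacetime

namespace GoodBox

variable {E : Type*} [NormedAddCommGroup E] [NormedSpace ℝ E]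
  {G : E → E →L[ℝ] E →L[ℝ] ℝ} {Γ : E → E →L[ℝ] E →L[ℝ] E} {y₀ e : E} {ρ K : ℝ}
  (h : GoodBox G Γ y₀ e ρ K) {z : ℝ → E × (E →L[ℝ] E) × (E →L[ℝ] E) × E} {a b : ℝ}
  (hz : IsDevelopment G Γ y₀ e ρ z a b)
include h hz

/-- A causal curve whose mean direction is null is a geodesic. -/
theorem eq_geodesic_of_null {L S : ℝ} {m : E} {σ w : ℝ → E} (hL : L = -G (z a).1 e (z b).2.2.2)
    (hm : m = L⁻¹ • (z b).2.2.2) (hμ : G (z a).1 m m = 0)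
    (hσ : ∀ s ∈ Icc 0 S, HasDerivWithinAt σ (w s) (Icc 0 S) s)
    (hw : ∀ s ∈ Icc 0 S, HasDerivWithinAt w (-Γ (σ s) (w s) (w s)) (Icc 0 S) s)
    (hball : ∀ s ∈ Icc 0 S, σ s ∈ Metric.ball y₀ ρ) (hwK : ∀ s ∈ Icc 0 S, ‖w s‖ ≤ 4 * K)
    (hσ0 : σ 0 = (z a).1) (hw0 : w 0 = m) {t : ℝ} (ht : t ∈ Icc a b)
    (hR : -G (z a).1 e (z t).2.2.2 ≤ S) :
    (z t).1 = σ (-G (z a).1 e (z t).2.2.2) := by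
  have hK := h.K_pos
  obtain ⟨hL0, -⟩ := h.dev_mean hz hL hm
  have key : ∀ θ > 0, ‖(z t).1 - σ (-G (z a).1 e (z t).2.2.2)‖ ≤ 2 * (θ + 4 * K ^ 2 * θ * L) :=
    fun θ hθ ↦ h.dist_geodesic_le hz hL hm hσ hw hball hwK hθ (by rw [hμ]; simp; positivity) hθ
      (by rw [hσ0, sub_self, norm_zero]; exact hθ.le) (by rw [hw0, sub_self, norm_zero]; exact hθ.le)
      ht hR
  rw [← sub_eq_zero, ← norm_le_zero_iff]
  refine le_of_forall_pos_le_add fun ε hε ↦ ?_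
  have hpos : 0 < 2 * (1 + 4 * K ^ 2 * L) := by positivity
  have h1 := key (ε / (2 * (1 + 4 * K ^ 2 * L))) (by positivity)
  refine h1.trans_eq ?_
  field_simp
  ring

/-- At the initial point the transport is the identity, so curve and development have the same
velocity, and the development runs straight along m. -/
theorem initial_velocity_of_null {L : ℝ} {m u : E} (hL : L = -G (z a).1 e (z b).2.2.2)
    (hm : m = L⁻¹ • (z b).2.2.2) (hμ : G (z a).1 m m = 0)
    (hu : HasDerivWithinAt (fun t ↦ (z t).1) u (Ici a) a) :
    u = (-G (z a).1 e u) • m := by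
  obtain ⟨v, hv, hv'⟩ := hz.curve.exists_hasDerivWithinAt ⟨le_rfl, hz.lt⟩
  have h1 : HasDerivWithinAt (fun t ↦ (z t).1) v.1 (Ici a) a :=
    (devBase E).hasFDerivAt.comp_hasDerivWithinAt a hv
  have hv1 : v.1 = u := (uniqueDiffOn_Ici a a self_mem_Ici).eq_deriv _ h1 hu
  have hv2 : v.2.2.2 = u := by
    have h2 := hv'.2.2.2
    rw [hz.start, hv1] at h2
    exact h2
  have d1 : HasDerivWithinAt (fun t ↦ devProj E (z t)) (devProj E v) (Icc a b) a :=
    ((devProj E).hasFDerivAt.comp_hasDerivWithinAt a hv).mono Icc_subset_Ici_self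
  have d2 : HasDerivWithinAt (fun t ↦ ((-(G (z a).1 e).comp (devProj E)).smulRight m) (z t))
      (((-(G (z a).1 e).comp (devProj E)).smulRight m) v) (Icc a b) a :=
    (((-(G (z a).1 e).comp (devProj E)).smulRight m).hasFDerivAt.comp_hasDerivWithinAt a hv).mono
      Icc_subset_Ici_self
  have d3 := d2.congr (f₁ := fun t ↦ devProj E (z t)) (fun t ht ↦ h.dev_straight hz hL hm hμ ht)
    (h.dev_straight hz hL hm hμ ⟨le_rfl, hz.lt.le⟩)
  have h3 := (uniqueDiffOn_Icc hz.lt a ⟨le_rfl, hz.lt.le⟩).eq_deriv _ d1 d3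
  have h4 : v.2.2.2 = (-G (z a).1 e v.2.2.2) • m := h3
  rwa [hv2] at h4

end GoodBox

section Continuation

variable {d : ℕ} {M : Type*} [TopologicalSpace M] [ChartedSpace (ModelSpace d) M]
  [IsManifold 𝓘(ℝ, ModelSpace d) ∞ M] {g : LorentzSpacetime d M} {V : Set M}

/-- The concatenation of two causal curves parametrised by intervals. -/
theorem IsCausalCurve.concat_translate {σ τ : ℝ → M} {a T δ : ℝ} (haT : a < T) (hδ : 0 < δ)
    (hσ : g.IsCausalCurve σ (Icc a T)) (hτ : g.IsCausalCurve τ (Icc 0 δ)) (h0 : τ 0 = σ T) :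
    g.IsCausalCurve (concatAt T σ fun s ↦ τ (s + -T)) (Icc a (T + δ)) := by
  have h1 := IsPiecewiseC1Curve.translate hτ (-T)
  have h2 : (fun s ↦ s + -T) ⁻¹' Icc 0 δ = Icc T (T + δ) := by
    ext s; simp only [mem_preimage, mem_Icc]; constructor <;> rintro ⟨h1, h2⟩ <;> constructor <;> linarith
  rw [h2] at h1
  have h3 := IsPiecewiseC1Curve.concat (t₁ := T) hσ h1 (isGreatest_Icc haT.le)
    (isLeast_Icc (by linarith)) (by simp [h0])
  rwa [Icc_union_Icc_eq_Icc haT.le (by linarith)] at h3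

/-- A boundary generator τ attached at σ T cannot form a corner: the joined curve lies in the
achronal boundary, so its mean direction is null and it is an unbroken geodesic. Comparison with σ,
which has the same initial data up to scale, shows that σ follows the joined curve past T. -/
theorem IsEndlessPast.exists_continuation [T2Space M] (hV : g.IsEndlessPast V)
    (hcomplete : g.FutureNullComplete) {σ : ℝ → M} (hσ : g.IsNullGeodesic σ (Ici 0)) {T : ℝ}
    (hT : 0 < T) (hA : ∀ s ∈ Icc 0 T, σ s ∈ frontier V) :
    ∃ T' > T, ∀ s ∈ Icc 0 T', σ s ∈ frontier V := by
  have hfr : frontier V = closure V \ V := hV.isOpen.frontier_eq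
  set p := σ T with hp
  have hpA : p ∈ frontier V := hA T ⟨hT.le, le_rfl⟩
  obtain ⟨v, hv, hgen⟩ := hV.exists_local_generator hpA
  obtain ⟨τ, hτ, hτ0⟩ := hcomplete p v hv
  obtain ⟨S₂, hS₂, hτA⟩ := hgen τ hτ hτ0
  have hτp : τ 0 = p := congrArg Bundle.TotalSpace.proj hτ0
  obtain ⟨e, K, ρ, hρ, hbox⟩ := g.exists_isChartBox p
  have hbox := hbox ρ hρ le_rfl
  have hG := hbox.good
  have hK := hG.K_pos
  set y₀ := chart d p p with hy₀
  set w := coordVelocity d p σ (Ici 0) with hw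
  set B := (chart d p).source ∩ chart d p ⁻¹' Metric.ball y₀ (ρ / 2) with hB
  have hBsub : B ⊆ (chart d p).source ∩ chart d p ⁻¹' Metric.ball y₀ ρ := fun x hx ↦
    ⟨hx.1, Metric.ball_subset_ball (by linarith) hx.2⟩
  have hBnhds : B ∈ 𝓝 p := chart_ball_mem_nhds (d := d) p (by positivity)
  have hnt : (Ici (0 : ℝ)).Nontrivial := ⟨0, by simp, 1, by simp, zero_ne_one⟩
  have hσcaus := hσ.causal ordConnected_Ici hnt
  have hτcaus := hτ.causal ordConnected_Ici hnt
  set l : ModelSpace d →L[ℝ] ℝ := -(g.chartForm p y₀ e) with hl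
  have hbc : ∀ s, 0 ≤ s → σ s ∈ B → BoxCausal (g.chartForm p) y₀ e (chart d p (σ s)) (w s) :=
    fun s hs hsB ↦ hbox.boxCausal hsB.1 (hBsub hsB).2
      ⟨(hσ.2.2 s hs).1.le, (hσ.2.2 s hs).2⟩
  have hlpos : ∀ s, 0 ≤ s → σ s ∈ B → 0 < l (w s) := fun s hs hsB ↦ by
    have := (hbc s hs hsB).2
    show 0 < -(g.chartForm p y₀ e (w s))
    linarith
  have hpB : σ T ∈ B := mem_of_mem_nhds hBnhds
  have hlT := hlpos T hT.le hpB
  -- The bounds on the time component of the velocity ensure that, after rescaling, the speed of σ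
  -- stays below the 4K required by `eq_geodesic_of_null`.
  obtain ⟨η, hη, hηsub⟩ : ∃ η > 0, ∀ s ∈ Icc (T - η) (T + η), 0 ≤ s ∧ σ s ∈ B ∧
      2 / 3 * l (w T) < l (w s) ∧ l (w s) < 4 / 3 * l (w T) := by
    have hI : Ici (0 : ℝ) ∈ 𝓝 T := Ici_mem_nhds hT
    have h1 : ∀ᶠ s in 𝓝 T, σ s ∈ B :=
      (hσ.1.continuousOn.continuousAt hI).preimage_mem_nhds hBnhds
    have h2 : ContinuousAt (fun s ↦ l (w s)) T :=
      l.continuous.continuousAt.comp ((hσ.hasDerivWithinAt_coordVelocity hbox hT.le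
        (hBsub hpB)).continuousWithinAt.continuousAt hI)
    have h3 : ∀ᶠ s in 𝓝 T, 2 / 3 * l (w T) < l (w s) :=
      h2.eventually_const_lt (by linarith)
    have h4 : ∀ᶠ s in 𝓝 T, l (w s) < 4 / 3 * l (w T) :=
      h2.eventually_lt_const (by linarith)
    have h0 : ∀ᶠ s in 𝓝 T, 0 ≤ s := hI
    obtain ⟨η, hη, hsub⟩ := Metric.nhds_basis_closedBall.mem_iff.mp
      (h0.and (h1.and (h3.and h4)))
    refine ⟨η, hη, fun s hs ↦ hsub ?_⟩
    rwa [Real.closedBall_eq_Icc]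
  obtain ⟨δ, hδ, hδ2, hδsub⟩ : ∃ δ > 0, δ ≤ S₂ ∧ ∀ s ∈ Icc 0 δ, τ s ∈ B := by
    have h1 : ∀ᶠ s in 𝓝[≥] (0 : ℝ), τ s ∈ B :=
      (hτ.1.continuousOn 0 self_mem_Ici).preimage_mem_nhdsWithin (by rwa [hτp])
    obtain ⟨δ, hδ, hsub⟩ := mem_nhdsGE_iff_exists_Icc_subset.mp h1
    exact ⟨min δ S₂, lt_min hδ hS₂, min_le_right _ _, fun s hs ↦
      hsub ⟨hs.1, hs.2.trans (min_le_left _ _)⟩⟩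
  set a := T - η with ha
  set b := T + δ with hb
  have haT : a < T := by linarith
  have hTb : T < b := by linarith
  have ha0 : 0 ≤ a := (hηsub a ⟨le_rfl, by linarith⟩).1
  set κ : ℝ → M := concatAt T σ fun s ↦ τ (s + -T) with hκ
  have hκ1 : ∀ s, s ≤ T → κ s = σ s := fun s hs ↦ by simp only [hκ, concatAt, if_pos hs]
  have hκ2 : ∀ s, T < s → κ s = τ (s + -T) := fun s hs ↦ by
    simp only [hκ, concatAt, if_neg (not_le.mpr hs)]
  have hκc : g.IsCausalCurve κ (Icc a b) := IsCausalCurve.concat_translate haT hδ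
    (IsPiecewiseC1Curve.sub_Icc hσcaus haT ha0 hT.le)
    (IsPiecewiseC1Curve.sub_Icc hτcaus hδ self_mem_Ici hδ.le) hτp
  have hκm : MapsTo κ (Icc a b) B := fun s hs ↦ by
    rcases le_or_gt s T with h | h
    · rw [hκ1 s h]; exact (hηsub s ⟨hs.1, by linarith⟩).2.1
    · rw [hκ2 s h]; exact hδsub _ ⟨by linarith, by have := hs.2; linarith⟩
  have hκA : ∀ s ∈ Icc a b, κ s ∈ frontier V := fun s hs ↦ by
    rcases le_or_gt s T with h | h
    · rw [hκ1 s h]; exact hA s ⟨ha0.trans hs.1, h⟩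
    · rw [hκ2 s h]; exact hτA _ ⟨by linarith, by have := hs.2; linarith⟩
  obtain ⟨z, hz, hzκ⟩ := hbox.exists_isDevelopment (haT.trans hTb) hκc hκm
  have hab := hz.lt
  have haI : a ∈ Icc a b := ⟨le_rfl, hab.le⟩
  have hbI : b ∈ Icc a b := ⟨hab.le, le_rfl⟩
  set L := -g.chartForm p (z a).1 e (z b).2.2.2 with hL
  set m := L⁻¹ • (z b).2.2.2 with hm
  have hsymm : ∀ s ∈ Icc a b, (chart d p).symm (z s).1 = κ s := fun s hs ↦ by
    rw [hzκ, (chart d p).left_inv (hκm hs).1]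
  have hL0 := (hG.dev_mean hz (L := L) (m := m) rfl rfl).1
  -- A timelike mean direction would yield, with displacement w = 0, a timelike curve between two
  -- boundary points.
  have hμ : g.chartForm p (z a).1 m m = 0 := by
    refine le_antisymm (hG.dev_mean_causal hz (L := L) rfl rfl) ?_
    by_contra! hneg
    obtain ⟨c, hc, hcm, hca, hcb⟩ := hG.exists_timelike_of_defect hz (L := L) (m := m) (w := 0)
      rfl rfl rfl (neg_pos.mpr hneg) (by rw [norm_zero]; positivity)
    have h3 := hbox.chron_of_boxTimelike hab hc hcm
    rw [hca, hcb, add_zero, hsymm a haI, hsymm b hbI] at h3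
    have h4 := hκA b hbI
    have h5 := hκA a haI
    rw [hfr] at h4 h5
    exact h5.2 (hV.mem_of_chron_closure h4.1 h3)
  have hza : (z a).1 = chart d p (σ a) := by rw [hzκ, hκ1 a haT.le]
  have haη := hηsub a ⟨le_rfl, by linarith⟩
  set r := -g.chartForm p (z a).1 e (w a) with hr
  have hwa : w a = r • m := by
    refine hG.initial_velocity_of_null hz (L := L) rfl rfl hμ ?_
    have h1 : HasDerivWithinAt (fun s ↦ chart d p (σ s)) (w a) (Ici a) a :=
      (hσ.hasDerivWithinAt_chart ha0 haη.2.1.1).mono (Ici_subset_Ici.mpr ha0)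
    refine h1.congr_of_eventuallyEq_of_mem ?_ self_mem_Ici
    filter_upwards [Icc_mem_nhdsGE haT] with s hs
    rw [hzκ, hκ1 s hs.2]
  have hrl : 99 / 100 * l (w a) ≤ r := by
    rw [hr, hza]
    exact hG.time_lower (hBsub haη.2.1).2 (hBsub haη.2.1).2 (hbc a ha0 haη.2.1)
  have hr0 : 0 < r := by have := haη.2.2.1; linarith
  -- The substitution s ↦ a + s/r gives σ the initial velocity m, and s = S corresponds to the
  -- parameter T + η.
  set S := 2 * η * r with hS
  have hSI : ∀ s ∈ Icc 0 S, a + r⁻¹ * s ∈ Icc (T - η) (T + η) := fun s hs ↦ by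
    have h1 : r⁻¹ * s ≤ 2 * η := by
      rw [inv_mul_le_iff₀ hr0]; linarith [hs.2]
    have h2 : 0 ≤ r⁻¹ * s := mul_nonneg (inv_nonneg.mpr hr0.le) hs.1
    constructor <;> linarith
  have hφ : ∀ s, HasDerivWithinAt (fun s ↦ a + r⁻¹ * s) r⁻¹ (Icc 0 S) s := fun s ↦ by
    simpa using! (((hasDerivAt_id s).const_mul r⁻¹).const_add a).hasDerivWithinAt
  have hφm : MapsTo (fun s ↦ a + r⁻¹ * s) (Icc 0 S) (Ici 0) := fun s hs ↦ (hηsub _ (hSI s hs)).1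
  have heq := fun t (ht : t ∈ Icc a b) ↦ hG.eq_geodesic_of_null hz (L := L) (m := m) (S := S)
    (σ := fun s ↦ chart d p (σ (a + r⁻¹ * s))) (w := fun s ↦ r⁻¹ • w (a + r⁻¹ * s)) rfl rfl hμ
    (fun s hs ↦ HasDerivWithinAt.scomp s
      (hσ.hasDerivWithinAt_chart (hφm hs) (hηsub _ (hSI s hs)).2.1.1) (hφ s) hφm)
    (fun s hs ↦ by
      have h1 := HasDerivWithinAt.scomp s (hσ.hasDerivWithinAt_coordVelocity hbox (hφm hs)
        (hBsub (hηsub _ (hSI s hs)).2.1)) (hφ s) hφm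
      have h2 := h1.const_smul r⁻¹
      convert! h2 using 1
      simp only [map_smul, smul_apply, smul_neg]
      rfl)
    (fun s hs ↦ (hBsub (hηsub _ (hSI s hs)).2.1).2)
    (fun s hs ↦ by
      obtain ⟨k1, k2, k3, k4⟩ := hηsub _ (hSI s hs)
      have h1 : ‖w (a + r⁻¹ * s)‖ ≤ K * l (w (a + r⁻¹ * s)) :=
        hG.norm_le_time (hBsub k2).2 (hbc _ k1 k2)
      have h2 := haη.2.2.1
      rw [norm_smul, norm_inv, Real.norm_of_nonneg hr0.le, inv_mul_le_iff₀ hr0]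
      have h3 : l (w (a + r⁻¹ * s)) ≤ 4 * r := by linarith
      nlinarith)
    (by simp only [mul_zero, add_zero]; exact hza.symm)
    (by simp only [mul_zero, add_zero]; rw [hwa, smul_smul, inv_mul_cancel₀ hr0.ne', one_smul]) ht
  have hmono : ∀ s t, a ≤ s → s < t → t ≤ b → l (z s).1 < l (z t).1 := fun s t hs hst ht ↦
    hz.curve.apply_lt_apply hab (l.comp (devBase _)) (fun t ht v hv ↦ by
      have := hv.1.2
      show 0 < -(g.chartForm p y₀ e v.1)
      linarith) hs hst ht
  -- The joined curve is longer than its part up to σ T, which has length r η. Otherwise its end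
  -- point would be an earlier point of σ, against the strict growth of the time coordinate.
  have hRb : r * η < L := by
    by_contra! hle
    have h1 := heq b hbI (hle.trans (by rw [hS]; nlinarith))
    have h2 : r⁻¹ * L ≤ η := by rw [inv_mul_le_iff₀ hr0]; exact hle
    have h3 : 0 ≤ r⁻¹ * L := by positivity
    have h4 : (z b).1 = (z (a + r⁻¹ * L)).1 := by
      rw [hzκ (a + r⁻¹ * L), hκ1 _ (by linarith)]
      exact h1
    have h5 := hmono (a + r⁻¹ * L) b (by linarith) (by linarith) le_rfl
    rw [h4] at h5
    exact lt_irrefl _ h5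
  refine ⟨a + r⁻¹ * min L S, ?_, fun s hs ↦ ?_⟩
  · have h1 : r * η < min L S := lt_min hRb (by rw [hS]; nlinarith)
    have h2 : η < r⁻¹ * min L S := by
      rw [← div_eq_inv_mul, lt_div_iff₀ hr0]; linarith
    show T < a + r⁻¹ * min L S
    linarith
  · rcases le_or_gt s T with h | h
    · exact hA s ⟨hs.1, h⟩
    have h1 : r * (s - a) ≤ min L S := by
      have h2 : s - a ≤ r⁻¹ * min L S := by linarith [hs.2]
      rwa [← div_eq_inv_mul, le_div_iff₀ hr0, mul_comm] at h2
    have h2 : 0 ≤ r * (s - a) := mul_nonneg hr0.le (by linarith)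
    obtain ⟨t, ht, hts⟩ := GoodBox.exists_dev_len_eq hz h2 (h1.trans (min_le_left _ _))
    have h3 := heq t ht (hts.le.trans (h1.trans (min_le_right _ _)))
    have h4 : a + r⁻¹ * (r * (s - a)) = s := by field_simp; ring
    rw [hts] at h3
    simp only [h4] at h3
    have h5 := hSI (r * (s - a)) ⟨h2, h1.trans (min_le_right _ _)⟩
    rw [h4] at h5
    have h6 : κ t = σ s := by
      refine (chart d p).injOn (hκm ht).1 (hηsub s h5).2.1.1 ?_
      rw [← h3, hzκ]
    rw [← h6]
    exact hκA t ht

/-- In a future null geodesically complete spacetime, the boundary of an endless past set is ruled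
by complete null geodesics. -/
theorem IsEndlessPast.exists_complete_generator [T2Space M] (hV : g.IsEndlessPast V)
    (hcomplete : g.FutureNullComplete) {q : M} (hq : q ∈ frontier V) :
    ∃ σ : ℝ → M, g.IsNullGeodesic σ (Ici 0) ∧ MapsTo σ (Ici 0) (frontier V) ∧ σ 0 = q := by
  obtain ⟨v, hv, hgen⟩ := hV.exists_local_generator hq
  obtain ⟨σ, hσ, hσ0⟩ := hcomplete q v hv
  obtain ⟨S, hS, hσA⟩ := hgen σ hσ hσ0
  refine ⟨σ, hσ, ?_, congrArg Bundle.TotalSpace.proj hσ0⟩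
  set C : Set ℝ := {T | ∀ s ∈ Icc 0 T, σ s ∈ frontier V} with hC
  by_contra hcon
  simp only [MapsTo, not_forall] at hcon
  obtain ⟨t, ht, hnt⟩ := hcon
  have hub : ∀ T ∈ C, T ≤ t := fun T hT ↦ by
    by_contra! h
    exact hnt (hT t ⟨ht, h.le⟩)
  have hbdd : BddAbove C := ⟨t, hub⟩
  have hSC : S ∈ C := hσA
  set T := sSup C with hT
  have hST : S ≤ T := le_csSup hbdd hSC
  have hT0 : 0 < T := hS.trans_le hST
  have hlt : ∀ s ∈ Ico 0 T, σ s ∈ frontier V := fun s hs ↦ by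
    obtain ⟨T', hT', hsT⟩ := exists_lt_of_lt_csSup ⟨S, hSC⟩ hs.2
    exact hT' s ⟨hs.1, hsT.le⟩
  have hTA : σ T ∈ frontier V := by
    have h1 : ContinuousWithinAt σ (Ico 0 T) T :=
      (hσ.1.continuousOn T hT0.le).mono fun s hs ↦ hs.1
    have h2 := h1.mem_closure (t := frontier V)
      (by rw [closure_Ico hT0.ne]; exact ⟨hT0.le, le_rfl⟩) hlt
    rwa [isClosed_frontier.closure_eq] at h2
  obtain ⟨T', hT', hT'A⟩ := hV.exists_continuation hcomplete hσ hT0 fun s hs ↦ by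
    rcases hs.2.eq_or_lt with rfl | h
    · exact hTA
    · exact hlt s ⟨hs.1, h⟩
  exact absurd (le_csSup hbdd hT'A) (not_le.mpr hT')

end Continuation

end LorentzSpacetime

end

set_option maxSynthPendingDepth 3

noncomputable section

namespace LorentzSpacetime

/-! ### Endless curves and the past of the worldline. -/

section Prolongation

variable {d : ℕ} {M : Type*} [TopologicalSpace M] [ChartedSpace (ModelSpace d) M]
  [IsManifold 𝓘(ℝ, ModelSpace d) ∞ M] {g : LorentzSpacetime d M}

/-- A causal curve can be followed by a causal curve without future endpoint. -/
theorem exists_prepend {c W : ℝ → M} {J : Set ℝ} {u v t : ℝ} (huv : u < v)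
    (hc : g.IsCausalCurve c (Icc u v)) (hW : g.IsCausalCurve W J)
    (hend : ¬ ∃ p, IsFutureEndpoint W J p) (ht : t ∈ J) (heq : c v = W t) :
    ∃ (γ : ℝ → M) (J' : Set ℝ), g.IsCausalCurve γ J' ∧ (¬ ∃ p, IsFutureEndpoint γ J' p) ∧
      c u ∈ γ '' J' ∧ γ '' J' ⊆ c '' Icc u v ∪ W '' (J ∩ Ici t) := by
  obtain ⟨t', ht', htt'⟩ : ∃ t' ∈ J, t < t' := by
    by_contra! hcon
    refine hend ⟨W t, fun O _ hO ↦ ⟨t, ht, fun s hs hts ↦ ?_⟩⟩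
    rwa [le_antisymm (hcon s hs) hts]
  set β := v - t with hβ
  have h1 : g.IsCausalCurve (fun s ↦ c (s + β)) (Icc (u - β) t) := by
    have := IsPiecewiseC1Curve.translate hc β
    have e : (fun s ↦ s + β) ⁻¹' Icc u v = Icc (u - β) t := by
      ext s; simp only [mem_preimage, mem_Icc]
      constructor <;> rintro ⟨h1, h2⟩ <;> constructor <;> linarith
    rwa [e] at this
  have h2 : g.IsCausalCurve W (J ∩ Ici t) := IsPiecewiseC1Curve.subset hW inter_subset_left
    (hW.1.inter ordConnected_Ici) ⟨t, ⟨ht, self_mem_Ici⟩, t', ⟨ht', htt'.le⟩, htt'.ne⟩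
  have hlt : u - β < t := by linarith
  have h3 := IsPiecewiseC1Curve.concat h1 h2 (isGreatest_Icc hlt.le)
    ⟨⟨ht, self_mem_Ici⟩, fun s hs ↦ hs.2⟩ (by simpa [hβ] using heq)
  refine ⟨_, _, h3, ?_, ⟨u - β, Or.inl ⟨le_rfl, hlt.le⟩, ?_⟩, ?_⟩
  · rintro ⟨p, hp⟩
    refine hend ⟨p, fun O hO hpO ↦ ?_⟩
    obtain ⟨t₀, ht₀, h⟩ := hp O hO hpO
    have hmax : max t₀ t' ∈ J := by
      rcases ht₀ with h0 | h0
      · rw [max_eq_right (h0.2.trans htt'.le)]; exact ht'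
      · rcases le_total t₀ t' with hle | hle
        · rwa [max_eq_right hle]
        · rw [max_eq_left hle]; exact h0.1
    refine ⟨_, hmax, fun s hs hle ↦ ?_⟩
    have hts : t < s := htt'.trans_le ((le_max_right _ _).trans hle)
    have := h s (Or.inr ⟨hs, hts.le⟩) ((le_max_left _ _).trans hle)
    rwa [concatAt, if_neg (not_le.mpr hts)] at this
  · rw [concatAt, if_pos hlt.le]; simp
  · rintro _ ⟨s, hs, rfl⟩
    rcases le_or_gt s t with hle | hlt'
    · rw [concatAt, if_pos hle]
      refine Or.inl ⟨s + β, ?_, rfl⟩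
      rcases hs with hs | hs
      · exact ⟨by linarith [hs.1], by linarith⟩
      · have := mem_Ici.mp hs.2
        exact ⟨by linarith, by linarith⟩
    · rw [concatAt, if_neg (not_le.mpr hlt')]
      rcases hs with hs | hs
      · exact absurd hs.2 (not_le.mpr hlt')
      · exact Or.inr ⟨s, hs, rfl⟩

/-- The greedy construction applied to V = M, where every point has a nearby successor. -/
theorem exists_endless_timelike_from [T2Space M] [SecondCountableTopology M]
    (g : LorentzSpacetime d M) (q : M) :
    ∃ γ : ℝ → M, g.IsTimelikeCurve γ (Ici 0) ∧ γ 0 = q ∧ ¬ ∃ p, IsFutureEndpoint γ (Ici 0) p := by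
  obtain ⟨γ, h1, h2, -, h3⟩ := exists_endless_timelike (g := g) (V := univ)
    (fun _ _ _ _ ↦ mem_univ _)
    (fun x _ ↦ by
      obtain ⟨y, -, -, hy⟩ := exists_chron_near (g := g) x univ_mem
      exact ⟨y, mem_univ _, hy⟩)
    (fun z _ ↦ by
      obtain ⟨y, -, hyz, hy⟩ := exists_chron_near (g := g) z univ_mem
      exact ⟨y, by simp, hyz, fun x hx ↦ hx.trans hy⟩) (mem_univ q)
  exact ⟨γ, h1, h2, h3⟩

theorem mem_closure_chronPast {A : Set M} {z : M} (hz : z ∈ A) : z ∈ closure (g.chronPast A) := by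
  rw [mem_closure_iff_nhds]
  intro O hO
  obtain ⟨y, hyO, -, hy⟩ := exists_chron_near_past (g := g) z hO
  exact ⟨y, hyO, mem_chronPast.mpr ⟨z, hz, hy⟩⟩

/-- The past of a causal curve without future endpoint is an endless past set. -/
theorem isEndlessPast_chronPast [T2Space M] [SecondCountableTopology M] {W : ℝ → M} {J : Set ℝ}
    (hW : g.IsCausalCurve W J) (hend : ¬ ∃ p, IsFutureEndpoint W J p) :
    g.IsEndlessPast (g.chronPast (W '' J)) := by
  have hpast : ∀ x y, y ∈ g.chronPast (W '' J) → g.Chron x y → x ∈ g.chronPast (W '' J) :=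
    fun x y hy hxy ↦ by
      obtain ⟨p, hp, h⟩ := mem_chronPast.mp hy
      exact mem_chronPast.mpr ⟨p, hp, hxy.trans h⟩
  refine ⟨isOpen_chronPast _, hpast, fun q hq ↦ exists_endless_timelike hpast ?_ ?_ hq⟩
  · intro x hx
    obtain ⟨p, hp, h⟩ := mem_chronPast.mp hx
    obtain ⟨c, hc, hc0, hc1⟩ := h.exists_on (show (0 : ℝ) < 2 by norm_num)
    refine ⟨c 1, mem_chronPast.mpr ⟨p, hp, ?_⟩, ?_⟩
    · rw [← hc1]; exact hc.chron (by norm_num) (by norm_num) (by norm_num)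
    · rw [← hc0]; exact hc.chron (by norm_num) (by norm_num) (by norm_num)
  · intro z hz
    -- A timelike curve up to `W` followed by the rest of `W` is endless; points of `W` are only
    -- known to lie in the closure of its past, which is enough here.
    refine exists_weak_successor (fun q hq ↦ ?_) hz
    obtain ⟨_, ⟨t, ht, rfl⟩, h⟩ := mem_chronPast.mp hq
    obtain ⟨c, hc, hc0, hc1⟩ := h.exists_on (show (0 : ℝ) < 1 by norm_num)
    obtain ⟨γ, J', h1, h2, h3, h4⟩ := exists_prepend one_pos hc.causal hW hend ht hc1
    refine ⟨γ, J', h1, fun s hs ↦ ?_, h2, hc0 ▸ h3⟩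
    rcases h4 ⟨s, hs, rfl⟩ with ⟨r, hr, hrs⟩ | ⟨r, hr, hrs⟩
    · rw [← hrs]
      rcases hr.2.eq_or_lt with rfl | hlt
      · rw [hc1]; exact mem_closure_chronPast ⟨t, ht, rfl⟩
      · refine subset_closure (mem_chronPast.mpr ⟨W t, ⟨t, ht, rfl⟩, ?_⟩)
        rw [← hc1]; exact hc.chron hr (by norm_num) hlt
    · rw [← hrs]; exact mem_closure_chronPast ⟨r, hr.1, rfl⟩

end Prolongation

/-! ### Domains of dependence and global hyperbolicity. -/

section Domains

variable {d : ℕ} {M : Type*} [TopologicalSpace M] [ChartedSpace (ModelSpace d) M]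
  [IsManifold 𝓘(ℝ, ModelSpace d) ∞ M] {g : LorentzSpacetime d M} {S : Set M}

theorem IsAchronalIn.not_chron (hS : g.IsAchronalIn univ S) {x y : M} (hx : x ∈ S) (hy : y ∈ S) :
    ¬ g.Chron x y :=
  fun h ↦ hS x hx y hy (mem_chronFutureIn_univ.mpr h)

theorem exists_chron_of_mem_pastDomain [T2Space M] [SecondCountableTopology M] {p : M}
    (hp : p ∈ g.pastDomainIn univ S) (hpS : p ∉ S) : ∃ s ∈ S, g.Chron p s := by
  obtain ⟨γ, hγ, rfl, hend⟩ := g.exists_endless_timelike_from p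
  obtain ⟨_, ⟨t, ht, rfl⟩, hts⟩ := hp.2 γ (Ici 0) hγ.causal (mapsTo_univ _ _)
    (by simpa using hend) ⟨0, self_mem_Ici, rfl⟩
  rcases (mem_Ici.mp ht).eq_or_lt with rfl | h
  · exact absurd hts hpS
  · exact ⟨_, hts, hγ.chron self_mem_Ici ht h⟩

theorem exists_chron_of_mem_futureDomain [T2Space M] [SecondCountableTopology M] {p : M}
    (hp : p ∈ g.futureDomainIn univ S) (hpS : p ∉ S) : ∃ s ∈ S, g.Chron s p := by
  rw [← pastDomainIn_reverse] at hp
  obtain ⟨s, hs, h⟩ := exists_chron_of_mem_pastDomain hp hpS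
  exact ⟨s, hs, chron_reverse.mp h⟩

/-- Going to the future from a point of the past domain of dependence, along a causal curve that
avoids `S`, one stays in the past domain of dependence. -/
theorem mem_pastDomain_of_causal {γ : ℝ → M} {u v : ℝ} (huv : u < v)
    (hγ : g.IsCausalCurve γ (Icc u v)) (hu : γ u ∈ g.pastDomainIn univ S)
    (hmiss : ∀ t ∈ Ico u v, γ t ∉ S) : γ v ∈ g.pastDomainIn univ S := by
  refine ⟨mem_univ _, fun c J hc _ hend hmem ↦ ?_⟩
  obtain ⟨t, ht, hct⟩ := hmem
  obtain ⟨c', J', h1, h2, h3, h4⟩ := exists_prepend huv hγ hc (by simpa using hend) ht hct.symm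
  obtain ⟨s, hs, hsS⟩ := hu.2 c' J' h1 (mapsTo_univ _ _) (by simpa using h2) h3
  rcases h4 hs with ⟨r, hr, rfl⟩ | ⟨r, hr, rfl⟩
  · rcases hr.2.eq_or_lt with rfl | h
    · exact ⟨_, ⟨t, ht, hct⟩, hsS⟩
    · exact absurd hsS (hmiss r ⟨hr.1, h⟩)
  · exact ⟨_, ⟨r, hr.1, rfl⟩, hsS⟩

/-- The timelike curve from p to x avoids S before x, because a point of S on it would precede the
point s of S. -/
theorem mem_pastDomain_of_chron (hS : g.IsAchronalIn univ S) {p x s : M}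
    (hp : p ∈ g.pastDomainIn univ S) (hpx : g.Chron p x) (hxs : g.Chron x s) (hs : s ∈ S) :
    x ∈ g.pastDomainIn univ S := by
  obtain ⟨c, hc, rfl, rfl⟩ := hpx.exists_on one_pos
  refine mem_pastDomain_of_causal one_pos hc.causal hp fun t ht htS ↦ ?_
  exact hS.not_chron htS hs ((hc.chron (Ico_subset_Icc_self ht) (by norm_num) ht.2).trans hxs)

/-- A curve endless within the interior of D(S) may still have an endpoint z in M. If it missed S,
then z would lie chronologically between a point p' of the past domain and a point s of S. All
points between p' and s belong to the past domain, so z would be interior after all. -/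
theorem pastDomain_subset_pastDomainIn [T2Space M] [SecondCountableTopology M]
    (hS : g.IsAchronalIn univ S) (hSD : S ⊆ interior (g.domain S)) {p : M}
    (hp : p ∈ g.pastDomainIn univ S) (hpU : p ∈ interior (g.domain S)) :
    p ∈ g.pastDomainIn (interior (g.domain S)) S := by
  refine ⟨hpU, fun γ J hγ hm hend hmem ↦ ?_⟩
  by_contra hmiss
  have hmiss : ∀ t ∈ J, γ t ∉ S := fun t ht h ↦ hmiss ⟨_, ⟨t, ht, rfl⟩, h⟩
  obtain ⟨t, ht, rfl⟩ := hmem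
  obtain ⟨z, hz⟩ : ∃ z, IsFutureEndpoint γ J z := by
    by_contra hcon
    obtain ⟨_, ⟨s, hs, rfl⟩, hsS⟩ := hp.2 γ J hγ (mapsTo_univ _ _) (by simpa using hcon) ⟨t, ht, rfl⟩
    exact hmiss s hs hsS
  have hzU : z ∉ interior (g.domain S) := fun h ↦ hend ⟨z, h, hz⟩
  have hzS : z ∉ S := fun h ↦ hzU (hSD h)
  obtain ⟨s₀, hs₀, hts₀⟩ := exists_chron_of_mem_pastDomain hp (hmiss t ht)
  obtain ⟨p', hp'U, -, hp't⟩ := exists_chron_near_past (g := g) (γ t) (isOpen_interior.mem_nhds hpU)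
  have hp'S : p' ∉ S := fun h ↦ hS.not_chron h hs₀ (hp't.trans hts₀)
  -- Membership in the future domain would put a point of S before p' and hence before s₀, against
  -- achronality.
  have hp' : p' ∈ g.pastDomainIn univ S := by
    rcases interior_subset hp'U with h | h
    · obtain ⟨s, hs, hsp⟩ := exists_chron_of_mem_futureDomain h hp'S
      exact absurd ((hsp.trans hp't).trans hts₀) (hS.not_chron hs hs₀)
    · exact h
  have hp'z : g.Chron p' z := Chron.trans_futureEndpoint hγ hz ht hp't
  have hγD : ∀ s ∈ J, t ≤ s → γ s ∈ g.pastDomainIn univ S := fun s hs hts ↦ by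
    rcases hts.eq_or_lt with rfl | h
    · exact hp
    · exact mem_pastDomain_of_causal h (IsPiecewiseC1Curve.sub_Icc hγ h ht hs) hp
        fun r hr ↦ hmiss r (hγ.1.out ht hs (Ico_subset_Icc_self hr))
  obtain ⟨σ, hσ, hσ0, hσend⟩ := g.exists_endless_timelike_from z
  obtain ⟨c, hc, hc0, hc1⟩ := hp'z.exists_on one_pos
  obtain ⟨c', J', h1, h2, h3, h4⟩ := exists_prepend one_pos hc.causal hσ.causal hσend self_mem_Ici
    (hc1.trans hσ0.symm)
  obtain ⟨s, hs, hsS⟩ := hp'.2 c' J' h1 (mapsTo_univ _ _) (by simpa using h2) (hc0 ▸ h3)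
  -- S cannot be met before z: such a point would precede late points of γ, which are in the past
  -- domain and off S, hence themselves precede S.
  have hzs : g.Chron z s := by
    rcases h4 hs with ⟨r, hr, rfl⟩ | ⟨r, hr, rfl⟩
    · exfalso
      rcases hr.2.eq_or_lt with rfl | h
      · exact hzS (hc1 ▸ hsS)
      · have hrz : g.Chron (c r) z := by
          rw [← hc1]; exact hc.chron hr (by norm_num) h
        obtain ⟨t₀, ht₀, hev⟩ := hz _ (isOpen_chron_future (c r)) hrz
        have hmaxJ : max t t₀ ∈ J := by
          rcases le_total t t₀ with h | h
          · rwa [max_eq_right h]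
          · rwa [max_eq_left h]
        obtain ⟨s₁, hs₁, h5⟩ := exists_chron_of_mem_pastDomain (hγD _ hmaxJ (le_max_left _ _))
          (hmiss _ hmaxJ)
        have h6 : g.Chron (c r) (γ (max t t₀)) := hev _ hmaxJ (le_max_right _ _)
        exact hS.not_chron hsS hs₁ (h6.trans h5)
    · rcases (mem_Ici.mp hr.1).eq_or_lt with rfl | h
      · exact absurd (hσ0 ▸ hsS) hzS
      · rw [← hσ0]; exact hσ.chron self_mem_Ici hr.1 h
  refine hzU (mem_interior.mpr ⟨{x | g.Chron p' x} ∩ {x | g.Chron x s}, fun x hx ↦ ?_,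
    (isOpen_chron_future p').inter (isOpen_chron_past s), ⟨hp'z, hzs⟩⟩)
  exact Or.inr (mem_pastDomain_of_chron hS hp' hx.1 hx.2 hsS)

/-- The interior of the domain of dependence of a closed achronal set that it contains is
globally hyperbolic. -/
theorem isGloballyHyperbolicOpen_interior_domain [T2Space M] [SecondCountableTopology M]
    (hcl : IsClosed S) (hS : g.IsAchronalIn univ S) (hSD : S ⊆ interior (g.domain S)) :
    g.IsGloballyHyperbolicOpen (interior (g.domain S)) := by
  refine ⟨isOpen_interior, S, hSD, ⟨S, hcl, (inter_eq_left.mpr hSD).symm⟩, ?_, ?_⟩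
  · exact fun p hp q hq h ↦ hS.not_chron hp hq (Chron.of_mem h)
  · refine subset_antisymm (union_subset (fun x hx ↦ hx.1) (fun x hx ↦ hx.1)) fun p hp ↦ ?_
    rcases interior_subset hp with h | h
    · left
      rw [← pastDomainIn_reverse] at h ⊢
      rw [← domain_reverse] at hp hSD ⊢
      exact pastDomain_subset_pastDomainIn (isAchronalIn_reverse hS) hSD h hp
    · exact Or.inr (pastDomain_subset_pastDomainIn hS hSD h hp)

end Domains

/-! ### Edges, the horizon and the entropy inequality. -/

section Exterior

variable {d : ℕ} {M : Type*} [TopologicalSpace M] [ChartedSpace (ModelSpace d) M]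
  [IsManifold 𝓘(ℝ, ModelSpace d) ∞ M] {g : LorentzSpacetime d M} {S V : Set M}

/-- Inside the open set V the sets S and V ∩ S agree, so an edge point of V ∩ S in V would be an
edge point of the slice. -/
theorem edge_inter_subset_frontier (hS : g.IsSlice S) (hV : IsOpen V) :
    g.edge (V ∩ S) ⊆ frontier V := by
  rintro p ⟨hp, hO⟩
  rw [hV.frontier_eq]
  refine ⟨closure_mono inter_subset_left hp, fun hpV ↦ ?_⟩
  have : p ∈ g.edge S := by
    refine ⟨closure_mono inter_subset_right hp, fun O hOo hpO ↦ ?_⟩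
    obtain ⟨γ, a, b, hab, hγ, hm, h1, h2, h3⟩ := hO (O ∩ V) (hOo.inter hV) ⟨hpO, hpV⟩
    refine ⟨γ, a, b, hab, hγ, hm.mono_right inter_subset_left, ?_, ?_, ?_⟩
    · obtain ⟨c, u, v, h⟩ := h1
      exact ⟨c, u, v, h.1, h.2.1, h.2.2.1.mono_right inter_subset_left, h.2.2.2⟩
    · obtain ⟨c, u, v, h⟩ := h2
      exact ⟨c, u, v, h.1, h.2.1, h.2.2.1.mono_right inter_subset_left, h.2.2.2⟩
    · rw [Set.disjoint_left] at h3 ⊢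
      rintro _ ⟨t, ht, rfl⟩ htS
      exact h3 ⟨t, ht, rfl⟩ ⟨(hm ht).2, htS⟩
  rw [hS.2.2] at this
  exact this

/-- Within the domain of dependence of a closed achronal set `S`, the boundary of the past of the
part `V ∩ S` of `S` lies, apart from that part itself, on the boundary of `V`. -/
theorem IsEndlessPast.frontier_chronPast_inter [T2Space M] [SecondCountableTopology M]
    (hV : g.IsEndlessPast V) (hS : g.IsAchronalIn univ S) {q : M}
    (hq : q ∈ frontier (g.chronPast (V ∩ S)) \ (V ∩ S)) (hqD : q ∈ g.domain S) :
    q ∈ frontier V := by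
  have hsub : g.chronPast (V ∩ S) ⊆ V := fun x hx ↦ by
    obtain ⟨y, hy, h⟩ := mem_chronPast.mp hx
    exact hV.past _ _ hy.1 h
  obtain ⟨hqf, hqa⟩ := hq
  rw [(isOpen_chronPast _).frontier_eq] at hqf
  rw [hV.isOpen.frontier_eq]
  refine ⟨closure_mono hsub hqf.1, fun hqV ↦ ?_⟩
  have hqS : q ∉ S := fun h ↦ hqa ⟨hqV, h⟩
  -- From the future domain, a point of S would precede another point of S. From the past domain,
  -- the endless curve in V starting at q meets S at a point of V ∩ S, which puts q into the open
  -- past of that set.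
  rcases hqD with h | h
  · obtain ⟨s, hs, hsq⟩ := exists_chron_of_mem_futureDomain h hqS
    obtain ⟨x, hx1, hx2⟩ := mem_closure_iff.mp hqf.1 _ (isOpen_chron_future s) hsq
    obtain ⟨y, hy, hxy⟩ := mem_chronPast.mp hx2
    exact hS.not_chron hs hy.2 (Chron.trans hx1 hxy)
  · obtain ⟨γ, hγ, rfl, hm, hend⟩ := hV.endless q hqV
    obtain ⟨_, ⟨t, ht, rfl⟩, htS⟩ := h.2 γ (Ici 0) hγ.causal (mapsTo_univ _ _)
      (by simpa using hend) ⟨0, self_mem_Ici, rfl⟩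
    rcases (mem_Ici.mp ht).eq_or_lt with rfl | h
    · exact hqS htS
    · exact hqf.2 (mem_chronPast.mpr ⟨_, ⟨hm ht, htS⟩, hγ.chron self_mem_Ici ht h⟩)

end Exterior

end LorentzSpacetime

end

theorem mainTheorem3 {d : ℕ} (hd : 2 ≤ d) {M : Type*} [TopologicalSpace M] [T2Space M]
    [SecondCountableTopology M] [ChartedSpace (ModelSpace d) M]
    [IsManifold 𝓘(ℝ, ModelSpace d) ∞ M] (g : LorentzSpacetime d M)
    (hstable : g.StablyCausal) (hcomplete : g.FutureNullComplete)
    (W : ℝ → M) (J : Set ℝ) (hW : g.IsFutureInfiniteWorldline W J)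
    (S : Set M) (hS : g.IsSlice S) (hSD : S ⊆ interior (g.domain S)) :
    g.IsExterior W J (g.chronPast (W '' J) ∩ S) ∧
      ∀ Sgen : Set M → ℝ, g.GeneralizedSecondLaw Sgen W J →
        ∀ p ∈ g.edge (g.chronPast (W '' J) ∩ S),
          g.EntropyNormalAt Sgen (g.chronPast (W '' J) ∩ S) p := by
  have hV := LorentzSpacetime.isEndlessPast_chronPast hW.1 hW.not_endpoint
  set V := g.chronPast (W '' J) with hVdef
  have hedge : g.edge (V ∩ S) ⊆ frontier V :=
    LorentzSpacetime.edge_inter_subset_frontier hS hV.isOpen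
  have hext : g.IsExterior W J (V ∩ S) :=
    ⟨⟨S, hS, V, hV.isOpen, rfl⟩, inter_subset_left.trans subset_closure, hedge⟩
  refine ⟨hext, fun Sgen hgsl p hp ↦ ?_⟩
  obtain ⟨x₀, hx₀⟩ : (V ∩ S).Nonempty := closure_nonempty_iff.mp ⟨p, hp.1⟩
  have hpS : p ∈ S := by
    have := closure_mono (inter_subset_right (s := V)) hp.1
    rwa [hS.1.closure_eq] at this
  have hpV : p ∉ V := by
    have := hedge hp
    rw [hV.isOpen.frontier_eq] at this
    exact this.2
  -- The interior of D(S) confines b to a globally hyperbolic set. A deformation cannot alter a at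
  -- the removed point x₀, so b contains x₀; and p differs from x₀ because p is not in V.
  refine ⟨interior (g.domain S) \ {x₀}, isOpen_interior.sdiff isClosed_singleton,
    ⟨hSD hpS, fun h ↦ hpV (mem_singleton_iff.mp h ▸ hx₀.1)⟩, fun b hb ↦ ?_⟩
  obtain ⟨hbh, hbD, hbcl, hbΔ, hbe⟩ := hb
  have hx₀b : x₀ ∈ b := by
    by_contra hx
    exact (hbΔ (Or.inl ⟨hx₀, hx⟩)).2 rfl
  have hpast : g.chronPast (V ∩ S) ⊆ V := fun x hx ↦ by
    obtain ⟨y, hy, h⟩ := LorentzSpacetime.mem_chronPast.mp hx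
    exact hV.past _ _ hy.1 h
  have hbedge : g.edge b ⊆ frontier V := fun q hq ↦ by
    rcases hbe hq with h | h
    · exact hedge h
    · exact hV.frontier_chronPast_inter hS.2.1 h.1 (interior_subset h.2.1)
  have hbU : b ⊆ interior (g.domain S) := fun x hx ↦ by
    by_cases hxa : x ∈ V ∩ S
    · exact hSD hxa.2
    · exact (hbΔ (Or.inr ⟨hx, hxa⟩)).1
  have := hgsl (V ∩ S) b ⟨x₀, hx₀⟩ ⟨x₀, hx₀b⟩ hext
    ⟨hbh, hbcl.trans (closure_mono hpast), hbedge⟩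
    ⟨_, LorentzSpacetime.isGloballyHyperbolicOpen_interior_domain hS.1 hS.2.1 hSD,
      inter_subset_right.trans hSD, hbU⟩ hbD fun q hq ↦ by
        obtain ⟨σ, hσ, hσV, hσ0⟩ := hV.exists_complete_generator hcomplete (hbedge hq.1)
        exact ⟨σ, hσ, hσV, 0, self_mem_Ici, hσ0⟩
  linarith
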